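/- Let $G=(V,E)$ be the complete graph on a finite vertex set $V=\{0,\dots,n-1\}$ with a root $r\in V$. For $S\subseteq V$ let $\delta(S)$ be the set of edges with exactly one endpoint in $S$, put $\delta(v)=\delta(\{v\})$, and for a set $F$ of edges write $x(F)=\sum_{e\in F}x_e$ and $\chi^F$ for the incidence vector of $F$. Let $(x,y)\in\mathbb R^E\times\mathbb R^V$ be feasible for the PCTSP LP relaxation, i.e. \[ \begin{aligned} &x(\delta(v))=2y_v\ \ (v\in V\setminus\{r\}),\qquad x(\delta(r))\le 2,\qquad x(\delta(S))\ge 2y_v\ \ (S\subseteq V\setminus\{r\},\ v\in S),\\ &y_r=1,\qquad x_e\ge 0\ \ (e\in E),\qquad y_v\in[0,1]\ \ (v\in V). \end{aligned} \] Let $V_1=\{v\in V: y_v=1\}$, and let $e_0\in\binom{V_1}{2}$ be an edge with $x_{e_0}\ge 1$. Then there are a finite set $\mathcal T$ of trees that are subgraphs of $G$, each with vertex set $V[T]$ and edge set $E[T]$, and weights $\mu\in[0,1]^{\mathcal T}$ such that: (i) $x=\sum_{T\in\mathcal T}\mu_T\,\chi^{E[T]}+\chi^{e_0}$; (ii) for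 every $v\in V\setminus V_1$, $\ \sum_{T\in\mathcal T:\,v\in V[T]}\mu_T=y_v$; (iii) for every $T\in\mathcal T$, $|V[T]\cap V_1|=2$ (the two vertices in $V[T]\cap V_1$ are the anchors of $T$); (iv) for $T\in\mathcal T$ let $e_T=V[T]\cap V_1$ be the edge joining the anchors of $T$, and let $G_1=(V_1,E_1)$ be the multigraph with edge set $E_1=\{e_0\}\cup\{e_T:T\in\mathcal T\}$, in which these edges are regarded as pairwise distinct, possibly parallel edges. Then $z=\sum_{T\in\mathcal T}\mu_T\,\chi^{e_T}+\chi^{e_0}$ lies in the Held–Karp polytope \[ P_{\mathrm{HK}}(G_1)=\{z\in\mathbb R_{\ge0}^{E_1}: z(\delta(v))=2\ \ (v\in V_1),\quad z(\delta(S))\ge 2\ \ (\emptyset\ne S\subsetneq V_1)\}. \] Moreover, such $\mathcal T$ and $\mu$ can be constructed in polynomial time: there is one random access machine program, whose operations on numbers are addition, subtraction, halving and comparison, that outputs such $\mathcal T$ and $\mu$ on input $(n,r,e_0,x,y)$. For real data its running time is at most polynomial in $n$ (each arithmetic operation on reals has unit cost; indices count with their binary length). For rational data the outputs $\mu_T$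 are rational, and its running time, with all numbers that occur counted with their binary length (logarithmic cost), is at most polynomial in the binary length of the input. -/

import Mathlib

namespace PrizeCollecting

section Polyhedra

/-- The edge set `E` of the complete graph on the vertex set `V`. -/
abbrev Edge (V : Type) : Type := (⊤ : SimpleGraph V).edgeSet

/-- The edge `{u, v}` of the complete graph. -/
def mkEdge {V : Type} (u v : V) (h : u ≠ v) : Edge V :=
  ⟨s(u, v), by simpa using h⟩

/-- The set of the two endpoints of an edge. -/
def Edge.ends {V : Type} (e : Edge V) : Set V := {v | v ∈ (e : Sym2 V)}

/-- An edge with set of endpoints `e` lies in `δ(S)`, i.e. `|e ∩ S| = |e \ S| = 1`. -/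
def Crosses {V : Type} (e S : Set V) : Prop := (e ∩ S).ncard = 1 ∧ (e \ S).ncard = 1

open Classical in
/-- The weight `z(δ(S))` of a cut in a multigraph whose edges are indexed by `ι`,
where the edge `i` has the set of endpoints `ends i`. -/
noncomputable def cutWeight {V ι K : Type} [Fintype ι] [Field K]
    (ends : ι → Set V) (z : ι → K) (S : Set V) : K :=
  ∑ i : ι, if Crosses (ends i) S then z i else 0

/-- The point `(x, y)` is feasible for the linear programming relaxation of the prize-collecting
travelling salesperson problem on the complete graph on `V` with root `r`. -/
structure Feasible {V K : Type} [Fintype V] [DecidableEq V] [Field K] [LinearOrder K]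
    (r : V) (x : Edge V → K) (y : V → K) : Prop where
  degree : ∀ v, v ≠ r → cutWeight Edge.ends x {v} = 2 * y v
  degree_root : cutWeight Edge.ends x {r} ≤ 2
  cut : ∀ S : Set V, r ∉ S → ∀ v ∈ S, 2 * y v ≤ cutWeight Edge.ends x S
  root : y r = 1
  edge_nonneg : ∀ e, 0 ≤ x e
  vertex_mem : ∀ v, 0 ≤ y v ∧ y v ≤ 1

/-- The Held-Karp polytope of the multigraph with vertex set `U` whose edges are indexed by `ι`,
where the edge `i` has the set of endpoints `ends i`. -/
def heldKarp {V ι K : Type} [Fintype ι] [Field K] [LinearOrder K]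
    (U : Set V) (ends : ι → Set V) : Set (ι → K) :=
  {z | (∀ i, 0 ≤ z i) ∧ (∀ v ∈ U, cutWeight ends z {v} = 2) ∧
    ∀ S : Set V, S ⊂ U → S.Nonempty → 2 ≤ cutWeight ends z S}

/-- The core set `V₁` of the vertices `v` with `y v = 1`. -/
def core {V K : Type} [Field K] (y : V → K) : Set V := {v | y v = 1}

open Classical in
/-- The incidence vector `χ^F` of a set `F` of edges. -/
noncomputable def chi {V K : Type} [Field K] (F : Set (Sym2 V)) : Edge V → K :=
  fun e => if (e : Sym2 V) ∈ F then 1 else 0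

/-- The endpoints of the edges of the multigraph `G₁`: the edge `none` is `e₀`, and the edge
`some t` is the edge `e_T` joining the two anchors of the tree `T = T t`. -/
def anchorEnds {V K : Type} [Field K] (y : V → K) (e₀ : Edge V) {k : ℕ}
    (T : Fin k → (⊤ : SimpleGraph V).Subgraph) : Option (Fin k) → Set V
  | none => e₀.ends
  | some t => (T t).verts ∩ core y

open Classical in
/-- The set `{T t | t < k}` of (pairwise distinct) trees with the weights `μ t` is a decomposition
of the solution `(x, y)` with respect to the edge `e₀`. -/
structure IsDecomposition {V K : Type} [Field K] [LinearOrder K]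
    (x : Edge V → K) (y : V → K) (e₀ : Edge V) {k : ℕ}
    (T : Fin k → (⊤ : SimpleGraph V).Subgraph) (μ : Fin k → K) : Prop where
  distinct : Function.Injective T
  isTree : ∀ t, (T t).coe.IsTree
  weight_mem : ∀ t, 0 ≤ μ t ∧ μ t ≤ 1
  conic : x = ∑ t, μ t • chi (T t).edgeSet + chi {(e₀ : Sym2 V)}
  coverage : ∀ v, v ∉ core y → (∑ t, if v ∈ (T t).verts then μ t else 0) = y v
  anchors : ∀ t, ((T t).verts ∩ core y).ncard = 2
  subtour : (∑ t, μ t • Pi.single (some t) (1 : K) + Pi.single none (1 : K) :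
    Option (Fin k) → K) ∈ heldKarp (core y) (anchorEnds y e₀ T)

end Polyhedra

/-! ### A random access machine with logarithmic cost

Programs are written in a small imperative language. The memory consists of finitely many (the
names of the arrays are fixed in the program) unbounded arrays of natural numbers and unbounded
arrays of elements of an ordered field `K`; the arrays are indirectly addressed. The only operations
on `K` are comparison, addition, subtraction, halving and the constants `0` and `1`.
The cost of a computation is the number of elementary operations plus the total size of all values
that occur, where a natural number counts with its binary length, and an element of `K` with its
value under a given size function `bits`. -/

section Machine

/-- The memory: cell `i` of array `a` is `nat a i`, respectively `num a i`. -/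
structure State (K : Type) where
  nat : ℕ → ℕ → ℕ
  num : ℕ → ℕ → K

/-- Expressions for natural numbers. -/
inductive NExp : Type where
  | lit (c : ℕ)
  | get (a : ℕ) (i : NExp)
  | add (e f : NExp)
  | sub (e f : NExp)
  | mul (e f : NExp)

/-- Expressions for elements of the field. -/
inductive FExp : Type where
  | zero
  | one
  | get (a : ℕ) (i : NExp)
  | add (e f : FExp)
  | sub (e f : FExp)
  | half (e : FExp)

/-- Conditions. -/
inductive BExp : Type where
  | nle (e f : NExp)
  | fle (e f : FExp)
  | neg (b : BExp)
  | conj (b c : BExp)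

/-- Programs. -/
inductive Program : Type where
  | skip
  | setNat (a : ℕ) (i e : NExp)
  | setNum (a : ℕ) (i : NExp) (e : FExp)
  | seq (c d : Program)
  | ite (b : BExp) (c d : Program)
  | while (b : BExp) (c : Program)

variable {K : Type}

/-- The value of an expression; `sub` is truncated subtraction. -/
def NExp.eval (σ : State K) : NExp → ℕ
  | .lit c => c
  | .get a i => σ.nat a (i.eval σ)
  | .add e f => e.eval σ + f.eval σ
  | .sub e f => e.eval σ - f.eval σ
  | .mul e f => e.eval σ * f.eval σ

/-- The cost of evaluating an expression. -/
def NExp.cost (σ : State K) : NExp → ℕ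
  | .lit c => 1 + c.size
  | .get a i => i.cost σ + 1 + (σ.nat a (i.eval σ)).size
  | .add e f => e.cost σ + f.cost σ + 1 + (e.eval σ + f.eval σ).size
  | .sub e f => e.cost σ + f.cost σ + 1 + (e.eval σ - f.eval σ).size
  | .mul e f => e.cost σ + f.cost σ + 1 + (e.eval σ * f.eval σ).size

/-- The value of an expression. -/
def FExp.eval [Field K] (σ : State K) : FExp → K
  | .zero => 0
  | .one => 1
  | .get a i => σ.num a (i.eval σ)
  | .add e f => e.eval σ + f.eval σ
  | .sub e f => e.eval σ - f.eval σ
  | .half e => e.eval σ / 2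

/-- The cost of evaluating an expression. -/
def FExp.cost [Field K] (bits : K → ℕ) (σ : State K) : FExp → ℕ
  | .zero => 1 + bits 0
  | .one => 1 + bits 1
  | .get a i => i.cost σ + 1 + bits (σ.num a (i.eval σ))
  | .add e f => e.cost bits σ + f.cost bits σ + 1 + bits (e.eval σ + f.eval σ)
  | .sub e f => e.cost bits σ + f.cost bits σ + 1 + bits (e.eval σ - f.eval σ)
  | .half e => e.cost bits σ + 1 + bits (e.eval σ / 2)

/-- The truth of a condition. -/
def BExp.Holds [Field K] [LinearOrder K] (σ : State K) : BExp → Prop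
  | .nle e f => e.eval σ ≤ f.eval σ
  | .fle e f => e.eval σ ≤ f.eval σ
  | .neg b => ¬ b.Holds σ
  | .conj b c => b.Holds σ ∧ c.Holds σ

/-- The cost of evaluating a condition. -/
def BExp.cost [Field K] (bits : K → ℕ) (σ : State K) : BExp → ℕ
  | .nle e f => e.cost σ + f.cost σ + 1
  | .fle e f => e.cost bits σ + f.cost bits σ + 1
  | .neg b => b.cost bits σ + 1
  | .conj b c => b.cost bits σ + c.cost bits σ + 1

/-- The memory after writing `m` into cell `i` of the array `a` of natural numbers. -/
def State.writeNat (σ : State K) (a i m : ℕ) : State K :=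
  { σ with nat := Function.update σ.nat a (Function.update (σ.nat a) i m) }

/-- The memory after writing `q` into cell `i` of the array `a` of field elements. -/
def State.writeNum (σ : State K) (a i : ℕ) (q : K) : State K :=
  { σ with num := Function.update σ.num a (Function.update (σ.num a) i q) }

/-- `Exec bits c σ τ t`: started in the memory `σ`, the program `c` terminates with the
memory `τ`, and the computation has cost `t`. -/
inductive Exec [Field K] [LinearOrder K] (bits : K → ℕ) :
    Program → State K → State K → ℕ → Prop where
  | skip (σ : State K) : Exec bits .skip σ σ 1
  | setNat (σ : State K) (a : ℕ) (i e : NExp) :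
      Exec bits (.setNat a i e) σ (σ.writeNat a (i.eval σ) (e.eval σ)) (i.cost σ + e.cost σ + 1)
  | setNum (σ : State K) (a : ℕ) (i : NExp) (e : FExp) :
      Exec bits (.setNum a i e) σ (σ.writeNum a (i.eval σ) (e.eval σ))
        (i.cost σ + e.cost bits σ + 1)
  | seq {c d : Program} {σ τ ρ : State K} {s t : ℕ} :
      Exec bits c σ τ s → Exec bits d τ ρ t → Exec bits (.seq c d) σ ρ (s + t)
  | ite_true {b : BExp} {c d : Program} {σ τ : State K} {t : ℕ} :
      b.Holds σ → Exec bits c σ τ t → Exec bits (.ite b c d) σ τ (b.cost bits σ + 1 + t)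
  | ite_false {b : BExp} {c d : Program} {σ τ : State K} {t : ℕ} :
      ¬ b.Holds σ → Exec bits d σ τ t → Exec bits (.ite b c d) σ τ (b.cost bits σ + 1 + t)
  | while_true {b : BExp} {c : Program} {σ τ ρ : State K} {s t : ℕ} :
      b.Holds σ → Exec bits c σ τ s → Exec bits (.while b c) τ ρ t →
        Exec bits (.while b c) σ ρ (b.cost bits σ + 1 + s + t)
  | while_false {b : BExp} {c : Program} {σ : State K} :
      ¬ b.Holds σ → Exec bits (.while b c) σ σ (b.cost bits σ + 1)

end Machine

section Encoding

/-- The size function for unit-cost arithmetic: only the number of operations counts. -/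
def unitBits : ℝ → ℕ := fun _ => 0

/-- The binary length of a rational number, written as a reduced fraction. -/
def ratBits : ℚ → ℕ := fun q => q.num.natAbs.size + q.den.size

/-- The length of an encoding of `(x, y)`, up to the (polynomially many) separators. -/
noncomputable def inputLength {n : ℕ} {K : Type} (bits : K → ℕ)
    (x : Edge (Fin n) → K) (y : Fin n → K) : ℕ :=
  n + ∑ e, bits (x e) + ∑ v, bits (y v)

/-- The initial memory: `n`, `r`, `u`, `v` (with `e₀ = {u, v}`) in the first four cells of the
array `0` of natural numbers, the symmetric matrix of the values of `x` (with zero diagonal) row by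
row in the array `0` of field elements, and `y` in the array `1` of field elements.
All other cells are zero. -/
def initState {n : ℕ} {K : Type} [Field K] (r u v : Fin n)
    (x : Edge (Fin n) → K) (y : Fin n → K) : State K where
  nat a i := if a = 0 then ([n, r, u, v] : List ℕ).getD i 0 else 0
  num a i :=
    if a = 0 then
      if h : i / n < n ∧ i % n < n ∧ i / n ≠ i % n then
        x (mkEdge ⟨i / n, h.1⟩ ⟨i % n, h.2.1⟩ (by simpa using h.2.2))
      else 0
    else if a = 1 then
      if h : i < n then y ⟨i, h⟩ else 0
    else 0

/-- The weighted trees are the output found in the memory `σ`: their number `k` is in cell `0` of the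
array `1` of natural numbers, the weights are in the array `2` of field elements, and
the vertex sets and the adjacency matrices of the trees are stored one after the other, as
`0`-`1`-vectors, in the arrays `2` and `3` of natural numbers. -/
structure Outputs {n : ℕ} {K : Type} (σ : State K) {k : ℕ}
    (T : Fin k → (⊤ : SimpleGraph (Fin n)).Subgraph) (μ : Fin k → K) : Prop where
  number : σ.nat 1 0 = k
  weight : ∀ t : Fin k, σ.num 2 t = μ t
  vertex_binary : ∀ (t : Fin k) (i : Fin n), σ.nat 2 (t * n + i) ≤ 1
  vertex : ∀ (t : Fin k) (i : Fin n), σ.nat 2 (t * n + i) = 1 ↔ i ∈ (T t).verts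
  edge_binary : ∀ (t : Fin k) (i j : Fin n), σ.nat 3 ((t * n + i) * n + j) ≤ 1
  edge : ∀ (t : Fin k) (i j : Fin n), σ.nat 3 ((t * n + i) * n + j) = 1 ↔ (T t).Adj i j

end Encoding

end PrizeCollecting

open PrizeCollecting

/-! Outline of the mathematics. The vertices outside the core set are eliminated by complete
splitting off, in the order of increasing `y`. Splitting off the pair `{a,v}`, `{b,v}` moves weight
to `{a,b}`; it preserves the degrees of all vertices other than `v`, and it is carried out only as
far as the remaining cut conditions `x(δ(S)) ≥ 2 y_w` permit. If no pair at `v` can be split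
further, then every two neighbours of `v` lie in a common tight set avoiding `v`. Uncrossing
(`CutFeasible.tightCut_union`) yields one tight set containing all neighbours of `v`, and adding `v`
to it would give a cut that is too small. So `v` has become isolated
(`CutFeasible.isolated_of_blocked`). In the end only the core set carries weight, and the resulting
matrix `Z` has degrees 2 and cuts of weight at least 2, i.e. it is a Held–Karp point. Weights
between surviving vertices never decrease, hence `Z` is still at least 1 on `e₀`.

The trees are built backwards. Initially each edge of `Z - e₀` is a tree with two anchors. When `v`
is reinserted, the weight that splitting off put on an edge `{a,b}` is taken out of trees containing
`{a,b}`, and these are rerouted through `v`. A tree without `v` receives the path `a, v, b`. A tree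
that already contains `v` would get a cycle; it receives only the edge from `v` to the end of
`{a,b}` on the other side, and the edge from `v` to the end `p` on its own side is released. Every
rerouted unit thus either adds `v` to a tree or releases a unit, so the weight of the trees
containing `v` plus the released weight is half the degree of `v`, namely `y_v`. Released edges
`{a,v}` are used up by attaching `v` as a leaf to trees that contain `a` but not `v`. There is
enough of them: by the order of elimination `a` is covered at least `y_v` times (a core vertex at
least once), whereas `v` is covered less than `y_v` times as long as some released weight is left.
Core vertices are never inserted, so the anchors of a tree do not change and the anchor edges keep
summing to `Z - e₀`; this gives (iii) and (iv). The core of this argument is `rerouteAll_spec`,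
`attachAll_spec` and `insertVertex_spec`.

For the running time, the algorithm is written in a language whose loops have `n ^ d` rounds and
which never stores a product. Natural numbers then keep polynomial length (`Code.exists_exec`).
Field elements arise by addition, subtraction and halving only, so each operation adds boundedly
many bits to a common denominator (`Exec.exists_ratBits`). The amounts that can be split off come
from minimum cuts, computed by a push-relabel method with a polynomial number of rounds. -/

namespace PrizeCollecting

/-! ### Loop programs -/

/-- Programs in which the only iteration is a loop with `n ^ d` rounds, where `n` is the value of
cell `0` of the array `0`; the cell `0` of the array `a` counts the rounds. -/
inductive Code : Type where
  | skip
  | setNat (a : ℕ) (i e : NExp)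
  | setNum (a : ℕ) (i : NExp) (e : FExp)
  | seq (c d : Code)
  | ite (b : BExp) (c d : Code)
  | loop (a d : ℕ) (c : Code)

/-- The expression `e ^ d`. -/
def NExp.pow (e : NExp) : ℕ → NExp
  | 0 => .lit 1
  | d + 1 => .mul (e.pow d) e

/-- The translation of loop programs to programs. -/
def Code.toProgram : Code → Program
  | .skip => .skip
  | .setNat a i e => .setNat a i e
  | .setNum a i e => .setNum a i e
  | .seq c d => .seq c.toProgram d.toProgram
  | .ite b c d => .ite b c.toProgram d.toProgram
  | .loop a d c =>
    .seq (.setNat a (.lit 0) (.lit 0))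
      (.while (.neg (.nle ((NExp.get 0 (.lit 0)).pow d) (.get a (.lit 0))))
        (.seq c.toProgram (.setNat a (.lit 0) (.add (.get a (.lit 0)) (.lit 1)))))

open Classical in
/-- The effect of a loop program on the memory. -/
noncomputable def Code.run {K : Type} [Field K] [LinearOrder K] : Code → State K → State K
  | .skip, σ => σ
  | .setNat a i e, σ => σ.writeNat a (i.eval σ) (e.eval σ)
  | .setNum a i e, σ => σ.writeNum a (i.eval σ) (e.eval σ)
  | .seq c d, σ => d.run (c.run σ)
  | .ite b c d, σ => if b.Holds σ then c.run σ else d.run σ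
  | .loop a d c, σ =>
    Nat.rec (σ.writeNat a 0 0) (fun i s => (c.run s).writeNat a 0 (i + 1)) (σ.nat 0 0 ^ d)

/-- The arrays of natural numbers that a loop program may change. -/
def Code.natWrites : Code → List ℕ
  | .skip => []
  | .setNat a _ _ => [a]
  | .setNum _ _ _ => []
  | .seq c d => c.natWrites ++ d.natWrites
  | .ite _ c d => c.natWrites ++ d.natWrites
  | .loop a _ c => a :: c.natWrites

/-- The arrays of field elements that a loop program may change. -/
def Code.numWrites : Code → List ℕ
  | .skip => []
  | .setNat _ _ _ => []
  | .setNum a _ _ => [a]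
  | .seq c d => c.numWrites ++ d.numWrites
  | .ite _ c d => c.numWrites ++ d.numWrites
  | .loop _ _ c => c.numWrites

/-- The value of the expression is not the result of a multiplication. -/
def NExp.mulFree : NExp → Bool
  | .lit _ => true
  | .get _ _ => true
  | .add e f => e.mulFree && f.mulFree
  | .sub e f => e.mulFree && f.mulFree
  | .mul _ _ => false

/-- Products are not stored, and the array `0` and the loop counters are not overwritten. -/
def Code.ok : Code → Bool
  | .skip => true
  | .setNat a _ e => a != 0 && e.mulFree
  | .setNum _ _ _ => true
  | .seq c d => c.ok && d.ok
  | .ite _ c d => c.ok && d.ok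
  | .loop a _ c => a != 0 && !c.natWrites.contains a && c.ok

section Run

variable {K : Type}

theorem State.nat_writeNat (σ : State K) (a i m b j : ℕ) :
    (σ.writeNat a i m).nat b j = if b = a ∧ j = i then m else σ.nat b j := by
  by_cases h : b = a
  · subst h
    by_cases h' : j = i <;> simp [State.writeNat, h']
  · simp [State.writeNat, h]

@[simp] theorem State.num_writeNat (σ : State K) (a i m : ℕ) :
    (σ.writeNat a i m).num = σ.num := rfl

theorem State.num_writeNum (σ : State K) (a i : ℕ) (q : K) (b j : ℕ) :
    (σ.writeNum a i q).num b j = if b = a ∧ j = i then q else σ.num b j := by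
  by_cases h : b = a
  · subst h
    by_cases h' : j = i <;> simp [State.writeNum, h']
  · simp [State.writeNum, h]

@[simp] theorem State.nat_writeNum (σ : State K) (a i : ℕ) (q : K) :
    (σ.writeNum a i q).nat = σ.nat := rfl

variable [Field K] [LinearOrder K]

/-- Frame rule. The list `natWrites` depends on the syntax alone, so for a concrete program the
hypothesis can be closed by `decide`. -/
theorem Code.run_nat_of_notMem (c : Code) {a : ℕ} (h : a ∉ c.natWrites) (σ : State K) :
    (c.run σ).nat a = σ.nat a := by
  induction c generalizing σ with
  | skip => rfl
  | setNat b i e =>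
    funext j
    simp only [natWrites, List.mem_singleton] at h
    simp [run, State.nat_writeNat, h]
  | setNum b i e => rfl
  | seq c d hc hd =>
    simp only [natWrites, List.mem_append, not_or] at h
    simp [run, hc h.1, hd h.2]
  | ite b c d hc hd =>
    simp only [natWrites, List.mem_append, not_or] at h
    simp only [run]
    split_ifs
    · exact hc h.1 σ
    · exact hd h.2 σ
  | loop b d c hc =>
    simp only [natWrites, List.mem_cons, not_or] at h
    simp only [run]
    induction σ.nat 0 0 ^ d with
    | zero => funext j; simp [State.nat_writeNat, h.1]
    | succ k ih =>
      funext j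
      simp only [State.nat_writeNat, h.1, false_and, if_false, hc h.2]
      rw [ih]

theorem Code.run_num_of_notMem (c : Code) {a : ℕ} (h : a ∉ c.numWrites) (σ : State K) :
    (c.run σ).num a = σ.num a := by
  induction c generalizing σ with
  | skip => rfl
  | setNat b i e => rfl
  | setNum b i e =>
    funext j
    simp only [numWrites, List.mem_singleton] at h
    simp [run, State.num_writeNum, h]
  | seq c d hc hd =>
    simp only [numWrites, List.mem_append, not_or] at h
    simp [run, hc h.1, hd h.2]
  | ite b c d hc hd =>
    simp only [numWrites, List.mem_append, not_or] at h
    simp only [run]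
    split_ifs
    · exact hc h.1 σ
    · exact hd h.2 σ
  | loop b d c hc =>
    simp only [numWrites] at h
    simp only [run]
    induction σ.nat 0 0 ^ d with
    | zero => rfl
    | succ k ih =>
      simp only [State.num_writeNat, hc h]
      rw [ih]

/-- The invariant rule for loops. -/
theorem Code.loop_induction {a d : ℕ} {c : Code} {σ : State K} {n : ℕ} (hn : σ.nat 0 0 = n)
    (P : ℕ → State K → Prop) (h0 : P 0 (σ.writeNat a 0 0))
    (hs : ∀ i < n ^ d, ∀ s : State K, s.nat a 0 = i →
      (∀ b ∉ (Code.loop a d c).natWrites, s.nat b = σ.nat b) →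
      (∀ b ∉ c.numWrites, s.num b = σ.num b) →
      P i s → P (i + 1) ((c.run s).writeNat a 0 (i + 1))) :
    P (n ^ d) ((Code.loop a d c).run σ) := by
  subst hn
  simp only [run]
  set f : ℕ → State K := fun N =>
    Nat.rec (σ.writeNat a 0 0) (fun i s => (c.run s).writeNat a 0 (i + 1)) N with hf
  have hf1 : ∀ N, f (N + 1) = (c.run (f N)).writeNat a 0 (N + 1) := fun N => rfl
  suffices H : ∀ N ≤ σ.nat 0 0 ^ d, P N (f N) ∧ (f N).nat a 0 = N ∧
      (∀ b ∉ (Code.loop a d c).natWrites, (f N).nat b = σ.nat b) ∧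
      (∀ b ∉ c.numWrites, (f N).num b = σ.num b) from (H _ le_rfl).1
  intro N
  induction N with
  | zero =>
    intro _
    refine ⟨h0, by simp [hf, State.nat_writeNat], fun b hb => ?_, fun b _ => rfl⟩
    simp only [natWrites, List.mem_cons, not_or] at hb
    funext j
    simp [hf, State.nat_writeNat, hb.1]
  | succ N ih =>
    intro hN
    obtain ⟨h1, h2, h3, h4⟩ := ih (by omega)
    refine ⟨?_, ?_, fun b hb => ?_, fun b hb => ?_⟩
    · rw [hf1]; exact hs N (by omega) _ h2 h3 h4 h1
    · rw [hf1]; simp [State.nat_writeNat]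
    · have hb' := hb
      simp only [natWrites, List.mem_cons, not_or] at hb
      rw [hf1]
      funext j
      simp only [State.nat_writeNat, hb.1, false_and, if_false, run_nat_of_notMem c hb.2]
      rw [h3 b hb']
    · rw [hf1]
      simp only [State.num_writeNat, run_num_of_notMem c hb]
      exact h4 b hb

end Run

/-! ### Polynomial running time when field operations have unit cost. -/

section Cost

theorem eval_mono (p : Polynomial ℕ) {a b : ℕ} (h : a ≤ b) : p.eval a ≤ p.eval b := by
  induction p using Polynomial.induction_on' with
  | add p q hp hq => simpa using Nat.add_le_add hp hq
  | monomial k c => simpa using Nat.mul_le_mul_left c (Nat.pow_le_pow_left h k)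

theorem size_le_self (m : ℕ) : m.size ≤ m := Nat.size_le.2 Nat.lt_two_pow_self

theorem size_add_le (a b B : ℕ) (ha : a.size ≤ B) (hb : b.size ≤ B) : (a + b).size ≤ B + 1 := by
  rw [Nat.size_le] at *
  rw [pow_succ]; omega

theorem size_mul_le (a b : ℕ) : (a * b).size ≤ a.size + b.size := by
  rw [Nat.size_le, pow_add]
  exact Nat.mul_lt_mul'' (Nat.lt_size_self a) (Nat.lt_size_self b)

variable {K : Type}

/-- All natural numbers in the memory have binary length at most `B`. -/
def State.NatBound (σ : State K) (B : ℕ) : Prop := ∀ a i, (σ.nat a i).size ≤ B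

theorem State.NatBound.mono {σ : State K} {B C : ℕ} (h : σ.NatBound B) (hBC : B ≤ C) :
    σ.NatBound C := fun a i => (h a i).trans hBC

theorem State.NatBound.writeNat {σ : State K} {B : ℕ} (h : σ.NatBound B) (a i m : ℕ)
    (hm : m.size ≤ B) : (σ.writeNat a i m).NatBound B := by
  intro b j
  by_cases hb : b = a
  · subst hb
    by_cases h' : j = i
    · simpa [State.writeNat, h', Function.update_apply]
    · simpa [State.writeNat, h', Function.update_apply] using h b j
  · simpa [State.writeNat, hb, Function.update_apply] using h b j

/-- The constant depends on the expression only: a fixed number of products multiplies lengths by at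
most a constant factor. -/
theorem NExp.exists_cost_le (e : NExp) : ∃ C, ∀ (K : Type) (σ : State K) (B : ℕ), σ.NatBound B →
    (e.eval σ).size ≤ C * (B + 1) ∧ e.cost σ ≤ C * (B + 1) := by
  have key : ∀ (c d : ℕ) (s t u v w B : ℕ), s ≤ c * (B + 1) → t ≤ c * (B + 1) →
      u ≤ d * (B + 1) → v ≤ d * (B + 1) → w ≤ s + u + 1 →
      w ≤ (2 * c + 2 * d + 2) * (B + 1) ∧ t + v + 1 + w ≤ (2 * c + 2 * d + 2) * (B + 1) := by
    intro c d s t u v w B hs ht hu hv hw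
    have : (2 * c + 2 * d + 2) * (B + 1) =
      2 * (c * (B + 1)) + 2 * (d * (B + 1)) + 2 * (B + 1) := by ring
    constructor <;> omega
  induction e with
  | lit c =>
    refine ⟨1 + c.size, fun K σ B _ => ?_⟩
    simp only [eval, cost]
    constructor <;> nlinarith [Nat.zero_le B, Nat.zero_le c.size]
  | get a i ih =>
    obtain ⟨C, hC⟩ := ih
    refine ⟨C + 1, fun K σ B h => ?_⟩
    have h1 := hC K σ B h
    have h2 := h a (i.eval σ)
    simp only [eval, cost, add_mul, one_mul]
    constructor <;> omega
  | add e f he hf =>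
    obtain ⟨C, hC⟩ := he
    obtain ⟨D, hD⟩ := hf
    refine ⟨2 * C + 2 * D + 2, fun K σ B h => ?_⟩
    refine key C D _ _ _ _ _ B (hC K σ B h).1 (hC K σ B h).2 (hD K σ B h).1 (hD K σ B h).2 ?_
    exact size_add_le _ _ _ (Nat.le_add_right _ _) (Nat.le_add_left _ _)
  | sub e f he hf =>
    obtain ⟨C, hC⟩ := he
    obtain ⟨D, hD⟩ := hf
    refine ⟨2 * C + 2 * D + 2, fun K σ B h => ?_⟩
    refine key C D _ _ _ _ _ B (hC K σ B h).1 (hC K σ B h).2 (hD K σ B h).1 (hD K σ B h).2 ?_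
    exact (Nat.size_le_size (Nat.sub_le _ _)).trans (by omega)
  | mul e f he hf =>
    obtain ⟨C, hC⟩ := he
    obtain ⟨D, hD⟩ := hf
    refine ⟨2 * C + 2 * D + 2, fun K σ B h => ?_⟩
    refine key C D _ _ _ _ _ B (hC K σ B h).1 (hC K σ B h).2 (hD K σ B h).1 (hD K σ B h).2 ?_
    exact (size_mul_le _ _).trans (by omega)

/-- For stored values the growth has to be additive, `B + C`. This bound can be iterated
polynomially often, whereas a multiplicative one would become exponential. -/
theorem NExp.exists_size_le (e : NExp) (he : e.mulFree = true) :
    ∃ C, ∀ (K : Type) (σ : State K) (B : ℕ), σ.NatBound B → (e.eval σ).size ≤ B + C := by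
  induction e with
  | lit c => exact ⟨c.size, fun K σ B _ => by simp [eval]⟩
  | get a i ih => exact ⟨0, fun K σ B h => h _ _⟩
  | add e f ihe ihf =>
    simp only [mulFree, Bool.and_eq_true] at he
    obtain ⟨C, hC⟩ := ihe he.1
    obtain ⟨D, hD⟩ := ihf he.2
    refine ⟨C + D + 1, fun K σ B h => ?_⟩
    have := size_add_le (e.eval σ) (f.eval σ) (B + C + D) ((hC K σ B h).trans (by omega))
      ((hD K σ B h).trans (by omega))
    simp only [eval]; omega
  | sub e f ihe ihf =>
    simp only [mulFree, Bool.and_eq_true] at he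
    obtain ⟨C, hC⟩ := ihe he.1
    exact ⟨C, fun K σ B h => (Nat.size_le_size (Nat.sub_le _ _)).trans (hC K σ B h)⟩
  | mul e f => simp [mulFree] at he

theorem FExp.exists_cost_le (e : FExp) : ∃ C, ∀ (K : Type) [Field K] (σ : State K) (B : ℕ),
    σ.NatBound B → e.cost (fun _ => 0) σ ≤ C * (B + 1) := by
  induction e with
  | zero => exact ⟨1, fun K _ σ B _ => by simp [cost]⟩
  | one => exact ⟨1, fun K _ σ B _ => by simp [cost]⟩
  | get a i =>
    obtain ⟨C, hC⟩ := i.exists_cost_le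
    refine ⟨C + 1, fun K _ σ B h => ?_⟩
    have h1 := (hC K σ B h).2
    simp only [cost, add_mul, one_mul]; omega
  | add e f he hf =>
    obtain ⟨C, hC⟩ := he
    obtain ⟨D, hD⟩ := hf
    refine ⟨C + D + 1, fun K _ σ B h => ?_⟩
    have h1 := hC K σ B h
    have h2 := hD K σ B h
    simp only [cost, add_mul, one_mul]; omega
  | sub e f he hf =>
    obtain ⟨C, hC⟩ := he
    obtain ⟨D, hD⟩ := hf
    refine ⟨C + D + 1, fun K _ σ B h => ?_⟩
    have h1 := hC K σ B h
    have h2 := hD K σ B h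
    simp only [cost, add_mul, one_mul]; omega
  | half e he =>
    obtain ⟨C, hC⟩ := he
    refine ⟨C + 1, fun K _ σ B h => ?_⟩
    have h1 := hC K σ B h
    simp only [cost, add_mul, one_mul]; omega

theorem BExp.exists_cost_le (b : BExp) : ∃ C, ∀ (K : Type) [Field K] (σ : State K) (B : ℕ),
    σ.NatBound B → b.cost (fun _ => 0) σ ≤ C * (B + 1) := by
  induction b with
  | nle e f =>
    obtain ⟨C, hC⟩ := e.exists_cost_le
    obtain ⟨D, hD⟩ := f.exists_cost_le
    refine ⟨C + D + 1, fun K _ σ B h => ?_⟩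
    have h1 := (hC K σ B h).2
    have h2 := (hD K σ B h).2
    simp only [cost, add_mul, one_mul]; omega
  | fle e f =>
    obtain ⟨C, hC⟩ := e.exists_cost_le
    obtain ⟨D, hD⟩ := f.exists_cost_le
    refine ⟨C + D + 1, fun K _ σ B h => ?_⟩
    have h1 := hC K σ B h
    have h2 := hD K σ B h
    simp only [cost, add_mul, one_mul]; omega
  | neg b hb =>
    obtain ⟨C, hC⟩ := hb
    refine ⟨C + 1, fun K _ σ B h => ?_⟩
    have h1 := hC K σ B h
    simp only [cost, add_mul, one_mul]; omega
  | conj b c hb hc =>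
    obtain ⟨C, hC⟩ := hb
    obtain ⟨D, hD⟩ := hc
    refine ⟨C + D + 1, fun K _ σ B h => ?_⟩
    have h1 := hC K σ B h
    have h2 := hD K σ B h
    simp only [cost, add_mul, one_mul]; omega

theorem NExp.eval_pow (e : NExp) (σ : State K) (d : ℕ) : (e.pow d).eval σ = e.eval σ ^ d := by
  induction d with
  | zero => rfl
  | succ d ih => simp [pow, eval, ih, pow_succ]

/-- Execution of a loop, given the executions of its body. -/
theorem Code.exec_while [Field K] [LinearOrder K] {a d : ℕ} {c : Code} {f : ℕ → State K} {N T : ℕ}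
    (hcount : ∀ i ≤ N, (f i).nat a 0 = i) (hN : ∀ i ≤ N, (f i).nat 0 0 ^ d = N)
    (hf : ∀ i < N, f (i + 1) = (c.run (f i)).writeNat a 0 (i + 1))
    (hca : ∀ i < N, (c.run (f i)).nat a 0 = i)
    (hcond : ∀ i ≤ N, (BExp.neg (.nle ((NExp.get 0 (.lit 0)).pow d) (.get a (.lit 0)))).cost
      (fun _ => 0) (f i) ≤ T)
    (hinc : ∀ i < N, (NExp.add (.get a (.lit 0)) (.lit 1)).cost (c.run (f i)) ≤ T)
    (hbody : ∀ i < N, ∃ t ≤ T, Exec (fun _ => 0) c.toProgram (f i) (c.run (f i)) t) :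
    ∃ t ≤ (N + 1) * (3 * T + 10), Exec (fun _ => 0)
      (.while (.neg (.nle ((NExp.get 0 (.lit 0)).pow d) (.get a (.lit 0))))
        (.seq c.toProgram (.setNat a (.lit 0) (.add (.get a (.lit 0)) (.lit 1))))) (f 0) (f N) t := by
  -- The induction is on the number of rounds still to come, because the rule for `while` puts a
  -- round in front of an execution.
  suffices H : ∀ k ≤ N, ∃ t ≤ (k + 1) * (3 * T + 10), Exec (fun _ => 0)
      (.while (.neg (.nle ((NExp.get 0 (.lit 0)).pow d) (.get a (.lit 0))))
        (.seq c.toProgram (.setNat a (.lit 0) (.add (.get a (.lit 0)) (.lit 1)))))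
      (f (N - k)) (f N) t by simpa using H N le_rfl
  intro k
  induction k with
  | zero =>
    intro _
    refine ⟨_, ?_, Exec.while_false ?_⟩
    · have := hcond N le_rfl
      simp only [Nat.sub_zero]; omega
    · simp [BExp.Holds, NExp.eval_pow, NExp.eval, hcount N le_rfl, hN N le_rfl]
  | succ k ih =>
    intro hk
    obtain ⟨t, ht, hE⟩ := ih (by omega)
    have hi : N - (k + 1) < N := by omega
    set i := N - (k + 1) with hidef
    have hi1 : N - k = i + 1 := by omega
    rw [hi1] at hE
    obtain ⟨t', ht', hE'⟩ := hbody i hi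
    have hset := Exec.setNat (bits := fun _ => 0) (c.run (f i)) a (.lit 0)
      (.add (.get a (.lit 0)) (.lit 1))
    simp only [NExp.eval, hca i hi] at hset
    rw [← hf i hi] at hset
    refine ⟨_, ?_, Exec.while_true ?_ (Exec.seq hE' hset) hE⟩
    · have h1 := hcond i hi.le
      have h2 := hinc i hi
      have h3 : (NExp.lit 0).cost (c.run (f i)) = 1 := by simp [NExp.cost]
      rw [h3]
      have : (k + 1 + 1) * (3 * T + 10) = (k + 1) * (3 * T + 10) + (3 * T + 10) := by ring
      omega
    · simp [BExp.Holds, NExp.eval_pow, NExp.eval, hcount i hi.le, hN i hi.le, hi]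

theorem Code.zero_notMem_natWrites (c : Code) (hc : c.ok = true) : 0 ∉ c.natWrites := by
  induction c with
  | skip => simp [natWrites]
  | setNat a i e =>
    simp only [ok, Bool.and_eq_true, bne_iff_ne] at hc
    simpa [natWrites] using hc.1.symm
  | setNum a i e => simp [natWrites]
  | seq c d ihc ihd =>
    simp only [ok, Bool.and_eq_true] at hc
    simp [natWrites, ihc hc.1, ihd hc.2]
  | ite b c d ihc ihd =>
    simp only [ok, Bool.and_eq_true] at hc
    simp [natWrites, ihc hc.1, ihd hc.2]
  | loop a d c ih =>
    simp only [ok, Bool.and_eq_true, bne_iff_ne] at hc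
    simp [natWrites, ih hc.2, hc.1.1.symm]

open Polynomial in
/-- Loop programs run in polynomial time when arithmetic in the field has unit cost. -/
theorem Code.exists_exec (c : Code) (hc : c.ok = true) : ∃ g q : Polynomial ℕ,
    ∀ (K : Type) [Field K] [LinearOrder K] (σ : State K) (B : ℕ), σ.NatBound B →
      (c.run σ).NatBound (B + g.eval (σ.nat 0 0)) ∧
      ∃ t ≤ q.eval (σ.nat 0 0 + B), Exec (fun _ => 0) c.toProgram σ (c.run σ) t := by
  induction c with
  | skip => exact ⟨0, 1, fun K _ _ σ B h => ⟨by simpa [run], 1, by simp, Exec.skip σ⟩⟩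
  | setNat a i e =>
    simp only [ok, Bool.and_eq_true] at hc
    obtain ⟨C, hC⟩ := i.exists_cost_le
    obtain ⟨D, hD⟩ := e.exists_cost_le
    obtain ⟨F, hF⟩ := e.exists_size_le hc.2
    refine ⟨Polynomial.C F, Polynomial.C (C + D + 1) * (X + 1), fun K _ _ σ B h =>
      ⟨?_, _, ?_, Exec.setNat σ a i e⟩⟩
    · simp only [run, eval_C]
      exact (h.mono (by omega)).writeNat _ _ _ (hF K σ B h)
    · have h1 := (hC K σ B h).2
      have h2 := (hD K σ B h).2
      simp only [eval_mul, eval_C, eval_add, eval_X, eval_one]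
      nlinarith [Nat.zero_le (σ.nat 0 0)]
  | setNum a i e =>
    obtain ⟨C, hC⟩ := i.exists_cost_le
    obtain ⟨D, hD⟩ := e.exists_cost_le
    refine ⟨0, Polynomial.C (C + D + 1) * (X + 1), fun K _ _ σ B h =>
      ⟨fun b j => by simpa [run] using h b j, _, ?_, Exec.setNum σ a i e⟩⟩
    have h1 := (hC K σ B h).2
    have h2 := (hD K σ B h)
    simp only [eval_mul, eval_C, eval_add, eval_X, eval_one]
    nlinarith [Nat.zero_le (σ.nat 0 0)]
  | seq c d ihc ihd =>
    simp only [ok, Bool.and_eq_true] at hc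
    obtain ⟨g, q, hq⟩ := ihc hc.1
    obtain ⟨g', q', hq'⟩ := ihd hc.2
    refine ⟨g + g', q + q'.comp (X + g), fun K _ _ σ B h => ?_⟩
    obtain ⟨h1, t, ht, hE⟩ := hq K σ B h
    obtain ⟨h1', t', ht', hE'⟩ := hq' K _ _ h1
    have h0 : (c.run σ).nat 0 0 ≤ σ.nat 0 0 := by
      rw [run_nat_of_notMem c (zero_notMem_natWrites c hc.1) σ]
    refine ⟨?_, t + t', ?_, Exec.seq hE hE'⟩
    · refine h1'.mono ?_
      have := eval_mono g' h0
      simp only [eval_add]; omega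
    · simp only [eval_add, eval_comp, eval_X]
      have h2 := eval_mono g (Nat.le_add_right (σ.nat 0 0) B)
      have := eval_mono q' (a := (c.run σ).nat 0 0 + (B + g.eval (σ.nat 0 0)))
        (b := σ.nat 0 0 + B + g.eval (σ.nat 0 0 + B)) (by omega)
      omega
  | ite b c d ihc ihd =>
    simp only [ok, Bool.and_eq_true] at hc
    obtain ⟨g, q, hq⟩ := ihc hc.1
    obtain ⟨g', q', hq'⟩ := ihd hc.2
    obtain ⟨C, hC⟩ := b.exists_cost_le
    refine ⟨g + g', q + q' + Polynomial.C C * (X + 1) + 1, fun K _ _ σ B h => ?_⟩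
    have hb := hC K σ B h
    have hb' : C * (B + 1) ≤ C * (σ.nat 0 0 + B + 1) := Nat.mul_le_mul_left _ (by omega)
    simp only [eval_add, eval_mul, eval_C, eval_X, eval_one, run]
    by_cases hcond : b.Holds σ
    · obtain ⟨h1, t, ht, hE⟩ := hq K σ B h
      rw [if_pos hcond]
      exact ⟨h1.mono (by omega), _, by omega, Exec.ite_true hcond hE⟩
    · obtain ⟨h1, t, ht, hE⟩ := hq' K σ B h
      rw [if_neg hcond]
      exact ⟨h1.mono (by omega), _, by omega, Exec.ite_false hcond hE⟩
  | loop a d c ih =>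
    simp only [ok, Bool.and_eq_true, bne_iff_ne, ne_eq, Bool.not_eq_eq_eq_not, Bool.not_true,
      List.contains_eq_mem, decide_eq_false_iff_not] at hc
    obtain ⟨⟨ha, hac⟩, hc⟩ := hc
    have h0c : 0 ∉ c.natWrites := zero_notMem_natWrites c hc
    obtain ⟨g, q, hq⟩ := ih hc
    obtain ⟨C, hC⟩ := (BExp.neg (.nle ((NExp.get 0 (.lit 0)).pow d)
      (.get a (.lit 0)))).exists_cost_le
    obtain ⟨D, hD⟩ := (NExp.add (.get a (.lit 0)) (.lit 1)).exists_cost_le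
    -- The summand `X ^ d` covers the value of the loop counter, and `X ^ d * g` covers the growth
    -- in the `n ^ d` executions of the body. It is essential that `g` depends on `n` and not on
    -- `B`.
    set G : Polynomial ℕ := X ^ d + X ^ d * g with hG
    refine ⟨G, (X ^ d + 1) * (3 * (Polynomial.C (C + D) * (X + G + 1) + q.comp (X + G)) + 10) + 3,
      fun K _ _ σ B h => ?_⟩
    set n := σ.nat 0 0 with hn
    set f : ℕ → State K := fun N =>
      Nat.rec (σ.writeNat a 0 0) (fun i s => (c.run s).writeNat a 0 (i + 1)) N with hf
    have hf1 : ∀ N, f (N + 1) = (c.run (f N)).writeNat a 0 (N + 1) := fun N => rfl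
    have hfa : ∀ N, (f N).nat a 0 = N := by
      intro N
      cases N <;> simp [hf, State.nat_writeNat]
    have hf0 : ∀ N, (f N).nat 0 0 = n := by
      intro N
      induction N with
      | zero => simp [hf, State.nat_writeNat, Ne.symm ha, hn]
      | succ N ih => simp [hf1, State.nat_writeNat, Ne.symm ha, run_nat_of_notMem c h0c, ih]
    have hbd : ∀ i ≤ n ^ d, (f i).NatBound (B + n ^ d + i * g.eval n) := by
      intro i
      induction i with
      | zero =>
        intro _
        exact (h.mono (by omega)).writeNat _ _ _ (by simp)
      | succ i ih =>
        intro hi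
        rw [hf1]
        have := (hq K _ _ (ih (by omega))).1
        rw [hf0] at this
        refine (this.mono ?_).writeNat _ _ _ ((size_le_self _).trans ?_)
        · rw [add_mul]; omega
        · omega
    have hBG : ∀ i ≤ n ^ d, B + n ^ d + i * g.eval n ≤ B + G.eval n := by
      intro i hi
      have := Nat.mul_le_mul_right (g.eval n) hi
      simp only [hG, eval_add, eval_mul, eval_pow, eval_X]; omega
    have hbody : ∀ i < n ^ d, (c.run (f i)).NatBound (B + G.eval n) ∧
        ∃ t ≤ q.eval (n + (B + G.eval n)), Exec (fun _ => 0) c.toProgram (f i) (c.run (f i)) t := by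
      intro i hi
      obtain ⟨h1, t, ht, hE⟩ := hq K _ _ (hbd i hi.le)
      rw [hf0] at h1 ht
      refine ⟨h1.mono ?_, t, ht.trans (eval_mono q ?_), hE⟩
      · have := hBG (i + 1) hi
        rw [add_mul] at this; omega
      · have := hBG i hi.le
        omega
    refine ⟨(hbd _ le_rfl).mono (hBG _ le_rfl), ?_⟩
    set T := (C + D) * (B + G.eval n + 1) + q.eval (n + (B + G.eval n)) with hT
    obtain ⟨t, ht, hE⟩ := Code.exec_while (a := a) (d := d) (c := c) (f := f) (N := n ^ d) (T := T)
      (fun i _ => hfa i) (fun i _ => by rw [hf0]) (fun i _ => hf1 i)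
      (fun i _ => by rw [run_nat_of_notMem c hac, hfa])
      (fun i hi => by
        have := hC K _ _ ((hbd i hi).mono (hBG i hi))
        rw [hT, add_mul]; omega)
      (fun i hi => by
        have := (hD K _ _ (hbody i hi).1).2
        rw [hT, add_mul]; omega)
      (fun i hi => by
        obtain ⟨_, t, ht, hE⟩ := hbody i hi
        exact ⟨t, by omega, hE⟩)
    refine ⟨_, ?_, Exec.seq (Exec.setNat σ a (.lit 0) (.lit 0)) hE⟩
    have hGm : G.eval n ≤ G.eval (n + B) := eval_mono G (Nat.le_add_right _ _)
    have hq2 := eval_mono q (a := n + (B + G.eval n)) (b := n + B + G.eval (n + B)) (by omega)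
    have hpow : n ^ d ≤ (n + B) ^ d := Nat.pow_le_pow_left (Nat.le_add_right _ _) d
    have hT2 : T ≤ (C + D) * (n + B + G.eval (n + B) + 1) + q.eval (n + B + G.eval (n + B)) := by
      have := Nat.mul_le_mul_left (C + D) (show B + G.eval n + 1 ≤ n + B + G.eval (n + B) + 1 by omega)
      omega
    have h10 : eval (n + B) (10 : Polynomial ℕ) = 10 := by
      rw [← Polynomial.C_ofNat, eval_C]
    have h3 : eval (n + B) (3 : Polynomial ℕ) = 3 := by
      rw [← Polynomial.C_ofNat, eval_C]
    simp only [eval_add, eval_mul, eval_pow, eval_X, eval_C, eval_comp, eval_one, h10, h3]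
    have h0cost : (NExp.lit 0).cost σ = 1 := by simp [NExp.cost]
    rw [h0cost]
    have := Nat.mul_le_mul (show n ^ d + 1 ≤ (n + B) ^ d + 1 by omega)
      (show 3 * T + 10 ≤ 3 * ((C + D) * (n + B + G.eval (n + B) + 1) +
        q.eval (n + B + G.eval (n + B))) + 10 by omega)
    omega

end Cost

/-! ### Bit lengths over the rational numbers. -/

section RationalCost

/-- The rational number `q` is a fraction with denominator `2 ^ s * D` and numerator of absolute
value at most `4 ^ s * A`. -/
def RatBound (D A s : ℕ) (q : ℚ) : Prop := ∃ z : ℤ, q * (2 ^ s * D) = z ∧ |z| ≤ 4 ^ s * A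

variable {D A s : ℕ}

theorem RatBound.succ {q : ℚ} (h : RatBound D A s q) : RatBound D A (s + 1) q := by
  obtain ⟨z, h1, h2⟩ := h
  refine ⟨2 * z, by push_cast; rw [← h1]; ring, ?_⟩
  rw [abs_mul, abs_two, pow_succ]
  nlinarith [abs_nonneg z]

theorem RatBound.mono {q : ℚ} (h : RatBound D A s q) {t : ℕ} (hst : s ≤ t) : RatBound D A t q := by
  induction t, hst using Nat.le_induction with
  | base => exact h
  | succ t _ ih => exact ih.succ

/-- Passing from `2 ^ s * D` to `2 ^ (s + 1) * D` doubles the numerators, and the sum of two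
numerators doubles the bound once more; hence the base 4 for numerators. -/
theorem RatBound.add {p q : ℚ} (hp : RatBound D A s p) (hq : RatBound D A s q) :
    RatBound D A (s + 1) (p + q) := by
  obtain ⟨z, h1, h2⟩ := hp
  obtain ⟨w, h3, h4⟩ := hq
  refine ⟨2 * (z + w), by push_cast; rw [← h1, ← h3]; ring, ?_⟩
  rw [abs_mul, abs_two, pow_succ]
  have := abs_add_le z w
  nlinarith [abs_nonneg z]

theorem RatBound.neg {q : ℚ} (hq : RatBound D A s q) : RatBound D A s (-q) := by
  obtain ⟨w, h3, h4⟩ := hq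
  exact ⟨-w, by push_cast; rw [← h3]; ring, by rwa [abs_neg]⟩

theorem RatBound.half {q : ℚ} (hq : RatBound D A s q) : RatBound D A (s + 1) (q / 2) := by
  obtain ⟨w, h3, h4⟩ := hq
  refine ⟨w, by rw [← h3]; ring, ?_⟩
  rw [pow_succ]
  nlinarith [abs_nonneg w]

theorem RatBound.ratBits_le {q : ℚ} (hD : 0 < D) (h : RatBound D A s q) :
    ratBits q ≤ 3 * s + (D.size + A.size) := by
  obtain ⟨z, h1, h2⟩ := h
  have hpos : (0 : ℤ) < 2 ^ s * D := by positivity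
  have hq : q = Rat.divInt z (2 ^ s * D) := by
    rw [Rat.divInt_eq_div]
    push_cast
    rw [← h1]
    have : (2 : ℚ) ^ s * D ≠ 0 := by positivity
    field_simp
  have hden : q.den ≤ 2 ^ s * D := by
    have h3 := Rat.den_dvd z (2 ^ s * D)
    rw [← hq] at h3
    have := Int.le_of_dvd hpos h3
    exact_mod_cast this
  have hnum : q.num.natAbs ≤ 4 ^ s * A := by
    have h3 := Rat.num_dvd z (b := 2 ^ s * D) hpos.ne'
    rw [← hq] at h3
    rcases eq_or_ne z 0 with hz | hz
    · subst hz
      have : q = 0 := by rw [hq]; simp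
      simp [this]
    · have h4 := Int.natAbs_dvd_natAbs.2 h3
      have h5 := Nat.le_of_dvd (Int.natAbs_pos.2 hz) h4
      have : (z.natAbs : ℤ) ≤ 4 ^ s * A := by rwa [Int.natCast_natAbs]
      have h6 : z.natAbs ≤ 4 ^ s * A := by exact_mod_cast this
      omega
  have e1 : (2 ^ s * D).size ≤ s + D.size := by
    rw [Nat.size_le, pow_add]
    exact Nat.mul_lt_mul_of_pos_left (Nat.lt_size_self D) (by positivity)
  have e2 : (4 ^ s * A).size ≤ 2 * s + A.size := by
    rw [Nat.size_le, pow_add, pow_mul]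
    exact Nat.mul_lt_mul_of_pos_left (Nat.lt_size_self A) (by positivity)
  have e3 := Nat.size_le_size hden
  have e4 := Nat.size_le_size hnum
  unfold ratBits
  omega

/-- The exponent `s` serves as a clock: each operation advances it by at most its unit cost. There
is no multiplication in the field, so `D` never has to be enlarged. -/
theorem FExp.ratBound_eval (hDA : D ≤ A) (σ : State ℚ) (hσ : ∀ a i, RatBound D A s (σ.num a i))
    (e : FExp) : RatBound D A (s + e.cost (fun _ => 0) σ) (e.eval σ) := by
  induction e with
  | zero => exact ⟨0, by simp [eval], by simp⟩
  | one =>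
    -- The constant 1 has the whole denominator as its numerator, and this is what `D ≤ A` is for.
    refine ⟨2 ^ (s + 1) * D, by simp [eval, cost], ?_⟩
    rw [abs_of_nonneg (by positivity)]
    have h1 : (2 : ℤ) ^ (s + 1) ≤ 4 ^ (s + 1) := pow_le_pow_left₀ (by norm_num) (by norm_num) _
    have h2 : (D : ℤ) ≤ A := by exact_mod_cast hDA
    simp only [cost]
    exact mul_le_mul h1 h2 (by positivity) (by positivity)
  | get a i => exact (hσ _ _).mono (Nat.le_add_right _ _)
  | add e f he hf =>
    simp only [eval, cost, add_zero]
    exact ((he.mono (by omega)).add (hf.mono (by omega)) :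
      RatBound D A (s + (e.cost (fun _ => 0) σ + f.cost (fun _ => 0) σ) + 1) _)
  | sub e f he hf =>
    simp only [eval, cost, add_zero, sub_eq_add_neg]
    exact ((he.mono (by omega)).add (hf.neg.mono (by omega)) :
      RatBound D A (s + (e.cost (fun _ => 0) σ + f.cost (fun _ => 0) σ) + 1) _)
  | half e he =>
    simp only [eval, cost, add_zero]
    exact he.half

theorem FExp.cost_ratBits_le (hD : 0 < D) (hDA : D ≤ A) (σ : State ℚ)
    (hσ : ∀ a i, RatBound D A s (σ.num a i)) (e : FExp) (M : ℕ)
    (hM : 3 * (s + e.cost (fun _ => 0) σ) + (D.size + A.size) ≤ M) :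
    e.cost ratBits σ ≤ e.cost (fun _ => 0) σ * (1 + M) := by
  have key := (e.ratBound_eval hDA σ hσ).ratBits_le hD
  induction e with
  | zero => simp only [eval, cost] at *; omega
  | one => simp only [eval, cost] at *; omega
  | get a i =>
    simp only [eval, cost, add_zero] at *
    have := Nat.le_mul_of_pos_right (i.cost σ) (show 0 < 1 + M by omega)
    rw [add_mul]; omega
  | add e f he hf =>
    have h1 := (e.ratBound_eval hDA σ hσ).ratBits_le hD
    have h2 := (f.ratBound_eval hDA σ hσ).ratBits_le hD
    simp only [eval, cost, add_zero] at *
    have h3 := he (by omega) h1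
    have h4 := hf (by omega) h2
    simp only [add_mul]; omega
  | sub e f he hf =>
    have h1 := (e.ratBound_eval hDA σ hσ).ratBits_le hD
    have h2 := (f.ratBound_eval hDA σ hσ).ratBits_le hD
    simp only [eval, cost, add_zero] at *
    have h3 := he (by omega) h1
    have h4 := hf (by omega) h2
    simp only [add_mul]; omega
  | half e he =>
    have h1 := (e.ratBound_eval hDA σ hσ).ratBits_le hD
    simp only [eval, cost, add_zero] at *
    have h3 := he (by omega) h1
    simp only [add_mul]; omega

theorem BExp.cost_ratBits_le (hD : 0 < D) (hDA : D ≤ A) (σ : State ℚ)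
    (hσ : ∀ a i, RatBound D A s (σ.num a i)) (b : BExp) (M : ℕ)
    (hM : 3 * (s + b.cost (fun _ => 0) σ) + (D.size + A.size) ≤ M) :
    b.cost ratBits σ ≤ b.cost (fun _ => 0) σ * (1 + M) := by
  induction b with
  | nle e f =>
    simp only [cost] at *
    exact Nat.le_mul_of_pos_right _ (by omega)
  | fle e f =>
    simp only [cost] at *
    have h1 := e.cost_ratBits_le hD hDA σ hσ M (by omega)
    have h2 := f.cost_ratBits_le hD hDA σ hσ M (by omega)
    simp only [add_mul]; omega
  | neg b hb =>
    simp only [cost] at *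
    have h1 := hb (by omega)
    simp only [add_mul]; omega
  | conj b c hb hc =>
    simp only [cost] at *
    have h1 := hb (by omega)
    have h2 := hc (by omega)
    simp only [add_mul]; omega

/-- The bit complexity of a computation in terms of its number of operations: an operation adds
only a bounded number of bits to the numbers involved. -/
theorem Exec.exists_ratBits (hD : 0 < D) (hDA : D ≤ A) {P : Program} {σ τ : State ℚ} {t : ℕ}
    (h : Exec (fun _ => 0) P σ τ t) (s : ℕ) (hσ : ∀ a i, RatBound D A s (σ.num a i)) (M : ℕ)
    (hM : 3 * (s + t) + (D.size + A.size) ≤ M) :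
    (∀ a i, RatBound D A (s + t) (τ.num a i)) ∧ ∃ t' ≤ t * (1 + M), Exec ratBits P σ τ t' := by
  induction h generalizing s with
  | skip σ => exact ⟨fun a i => (hσ a i).mono (by omega), 1, by omega, Exec.skip σ⟩
  | setNat σ a i e =>
    refine ⟨fun a i => (hσ a i).mono (by omega), _, ?_, Exec.setNat σ a i e⟩
    exact Nat.le_mul_of_pos_right _ (by omega)
  | setNum σ a i e =>
    have h1 := e.ratBound_eval hDA σ hσ
    refine ⟨fun b j => ?_, _, ?_, Exec.setNum σ a i e⟩
    · rw [State.num_writeNum]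
      split_ifs
      · exact h1.mono (by omega)
      · exact (hσ b j).mono (by omega)
    · have h2 := e.cost_ratBits_le hD hDA σ hσ M (by omega)
      have h3 := Nat.le_mul_of_pos_right (i.cost σ) (show 0 < 1 + M by omega)
      simp only [add_mul]; omega
  | seq h1 h2 ih1 ih2 =>
    obtain ⟨h3, t', ht', hE⟩ := ih1 s hσ (by omega)
    obtain ⟨h4, t'', ht'', hE'⟩ := ih2 _ h3 (by omega)
    refine ⟨fun a i => (h4 a i).mono (by omega), _, ?_, Exec.seq hE hE'⟩
    simp only [add_mul] at *; omega
  | @ite_true b c d σ τ t hb h1 ih =>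
    obtain ⟨h3, t', ht', hE⟩ := ih s hσ (by omega)
    refine ⟨fun a i => (h3 a i).mono (by omega), _, ?_, Exec.ite_true hb hE⟩
    have := b.cost_ratBits_le hD hDA σ hσ M (by omega)
    simp only [add_mul] at *; omega
  | @ite_false b c d σ τ t hb h1 ih =>
    obtain ⟨h3, t', ht', hE⟩ := ih s hσ (by omega)
    refine ⟨fun a i => (h3 a i).mono (by omega), _, ?_, Exec.ite_false hb hE⟩
    have := b.cost_ratBits_le hD hDA σ hσ M (by omega)
    simp only [add_mul] at *; omega
  | @while_true b c σ τ ρ u t hb h1 h2 ih1 ih2 =>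
    obtain ⟨h3, t', ht', hE⟩ := ih1 s hσ (by omega)
    obtain ⟨h4, t'', ht'', hE'⟩ := ih2 _ h3 (by omega)
    refine ⟨fun a i => (h4 a i).mono (by omega), _, ?_, Exec.while_true hb hE hE'⟩
    have := b.cost_ratBits_le hD hDA σ hσ M (by omega)
    simp only [add_mul] at *; omega
  | @while_false b c σ hb =>
    refine ⟨fun a i => (hσ a i).mono (by omega), _, ?_, Exec.while_false hb⟩
    have := b.cost_ratBits_le hD hDA σ hσ M (by omega)
    simp only [add_mul] at *; omega

/-- The numbers of the input have a common denominator of polynomial length. -/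
theorem exists_ratBound_initState {n : ℕ} (r u v : Fin n) (x : Edge (Fin n) → ℚ) (y : Fin n → ℚ) :
    ∃ D A : ℕ, 0 < D ∧ D ≤ A ∧ D.size + A.size ≤ 3 * inputLength ratBits x y + 2 ∧
      ∀ a i, RatBound D A 0 ((initState r u v x y).num a i) := by
  set L := inputLength ratBits x y with hL
  -- The product of all denominators is crude, but its length is at most the sum of their lengths.
  set D : ℕ := (∏ e, (x e).den) * ∏ w, (y w).den with hD
  have hDpos : 0 < D :=
    Nat.mul_pos (Finset.prod_pos fun e _ => (x e).pos) (Finset.prod_pos fun w _ => (y w).pos)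
  have hbits : ∀ q : ℚ, q.den ≤ 2 ^ ratBits q := fun q =>
    (Nat.lt_size_self q.den).le.trans (Nat.pow_le_pow_right (by norm_num) (by simp [ratBits]))
  have hnbits : ∀ q : ℚ, q.num.natAbs ≤ 2 ^ ratBits q := fun q =>
    (Nat.lt_size_self q.num.natAbs).le.trans
      (Nat.pow_le_pow_right (by norm_num) (by simp [ratBits]))
  have hDL : D ≤ 2 ^ L := by
    calc D ≤ (∏ e, 2 ^ ratBits (x e)) * ∏ w, 2 ^ ratBits (y w) :=
          Nat.mul_le_mul (Finset.prod_le_prod' fun e _ => hbits _)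
            (Finset.prod_le_prod' fun w _ => hbits _)
      _ = 2 ^ (∑ e, ratBits (x e) + ∑ w, ratBits (y w)) := by
          rw [Finset.prod_pow_eq_pow_sum, Finset.prod_pow_eq_pow_sum, pow_add]
      _ ≤ 2 ^ L := Nat.pow_le_pow_right (by norm_num) (by rw [hL, inputLength]; omega)
  -- Over the denominator `D` a numerator is multiplied by a cofactor of at most `D ≤ 2 ^ L`, and it
  -- is itself at most `2 ^ L`.
  refine ⟨D, 2 ^ (2 * L), hDpos, hDL.trans (Nat.pow_le_pow_right (by norm_num) (by omega)), ?_, ?_⟩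
  · have h1 : D.size ≤ L + 1 :=
      Nat.size_le.2 (lt_of_le_of_lt hDL (Nat.pow_lt_pow_right (by norm_num) (by omega)))
    have h2 : (2 ^ (2 * L)).size ≤ 2 * L + 1 :=
      Nat.size_le.2 (Nat.pow_lt_pow_right (by norm_num) (by omega))
    omega
  · have key : ∀ q : ℚ, q.den ∣ D → ratBits q ≤ L → RatBound D (2 ^ (2 * L)) 0 q := by
      intro q hq hqL
      obtain ⟨k, hk⟩ := hq
      refine ⟨q.num * k, ?_, ?_⟩
      · rw [hk]
        push_cast
        rw [pow_zero, one_mul, ← mul_assoc, Rat.mul_den_eq_num]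
      · have h1 : k ≤ 2 ^ L := le_trans (Nat.le_of_dvd hDpos ⟨q.den, by rw [hk, mul_comm]⟩) hDL
        have h2 : q.num.natAbs ≤ 2 ^ L :=
          (hnbits q).trans (Nat.pow_le_pow_right (by norm_num) hqL)
        have h3 := Nat.mul_le_mul h2 h1
        rw [abs_mul, ← Int.natCast_natAbs, pow_zero, one_mul, two_mul, pow_add]
        simp only [Nat.abs_cast]
        exact_mod_cast h3
    have h0 : RatBound D (2 ^ (2 * L)) 0 0 := ⟨0, by simp, by simp⟩
    intro a i
    simp only [initState]
    split_ifs with h1 h2 h3 h4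
    · refine key _ (dvd_mul_of_dvd_left (Finset.dvd_prod_of_mem (fun e => (x e).den)
        (Finset.mem_univ _)) _) ?_
      have := Finset.single_le_sum (f := fun e => ratBits (x e)) (fun _ _ => Nat.zero_le _)
        (Finset.mem_univ (mkEdge (⟨i / n, h2.1⟩ : Fin n) ⟨i % n, h2.2.1⟩ (by simpa using h2.2.2)))
      rw [hL, inputLength]
      omega
    · exact h0
    · refine key _ (dvd_mul_of_dvd_right (Finset.dvd_prod_of_mem (fun w => (y w).den)
        (Finset.mem_univ _)) _) ?_
      have := Finset.single_le_sum (f := fun w => ratBits (y w)) (fun _ _ => Nat.zero_le _)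
        (Finset.mem_univ (⟨i, h4⟩ : Fin n))
      rw [hL, inputLength]
      omega
    · exact h0
    · exact h0

end RationalCost

open Polynomial in
/-- A loop program that solves the problem over every ordered field yields the two running time
bounds. -/
theorem Code.exists_program (c : Code) (hc : c.ok = true) : ∃ p : Polynomial ℕ,
    (∀ (n : ℕ) (r u v : Fin n) (x : Edge (Fin n) → ℝ) (y : Fin n → ℝ),
      ∃ t ≤ p.eval n, Exec unitBits c.toProgram (initState r u v x y)
        (c.run (initState r u v x y)) t) ∧
    (∀ (n : ℕ) (r u v : Fin n) (x : Edge (Fin n) → ℚ) (y : Fin n → ℚ),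
      ∃ t ≤ p.eval (inputLength ratBits x y), Exec ratBits c.toProgram (initState r u v x y)
        (c.run (initState r u v x y)) t) := by
  obtain ⟨g, q, hq⟩ := c.exists_exec hc
  have hnat : ∀ (K : Type) [Field K] (n : ℕ) (r u v : Fin n) (x : Edge (Fin n) → K) (y : Fin n → K),
      (initState r u v x y).NatBound n ∧ (initState r u v x y).nat 0 0 = n := by
    intro K _ n r u v x y
    refine ⟨fun a i => ?_, by simp [initState]⟩
    refine (size_le_self _).trans ?_
    simp only [initState]
    split_ifs
    · rcases i with _ | _ | _ | _ | i <;> simp [Fin.is_le', (r.2).le, (u.2).le, (v.2).le]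
    · exact Nat.zero_le _
  -- The argument is `2 * X` because `n` bounds both the value of `n` itself and all initial
  -- lengths. The second factor bounds the length of any number that occurs: three bits per unit of
  -- time, plus the lengths of `D` and `A`.
  refine ⟨q.comp (2 * X) * (1 + (3 * q.comp (2 * X) + (3 * X + 2))), ?_, ?_⟩
  · intro n r u v x y
    obtain ⟨h1, h2⟩ := hnat ℝ n r u v x y
    obtain ⟨-, t, ht, hE⟩ := hq ℝ _ _ h1
    refine ⟨t, ht.trans ?_, hE⟩
    rw [h2, ← two_mul]
    simp only [eval_mul, eval_comp, eval_add, eval_X, eval_one, eval_ofNat]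
    exact Nat.le_mul_of_pos_right _ (by omega)
  · intro n r u v x y
    obtain ⟨h1, h2⟩ := hnat ℚ n r u v x y
    obtain ⟨-, t, ht, hE⟩ := hq ℚ _ _ h1
    rw [h2, ← two_mul] at ht
    obtain ⟨D, A, hD, hDA, hs, hb⟩ := exists_ratBound_initState r u v x y
    obtain ⟨-, t', ht', hE'⟩ := hE.exists_ratBits hD hDA 0 hb _ le_rfl
    refine ⟨t', ht'.trans ?_, hE'⟩
    have hnL : n ≤ inputLength ratBits x y := by rw [inputLength]; omega
    have htL : t ≤ q.eval (2 * inputLength ratBits x y) := ht.trans (eval_mono q (by omega))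
    simp only [eval_mul, eval_comp, eval_add, eval_X, eval_one, eval_ofNat]
    exact Nat.mul_le_mul htL (by omega)

/-! ### Cuts and splitting off -/

section Cuts

variable {V K : Type} [Fintype V] [DecidableEq V] [Field K]

/-- The weight of the cut `δ(S)` in the weighted graph with symmetric weight matrix `X`. -/
def cut (X : V → V → K) (S : Finset V) : K := ∑ i, ∑ j, if i ∈ S ∧ j ∉ S then X i j else 0

/-- The matrix of the edge `{p, q}`. -/
def edgeMatrix (p q : V) : V → V → K := fun i j => if (i = p ∧ j = q) ∨ (i = q ∧ j = p) then 1 else 0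

/-- Splitting off the pair of edges `{a, v}` and `{b, v}` by the amount `m`. -/
def splitOff (X : V → V → K) (v a b : V) (m : K) : V → V → K := fun i j =>
  X i j + m * (edgeMatrix a b i j - edgeMatrix a v i j - edgeMatrix b v i j)

theorem cut_compl {X : V → V → K} (hX : ∀ i j, X i j = X j i) (S : Finset V) :
    cut X Sᶜ = cut X S := by
  unfold cut
  rw [Finset.sum_comm]
  refine Finset.sum_congr rfl fun i _ => Finset.sum_congr rfl fun j _ => ?_
  rw [hX j i]
  simp [and_comm]

theorem cut_singleton {X : V → V → K} (hX : ∀ i, X i i = 0) (a : V) :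
    cut X {a} = ∑ j, X a j := by
  unfold cut
  rw [Finset.sum_eq_single a]
  · refine Finset.sum_congr rfl fun j _ => ?_
    by_cases h : j = a
    · subst h; simp [hX]
    · simp [h]
  · intro i _ hi
    simp [hi]
  · simp

theorem sum_edgeMatrix {p q : V} (hpq : p ≠ q) (i : V) :
    ∑ j, (edgeMatrix p q i j : K) = if i = p ∨ i = q then 1 else 0 := by
  unfold edgeMatrix
  by_cases h1 : i = p
  · subst h1
    simp [hpq]
  · by_cases h2 : i = q
    · subst h2
      simp [h1]
    · simp [h1, h2]

theorem cut_edgeMatrix {p q : V} (hpq : p ≠ q) (S : Finset V) :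
    cut (edgeMatrix p q : V → V → K) S = if (p ∈ S ↔ q ∈ S) then 0 else 1 := by
  have h : ∀ i j, (if i ∈ S ∧ j ∉ S then (edgeMatrix p q i j : K) else 0) =
      (if i = p then (if j = q then (if p ∈ S ∧ q ∉ S then (1 : K) else 0) else 0) else 0) +
      (if i = q then (if j = p then (if q ∈ S ∧ p ∉ S then (1 : K) else 0) else 0) else 0) := by
    intro i j
    unfold edgeMatrix
    have := hpq.symm
    by_cases h1 : i = p
    · subst h1
      by_cases h2 : j = q
      · subst h2; simp [hpq]
      · simp [h2, hpq]
    · by_cases h2 : i = q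
      · subst h2
        by_cases h3 : j = p
        · subst h3; simp [h1]
        · simp [h1, h3]
      · simp [h1, h2]
  unfold cut
  simp only [h, Finset.sum_add_distrib, Finset.sum_ite_irrel, Finset.sum_const_zero,
    Finset.sum_ite_eq', Finset.mem_univ, if_true]
  by_cases h1 : p ∈ S <;> by_cases h2 : q ∈ S <;> simp [h1, h2]

/-- Only the cuts with `a` and `b` on one side and `v` on the other change, and they lose both split
edges. -/
theorem cut_splitOff (X : V → V → K) {v a b : V} (hab : a ≠ b) (hav : a ≠ v) (hbv : b ≠ v) (m : K)
    (S : Finset V) : cut (splitOff X v a b m) S =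
      cut X S - if (a ∈ S ↔ b ∈ S) ∧ ¬ (v ∈ S ↔ a ∈ S) then 2 * m else 0 := by
  have h : cut (splitOff X v a b m) S = cut X S + m * (cut (edgeMatrix a b) S -
      cut (edgeMatrix a v) S - cut (edgeMatrix b v) S) := by
    simp only [cut, splitOff, Finset.mul_sum, ← Finset.sum_add_distrib, ← Finset.sum_sub_distrib]
    refine Finset.sum_congr rfl fun i _ => Finset.sum_congr rfl fun j _ => ?_
    split_ifs <;> ring
  rw [h, cut_edgeMatrix hab, cut_edgeMatrix hav, cut_edgeMatrix hbv]
  by_cases h1 : a ∈ S <;> by_cases h2 : b ∈ S <;> by_cases h3 : v ∈ S <;> simp [h1, h2, h3] <;> ring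

/-- Also needed for negative amounts: the program first splits off too much and then takes the
excess back. -/
theorem splitOff_splitOff (X : V → V → K) (v a b : V) (m m' : K) :
    splitOff (splitOff X v a b m) v a b m' = splitOff X v a b (m + m') := by
  funext i j
  simp only [splitOff]
  ring

variable [LinearOrder K] [IsStrictOrderedRing K]

theorem cut_submodular {X : V → V → K} (hX : ∀ i j, 0 ≤ X i j) (S T : Finset V) :
    cut X (S ∩ T) + cut X (S ∪ T) ≤ cut X S + cut X T := by
  simp only [cut, ← Finset.sum_add_distrib]
  refine Finset.sum_le_sum fun i _ => Finset.sum_le_sum fun j _ => ?_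
  have := hX i j
  by_cases h1 : i ∈ S <;> by_cases h2 : i ∈ T <;> by_cases h3 : j ∈ S <;> by_cases h4 : j ∈ T <;>
    simp [h1, h2, h3, h4] <;> linarith

/-- An edge between `S \ T` and `T \ S` counts twice on the right and not at all on the left. -/
theorem cut_submodular_strict {X : V → V → K} (hX : ∀ i j, 0 ≤ X i j) {S T : Finset V} {a v : V}
    (haS : a ∈ S) (haT : a ∉ T) (hvS : v ∉ S) (hvT : v ∈ T) (hpos : 0 < X a v) :
    cut X (S ∩ T) + cut X (S ∪ T) < cut X S + cut X T := by
  simp only [cut, ← Finset.sum_add_distrib]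
  have hle : ∀ i j, ((if i ∈ S ∩ T ∧ j ∉ S ∩ T then X i j else 0) +
      if i ∈ S ∪ T ∧ j ∉ S ∪ T then X i j else 0) ≤
      (if i ∈ S ∧ j ∉ S then X i j else 0) + if i ∈ T ∧ j ∉ T then X i j else 0 := by
    intro i j
    have := hX i j
    by_cases h1 : i ∈ S <;> by_cases h2 : i ∈ T <;> by_cases h3 : j ∈ S <;> by_cases h4 : j ∈ T <;>
      simp [h1, h2, h3, h4] <;> linarith
  refine Finset.sum_lt_sum (fun i _ => Finset.sum_le_sum fun j _ => hle i j)
    ⟨a, Finset.mem_univ _, Finset.sum_lt_sum (fun j _ => hle a j) ⟨v, Finset.mem_univ _, ?_⟩⟩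
  simp [haS, haT, hvS, hvT, hpos]

/-- The weighted graph `X` has degrees `d` on `W`, and each cut separating `w ∈ W` from `r` has at
least the weight `d w`. -/
structure CutFeasible (W : Finset V) (r : V) (d : V → K) (X : V → V → K) : Prop where
  symm : ∀ i j, X i j = X j i
  diag : ∀ i, X i i = 0
  nonneg : ∀ i j, 0 ≤ X i j
  degree : ∀ w ∈ W, ∑ j, X w j = d w
  cut : ∀ S, r ∉ S → ∀ w ∈ S, w ∈ W → d w ≤ cut X S

variable {W : Finset V} {r : V} {d : V → K} {X : V → V → K}

/-- The cut `δ(S)` is as small as possible, because of the vertex `w`. -/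
def TightCut (W : Finset V) (r : V) (d : V → K) (X : V → V → K) (S : Finset V) : Prop :=
  ∃ w ∈ W, (w ∈ S ↔ r ∉ S) ∧ PrizeCollecting.cut X S ≤ d w

/-- Passing to the complement removes the assumption `r ∉ S`; only the separation of `w` from the
root matters. -/
theorem CutFeasible.le_cut (h : CutFeasible W r d X) {S : Finset V} {w : V} (hw : w ∈ W)
    (hwS : w ∈ S ↔ r ∉ S) : d w ≤ PrizeCollecting.cut X S := by
  by_cases hr : r ∈ S
  · rw [← cut_compl h.symm]
    exact h.cut _ (by simpa using hr) w (by simp [hwS, hr]) hw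
  · exact h.cut _ hr w (hwS.2 hr) hw

/-- Uncrossing of tight cuts. -/
theorem CutFeasible.tightCut_union (h : CutFeasible W r d X) {S T : Finset V} {a v : V}
    (haS : a ∈ S) (haT : a ∈ T) (hvS : v ∉ S) (hvT : v ∉ T) (hpos : 0 < X a v)
    (hS : TightCut W r d X S) (hT : TightCut W r d X T) : TightCut W r d X (S ∪ T) := by
  obtain ⟨p, hp, hpS, hpc⟩ := hS
  obtain ⟨q, hq, hqT, hqc⟩ := hT
  have hsub := cut_submodular h.nonneg S T
  -- Strict submodularity for `S` and the complement of `T`: the edge `{a,v}` joins `S ∩ T` to the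
  -- outside of `S ∪ T`.
  have hpos' : PrizeCollecting.cut X (S \ T) + PrizeCollecting.cut X (T \ S) <
      PrizeCollecting.cut X S + PrizeCollecting.cut X T := by
    have h1 := cut_submodular_strict h.nonneg (S := S) (T := Tᶜ) haS (by simpa) hvS (by simpa) hpos
    rw [cut_compl h.symm T] at h1
    have h2 : S ∩ Tᶜ = S \ T := by ext; simp
    have h3 : S ∪ Tᶜ = (T \ S)ᶜ := by ext; simp; tauto
    rwa [h2, h3, cut_compl h.symm] at h1
  have kI : ∀ w ∈ W, (w ∈ S ∩ T ↔ r ∉ S ∩ T) → d w ≤ PrizeCollecting.cut X (S ∩ T) :=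
    fun w hw => h.le_cut hw
  have kU : ∀ w ∈ W, (w ∈ S ∪ T ↔ r ∉ S ∪ T) → d w ≤ PrizeCollecting.cut X (S ∪ T) :=
    fun w hw => h.le_cut hw
  have kD : ∀ w ∈ W, (w ∈ S \ T ↔ r ∉ S \ T) → d w ≤ PrizeCollecting.cut X (S \ T) :=
    fun w hw => h.le_cut hw
  have kE : ∀ w ∈ W, (w ∈ T \ S ↔ r ∉ T \ S) → d w ≤ PrizeCollecting.cut X (T \ S) :=
    fun w hw => h.le_cut hw
  -- If one of the certificates `p`, `q` of the tight sets separates the intersection from `r` and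
  -- the other the union, then both of these cuts are tight. If instead they separate the two
  -- differences, the strict inequality is violated.
  have c1 : (p ∈ S ∩ T ↔ r ∉ S ∩ T) → (q ∈ S ∪ T ↔ r ∉ S ∪ T) → TightCut W r d X (S ∪ T) :=
    fun h1 h2 => ⟨q, hq, h2, by linarith [kI p hp h1]⟩
  have c2 : (q ∈ S ∩ T ↔ r ∉ S ∩ T) → (p ∈ S ∪ T ↔ r ∉ S ∪ T) → TightCut W r d X (S ∪ T) :=
    fun h1 h2 => ⟨p, hp, h2, by linarith [kI q hq h1]⟩
  have c3 : (p ∈ S \ T ↔ r ∉ S \ T) → (q ∈ T \ S ↔ r ∉ T \ S) → TightCut W r d X (S ∪ T) :=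
    fun h1 h2 => absurd (add_le_add (kD p hp h1) (kE q hq h2)) (by linarith)
  have c4 : (q ∈ S \ T ↔ r ∉ S \ T) → (p ∈ T \ S ↔ r ∉ T \ S) → TightCut W r d X (S ∪ T) :=
    fun h1 h2 => absurd (add_le_add (kD q hq h1) (kE p hp h2)) (by linarith)
  clear kI kU kD kE hsub hpos' hpc hqc
  simp only [Finset.mem_inter, Finset.mem_union, Finset.mem_sdiff] at c1 c2 c3 c4
  -- In every position of `r`, `p` and `q` relative to `S` and `T`, one of the four implications
  -- applies.
  by_cases h1 : r ∈ S <;> by_cases h2 : r ∈ T <;> by_cases h3 : p ∈ T <;> by_cases h4 : q ∈ S <;>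
    simp only [h1, h2, h3, h4, iff_true, iff_false, not_true_eq_false, not_false_eq_true, true_and,
      and_true, false_and, and_false, true_or, or_true, or_false, false_or, forall_const, true_iff,
      false_iff, not_not, and_self, or_self, IsEmpty.forall_iff] at hpS hqT c1 c2 c3 c4 <;>
    simp only [hpS, hqT, not_true_eq_false, not_false_eq_true, forall_const] at c1 c2 c3 c4 <;>
    assumption

/-- The pair `{a, v}`, `{b, v}` cannot be split off. -/
def Blocked (W : Finset V) (r : V) (d : V → K) (X : V → V → K) (v a b : V) : Prop :=
  X a v = 0 ∨ X b v = 0 ∨ ∃ S, TightCut W r d X S ∧ a ∈ S ∧ b ∈ S ∧ v ∉ S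

theorem splitOff_apply_left (X : V → V → K) {v a b i : V} (hi : i ≠ v) (hab : a ≠ b) (hav : a ≠ v)
    (hbv : b ≠ v) (m : K) :
    splitOff X v a b m i v = X i v - if i = a ∨ i = b then m else 0 := by
  unfold splitOff edgeMatrix
  have e1 : ¬ (v = a) := hav.symm
  have e2 : ¬ (v = b) := hbv.symm
  by_cases h1 : i = a
  · simp only [h1, hab, hav, e1, e2, true_and, and_true, and_false, or_false, true_or,
      if_true, if_false]
    ring
  · by_cases h2 : i = b
    · simp only [h2, hab.symm, hbv, e1, e2, true_and, and_true, and_false, false_and, or_false,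
        or_true, if_true, if_false]
      ring
    · simp only [h1, h2, hi, false_and, or_false, if_false]
      ring

/-- Blocking is permanent: further splitting at `v` can only lower the weights of edges at `v` and
the weights of cuts. A single pass over all pairs therefore suffices. -/
theorem Blocked.splitOff {v a b p q : V} (h : Blocked W r d X v a b) (hpq : p ≠ q) (hpv : p ≠ v)
    (hqv : q ≠ v) (hav : a ≠ v) (hbv : b ≠ v) {m : K} (hm : 0 ≤ m)
    (hX : ∀ i j, 0 ≤ splitOff X v p q m i j) : Blocked W r d (splitOff X v p q m) v a b := by
  rcases h with h | h | ⟨S, ⟨w, hw, hwS, hc⟩, ha, hb, hv⟩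
  · left
    refine le_antisymm ?_ (hX _ _)
    rw [splitOff_apply_left X hav hpq hpv hqv, h]
    split_ifs <;> linarith
  · right; left
    refine le_antisymm ?_ (hX _ _)
    rw [splitOff_apply_left X hbv hpq hpv hqv, h]
    split_ifs <;> linarith
  · refine Or.inr (Or.inr ⟨S, ⟨w, hw, hwS, ?_⟩, ha, hb, hv⟩)
    rw [cut_splitOff X hpq hpv hqv]
    split_ifs <;> linarith

theorem edgeMatrix_nonneg (p q i j : V) : (0 : K) ≤ edgeMatrix p q i j := by
  unfold edgeMatrix; split_ifs <;> simp

theorem splitOff_nonneg (hX : ∀ i j, 0 ≤ X i j) (hs : ∀ i j, X i j = X j i) {v a b : V}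
    (hab : a ≠ b) (hav : a ≠ v) (hbv : b ≠ v) {m : K} (hm : 0 ≤ m) (ha : m ≤ X a v)
    (hb : m ≤ X b v) (i j : V) : 0 ≤ splitOff X v a b m i j := by
  have hva := hs v a
  have hvb := hs v b
  have h0 := hX i j
  have h1 := edgeMatrix_nonneg (K := K) a b i j
  unfold splitOff
  by_cases hA : (i = a ∧ j = v) ∨ (i = v ∧ j = a)
  · have : ¬ ((i = b ∧ j = v) ∨ (i = v ∧ j = b)) := by
      clear hva hvb h0 h1
      intro hB
      rcases hA with ⟨h1, h2⟩ | ⟨h1, h2⟩ <;> rcases hB with ⟨h3, h4⟩ | ⟨h3, h4⟩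
      · exact hab (h1.symm.trans h3)
      · exact hav (h1.symm.trans h3)
      · exact hbv (h3.symm.trans h1)
      · exact hab (h2.symm.trans h4)
    have e1 : (edgeMatrix a v i j : K) = 1 := if_pos hA
    have e2 : (edgeMatrix b v i j : K) = 0 := if_neg this
    have : m ≤ X i j := by rcases hA with ⟨rfl, rfl⟩ | ⟨rfl, rfl⟩ <;> linarith
    rw [e1, e2]
    nlinarith
  · have e1 : (edgeMatrix a v i j : K) = 0 := if_neg hA
    by_cases hB : (i = b ∧ j = v) ∨ (i = v ∧ j = b)
    · have e2 : (edgeMatrix b v i j : K) = 1 := if_pos hB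
      have : m ≤ X i j := by rcases hB with ⟨rfl, rfl⟩ | ⟨rfl, rfl⟩ <;> linarith
      rw [e1, e2]
      nlinarith
    · have e2 : (edgeMatrix b v i j : K) = 0 := if_neg hB
      rw [e1, e2]
      nlinarith

theorem edgeMatrix_symm (p q i j : V) : (edgeMatrix p q i j : K) = edgeMatrix p q j i := by
  unfold edgeMatrix
  congr 1
  simp only [eq_iff_iff]; tauto

theorem splitOff_symm (hs : ∀ i j, X i j = X j i) (v a b : V) (m : K) (i j : V) :
    splitOff X v a b m i j = splitOff X v a b m j i := by
  unfold splitOff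
  rw [hs i j, edgeMatrix_symm a b, edgeMatrix_symm a v, edgeMatrix_symm b v]

theorem sum_splitOff {v a b : V} (hab : a ≠ b) (hav : a ≠ v) (hbv : b ≠ v) (m : K) {i : V}
    (hi : i ≠ v) : ∑ j, splitOff X v a b m i j = ∑ j, X i j := by
  simp only [splitOff, Finset.sum_add_distrib, ← Finset.mul_sum, Finset.sum_sub_distrib,
    sum_edgeMatrix hab, sum_edgeMatrix hav, sum_edgeMatrix hbv, hi, or_false]
  by_cases h1 : i = a
  · subst h1; simp [hab]
  · simp [h1]

/-- Splitting off a pair by the largest amount that the cut conditions admit. Here `q` is the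
largest violation of the cut conditions after splitting off by the amount `m`. -/
theorem CutFeasible.splitOff_max (h : CutFeasible W r d X) {v a b : V} (hvW : v ∉ W) (hab : a ≠ b)
    (hav : a ≠ v) (hbv : b ≠ v) {m q : K} (hm : m = min (X a v) (X b v)) (hq0 : 0 ≤ q)
    (hle : ∀ S, r ∉ S → ∀ w ∈ S, w ∈ W → d w ≤ PrizeCollecting.cut (splitOff X v a b m) S + q)
    (hex : q = 0 ∨ ∃ S, ∃ w ∈ S, r ∉ S ∧ w ∈ W ∧
      d w = PrizeCollecting.cut (splitOff X v a b m) S + q) :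
    0 ≤ m - q / 2 ∧ CutFeasible W r d (splitOff X v a b (m - q / 2)) ∧
      Blocked W r d (splitOff X v a b (m - q / 2)) v a b := by
  have hm0 : 0 ≤ m := by rw [hm]; exact le_min (h.nonneg _ _) (h.nonneg _ _)
  have ha : m ≤ X a v := by rw [hm]; exact min_le_left _ _
  have hb : m ≤ X b v := by rw [hm]; exact min_le_right _ _
  simp only [cut_splitOff X hab hav hbv] at hle hex
  -- A cut that splitting off does not change satisfies its condition afterwards as well, so it can
  -- attain the maximum violation only for `q = 0`. A positive violation comes from a set that
  -- separates `v` from both `a` and `b`.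
  have key : q = 0 ∨ ∃ S, ∃ w ∈ S, r ∉ S ∧ w ∈ W ∧
      ((a ∈ S ↔ b ∈ S) ∧ ¬ (v ∈ S ↔ a ∈ S)) ∧ d w = PrizeCollecting.cut X S - 2 * m + q := by
    rcases hex with hq | ⟨S, w, hwS, hrS, hwW, he⟩
    · exact Or.inl hq
    · by_cases hsep : (a ∈ S ↔ b ∈ S) ∧ ¬ (v ∈ S ↔ a ∈ S)
      · rw [if_pos hsep] at he
        exact Or.inr ⟨S, w, hwS, hrS, hwW, hsep, he⟩
      · rw [if_neg hsep] at he
        have := h.cut S hrS w hwS hwW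
        left; linarith
  have hmq : 0 ≤ m - q / 2 := by
    rcases key with hq | ⟨S, w, hwS, hrS, hwW, hsep, he⟩
    · rw [hq]; linarith
    · have := h.cut S hrS w hwS hwW
      linarith
  have hnn := splitOff_nonneg h.nonneg h.symm hab hav hbv hmq (by linarith) (by linarith)
  refine ⟨hmq, ⟨splitOff_symm h.symm v a b _, fun i => ?_, hnn, fun w hw => ?_, ?_⟩, ?_⟩
  · have e : ∀ p q : V, p ≠ q → (edgeMatrix p q i i : K) = 0 := by
      intro p q hpq
      refine if_neg ?_
      rintro (⟨rfl, rfl⟩ | ⟨rfl, rfl⟩) <;> exact hpq rfl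
    simp [splitOff, e _ _ hab, e _ _ hav, e _ _ hbv, h.diag]
  · rw [sum_splitOff hab hav hbv _ (fun e => hvW (e ▸ hw)), h.degree w hw]
  · intro S hrS w hwS hwW
    rw [cut_splitOff X hab hav hbv]
    have h1 := hle S hrS w hwS hwW
    have h2 := h.cut S hrS w hwS hwW
    split_ifs at h1 ⊢ <;> linarith
  -- If `q = 0`, the smaller of the two edges is used up. Otherwise taking back `q / 2` raises the
  -- most violated cut by `q`, which makes it tight.
  · rcases key with hq | ⟨S, w, hwS, hrS, hwW, hsep, he⟩
    · rcases min_choice (X a v) (X b v) with hc | hc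
      · left
        rw [splitOff_apply_left X hav hab hav hbv, hq, hm, hc]
        simp
      · right; left
        rw [splitOff_apply_left X hbv hab hav hbv, hq, hm, hc]
        simp
    · right; right
      have hc : PrizeCollecting.cut (splitOff X v a b (m - q / 2)) S ≤ d w := by
        rw [cut_splitOff X hab hav hbv, if_pos hsep]; linarith
      by_cases haS : a ∈ S
      · refine ⟨S, ⟨w, hwW, by simp [hwS, hrS], hc⟩, haS, hsep.1.1 haS, ?_⟩
        intro hvS; exact hsep.2 (by simp [haS, hvS])
      -- Tightness is symmetric under complements, so the side that contains `a` and `b` can be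
      -- chosen.
      · refine ⟨Sᶜ, ⟨w, hwW, by simp [hwS, hrS], ?_⟩, by simpa, ?_, ?_⟩
        · rwa [cut_compl (splitOff_symm h.symm v a b _)]
        · simpa [← hsep.1]
        · simp only [Finset.mem_compl, not_not]
          by_contra hvS
          exact hsep.2 (by simp [haS, hvS])

/-- If no pair of edges at `v` can be split off, then there is no edge at `v`. -/
theorem CutFeasible.isolated_of_blocked (h : CutFeasible W r d X) {v u : V} (hrW : r ∈ W)
    (hvW : v ∉ W) (hu : u ∈ W) (hur : u ≠ r) (hdu : d r ≤ d u)
    (hout : ∀ w, w ∉ W → w ≠ v → ∀ j, X w j = 0)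
    (hbl : ∀ a b, a ≠ b → a ≠ v → b ≠ v → Blocked W r d X v a b) (a : V) : X a v = 0 := by
  by_contra hne
  have hpos : 0 < X a v := lt_of_le_of_ne (h.nonneg _ _) (Ne.symm hne)
  have hav : a ≠ v := by rintro rfl; exact hne (h.diag _)
  have haW : a ∈ W := by
    by_contra haW
    exact hne (hout a haW hav v)
  -- The blocking sets of the pairs formed by `a` and the other neighbours of `v` are united one
  -- after the other. All of them contain `a` and avoid `v`, as uncrossing along the edge `{a,v}`
  -- requires.
  have key : ∀ B : Finset V, ∃ S, TightCut W r d X S ∧ a ∈ S ∧ v ∉ S ∧ ∀ b ∈ B, 0 < X b v → b ∈ S := by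
    intro B
    induction B using Finset.induction_on with
    | empty =>
      -- The singleton is tight by the degree condition of `a`; if `a` is the root, `u` serves as
      -- the certificate.
      refine ⟨{a}, ?_, by simp, by simpa using hav.symm, by simp⟩
      have hc := cut_singleton h.diag a
      rw [h.degree a haW] at hc
      by_cases har : a = r
      · subst har
        exact ⟨u, hu, by simp [hur], by rw [hc]; exact hdu⟩
      · exact ⟨a, haW, by simp [Ne.symm har], hc.le⟩
    | insert b B _ ih =>
      obtain ⟨S, hS, haS, hvS, hBS⟩ := ih
      by_cases hb : 0 < X b v ∧ b ≠ a
      · have hbv : b ≠ v := by rintro rfl; exact hb.1.ne' (h.diag _)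
        rcases hbl a b hb.2.symm hav hbv with h1 | h1 | ⟨T, hT, haT, hbT, hvT⟩
        · exact absurd h1 hne
        · exact absurd h1 hb.1.ne'
        · refine ⟨S ∪ T, h.tightCut_union haS haT hvS hvT hpos hS hT, by simp [haS],
            by simp [hvS, hvT], ?_⟩
          intro c hc hcv
          rcases Finset.mem_insert.1 hc with rfl | hc
          · simp [hbT]
          · simp [hBS c hc hcv]
      · refine ⟨S, hS, haS, hvS, ?_⟩
        intro c hc hcv
        rcases Finset.mem_insert.1 hc with rfl | hc
        · by_cases hca : c = a
          · rwa [hca]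
          · exact absurd ⟨hcv, hca⟩ hb
        · exact hBS c hc hcv
  obtain ⟨S, ⟨w, hw, hwS, hc⟩, haS, hvS, hall⟩ := key Finset.univ
  have hrv : r ≠ v := fun e => hvW (e ▸ hrW)
  have hwv : w ≠ v := fun e => hvW (e ▸ hw)
  -- Neither `r` nor `w` equals `v`, so the enlarged set still separates them. As `S` contains all
  -- neighbours of `v`, adding `v` removes edges from the cut, among them `{a,v}`, and creates none.
  have h1 := h.le_cut (S := insert v S) hw (by simp [hrv, hwv, hwS])
  have h2 : PrizeCollecting.cut X (insert v S) < PrizeCollecting.cut X S := by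
    unfold PrizeCollecting.cut
    have hle : ∀ i j, (if i ∈ insert v S ∧ j ∉ insert v S then X i j else 0) ≤
        if i ∈ S ∧ j ∉ S then X i j else 0 := by
      intro i j
      have h0 := h.nonneg i j
      by_cases hi : i = v
      · subst hi
        by_cases hj : j ∈ S
        · simp [hvS, hj]
        · have : X i j = 0 := by
            by_contra hX
            rw [h.symm] at hX
            exact hj (hall j (Finset.mem_univ _) (lt_of_le_of_ne (h.nonneg _ _) (Ne.symm hX)))
          simp [this]
      · by_cases hj : j = v
        · subst hj
          by_cases hiS : i ∈ S <;> simp [hi, hiS, hvS, h0]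
        · simp [hi, hj]
    refine Finset.sum_lt_sum (fun i _ => Finset.sum_le_sum fun j _ => hle i j)
      ⟨a, Finset.mem_univ _, Finset.sum_lt_sum (fun j _ => hle a j) ⟨v, Finset.mem_univ _, ?_⟩⟩
    simp [haS, hvS, hpos]
  linarith

end Cuts

/-! ### Minimum cuts by the push-relabel method -/

section PushRelabel

variable {V K : Type} [Fintype V] [DecidableEq V] [Field K] [LinearOrder K] [IsStrictOrderedRing K]

/-- A preflow from `s` to `t` in the graph with symmetric capacities `X`, given by its residual
capacities `R`, the excesses `e` and valid distance labels `h`. -/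
structure Preflow (X : V → V → K) (s t : V) (R : V → V → K) (e : V → K) (h : V → ℕ) : Prop where
  nonneg : ∀ i j, 0 ≤ R i j
  antisymm : ∀ i j, R i j + R j i = X i j + X j i
  excess : ∀ i, i ≠ s → e i = ∑ j, (R i j - X i j)
  excess_nonneg : ∀ i, i ≠ s → 0 ≤ e i
  label : ∀ i j, 0 < R i j → h i ≤ h j + 1
  label_source : h s = Fintype.card V
  label_sink : h t = 0
  label_le : ∀ i, h i ≤ Fintype.card V

/-- The vertices that the push-relabel method has to process. -/
def Active (s t : V) (e : V → K) (h : V → ℕ) (u : V) : Prop :=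
  u ≠ s ∧ u ≠ t ∧ 0 < e u ∧ h u < Fintype.card V

variable {X : V → V → K} {s t : V} {R : V → V → K} {e : V → K} {h : V → ℕ}

theorem Preflow.push (hf : Preflow X s t R e h) {u w : V} {m : K} (huw : u ≠ w) (hus : u ≠ s)
    (hm : 0 ≤ m) (hme : m ≤ e u) (hmR : m ≤ R u w) (hh : h u = h w + 1) {R' : V → V → K} {e' : V → K}
    (hR' : ∀ i j, R' i j = if i = u ∧ j = w then R u w - m else if i = w ∧ j = u then R w u + m
      else R i j)
    (he' : ∀ i, e' i = if i = u then e u - m else if i = w then e w + m else e i) :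
    Preflow X s t R' e' h := by
  have hwu := huw.symm
  have hsum : ∀ i, ∑ j, R' i j = ∑ j, R i j + if i = u then -m else if i = w then m else 0 := by
    intro i
    by_cases hi : i = u
    · subst hi
      have : ∀ j, R' i j = R i j + if j = w then -m else 0 := by
        intro j
        rw [hR']
        by_cases hj : j = w
        · subst hj; simp; ring
        · simp [hj, huw]
      simp [this, Finset.sum_add_distrib]
    · by_cases hi' : i = w
      · subst hi'
        have : ∀ j, R' i j = R i j + if j = u then m else 0 := by
          intro j
          rw [hR']
          by_cases hj : j = u
          · subst hj; simp [hi]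
          · simp [hj, hi]
        simp [this, Finset.sum_add_distrib, hi]
      · simp [hR', hi, hi']
  refine ⟨?_, ?_, ?_, ?_, ?_, hf.label_source, hf.label_sink, hf.label_le⟩
  · intro i j
    rw [hR']
    split_ifs
    · linarith
    · linarith [hf.nonneg w u]
    · exact hf.nonneg i j
  · intro i j
    have h1 := hf.antisymm i j
    have h2 := hf.antisymm u w
    rw [hR' i j, hR' j i]
    by_cases c1 : i = u ∧ j = w
    · obtain ⟨rfl, rfl⟩ := c1
      simp [huw, hwu]; linarith
    · by_cases c2 : i = w ∧ j = u
      · obtain ⟨rfl, rfl⟩ := c2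
        simp [huw, hwu]; linarith
      · have c3 : ¬ (j = u ∧ i = w) := fun c => c2 c.symm
        have c4 : ¬ (j = w ∧ i = u) := fun c => c1 c.symm
        simp only [c1, c2, c3, c4, if_false]; exact h1
  · intro i hi
    rw [Finset.sum_sub_distrib, hsum, he']
    have h1 := hf.excess i hi
    rw [Finset.sum_sub_distrib] at h1
    by_cases c1 : i = u
    · subst c1; simp; linarith
    · by_cases c2 : i = w
      · subst c2; simp [c1]; linarith
      · simp [c1, c2]; linarith
  · intro i hi
    rw [he']
    split_ifs with c1 c2
    · linarith
    · subst c2; linarith [hf.excess_nonneg i hi]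
    · exact hf.excess_nonneg i hi
  · intro i j hij
    rw [hR'] at hij
    split_ifs at hij with c1 c2
    · exact hf.label i j (by rw [c1.1, c1.2]; linarith)
    · rw [c2.1, c2.2]; omega
    · exact hf.label i j hij

/-- In the absence of admissible edges, all residual edges out of `u` leave one unit of slack in the
label condition. -/
theorem Preflow.relabel (hf : Preflow X s t R e h) {u : V} (hus : u ≠ s) (hut : u ≠ t)
    (hu : h u < Fintype.card V) (hadm : ∀ w, 0 < R u w → h u ≠ h w + 1) {h' : V → ℕ}
    (hh' : ∀ i, h' i = if i = u then h u + 1 else h i) : Preflow X s t R e h' := by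
  refine ⟨hf.nonneg, hf.antisymm, hf.excess, hf.excess_nonneg, ?_, ?_, ?_, ?_⟩
  · intro i j hij
    have h1 := hf.label i j hij
    rw [hh', hh']
    split_ifs with c1 c2 c2
    · omega
    · subst c1
      have := hadm j hij
      omega
    · subst c2; omega
    · exact h1
  · rw [hh', if_neg hus.symm, hf.label_source]
  · rw [hh', if_neg hut.symm, hf.label_sink]
  · intro i
    rw [hh']
    split_ifs
    · omega
    · exact hf.label_le i

/-- The flow inside `S` cancels by antisymmetry, and the net inflow through the boundary remains. -/
theorem Preflow.sum_excess (hf : Preflow X s t R e h) (hX : ∀ i j, X i j = X j i) {S : Finset V}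
    (hs : s ∉ S) : ∑ i ∈ S, e i = cut X S - ∑ i ∈ S, ∑ j ∈ Sᶜ, R j i := by
  have h1 : ∑ i ∈ S, e i = ∑ i ∈ S, ∑ j ∈ S, (R i j - X i j) + ∑ i ∈ S, ∑ j ∈ Sᶜ, (R i j - X i j) := by
    rw [← Finset.sum_add_distrib]
    refine Finset.sum_congr rfl fun i hi => ?_
    rw [hf.excess i (fun c => hs (c ▸ hi)), Finset.sum_add_sum_compl]
  have h2 : ∑ i ∈ S, ∑ j ∈ S, (R i j - X i j) = 0 := by
    have h3 : ∑ i ∈ S, ∑ j ∈ S, (R i j - X i j) = ∑ i ∈ S, ∑ j ∈ S, -(R i j - X i j) := by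
      rw [Finset.sum_comm]
      refine Finset.sum_congr rfl fun i _ => Finset.sum_congr rfl fun j _ => ?_
      have := hf.antisymm i j
      have := hX i j
      linarith
    simp only [Finset.sum_neg_distrib] at h3
    linarith
  have h4 : cut X S = ∑ i ∈ S, ∑ j ∈ Sᶜ, X i j := by
    unfold cut
    rw [← Finset.sum_subset (Finset.subset_univ S)]
    · refine Finset.sum_congr rfl fun i hi => ?_
      rw [← Finset.sum_subset (Finset.subset_univ Sᶜ)]
      · refine Finset.sum_congr rfl fun j hj => ?_
        rw [if_pos ⟨hi, by simpa using hj⟩]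
      · intro j _ hj
        simp only [Finset.mem_compl, not_not] at hj
        simp [hj]
    · intro i _ hi
      simp [hi]
  rw [h1, h2, h4, zero_add, ← Finset.sum_sub_distrib]
  refine Finset.sum_congr rfl fun i _ => ?_
  rw [← Finset.sum_sub_distrib]
  refine Finset.sum_congr rfl fun j _ => ?_
  have := hf.antisymm i j
  have := hX i j
  linarith

theorem Preflow.excess_le_cut (hf : Preflow X s t R e h) (hX : ∀ i j, X i j = X j i) {S : Finset V}
    (hs : s ∉ S) (ht : t ∈ S) : e t ≤ cut X S := by
  have h1 := hf.sum_excess hX hs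
  have h2 : e t ≤ ∑ i ∈ S, e i :=
    Finset.single_le_sum (fun i hi => hf.excess_nonneg i fun c => hs (c ▸ hi)) ht
  have h3 : 0 ≤ ∑ i ∈ S, ∑ j ∈ Sᶜ, R j i :=
    Finset.sum_nonneg fun i _ => Finset.sum_nonneg fun j _ => hf.nonneg j i
  linarith

/-- When the push-relabel method ends, the excess of the sink is the minimum cut. -/
theorem Preflow.exists_cut_eq (hf : Preflow X s t R e h) (hX : ∀ i j, X i j = X j i)
    (hact : ∀ u, ¬ Active s t e h u) : ∃ S, s ∉ S ∧ t ∈ S ∧ e t = cut X S := by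
  -- Gap argument: there are `card V + 1` possible labels and only `card V` vertices, and the
  -- extreme labels are taken by the sink and the source.
  obtain ⟨k, hk0, hkN, hk⟩ : ∃ k, 0 < k ∧ k < Fintype.card V ∧ ∀ u, h u ≠ k := by
    by_contra hcon
    push Not at hcon
    have hsub : Finset.range (Fintype.card V + 1) ⊆ Finset.univ.image h := by
      intro k hk
      simp only [Finset.mem_image, Finset.mem_univ, true_and]
      rcases Nat.eq_zero_or_pos k with rfl | hk0
      · exact ⟨t, hf.label_sink⟩
      · rcases (Nat.lt_succ_iff.1 (Finset.mem_range.1 hk)).eq_or_lt with rfl | hlt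
        · exact ⟨s, hf.label_source⟩
        · exact hcon k hk0 hlt
    have h1 := Finset.card_le_card hsub
    have h2 := Finset.card_image_le (s := Finset.univ) (f := h)
    rw [Finset.card_range] at h1
    rw [Finset.card_univ] at h2
    omega
  refine ⟨Finset.univ.filter fun u => h u < k, ?_, ?_, ?_⟩
  · simp [hf.label_source, hkN.le]
  · simp [hf.label_sink, hk0]
  · have h1 := hf.sum_excess hX (S := Finset.univ.filter fun u => h u < k)
      (by simp [hf.label_source, hkN.le])
    -- A residual edge into the lower side would descend by at least two levels, since the level `k`
    -- is empty.
    have h2 : ∑ i ∈ Finset.univ.filter (fun u => h u < k),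
        ∑ j ∈ (Finset.univ.filter fun u => h u < k)ᶜ, R j i = 0 := by
      refine Finset.sum_eq_zero fun i hi => Finset.sum_eq_zero fun j hj => ?_
      simp only [Finset.mem_filter, Finset.mem_univ, true_and, Finset.mem_compl, not_lt] at hi hj
      by_contra hne
      have h3 := hf.label j i (lt_of_le_of_ne (hf.nonneg _ _) (Ne.symm hne))
      have := hk j
      omega
    have h3 : ∑ i ∈ Finset.univ.filter (fun u => h u < k), e i = e t := by
      refine Finset.sum_eq_single t ?_ (by simp [hf.label_sink, hk0])
      intro i hi hit
      simp only [Finset.mem_filter, Finset.mem_univ, true_and] at hi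
      have his : i ≠ s := by
        rintro rfl
        rw [hf.label_source] at hi; omega
      by_contra hne
      exact hact i ⟨his, hit, lt_of_le_of_ne (hf.excess_nonneg i his) (Ne.symm hne), by omega⟩
    rw [h2, h3] at h1
    linarith

/-- The invariant within one round of the push-relabel method: at the beginning of the round the
sum of the labels was `H₀` and the labels of the active vertices were less than `B`; the vertices
in `done` have been processed in this round. -/
structure RoundInv (s t : V) (B H₀ : ℕ) (done : V → Prop) (e : V → K) (h : V → ℕ) : Prop where
  mono : H₀ ≤ ∑ i, h i
  pos : H₀ < ∑ i, h i → 0 < B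
  lt_succ : ∀ u, Active s t e h u → h u < B + 1
  lt : ∀ u, Active s t e h u → ¬ done u → h u < B
  lt_of_eq : ∑ i, h i = H₀ → ∀ u, Active s t e h u → h u < B ∧ (done u → h u + 1 < B)

theorem RoundInv.skip {B H₀ : ℕ} {done done' : V → Prop} (hr : RoundInv s t B H₀ done e h) {u : V}
    (hu : ¬ Active s t e h u) (hd : ∀ w, done' w ↔ done w ∨ w = u) :
    RoundInv s t B H₀ done' e h := by
  refine ⟨hr.mono, hr.pos, hr.lt_succ, fun w hw hdw => hr.lt w hw fun c => hdw ((hd w).2 (.inl c)), ?_⟩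
  intro hH w hw
  refine ⟨(hr.lt_of_eq hH w hw).1, fun hdw => ?_⟩
  rcases (hd w).1 hdw with c | rfl
  · exact (hr.lt_of_eq hH w hw).2 c
  · exact absurd hw hu

/-- A vertex that becomes active through a push lies one level below `u`, hence at least two below
`B`. If `u` itself stays active, it was relabelled and the sum of the labels has grown. -/
theorem RoundInv.discharge {B H₀ : ℕ} {done done' : V → Prop} (hr : RoundInv s t B H₀ done e h)
    {u : V} (hu : Active s t e h u) (hdu : ¬ done u) (hd : ∀ w, done' w ↔ done w ∨ w = u)
    {e' : V → K} {h' : V → ℕ} (hh : ∀ w, w ≠ u → h' w = h w)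
    (he : ∀ w, w ≠ u → 0 < e' w → 0 < e w ∨ h u = h w + 1)
    (hcase : (e' u ≤ 0 ∧ h' u = h u) ∨ h' u = h u + 1) : RoundInv s t B H₀ done' e' h' := by
  have huB := hr.lt u hu hdu
  have hsum : ∑ i, h' i + h u = ∑ i, h i + h' u := by
    have h1 := Finset.add_sum_erase Finset.univ h' (Finset.mem_univ u)
    have h2 := Finset.add_sum_erase Finset.univ h (Finset.mem_univ u)
    have h3 : ∑ x ∈ Finset.univ.erase u, h' x = ∑ x ∈ Finset.univ.erase u, h x :=
      Finset.sum_congr rfl fun w hw => hh w (Finset.ne_of_mem_erase hw)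
    omega
  have hact : ∀ w, w ≠ u → Active s t e' h' w → Active s t e h w ∨ h w + 1 < B := by
    rintro w hwu ⟨h1, h2, h3, h4⟩
    rw [hh w hwu] at h4
    rcases he w hwu h3 with h5 | h5
    · exact Or.inl ⟨h1, h2, h5, h4⟩
    · right; omega
  have hmono := hr.mono
  refine ⟨by omega, fun _ => by omega, fun w hw => ?_, fun w hw hdw => ?_, fun hH w hw => ?_⟩
  · by_cases hwu : w = u
    · subst hwu; omega
    · rw [hh w hwu]
      rcases hact w hwu hw with h1 | h1
      · exact hr.lt_succ w h1
      · omega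
  · have hwu : w ≠ u := fun c => hdw ((hd w).2 (.inr c))
    rw [hh w hwu]
    rcases hact w hwu hw with h1 | h1
    · exact hr.lt w h1 fun c => hdw ((hd w).2 (.inl c))
    · omega
  · rcases hcase with ⟨h1, h2⟩ | h2
    · have hwu : w ≠ u := by
        rintro rfl
        exact absurd hw.2.2.1 (not_lt.2 h1)
      rw [hh w hwu]
      rcases hact w hwu hw with h3 | h3
      · have := hr.lt_of_eq (by omega) w h3
        refine ⟨this.1, fun hdw => this.2 ?_⟩
        exact ((hd w).1 hdw).resolve_right hwu
      · exact ⟨by omega, fun _ => h3⟩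
    · omega

/-- The invariant after `k` rounds of the push-relabel method. -/
def RoundsInv (s t : V) (k : ℕ) (e : V → K) (h : V → ℕ) : Prop :=
  ∃ B, (∀ u, Active s t e h u → h u < B) ∧ (B = 0 ∨ k + B ≤ 2 * ∑ i, h i + 1)

theorem RoundsInv.roundInv {B : ℕ} (hB : ∀ u, Active s t e h u → h u < B) {done : V → Prop}
    (hd : ∀ u, ¬ done u) : RoundInv s t B (∑ i, h i) done e h :=
  ⟨le_rfl, fun c => absurd c (lt_irrefl _), fun u hu => (hB u hu).trans (Nat.lt_succ_self _),
    fun u hu _ => hB u hu, fun _ u hu => ⟨hB u hu, fun c => absurd c (hd u)⟩⟩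

/-- Potential argument: a round without relabelling lowers the bound `B` on the active labels by
one; any other round raises it by one, but then `2 * ∑ h` grows by at least two. -/
theorem RoundInv.roundsInv {k B H₀ : ℕ} {done : V → Prop} (hr : RoundInv s t B H₀ done e h)
    (hd : ∀ u, done u) (hB : B = 0 ∨ k + B ≤ 2 * H₀ + 1) : RoundsInv s t (k + 1) e h := by
  rcases hr.mono.eq_or_lt with hH | hH
  · refine ⟨B - 1, fun u hu => ?_, by omega⟩
    have := (hr.lt_of_eq hH.symm u hu).2 (hd u)
    omega
  · have := hr.pos hH
    exact ⟨B + 1, hr.lt_succ, by omega⟩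

/-- Labels never exceed `card V`, so the potential bounds the number of rounds with active vertices
quadratically. -/
theorem RoundsInv.not_active {k : ℕ} (hr : RoundsInv s t k e h)
    (hle : ∀ i, h i ≤ Fintype.card V) (hk : 2 * Fintype.card V ^ 2 + 2 ≤ k) (u : V) :
    ¬ Active s t e h u := by
  intro hu
  obtain ⟨B, h1, h2⟩ := hr
  have h3 : ∑ i, h i ≤ Fintype.card V ^ 2 := by
    calc ∑ i, h i ≤ ∑ _i : V, Fintype.card V := Finset.sum_le_sum fun i _ => hle i
      _ = Fintype.card V ^ 2 := by simp [sq]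
  have := h1 u hu
  omega

end PushRelabel

/-! ### Auxiliary expressions and loops -/

/-- An injective pairing of natural numbers, used for the indices of matrices. -/
def pr (i j : ℕ) : ℕ := (i + j) * (i + j) + i

-- The value lies between `(i + j) ^ 2` and the next square, so it determines `i + j` and then `i`.
-- In contrast to `i * n + j`, the pairing is injective without any bound on the indices.
@[simp] theorem pr_inj {i j i' j' : ℕ} : pr i j = pr i' j' ↔ i = i' ∧ j = j' := by
  refine ⟨fun h => ?_, fun h => by rw [h.1, h.2]⟩
  unfold pr at h
  have key : i + j = i' + j' := by
    by_contra hne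
    rcases Nat.lt_or_gt_of_ne hne with hlt | hlt
    · have h1 : (i + j + 1) * (i + j + 1) ≤ (i' + j') * (i' + j') := Nat.mul_le_mul hlt hlt
      nlinarith
    · have h1 : (i' + j' + 1) * (i' + j' + 1) ≤ (i + j) * (i + j) := Nat.mul_le_mul hlt hlt
      nlinarith
  rw [key] at h
  omega

/-- The pairing of the values of two expressions. -/
def NExp.pr (e f : NExp) : NExp := .add (.mul (.add e f) (.add e f)) e

/-- The value of a variable. -/
def NExp.var (a : ℕ) : NExp := .get a (.lit 0)

/-- The value of a variable. -/
def FExp.var (a : ℕ) : FExp := .get a (.lit 0)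

/-- The number `n` of vertices. -/
def NExp.card : NExp := .get 0 (.lit 0)

/-- The root. -/
def NExp.root : NExp := .get 0 (.lit 1)

/-- Comparison of natural numbers. -/
def BExp.nlt (e f : NExp) : BExp := .neg (.nle f e)

/-- Equality of natural numbers. -/
def BExp.neq (e f : NExp) : BExp := .conj (.nle e f) (.nle f e)

/-- Comparison of field elements. -/
def BExp.flt (e f : FExp) : BExp := .neg (.fle f e)

/-- Assignment to a variable. -/
def Code.letNat (a : ℕ) (e : NExp) : Code := .setNat a (.lit 0) e

/-- Assignment to a variable. -/
def Code.letNum (a : ℕ) (e : FExp) : Code := .setNum a (.lit 0) e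

/-- Conditional execution. -/
def Code.when (b : BExp) (c : Code) : Code := .ite b c .skip

infixr:60 " ;; " => Code.seq

section Eval

variable {K : Type}

@[simp] theorem NExp.eval_pr (σ : State K) (e f : NExp) :
    (NExp.pr e f).eval σ = PrizeCollecting.pr (e.eval σ) (f.eval σ) := rfl

@[simp] theorem NExp.eval_var (σ : State K) (a : ℕ) : (NExp.var a).eval σ = σ.nat a 0 := rfl

@[simp] theorem NExp.eval_card (σ : State K) : NExp.card.eval σ = σ.nat 0 0 := rfl

@[simp] theorem NExp.eval_root (σ : State K) : NExp.root.eval σ = σ.nat 0 1 := rfl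

@[simp] theorem NExp.eval_lit (σ : State K) (c : ℕ) : (NExp.lit c).eval σ = c := rfl

@[simp] theorem NExp.eval_get (σ : State K) (a : ℕ) (i : NExp) :
    (NExp.get a i).eval σ = σ.nat a (i.eval σ) := rfl

@[simp] theorem NExp.eval_add (σ : State K) (e f : NExp) :
    (NExp.add e f).eval σ = e.eval σ + f.eval σ := rfl

@[simp] theorem NExp.eval_sub (σ : State K) (e f : NExp) :
    (NExp.sub e f).eval σ = e.eval σ - f.eval σ := rfl

@[simp] theorem NExp.eval_mul (σ : State K) (e f : NExp) :
    (NExp.mul e f).eval σ = e.eval σ * f.eval σ := rfl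

variable [Field K]

@[simp] theorem FExp.eval_var (σ : State K) (a : ℕ) : (FExp.var a).eval σ = σ.num a 0 := rfl

@[simp] theorem FExp.eval_zero (σ : State K) : FExp.zero.eval σ = 0 := rfl

@[simp] theorem FExp.eval_one (σ : State K) : FExp.one.eval σ = 1 := rfl

@[simp] theorem FExp.eval_get (σ : State K) (a : ℕ) (i : NExp) :
    (FExp.get a i).eval σ = σ.num a (i.eval σ) := rfl

@[simp] theorem FExp.eval_add (σ : State K) (e f : FExp) :
    (FExp.add e f).eval σ = e.eval σ + f.eval σ := rfl

@[simp] theorem FExp.eval_sub (σ : State K) (e f : FExp) :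
    (FExp.sub e f).eval σ = e.eval σ - f.eval σ := rfl

@[simp] theorem FExp.eval_half (σ : State K) (e : FExp) : (FExp.half e).eval σ = e.eval σ / 2 := rfl

variable [LinearOrder K]

@[simp] theorem BExp.holds_nle (σ : State K) (e f : NExp) :
    (BExp.nle e f).Holds σ ↔ e.eval σ ≤ f.eval σ := Iff.rfl

@[simp] theorem BExp.holds_fle (σ : State K) (e f : FExp) :
    (BExp.fle e f).Holds σ ↔ e.eval σ ≤ f.eval σ := Iff.rfl

@[simp] theorem BExp.holds_neg (σ : State K) (b : BExp) : (BExp.neg b).Holds σ ↔ ¬ b.Holds σ := Iff.rfl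

@[simp] theorem BExp.holds_conj (σ : State K) (b c : BExp) :
    (BExp.conj b c).Holds σ ↔ b.Holds σ ∧ c.Holds σ := Iff.rfl

@[simp] theorem BExp.holds_nlt (σ : State K) (e f : NExp) :
    (BExp.nlt e f).Holds σ ↔ e.eval σ < f.eval σ := by
  simp [BExp.nlt]

@[simp] theorem BExp.holds_neq (σ : State K) (e f : NExp) :
    (BExp.neq e f).Holds σ ↔ e.eval σ = f.eval σ := by
  simp only [BExp.neq, holds_conj, holds_nle]; omega

@[simp] theorem BExp.holds_flt (σ : State K) (e f : FExp) :
    (BExp.flt e f).Holds σ ↔ e.eval σ < f.eval σ := by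
  simp [BExp.flt]

theorem Code.run_setNat (σ : State K) (a : ℕ) (i e : NExp) :
    (Code.setNat a i e).run σ = σ.writeNat a (i.eval σ) (e.eval σ) := rfl

theorem Code.run_setNum (σ : State K) (a : ℕ) (i : NExp) (e : FExp) :
    (Code.setNum a i e).run σ = σ.writeNum a (i.eval σ) (e.eval σ) := rfl

theorem Code.run_letNat (σ : State K) (a : ℕ) (e : NExp) :
    (Code.letNat a e).run σ = σ.writeNat a 0 (e.eval σ) := rfl

theorem Code.run_letNum (σ : State K) (a : ℕ) (e : FExp) :
    (Code.letNum a e).run σ = σ.writeNum a 0 (e.eval σ) := rfl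

theorem Code.run_seq (σ : State K) (c d : Code) : (c ;; d).run σ = d.run (c.run σ) := rfl

theorem Code.run_when_true {σ : State K} {b : BExp} (h : b.Holds σ) (c : Code) :
    (Code.when b c).run σ = c.run σ := if_pos h

theorem Code.run_when_false {σ : State K} {b : BExp} (h : ¬ b.Holds σ) (c : Code) :
    (Code.when b c).run σ = σ := if_neg h

theorem Code.run_ite_true {σ : State K} {b : BExp} (h : b.Holds σ) (c d : Code) :
    (Code.ite b c d).run σ = c.run σ := if_pos h

theorem Code.run_ite_false {σ : State K} {b : BExp} (h : ¬ b.Holds σ) (c d : Code) :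
    (Code.ite b c d).run σ = d.run σ := if_neg h

attribute [simp] Code.run_nat_of_notMem Code.run_num_of_notMem

/-- A loop that fills cells of an array of field elements. -/
theorem Code.run_loop_setNum {σ : State K} {n a b : ℕ} {ix : NExp} {ex : FExp}
    (hn : σ.nat 0 0 = n) (f : ℕ → ℕ) (g : ℕ → K)
    (hf : ∀ j < n, ∀ k < n, f j = f k → j = k)
    (hix : ∀ (s : State K), (∀ c, c ≠ b → s.nat c = σ.nat c) → (∀ c, c ≠ a → s.num c = σ.num c) →
      s.nat b 0 < n → ix.eval s = f (s.nat b 0) ∧ ex.eval s = g (s.nat b 0)) :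
    (∀ j < n, ((Code.loop b 1 (.setNum a ix ex)).run σ).num a (f j) = g j) ∧
    ∀ m, (∀ j < n, m ≠ f j) → ((Code.loop b 1 (.setNum a ix ex)).run σ).num a m = σ.num a m := by
  have key := Code.loop_induction (a := b) (d := 1) (c := .setNum a ix ex) hn
    (fun i s => (∀ j < i, s.num a (f j) = g j) ∧
      ∀ m, (∀ j < i, m ≠ f j) → s.num a m = σ.num a m) ⟨by simp, by simp⟩ ?_
  · rwa [pow_one] at key
  · rintro i hi s hs hnat hnum ⟨h1, h2⟩
    rw [pow_one] at hi
    have hnat' : ∀ c, c ≠ b → s.nat c = σ.nat c := fun c hc => hnat c (by simp [natWrites, hc])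
    have hnum' : ∀ c, c ≠ a → s.num c = σ.num c := fun c hc => hnum c (by simp [numWrites, hc])
    obtain ⟨e1, e2⟩ := hix s hnat' hnum' (by omega)
    rw [hs] at e1 e2
    simp only [run_setNum, State.num_writeNat, State.num_writeNum, true_and, e1, e2]
    constructor
    · intro j hj
      by_cases hji : j = i
      · simp [hji]
      · rw [if_neg, h1 j (by omega)]
        intro c
        exact hji (hf j (by omega) i hi c)
    · intro m hm
      rw [if_neg (hm i (by omega)), h2 m fun j hj => hm j (by omega)]

/-- A loop that fills cells of an array of natural numbers. -/
theorem Code.run_loop_setNat {σ : State K} {n a b : ℕ} {ix ex : NExp} (hab : a ≠ b)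
    (hn : σ.nat 0 0 = n) (f : ℕ → ℕ) (g : ℕ → ℕ)
    (hf : ∀ j < n, ∀ k < n, f j = f k → j = k)
    (hix : ∀ (s : State K), (∀ c, c ≠ b → c ≠ a → s.nat c = σ.nat c) → s.num = σ.num →
      (∀ m, (∀ j < n, m ≠ f j) → s.nat a m = σ.nat a m) →
      s.nat b 0 < n → ix.eval s = f (s.nat b 0) ∧ ex.eval s = g (s.nat b 0)) :
    (∀ j < n, ((Code.loop b 1 (.setNat a ix ex)).run σ).nat a (f j) = g j) ∧
    ∀ m, (∀ j < n, m ≠ f j) → ((Code.loop b 1 (.setNat a ix ex)).run σ).nat a m = σ.nat a m := by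
  have key := Code.loop_induction (a := b) (d := 1) (c := .setNat a ix ex) hn
    (fun i s => (∀ j < i, s.nat a (f j) = g j) ∧
      ∀ m, (∀ j < i, m ≠ f j) → s.nat a m = σ.nat a m)
      ⟨by simp, by simp [State.nat_writeNat, hab]⟩ ?_
  · rwa [pow_one] at key
  · rintro i hi s hs hnat hnum ⟨h1, h2⟩
    rw [pow_one] at hi
    have hnat' : ∀ c, c ≠ b → c ≠ a → s.nat c = σ.nat c :=
      fun c hc hc' => hnat c (by simp [natWrites, hc, hc'])
    have hnum' : s.num = σ.num := funext fun c => hnum c (by simp [numWrites])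
    obtain ⟨e1, e2⟩ := hix s hnat' hnum' (fun m hm => h2 m fun j hj => hm j (by omega)) (by omega)
    rw [hs] at e1 e2
    simp only [run_setNat, State.nat_writeNat, true_and, e1, e2, hab, false_and, if_false]
    constructor
    · intro j hj
      by_cases hji : j = i
      · simp [hji]
      · rw [if_neg, h1 j (by omega)]
        intro c
        exact hji (hf j (by omega) i hi c)
    · intro m hm
      rw [if_neg (hm i (by omega)), h2 m fun j hj => hm j (by omega)]

end Eval

/-! ### The minimum cut program -/

notation "arrX" => (3 : ℕ)
notation "arrRes" => (5 : ℕ)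
notation "arrExc" => (6 : ℕ)
notation "numM" => (9 : ℕ)
notation "arrHt" => (6 : ℕ)
notation "natSink" => (15 : ℕ)
notation "ctrRound" => (20 : ℕ)
notation "ctrU" => (21 : ℕ)
notation "ctrW" => (22 : ℕ)

/-- Initialization of the push-relabel method. -/
def flowInit : Code :=
  .loop ctrU 1 (
    .setNum arrExc (.var ctrU) (.get arrX (.pr .root (.var ctrU))) ;;
    .setNat arrHt (.var ctrU) (.lit 0) ;;
    .loop ctrW 1 (.setNum arrRes (.pr (.var ctrU) (.var ctrW))
      (.get arrX (.pr (.var ctrU) (.var ctrW))))) ;;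
  .setNat arrHt .root .card ;;
  .loop ctrU 1 (
    .setNum arrRes (.pr (.var ctrU) .root)
      (.add (.get arrX (.pr (.var ctrU) .root)) (.get arrX (.pr .root (.var ctrU)))) ;;
    .setNum arrRes (.pr .root (.var ctrU)) .zero)

/-- A push along an edge. -/
def flowPush : Code :=
  .ite (.fle (.get arrExc (.var ctrU)) (.get arrRes (.pr (.var ctrU) (.var ctrW))))
    (.letNum numM (.get arrExc (.var ctrU)))
    (.letNum numM (.get arrRes (.pr (.var ctrU) (.var ctrW)))) ;;
  .setNum arrRes (.pr (.var ctrU) (.var ctrW))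
    (.sub (.get arrRes (.pr (.var ctrU) (.var ctrW))) (.var numM)) ;;
  .setNum arrRes (.pr (.var ctrW) (.var ctrU))
    (.add (.get arrRes (.pr (.var ctrW) (.var ctrU))) (.var numM)) ;;
  .setNum arrExc (.var ctrU) (.sub (.get arrExc (.var ctrU)) (.var numM)) ;;
  .setNum arrExc (.var ctrW) (.add (.get arrExc (.var ctrW)) (.var numM))

/-- The processing of an active vertex: pushes along all admissible edges, and then a relabeling if
the vertex is still active. -/
def flowDischarge : Code :=
  .loop ctrW 1 (.when
    (.conj (.flt .zero (.get arrExc (.var ctrU)))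
      (.conj (.flt .zero (.get arrRes (.pr (.var ctrU) (.var ctrW))))
        (.neq (.get arrHt (.var ctrU)) (.add (.get arrHt (.var ctrW)) (.lit 1))))) flowPush) ;;
  .when (.flt .zero (.get arrExc (.var ctrU)))
    (.setNat arrHt (.var ctrU) (.add (.get arrHt (.var ctrU)) (.lit 1)))

/-- The rounds of the push-relabel method. -/
def flowRounds : Code :=
  .loop ctrRound 4 (.loop ctrU 1 (.when
    (.conj (.neg (.neq (.var ctrU) .root)) (.conj (.neg (.neq (.var ctrU) (.var natSink)))
      (.conj (.flt .zero (.get arrExc (.var ctrU))) (.nlt (.get arrHt (.var ctrU)) .card))))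
    flowDischarge))

/-- The push-relabel method; the minimum cut separating the root and the vertex in the variable
`natSink` is stored as the excess of the latter. -/
def flow : Code := flowInit ;; flowRounds

/-! ### Correctness of the minimum cut program. -/

section Flow

variable {K : Type} [Field K] [LinearOrder K] [IsStrictOrderedRing K]

/-- The matrix stored in an array. -/
def State.mat (s : State K) (n a : ℕ) : Fin n → Fin n → K := fun i j => s.num a (pr i j)

/-- The vector stored in an array. -/
def State.vec (s : State K) (n a : ℕ) : Fin n → K := fun i => s.num a i

/-- The vector stored in an array. -/
def State.natVec (s : State K) (n a : ℕ) : Fin n → ℕ := fun i => s.nat a i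

variable {n : ℕ} {r t : Fin n} {X : Fin n → Fin n → K}

/-- All edges at the root are saturated, so no residual edge leaves the root. This makes the labels
`n` at the root and `0` elsewhere valid. -/
theorem flowInit_spec {σ : State K} (hn : σ.nat 0 0 = n) (hr : σ.nat 0 1 = r) (hrt : r ≠ t)
    (hX : ∀ i j, σ.mat n arrX i j = X i j) (hnn : ∀ i j, 0 ≤ X i j) (hd : ∀ i, X i i = 0) :
    Preflow X r t ((flowInit.run σ).mat n arrRes) ((flowInit.run σ).vec n arrExc)
      ((flowInit.run σ).natVec n arrHt) := by
  set σ₁ := (Code.loop ctrU 1 (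
    .setNum arrExc (.var ctrU) (.get arrX (.pr .root (.var ctrU))) ;;
    .setNat arrHt (.var ctrU) (.lit 0) ;;
    .loop ctrW 1 (.setNum arrRes (.pr (.var ctrU) (.var ctrW))
      (.get arrX (.pr (.var ctrU) (.var ctrW)))))).run σ with hσ₁
  have h1 : ∀ i < n, (σ₁.num arrExc i = σ.num arrX (pr r i) ∧ σ₁.nat arrHt i = 0 ∧
      ∀ j < n, σ₁.num arrRes (pr i j) = σ.num arrX (pr i j)) := by
    rw [hσ₁]
    have key := Code.loop_induction (a := ctrU) (d := 1) (c := .setNum arrExc (.var ctrU) (.get arrX (.pr .root (.var ctrU))) ;;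
      .setNat arrHt (.var ctrU) (.lit 0) ;;
      .loop ctrW 1 (.setNum arrRes (.pr (.var ctrU) (.var ctrW))
      (.get arrX (.pr (.var ctrU) (.var ctrW))))) hn
      (fun k s => ∀ i < k, (s.num arrExc i = σ.num arrX (pr r i) ∧ s.nat arrHt i = 0 ∧
        ∀ j < n, s.num arrRes (pr i j) = σ.num arrX (pr i j))) (by simp) ?_
    · rwa [pow_one] at key
    · intro k hk s hs hnat hnum hP i hi
      have hs0 : s.nat 0 = σ.nat 0 := hnat 0 (by decide)
      have hs3 : s.num arrX = σ.num arrX := hnum arrX (by decide)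
      simp only [Code.run_seq, Code.run_setNum, Code.run_setNat]
      set s' := ((s.writeNum arrExc ((NExp.var ctrU).eval s)
        ((FExp.get arrX (.pr .root (.var ctrU))).eval s)).writeNat arrHt
          ((NExp.var ctrU).eval (s.writeNum arrExc ((NExp.var ctrU).eval s)
        ((FExp.get arrX (.pr .root (.var ctrU))).eval s))) ((NExp.lit 0).eval (s.writeNum arrExc ((NExp.var ctrU).eval s)
        ((FExp.get arrX (.pr .root (.var ctrU))).eval s)))) with hs'
      obtain ⟨g1, g2⟩ := Code.run_loop_setNum (σ := s') (n := n) (a := arrRes) (b := ctrW)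
        (ix := .pr (.var ctrU) (.var ctrW)) (ex := .get arrX (.pr (.var ctrU) (.var ctrW)))
        (by simp [hs', State.nat_writeNat, hs0, hn])
        (fun j => pr k j) (fun j => σ.num arrX (pr k j)) (by simp) (by
          intro s₂ e1 e2 _
          simp [e1, e2, hs', State.nat_writeNat, State.num_writeNum, hs3, hs])
      simp only [State.num_writeNat, State.nat_writeNat]
      by_cases hik : i = k
      · subst hik
        refine ⟨?_, ?_, fun j hj => g1 j hj⟩
        · simp [Code.numWrites, hs', State.num_writeNum, hs, hs3, hs0, hr]
        · simp [Code.natWrites, hs', State.nat_writeNat, hs]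
      · obtain ⟨p1, p2, p3⟩ := hP i (by omega)
        refine ⟨?_, ?_, fun j hj => ?_⟩
        · simp [Code.numWrites, hs', State.num_writeNum, hs, hik, p1]
        · simp [Code.natWrites, hs', State.nat_writeNat, hs, hik, p2]
        · rw [g2 _ (by simp [hik])]
          simp [hs', State.num_writeNum, p3 j hj]
  have hn1 : σ₁.nat 0 = σ.nat 0 := by rw [hσ₁]; simp [Code.natWrites]
  have hX1 : σ₁.num arrX = σ.num arrX := by rw [hσ₁]; simp [Code.numWrites]
  set σ₂ := σ₁.writeNat arrHt r n with hσ₂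
  have hrun : flowInit.run σ = (Code.loop ctrU 1 (
    .setNum arrRes (.pr (.var ctrU) .root)
      (.add (.get arrX (.pr (.var ctrU) .root)) (.get arrX (.pr .root (.var ctrU)))) ;;
    .setNum arrRes (.pr .root (.var ctrU)) .zero)).run σ₂ := by
    simp only [flowInit, Code.run_seq, Code.run_setNat, ← hσ₁, NExp.eval_root, NExp.eval_card, hn1,
      hn, hr]
    rfl
  have h2 := Code.loop_induction (a := ctrU) (d := 1) (c := .setNum arrRes (.pr (.var ctrU) .root)
      (.add (.get arrX (.pr (.var ctrU) .root)) (.get arrX (.pr .root (.var ctrU)))) ;;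
    .setNum arrRes (.pr .root (.var ctrU)) .zero) (σ := σ₂) (n := n)
    (by simp [hσ₂, State.nat_writeNat, hn1, hn])
    (fun k s => ∀ i < n, ∀ j < n, s.num arrRes (pr i j) =
      if i = r ∧ j < k then 0 else if j = r ∧ i < k then σ.num arrX (pr i r) + σ.num arrX (pr r i)
        else σ.num arrX (pr i j)) ?_ ?_
  rotate_left
  · intro i hi j hj
    simp [hσ₂, (h1 i hi).2.2 j hj]
  · intro k hk s hs hnat hnum hP i hi j hj
    rw [pow_one] at hk
    have hs0 : s.nat 0 1 = r := by
      rw [hnat 0 (by decide)]; simp [hσ₂, State.nat_writeNat, hn1, hr]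
    have hs3 : s.num arrX = σ.num arrX := by
      rw [hnum arrX (by decide)]; simp [hσ₂, hX1]
    have hp := hP i hi j hj
    simp only [Code.run_seq, Code.run_setNum, State.num_writeNat, State.num_writeNum, true_and,
      NExp.eval_pr, NExp.eval_var, NExp.eval_root, State.nat_writeNum, pr_inj, hs0, hs, FExp.eval_add,
      FExp.eval_get, hs3, FExp.eval_zero, hp]
    have hrr : σ.num arrX (pr r r) = 0 := by
      have := hX r r
      rw [hd] at this; exact this
    by_cases c1 : i = r
    · by_cases c2 : j = k
      · simp [c1, c2]
      · have : j < k + 1 ↔ j < k := by omega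
        simp only [c1, c2, this, true_and, and_false, if_false]
        by_cases c3 : j < k
        · simp [c3]; omega
        · simp only [c3, if_false]
          by_cases c4 : j = r
          · by_cases c5 : (r : ℕ) = k
            · omega
            · have : (r : ℕ) < k + 1 ↔ (r : ℕ) < k := by omega
              simp [c4, c5, this]
          · simp [c4]
    · by_cases c2 : j = r
      · by_cases c3 : i = k
        · subst c3; simp [c1, c2]
        · have : i < k + 1 ↔ i < k := by omega
          simp [c1, c2, c3, this]
      · simp [c1, c2]
  rw [pow_one, ← hrun] at h2
  have hR : ∀ i j : Fin n, (flowInit.run σ).mat n arrRes i j =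
      if i = r then 0 else if j = r then X i r + X r i else X i j := by
    intro i j
    rw [State.mat, h2 i i.2 j j.2, ← hX i j, ← hX i r, ← hX r i]
    simp [Fin.ext_iff, State.mat]
  have hE : ∀ i : Fin n, (flowInit.run σ).vec n arrExc i = X r i := by
    intro i
    rw [State.vec, hrun]
    rw [Code.run_num_of_notMem _ (by decide), hσ₂, State.num_writeNat, (h1 i i.2).1, ← hX r i, State.mat]
  have hH : ∀ i : Fin n, (flowInit.run σ).natVec n arrHt i = if i = r then n else 0 := by
    intro i
    rw [State.natVec, hrun]
    rw [Code.run_nat_of_notMem _ (by decide), hσ₂, State.nat_writeNat, (h1 i i.2).2.1]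
    simp [Fin.ext_iff]
  refine ⟨?_, ?_, ?_, ?_, ?_, ?_, ?_, ?_⟩
  · intro i j
    rw [hR]
    split_ifs
    · exact le_rfl
    · linarith [hnn i r, hnn r i]
    · exact hnn i j
  · intro i j
    rw [hR, hR]
    split_ifs with c1 c2 c2
    · subst c1; subst c2; simp [hd]
    · rw [c1]; ring
    · rw [c2]; ring
    · rfl
  · intro i hi
    rw [hE, Finset.sum_eq_single r]
    · rw [hR, if_neg hi, if_pos rfl]; ring
    · intro j _ hj
      rw [hR, if_neg hi, if_neg hj, sub_self]
    · simp
  · intro i _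
    rw [hE]; exact hnn _ _
  · intro i j hij
    rw [hR] at hij
    rw [hH, hH]
    split_ifs at hij ⊢ <;> simp_all
  · rw [hH]; simp
  · rw [hH, if_neg hrt.symm]
  · intro i
    rw [hH]
    split_ifs <;> simp

theorem flowPush_spec {σ : State K} {u w : Fin n} (hu : σ.nat ctrU 0 = u) (hw : σ.nat ctrW 0 = w)
    (huw : u ≠ w) : ∃ m, m = min (σ.vec n arrExc u) (σ.mat n arrRes u w) ∧
      (∀ i j, (flowPush.run σ).mat n arrRes i j = if i = u ∧ j = w then σ.mat n arrRes u w - m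
        else if i = w ∧ j = u then σ.mat n arrRes w u + m else σ.mat n arrRes i j) ∧
      ∀ i, (flowPush.run σ).vec n arrExc i = if i = u then σ.vec n arrExc u - m
        else if i = w then σ.vec n arrExc w + m else σ.vec n arrExc i := by
  refine ⟨_, rfl, ?_⟩
  have huw' : (u : ℕ) ≠ w := fun c => huw (Fin.ext c)
  obtain ⟨σ', hσ', h1, h2⟩ : ∃ σ' : State K, (Code.ite
      (.fle (.get arrExc (.var ctrU)) (.get arrRes (.pr (.var ctrU) (.var ctrW))))
      (.letNum numM (.get arrExc (.var ctrU)))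
      (.letNum numM (.get arrRes (.pr (.var ctrU) (.var ctrW))))).run σ = σ' ∧
      σ'.nat = σ.nat ∧ ∀ a i, σ'.num a i =
        if a = numM ∧ i = 0 then min (σ.vec n arrExc u) (σ.mat n arrRes u w) else σ.num a i := by
    refine ⟨_, rfl, ?_, ?_⟩
    · simp only [Code.run]
      split_ifs <;> rfl
    · intro a i
      simp only [Code.run, BExp.holds_fle, FExp.eval_get, NExp.eval_var, NExp.eval_pr, hu, hw]
      split_ifs with c1 c2 c2
      · simp [Code.run_letNum, State.num_writeNum, c2, hu, State.vec, State.mat, c1]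
      · simp [Code.run_letNum, State.num_writeNum, c2]
      · simp [Code.run_letNum, State.num_writeNum, c2, hu, hw, State.vec, State.mat, (not_le.1 c1).le]
      · simp [Code.run_letNum, State.num_writeNum, c2]
  simp only [flowPush, Code.run_seq, hσ']
  constructor
  · intro i j
    simp only [State.mat, Code.run_setNum, State.num_writeNum, State.nat_writeNum, NExp.eval_var,
      NExp.eval_pr, FExp.eval_sub, FExp.eval_add, FExp.eval_get, FExp.eval_var, h1, h2, hu, hw,
      Fin.ext_iff, pr_inj]
    by_cases c1 : (i : ℕ) = u
    · simp [c1, huw', huw'.symm]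
    · by_cases c2 : (i : ℕ) = w <;> simp [c1, c2, huw', huw'.symm]
  · intro i
    simp only [State.vec, Code.run_setNum, State.num_writeNum, State.nat_writeNum, NExp.eval_var,
      NExp.eval_pr, FExp.eval_sub, FExp.eval_add, FExp.eval_get, FExp.eval_var, h1, h2, hu, hw,
      Fin.ext_iff]
    by_cases c1 : (i : ℕ) = u
    · simp [c1, huw', huw'.symm]
    · by_cases c2 : (i : ℕ) = w <;> simp [c1, c2, huw', huw'.symm]

/-- Labels are fixed during the pass over `w`, and a push out of `u` creates no residual edge out of
`u`. After one pass either the excess of `u` is gone or no edge out of `u` is admissible, and then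
`u` may be relabelled. -/
theorem flowDischarge_spec {σ : State K} (hn : σ.nat 0 0 = n) {u : Fin n} (hu : σ.nat ctrU 0 = u)
    (hf : Preflow X r t (σ.mat n arrRes) (σ.vec n arrExc) (σ.natVec n arrHt))
    (hact : Active r t (σ.vec n arrExc) (σ.natVec n arrHt) u) {σ' : State K}
    (hσ' : flowDischarge.run σ = σ') :
    Preflow X r t (σ'.mat n arrRes) (σ'.vec n arrExc) (σ'.natVec n arrHt) ∧
      (∀ w, w ≠ u → σ'.natVec n arrHt w = σ.natVec n arrHt w) ∧
      (∀ w, w ≠ u → 0 < σ'.vec n arrExc w →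
        0 < σ.vec n arrExc w ∨ σ.natVec n arrHt u = σ.natVec n arrHt w + 1) ∧
      ((σ'.vec n arrExc u ≤ 0 ∧ σ'.natVec n arrHt u = σ.natVec n arrHt u) ∨
        σ'.natVec n arrHt u = σ.natVec n arrHt u + 1) := by
  set body := Code.when
    (.conj (.flt .zero (.get arrExc (.var ctrU)))
      (.conj (.flt .zero (.get arrRes (.pr (.var ctrU) (.var ctrW))))
        (.neq (.get arrHt (.var ctrU)) (.add (.get arrHt (.var ctrW)) (.lit 1))))) flowPush with hbody
  have hbn : body.natWrites = [] := rfl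
  have hbm : ctrU ∉ (Code.loop ctrW 1 body).natWrites := by decide
  -- The third clause says that, as long as `u` has excess, the vertices already scanned offer no
  -- admissible edge. It survives a push because the amount is the minimum of the excess and the
  -- residual capacity.
  have key := Code.loop_induction (a := ctrW) (d := 1) (c := body) hn
    (fun k s => Preflow X r t (s.mat n arrRes) (s.vec n arrExc) (σ.natVec n arrHt) ∧
      (∀ w, w ≠ u → 0 < s.vec n arrExc w →
        0 < σ.vec n arrExc w ∨ σ.natVec n arrHt u = σ.natVec n arrHt w + 1) ∧
      (0 < s.vec n arrExc u → ∀ w : Fin n, (w : ℕ) < k → 0 < s.mat n arrRes u w →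
        σ.natVec n arrHt u ≠ σ.natVec n arrHt w + 1)) ⟨hf, fun w _ h => Or.inl h, by simp⟩ ?_
  · rw [pow_one] at key
    set σ₁ := (Code.loop ctrW 1 body).run σ with hσ₁
    have hrun : flowDischarge.run σ = (Code.when (.flt .zero (.get arrExc (.var ctrU)))
        (.setNat arrHt (.var ctrU) (.add (.get arrHt (.var ctrU)) (.lit 1)))).run σ₁ := rfl
    have hu1 : σ₁.nat ctrU 0 = u := by
      rw [hσ₁, Code.run_nat_of_notMem _ hbm, hu]
    have hh1 : σ₁.nat arrHt = σ.nat arrHt := by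
      rw [hσ₁, Code.run_nat_of_notMem _ (by decide)]
    obtain ⟨k1, k2, k3⟩ := key
    rw [hσ'] at hrun
    by_cases hpos : 0 < σ₁.vec n arrExc u
    · rw [Code.run_when_true (by simpa [hu1, State.vec] using hpos), Code.run_setNat] at hrun
      have hh : ∀ i, σ'.natVec n arrHt i =
          if i = u then σ.natVec n arrHt u + 1 else σ.natVec n arrHt i := by
        intro i
        simp [hrun, State.natVec, State.nat_writeNat, hu1, hh1, Fin.ext_iff]
      have hmat : σ'.mat n arrRes = σ₁.mat n arrRes := by rw [hrun]; rfl
      have hvec : σ'.vec n arrExc = σ₁.vec n arrExc := by rw [hrun]; rfl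
      rw [hmat, hvec]
      refine ⟨k1.relabel hact.1 hact.2.1 hact.2.2.2 (fun w => k3 hpos w w.2) hh, ?_, k2, ?_⟩
      · intro w hw
        rw [hh, if_neg hw]
      · right
        rw [hh, if_pos rfl]
    · rw [Code.run_when_false (by simpa [hu1, State.vec] using hpos)] at hrun
      have hh : σ'.natVec n arrHt = σ.natVec n arrHt := by
        rw [hrun]; funext i; rw [State.natVec, hh1]; rfl
      rw [hh, hrun]
      exact ⟨k1, fun _ _ => rfl, k2, Or.inl ⟨not_lt.1 hpos, rfl⟩⟩
  · rintro k hk s hs hnat hnum ⟨p1, p2, p3⟩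
    rw [pow_one] at hk
    have hus : s.nat ctrU 0 = u := by rw [hnat _ hbm, hu]
    have hhs : s.nat arrHt = σ.nat arrHt := hnat _ (by decide)
    have e1 : ∀ s : State K, (s.writeNat ctrW 0 (k + 1)).mat n arrRes = s.mat n arrRes := fun _ => rfl
    have e2 : ∀ s : State K, (s.writeNat ctrW 0 (k + 1)).vec n arrExc = s.vec n arrExc := fun _ => rfl
    rw [e1, e2]
    by_cases hc : 0 < s.vec n arrExc u ∧ 0 < s.mat n arrRes u ⟨k, hk⟩ ∧
        σ.natVec n arrHt u = σ.natVec n arrHt ⟨k, hk⟩ + 1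
    · have huk : u ≠ ⟨k, hk⟩ := by
        intro c
        have := hc.2.2
        rw [← c] at this; omega
      rw [hbody, Code.run_when_true (by
        simpa [hus, hs, hhs, State.vec, State.mat, State.natVec] using hc)]
      obtain ⟨m, hm, g1, g2⟩ := flowPush_spec (σ := s) (n := n) (u := u) (w := ⟨k, hk⟩) hus hs huk
      have hme : m ≤ s.vec n arrExc u := hm ▸ min_le_left _ _
      have hmR : m ≤ s.mat n arrRes u ⟨k, hk⟩ := hm ▸ min_le_right _ _
      have hm0 : 0 ≤ m := hm ▸ le_min hc.1.le hc.2.1.le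
      refine ⟨p1.push huk hact.1 hm0 hme hmR hc.2.2 g1 g2, ?_, ?_⟩
      · intro w hw hpos
        by_cases hwk : w = ⟨k, hk⟩
        · right; rw [hwk]; exact hc.2.2
        · rw [g2, if_neg hw, if_neg hwk] at hpos
          exact p2 w hw hpos
      · intro hpos w hwk hR
        rw [g2, if_pos rfl] at hpos
        rw [g1] at hR
        by_cases hwk' : w = ⟨k, hk⟩
        · rw [if_pos ⟨rfl, hwk'⟩] at hR
          rcases min_choice (s.vec n arrExc u) (s.mat n arrRes u ⟨k, hk⟩) with h | h
          · rw [hm, h] at hpos; simp at hpos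
          · rw [hm, h] at hR; simp at hR
        · rw [if_neg fun c => hwk' c.2, if_neg fun c => huk c.1] at hR
          refine p3 hc.1 w ?_ hR
          have : (w : ℕ) ≠ k := fun c => hwk' (Fin.ext c)
          omega
    · rw [hbody, Code.run_when_false (by
        simpa [hus, hs, hhs, State.vec, State.mat, State.natVec] using hc)]
      refine ⟨p1, p2, ?_⟩
      intro hpos w hwk hR
      by_cases hwk' : w = ⟨k, hk⟩
      · subst hwk'
        exact fun c => hc ⟨hpos, hR, c⟩
      · refine p3 hpos w ?_ hR
        have : (w : ℕ) ≠ k := fun c => hwk' (Fin.ext c)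
        omega

theorem flow_spec {σ : State K} (hn : σ.nat 0 0 = n) (hr : σ.nat 0 1 = r)
    (ht : σ.nat natSink 0 = t) (hrt : r ≠ t) (hX : σ.mat n arrX = X) (hnn : ∀ i j, 0 ≤ X i j)
    (hd : ∀ i, X i i = 0) (hsymm : ∀ i j, X i j = X j i) :
    (∀ S, r ∉ S → t ∈ S → (flow.run σ).num arrExc t ≤ cut X S) ∧
      ∃ S, r ∉ S ∧ t ∈ S ∧ (flow.run σ).num arrExc t = cut X S := by
  have hinit := flowInit_spec (X := X) hn hr hrt (fun i j => by rw [hX]) hnn hd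
  set σ₁ := flowInit.run σ with hσ₁
  have hn1 : σ₁.nat 0 = σ.nat 0 := Code.run_nat_of_notMem _ (by decide) _
  have ht1 : σ₁.nat natSink = σ.nat natSink := Code.run_nat_of_notMem _ (by decide) _
  set step := Code.when
    (.conj (.neg (.neq (.var ctrU) .root)) (.conj (.neg (.neq (.var ctrU) (.var natSink)))
      (.conj (.flt .zero (.get arrExc (.var ctrU))) (.nlt (.get arrHt (.var ctrU)) .card))))
    flowDischarge with hstep
  have hrounds : flowRounds = .loop ctrRound 4 (.loop ctrU 1 step) := rfl
  have key := Code.loop_induction (a := ctrRound) (d := 4) (c := .loop ctrU 1 step) (σ := σ₁) (n := n)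
    (by rw [hn1, hn])
    (fun k s => Preflow X r t (s.mat n arrRes) (s.vec n arrExc) (s.natVec n arrHt) ∧
      RoundsInv r t k (s.vec n arrExc) (s.natVec n arrHt)) ⟨hinit, ?_⟩ ?_
  · obtain ⟨k1, k2⟩ := key
    have hn2 : 2 ≤ n := by
      have h1 := r.2
      have h2 := t.2
      have h3 : (r : ℕ) ≠ t := fun c => hrt (Fin.ext c)
      omega
    -- The `n ^ 4` rounds of the program exceed the quadratic bound as soon as `n ≥ 2`, which
    -- follows from `r ≠ t`.
    have hpow : 2 * Fintype.card (Fin n) ^ 2 + 2 ≤ n ^ 4 := by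
      rw [Fintype.card_fin]
      have h4 : 4 ≤ n ^ 2 := by nlinarith
      have h5 : n ^ 4 = n ^ 2 * n ^ 2 := by ring
      nlinarith
    have hna := k2.not_active k1.label_le hpow
    refine ⟨fun S h1 h2 => k1.excess_le_cut hsymm h1 h2, k1.exists_cut_eq hsymm hna⟩
  · refine ⟨∑ i, σ₁.natVec n arrHt i + 1, fun u _ => ?_, Or.inr ?_⟩
    · exact Nat.lt_succ_of_le (Finset.single_le_sum (f := fun i => σ₁.natVec n arrHt i)
        (fun _ _ => Nat.zero_le _) (Finset.mem_univ u))
    · change 0 + (∑ i, σ₁.natVec n arrHt i + 1) ≤ 2 * ∑ i, σ₁.natVec n arrHt i + 1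
      omega
  · rintro k - s hs hnat hnum ⟨p1, B, hB, hkB⟩
    have hn2 : s.nat 0 = σ.nat 0 := by rw [hnat 0 (by decide), hn1]
    have ht2 : s.nat natSink = σ.nat natSink := by rw [hnat natSink (by decide), ht1]
    have key := Code.loop_induction (a := ctrU) (d := 1) (c := step) (σ := s) (n := n)
      (by rw [hn2, hn])
      (fun k' s' => Preflow X r t (s'.mat n arrRes) (s'.vec n arrExc) (s'.natVec n arrHt) ∧
        RoundInv r t B (∑ i, s.natVec n arrHt i) (fun u => (u : ℕ) < k') (s'.vec n arrExc)
          (s'.natVec n arrHt)) ⟨p1, RoundsInv.roundInv hB (by simp)⟩ ?_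
    · rw [pow_one] at key
      exact ⟨key.1, key.2.roundsInv (fun u => u.2) hkB⟩
    · rintro k' hk' s' hs' hnat' hnum' ⟨q1, q2⟩
      rw [pow_one] at hk'
      have hn3 : s'.nat 0 = σ.nat 0 := by rw [hnat' 0 (by decide), hn2]
      have ht3 : s'.nat natSink = σ.nat natSink := by rw [hnat' natSink (by decide), ht2]
      have hd' : ∀ w : Fin n, (w : ℕ) < k' + 1 ↔ (w : ℕ) < k' ∨ w = ⟨k', hk'⟩ := by
        intro w
        rw [Fin.ext_iff]
        exact Nat.lt_succ_iff_lt_or_eq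
      have hcond : (BExp.conj (.neg (.neq (.var ctrU) .root))
          (.conj (.neg (.neq (.var ctrU) (.var natSink)))
          (.conj (.flt .zero (.get arrExc (.var ctrU))) (.nlt (.get arrHt (.var ctrU)) .card)))).Holds
          s' ↔ Active r t (s'.vec n arrExc) (s'.natVec n arrHt) ⟨k', hk'⟩ := by
        simp [Active, hs', hn3, ht3, hr, ht, hn, Fin.ext_iff, State.vec, State.natVec]
      by_cases hact : Active r t (s'.vec n arrExc) (s'.natVec n arrHt) ⟨k', hk'⟩
      · rw [hstep, Code.run_when_true (hcond.2 hact)]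
        obtain ⟨g1, g2, g3, g4⟩ := flowDischarge_spec (by rw [hn3, hn]) (u := ⟨k', hk'⟩) hs' q1 hact rfl
        exact ⟨g1, q2.discharge hact (by simp) hd' g2 g3 g4⟩
      · rw [hstep, Code.run_when_false (fun c => hact (hcond.1 c))]
        exact ⟨q1, q2.skip hact hd'⟩

end Flow

/-! ### The splitting off program -/

notation "arrY" => (1 : ℕ)
notation "arrSnap" => (4 : ℕ)
notation "numQ" => (10 : ℕ)
notation "numS" => (12 : ℕ)
notation "numN" => (13 : ℕ)
notation "arrAct" => (4 : ℕ)
notation "arrOrd" => (5 : ℕ)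
notation "natV" => (11 : ℕ)
notation "ctrA" => (23 : ℕ)
notation "ctrB" => (24 : ℕ)
notation "ctrStage" => (25 : ℕ)
notation "ctrT" => (26 : ℕ)

/-- Adds the value of the variable `b` to the weight of the edge `{p, q}`. -/
def addEdge (p q : NExp) (b : ℕ) : Code :=
  .setNum arrX (.pr p q) (.add (.get arrX (.pr p q)) (.var b)) ;;
  .setNum arrX (.pr q p) (.add (.get arrX (.pr q p)) (.var b))

/-- Splits off a pair of edges by the amount in `numS`. -/
def splitBy : Code :=
  .letNum numN (.sub .zero (.var numS)) ;;
  addEdge (.var ctrA) (.var ctrB) numS ;;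
  addEdge (.var ctrA) (.var natV) numN ;;
  addEdge (.var ctrB) (.var natV) numN

/-- Computes the largest violation of a cut condition. -/
def maxViolation : Code :=
  .letNum numQ .zero ;;
  .loop ctrT 1 (.when (.conj (.neq (.get arrAct (.var ctrT)) (.lit 1)) (.neg (.neq (.var ctrT) .root)))
    (.letNat natSink (.var ctrT) ;; flow ;;
      .when (.flt (.var numQ) (.sub (.add (.get arrY (.var ctrT)) (.get arrY (.var ctrT)))
          (.get arrExc (.var ctrT))))
        (.letNum numQ (.sub (.add (.get arrY (.var ctrT)) (.get arrY (.var ctrT)))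
          (.get arrExc (.var ctrT))))))

/-- Splits off a pair of edges by the largest possible amount. -/
def splitPair : Code :=
  .ite (.fle (.get arrX (.pr (.var ctrA) (.var natV))) (.get arrX (.pr (.var ctrB) (.var natV))))
    (.letNum numS (.get arrX (.pr (.var ctrA) (.var natV))))
    (.letNum numS (.get arrX (.pr (.var ctrB) (.var natV)))) ;;
  splitBy ;; maxViolation ;; .letNum numS (.sub .zero (.half (.var numQ))) ;; splitBy

/-- Splits off all pairs of edges at a vertex. -/
def splitVertex : Code :=
  .loop ctrA 1 (.loop ctrB 1 (.when (.conj (.neg (.neq (.var ctrA) (.var ctrB)))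
    (.conj (.neg (.neq (.var ctrA) (.var natV))) (.neg (.neq (.var ctrB) (.var natV))))) splitPair))

/-- Selects a vertex of minimum positive weight. -/
def selectVertex : Code :=
  .letNat natV .card ;;
  .loop ctrT 1 (.when (.conj (.neq (.get arrAct (.var ctrT)) (.lit 1))
      (.flt (.get arrY (.var ctrT)) .one))
    (.ite (.neq (.var natV) .card) (.letNat natV (.var ctrT))
      (.when (.flt (.get arrY (.var ctrT)) (.get arrY (.var natV))) (.letNat natV (.var ctrT)))))

/-- Stores a copy of the current weights. -/
def snapshot (e : NExp) : Code :=
  .loop ctrA 1 (.loop ctrB 1 (.setNum arrSnap (.pr (.pr e (.var ctrA)) (.var ctrB))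
    (.get arrX (.pr (.var ctrA) (.var ctrB)))))

/-- Splits off a vertex and records it. -/
def splitStage : Code :=
  selectVertex ;; .setNat arrOrd (.var ctrStage) (.var natV) ;;
  .when (.nlt (.var natV) .card) (.setNat arrAct (.var natV) (.lit 0) ;; splitVertex) ;;
  snapshot (.add (.var ctrStage) (.lit 1))

/-- Reads the input. -/
def readInput : Code :=
  .loop ctrA 1 (.setNat arrAct (.var ctrA) (.lit 1) ;;
    .loop ctrB 1 (.setNum arrX (.pr (.var ctrA) (.var ctrB))
      (.get 0 (.add (.mul (.var ctrA) .card) (.var ctrB)))))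

/-- Splits off all vertices outside the core set. -/
def splitAll : Code := readInput ;; snapshot (.lit 0) ;; .loop ctrStage 1 splitStage

/-! ### Correctness of splitting off a pair of edges. -/

section SplitSpec

variable {K : Type} [Field K] [LinearOrder K] [IsStrictOrderedRing K] {n : ℕ}

theorem addEdge_spec {σ : State K} {p q : NExp} {b : ℕ} (hb : b ≠ arrX) {i j : Fin n} (hij : i ≠ j)
    (hp : ∀ s : State K, s.nat = σ.nat → p.eval s = i)
    (hq : ∀ s : State K, s.nat = σ.nat → q.eval s = j) :
    ((addEdge p q b).run σ).mat n arrX = fun k l => σ.mat n arrX k l + σ.num b 0 * edgeMatrix i j k l := by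
  funext k l
  have hij' : (i : ℕ) ≠ j := fun c => hij (Fin.ext c)
  simp only [addEdge, Code.run_seq, Code.run_setNum, State.mat, State.num_writeNum, NExp.eval_pr,
    FExp.eval_add, FExp.eval_get, FExp.eval_var, State.nat_writeNum, hp _ rfl, hq _ rfl, hb, true_and,
    false_and, if_false, pr_inj, hp _ (State.nat_writeNum _ _ _ _), hq _ (State.nat_writeNum _ _ _ _),
    edgeMatrix, Fin.ext_iff]
  by_cases h1 : (k : ℕ) = i
  · by_cases h2 : (l : ℕ) = j
    · simp [h1, h2, hij', hij'.symm]
    · simp [h1, h2, hij', hij'.symm]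
  · by_cases h2 : (k : ℕ) = j
    · by_cases h3 : (l : ℕ) = i
      · simp [h2, h3, hij', hij'.symm]
      · simp [h2, h3, hij', hij'.symm]
    · simp [h1, h2]

theorem splitBy_spec {σ : State K} {v a b : Fin n} (hv : σ.nat natV 0 = v) (ha : σ.nat ctrA 0 = a)
    (hb : σ.nat ctrB 0 = b) (hab : a ≠ b) (hav : a ≠ v) (hbv : b ≠ v) :
    (splitBy.run σ).mat n arrX = splitOff (σ.mat n arrX) v a b (σ.num numS 0) := by
  have hnat : ∀ (p q : NExp) (b : ℕ) (s : State K), ((addEdge p q b).run s).nat = s.nat :=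
    fun p q b s => rfl
  simp only [splitBy, Code.run_seq, Code.run_letNum]
  rw [addEdge_spec (by decide) hbv (by intro s hs; simp [hs, hnat, hb]) (by intro s hs; simp [hs, hnat, hv]),
    addEdge_spec (by decide) hav (by intro s hs; simp [hs, hnat, ha]) (by intro s hs; simp [hs, hnat, hv]),
    addEdge_spec (by decide) hab (by intro s hs; simp [hs, ha]) (by intro s hs; simp [hs, hb])]
  have h1 : ∀ (p q : NExp) (b c : ℕ) (s : State K), c ≠ arrX → ((addEdge p q b).run s).num c = s.num c := by
    intro p q b c s hc
    exact Code.run_num_of_notMem _ (by simp [addEdge, Code.numWrites, hc]) _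
  funext i j
  simp [h1, State.num_writeNum, splitOff, State.mat]
  ring

variable {r : Fin n} {y : Fin n → K}

/-- For fixed `w` the most violated condition belongs to a minimum cut between `w` and the root.
Starting the maximum at zero accounts for the alternative that nothing is violated. -/
theorem maxViolation_spec {σ : State K} (hn : σ.nat 0 0 = n) (hr : σ.nat 0 1 = r)
    (hy : σ.vec n arrY = y) {X : Fin n → Fin n → K} (hX : σ.mat n arrX = X) (hnn : ∀ i j, 0 ≤ X i j)
    (hd : ∀ i, X i i = 0) (hsymm : ∀ i j, X i j = X j i) {W : Finset (Fin n)}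
    (hW : ∀ w : Fin n, σ.nat arrAct w = 1 ↔ w ∈ W) :
    0 ≤ (maxViolation.run σ).num numQ 0 ∧
      (∀ S, r ∉ S → ∀ w ∈ S, w ∈ W → 2 * y w ≤ cut X S + (maxViolation.run σ).num numQ 0) ∧
      ((maxViolation.run σ).num numQ 0 = 0 ∨ ∃ S, ∃ w ∈ S, r ∉ S ∧ w ∈ W ∧
        2 * y w = cut X S + (maxViolation.run σ).num numQ 0) := by
  set σ₁ := (Code.letNum numQ .zero).run σ with hσ₁
  set body := Code.when (.conj (.neq (.get arrAct (.var ctrT)) (.lit 1))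
      (.neg (.neq (.var ctrT) .root)))
    (.letNat natSink (.var ctrT) ;; flow ;;
      .when (.flt (.var numQ) (.sub (.add (.get arrY (.var ctrT)) (.get arrY (.var ctrT)))
          (.get arrExc (.var ctrT))))
        (.letNum numQ (.sub (.add (.get arrY (.var ctrT)) (.get arrY (.var ctrT)))
          (.get arrExc (.var ctrT))))) with hbody
  have hrun : maxViolation.run σ = (Code.loop ctrT 1 body).run σ₁ := rfl
  have key := Code.loop_induction (a := ctrT) (d := 1) (c := body) (σ := σ₁) (n := n) hn
    (fun k s => 0 ≤ s.num numQ 0 ∧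
      (∀ S, r ∉ S → ∀ w ∈ S, w ∈ W → (w : ℕ) < k → 2 * y w ≤ cut X S + s.num numQ 0) ∧
      (s.num numQ 0 = 0 ∨ ∃ S, ∃ w ∈ S, r ∉ S ∧ w ∈ W ∧ 2 * y w = cut X S + s.num numQ 0)) ?_ ?_
  · rw [pow_one, ← hrun] at key
    exact ⟨key.1, fun S hS w hw hwW => key.2.1 S hS w hw hwW w.2, key.2.2⟩
  · simp [hσ₁, Code.run_letNum, State.num_writeNum]
  · rintro k hk s hs hnat hnum ⟨p1, p2, p3⟩
    rw [pow_one] at hk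
    have hs0 : s.nat 0 = σ.nat 0 := hnat 0 (by decide)
    have hsA : s.nat arrAct = σ.nat arrAct := hnat arrAct (by decide)
    have hsY : s.num arrY = σ.num arrY := by
      rw [hnum arrY (by decide)]; funext i; simp [hσ₁, Code.run_letNum, State.num_writeNum]
    have hsX : s.num arrX = σ.num arrX := by
      rw [hnum arrX (by decide)]; funext i; simp [hσ₁, Code.run_letNum, State.num_writeNum]
    simp only [State.num_writeNat]
    set w : Fin n := ⟨k, hk⟩ with hw
    have hyw : σ.num arrY k = y w := by rw [← hy]; rfl
    have hlt : ∀ w' : Fin n, (w' : ℕ) < k + 1 → (w' : ℕ) < k ∨ w' = w := by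
      intro w' h
      rcases Nat.lt_succ_iff_lt_or_eq.1 h with h | h
      · exact Or.inl h
      · exact Or.inr (Fin.ext h)
    by_cases hc : w ∈ W ∧ w ≠ r
    · rw [hbody, Code.run_when_true (by
        have := (hW w).2 hc.1
        have h2 : k ≠ r := fun c => hc.2 (Fin.ext c)
        simpa [hs, hs0, hsA, hr, h2] using this)]
      simp only [Code.run_seq]
      set s₁ := (Code.letNat natSink (.var ctrT)).run s with hs₁
      have hs1X : s₁.mat n arrX = X := by
        rw [← hX]
        funext i j
        simp [State.mat, hs₁, Code.run_letNat, hsX]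
      obtain ⟨f1, f2⟩ := flow_spec (σ := s₁) (n := n) (r := r) (t := w) (X := X)
        (by simp [hs₁, Code.run_letNat, State.nat_writeNat, hs0, hn])
        (by simp [hs₁, Code.run_letNat, State.nat_writeNat, hs0, hr])
        (by simp [hs₁, Code.run_letNat, State.nat_writeNat, hs, hw]) hc.2.symm hs1X hnn hd hsymm
      set s₂ := flow.run s₁ with hs₂
      have g1 : s₂.nat ctrT 0 = k := by
        rw [hs₂, Code.run_nat_of_notMem _ (by decide)]
        simp [hs₁, Code.run_letNat, State.nat_writeNat, hs]
      have g2 : s₂.num arrY = σ.num arrY := by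
        rw [hs₂, Code.run_num_of_notMem _ (by decide), ← hsY]; rfl
      have g3 : s₂.num numQ 0 = s.num numQ 0 := by
        rw [hs₂, Code.run_num_of_notMem _ (by decide)]; rfl
      have g4 : s₂.num arrExc k = s₂.num arrExc w := rfl
      by_cases hq : s.num numQ 0 < y w + y w - s₂.num arrExc w
      · rw [Code.run_when_true (by simpa [g1, g2, g3, hyw] using hq)]
        simp only [Code.run_letNum, State.num_writeNum, and_self, if_true, FExp.eval_sub,
          FExp.eval_add, FExp.eval_get, NExp.eval_var, g1, g2, hyw, g4]
        refine ⟨by linarith, ?_, ?_⟩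
        · intro S hrS w' hwS hwW hlt'
          rcases hlt w' hlt' with h | rfl
          · linarith [p2 S hrS w' hwS hwW h]
          · linarith [f1 S hrS hwS]
        · right
          obtain ⟨S, h1, h2, h3⟩ := f2
          exact ⟨S, w, h2, h1, hc.1, by rw [← h3]; ring⟩
      · rw [Code.run_when_false (by simpa [g1, g2, g3, hyw] using hq), g3]
        refine ⟨p1, ?_, p3⟩
        intro S hrS w' hwS hwW hlt'
        rcases hlt w' hlt' with h | rfl
        · exact p2 S hrS w' hwS hwW h
        · linarith [f1 S hrS hwS]
    · rw [hbody, Code.run_when_false (by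
        intro h
        refine hc ⟨(hW w).1 ?_, ?_⟩
        · simpa [hs, hs0, hsA] using h.1
        · rintro hwr
          have : k = r := by rw [← hwr]
          exact h.2 (by simp [hs, hs0, hr, this]))]
      refine ⟨p1, ?_, p3⟩
      intro S hrS w' hwS hwW hlt'
      rcases hlt w' hlt' with h | rfl
      · exact p2 S hrS w' hwS hwW h
      · exact absurd ⟨hwW, fun c => hrS (c ▸ hwS)⟩ hc

/-- The pair is split off by the minimum of its two weights, the only limit set by nonnegativity.
Half of the largest violation is then taken back, because a cut loses twice the amount split off. -/
theorem splitPair_spec {σ : State K} (hn : σ.nat 0 0 = n) (hr : σ.nat 0 1 = r)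
    (hy : σ.vec n arrY = y) {v a b : Fin n} (hv : σ.nat natV 0 = v) (ha : σ.nat ctrA 0 = a)
    (hb : σ.nat ctrB 0 = b) (hab : a ≠ b) (hav : a ≠ v) (hbv : b ≠ v) {W : Finset (Fin n)}
    (hW : ∀ w : Fin n, σ.nat arrAct w = 1 ↔ w ∈ W) (hvW : v ∉ W)
    (hf : CutFeasible W r (fun w => 2 * y w) (σ.mat n arrX)) :
    ∃ m, 0 ≤ m ∧ (splitPair.run σ).mat n arrX = splitOff (σ.mat n arrX) v a b m ∧
      CutFeasible W r (fun w => 2 * y w) ((splitPair.run σ).mat n arrX) ∧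
      Blocked W r (fun w => 2 * y w) ((splitPair.run σ).mat n arrX) v a b := by
  set X := σ.mat n arrX with hX
  set m := min (X a v) (X b v) with hm
  obtain ⟨σ₁, hσ₁, h1, h2⟩ : ∃ σ₁ : State K, (Code.ite
      (.fle (.get arrX (.pr (.var ctrA) (.var natV))) (.get arrX (.pr (.var ctrB) (.var natV))))
      (.letNum numS (.get arrX (.pr (.var ctrA) (.var natV))))
      (.letNum numS (.get arrX (.pr (.var ctrB) (.var natV))))).run σ = σ₁ ∧
      σ₁.nat = σ.nat ∧ ∀ a i, σ₁.num a i = if a = numS ∧ i = 0 then m else σ.num a i := by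
    refine ⟨_, rfl, ?_, ?_⟩
    · simp only [Code.run]
      split_ifs <;> rfl
    · intro c i
      simp only [Code.run, BExp.holds_fle, FExp.eval_get, NExp.eval_var, NExp.eval_pr, ha, hb, hv]
      split_ifs with c1 c2 c2
      · have : X a v ≤ X b v := c1
        simp [Code.run_letNum, State.num_writeNum, c2, ha, hv, hm, this]; rfl
      · simp [Code.run_letNum, State.num_writeNum, c2]
      · have : X b v ≤ X a v := (not_le.1 c1).le
        simp [Code.run_letNum, State.num_writeNum, c2, hb, hv, hm, this]; rfl
      · simp [Code.run_letNum, State.num_writeNum, c2]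
  have hX1 : σ₁.mat n arrX = X := by
    funext i j
    simp [State.mat, h2, hX]
  simp only [splitPair, Code.run_seq, hσ₁]
  set σ₂ := splitBy.run σ₁ with hσ₂
  have hnat2 : ∀ c, σ₂.nat c = σ.nat c := by
    intro c; rw [← h1]; rfl
  have hX2 : σ₂.mat n arrX = splitOff X v a b m := by
    rw [hσ₂, splitBy_spec (by rw [h1, hv]) (by rw [h1, ha]) (by rw [h1, hb]) hab hav hbv, hX1]
    simp [h2]
  have hy2 : σ₂.vec n arrY = y := by
    rw [← hy]
    funext i
    rw [State.vec, hσ₂, Code.run_num_of_notMem _ (by decide)]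
    simp [h2, State.vec]
  have hm0 : 0 ≤ m := le_min (hf.nonneg _ _) (hf.nonneg _ _)
  have hd2 : ∀ i, splitOff X v a b m i i = 0 := by
    intro i
    have e : ∀ p q : Fin n, p ≠ q → (edgeMatrix p q i i : K) = 0 := by
      intro p q hpq
      refine if_neg ?_
      rintro (⟨rfl, rfl⟩ | ⟨rfl, rfl⟩) <;> exact hpq rfl
    simp [splitOff, e _ _ hab, e _ _ hav, e _ _ hbv, hf.diag]
  obtain ⟨q1, q2, q3⟩ := maxViolation_spec (σ := σ₂) (r := r) (by rw [hnat2, hn]) (by rw [hnat2, hr]) hy2 hX2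
    (splitOff_nonneg hf.nonneg hf.symm hab hav hbv hm0 (min_le_left _ _) (min_le_right _ _)) hd2
    (splitOff_symm hf.symm v a b m) (W := W) (by intro w; rw [hnat2, hW])
  set σ₃ := maxViolation.run σ₂ with hσ₃
  have hX3 : σ₃.mat n arrX = splitOff X v a b m := by
    rw [← hX2]
    funext i j
    rw [State.mat, hσ₃, Code.run_num_of_notMem _ (by decide)]; rfl
  have hfin : (splitBy.run ((Code.letNum numS (.sub .zero (.half (.var numQ)))).run σ₃)).mat n arrX =
      splitOff X v a b (m - σ₃.num numQ 0 / 2) := by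
    have hc : ∀ c, c ∉ maxViolation.natWrites →
        ((Code.letNum numS (.sub .zero (.half (.var numQ)))).run σ₃).nat c = σ.nat c := by
      intro c hc
      rw [Code.run_letNum, State.nat_writeNum, hσ₃, Code.run_nat_of_notMem _ hc, hnat2]
    rw [splitBy_spec (by rw [hc _ (by decide), hv]) (by rw [hc _ (by decide), ha])
      (by rw [hc _ (by decide), hb]) hab hav hbv]
    have e1 : ((Code.letNum numS (.sub .zero (.half (.var numQ)))).run σ₃).mat n arrX =
        splitOff X v a b m := by
      rw [← hX3]
      funext i j
      simp [State.mat, Code.run_letNum, State.num_writeNum]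
    rw [e1, splitOff_splitOff]
    simp [Code.run_letNum, State.num_writeNum, sub_eq_add_neg]
  rw [hfin]
  obtain ⟨k1, k2, k3⟩ := hf.splitOff_max hvW hab hav hbv hm q1 q2 q3
  exact ⟨_, k1, rfl, k2, k3⟩

end SplitSpec

/-! ### Correctness of the elimination of vertices. -/

section SplitAll

variable {K : Type} [Field K] [LinearOrder K] [IsStrictOrderedRing K] {n : ℕ} {r : Fin n}
  {y : Fin n → K}

/-- The invariant collects the pairs already treated; since they stay blocked, all pairs are blocked
after one pass. Off `v` weights only grow, as `{a,b}` gains what the edges at `v` lose. -/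
theorem splitVertex_spec {σ : State K} (hn : σ.nat 0 0 = n) (hr : σ.nat 0 1 = r)
    (hy : σ.vec n arrY = y) {v : Fin n} (hv : σ.nat natV 0 = v) {W : Finset (Fin n)}
    (hW : ∀ w : Fin n, σ.nat arrAct w = 1 ↔ w ∈ W) (hvW : v ∉ W)
    (hf : CutFeasible W r (fun w => 2 * y w) (σ.mat n arrX)) {X' : Fin n → Fin n → K}
    (hX' : (splitVertex.run σ).mat n arrX = X') :
    CutFeasible W r (fun w => 2 * y w) X' ∧
      (∀ a b, a ≠ v → b ≠ v → σ.mat n arrX a b ≤ X' a b) ∧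
      (∀ a, a ≠ v → ∑ j, X' a j = ∑ j, σ.mat n arrX a j) ∧
      ∀ a b, a ≠ b → a ≠ v → b ≠ v → Blocked W r (fun w => 2 * y w) X' v a b := by
  set X := σ.mat n arrX with hX
  set body := Code.when (.conj (.neg (.neq (.var ctrA) (.var ctrB)))
    (.conj (.neg (.neq (.var ctrA) (.var natV))) (.neg (.neq (.var ctrB) (.var natV))))) splitPair
    with hbody
  have hrun : splitVertex = .loop ctrA 1 (.loop ctrB 1 body) := rfl
  let Inv : (Fin n → Fin n → Prop) → State K → Prop := fun D s =>
    CutFeasible W r (fun w => 2 * y w) (s.mat n arrX) ∧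
      (∀ a b, a ≠ v → b ≠ v → X a b ≤ s.mat n arrX a b) ∧
      (∀ a, a ≠ v → ∑ j, s.mat n arrX a j = ∑ j, X a j) ∧
      ∀ a b, D a b → a ≠ b → a ≠ v → b ≠ v → Blocked W r (fun w => 2 * y w) (s.mat n arrX) v a b
  have key := Code.loop_induction (a := ctrA) (d := 1) (c := .loop ctrB 1 body) (σ := σ) (n := n) hn
    (fun k s => Inv (fun a _ => (a : ℕ) < k) s) ⟨hf, fun _ _ _ _ => le_rfl, fun _ _ => rfl, by simp⟩ ?_
  · rw [pow_one, ← hrun] at key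
    obtain ⟨k1, k2, k3, k4⟩ := key
    rw [hX'] at k1 k2 k3 k4
    exact ⟨k1, k2, k3, fun a b => k4 a b a.2⟩
  · intro k hk s hs hnat hnum hP
    rw [pow_one] at hk
    have key2 := Code.loop_induction (a := ctrB) (d := 1) (c := body) (σ := s) (n := n)
      (by rw [hnat 0 (by decide), hn])
      (fun l s => Inv (fun a b => (a : ℕ) < k ∨ (a : ℕ) = k ∧ (b : ℕ) < l) s) ?_ ?_
    · rw [pow_one] at key2
      obtain ⟨k1, k2, k3, k4⟩ := key2
      refine ⟨k1, k2, k3, fun a b hab => k4 a b ?_⟩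
      rcases Nat.lt_succ_iff_lt_or_eq.1 hab with h | h
      · exact Or.inl h
      · exact Or.inr ⟨h, b.2⟩
    · obtain ⟨k1, k2, k3, k4⟩ := hP
      exact ⟨k1, k2, k3, fun a b hab => k4 a b (by simpa using hab)⟩
    · rintro l hl s' hs' hnat' hnum' ⟨p1, p2, p3, p4⟩
      rw [pow_one] at hl
      have hN : ∀ c, c ∉ (Code.loop ctrA 1 (.loop ctrB 1 body)).natWrites →
          c ∉ (Code.loop ctrB 1 body).natWrites → s'.nat c = σ.nat c := by
        intro c h1 h2
        rw [hnat' c h2, hnat c h1]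
      have hA : s'.nat ctrA 0 = k := by rw [hnat' ctrA (by decide), hs]
      have hV : s'.nat natV 0 = v := by rw [hN natV (by decide) (by decide), hv]
      have hlt : ∀ a b : Fin n, ((a : ℕ) < k ∨ (a : ℕ) = k ∧ (b : ℕ) < l + 1) →
          ((a : ℕ) < k ∨ (a : ℕ) = k ∧ (b : ℕ) < l) ∨ (a = ⟨k, hk⟩ ∧ b = ⟨l, hl⟩) := by
        intro a b h
        simp only [Fin.ext_iff]
        omega
      by_cases hc : (⟨k, hk⟩ : Fin n) ≠ ⟨l, hl⟩ ∧ (⟨k, hk⟩ : Fin n) ≠ v ∧ (⟨l, hl⟩ : Fin n) ≠ v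
      · obtain ⟨c1, c2, c3⟩ := hc
        have c1' : k ≠ l := fun c => c1 (Fin.ext c)
        have c2' : k ≠ v := fun c => c2 (Fin.ext c)
        have c3' : l ≠ v := fun c => c3 (Fin.ext c)
        rw [hbody, Code.run_when_true (by simp [hA, hs', hV, c1', c2', c3'])]
        obtain ⟨m, hm, g1, g2, g3⟩ := splitPair_spec (σ := s') (r := r) (y := y) (v := v) (a := ⟨k, hk⟩)
          (b := ⟨l, hl⟩) (by rw [hN 0 (by decide) (by decide), hn])
          (by rw [hN 0 (by decide) (by decide), hr])
          (by
            rw [← hy]; funext i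
            rw [State.vec, hnum' arrY (by decide), hnum arrY (by decide)]; rfl) hV hA hs' c1 c2 c3
          (W := W) (by intro w; rw [hN arrAct (by decide) (by decide), hW]) hvW p1
        have hmat : ((splitPair.run s').writeNat ctrB 0 (l + 1)).mat n arrX =
            (splitPair.run s').mat n arrX := rfl
        simp only [Inv, hmat]
        have hle : ∀ a b, a ≠ v → b ≠ v → s'.mat n arrX a b ≤ (splitPair.run s').mat n arrX a b := by
          intro a b ha hb
          rw [g1]
          have e1 : (edgeMatrix (⟨k, hk⟩ : Fin n) v a b : K) = 0 := if_neg (by tauto)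
          have e2 : (edgeMatrix (⟨l, hl⟩ : Fin n) v a b : K) = 0 := if_neg (by tauto)
          have e3 := edgeMatrix_nonneg (K := K) (⟨k, hk⟩ : Fin n) ⟨l, hl⟩ a b
          simp only [splitOff, e1, e2]
          nlinarith
        refine ⟨g2, fun a b ha hb => (p2 a b ha hb).trans (hle a b ha hb), ?_, ?_⟩
        · intro a ha
          rw [← p3 a ha, g1, sum_splitOff c1 c2 c3 m ha]
        · intro a b hab h1 h2 h3
          rcases hlt a b hab with h | ⟨rfl, rfl⟩
          · have := p4 a b h h1 h2 h3
            have hnn := g2.nonneg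
            rw [g1] at hnn ⊢
            exact this.splitOff c1 c2 c3 h2 h3 hm hnn
          · exact g3
      · rw [hbody, Code.run_when_false (by
          intro h
          apply hc
          simpa [hA, hs', hV, Fin.ext_iff] using h)]
        refine ⟨p1, p2, p3, ?_⟩
        intro a b hab h1 h2 h3
        rcases hlt a b hab with h | ⟨rfl, rfl⟩
        · exact p4 a b h h1 h2 h3
        · exact absurd ⟨h1, h2, h3⟩ hc

/-- The value `n`, which is no vertex, signals that no vertex is left to be split off. -/
theorem selectVertex_spec {σ : State K} (hn : σ.nat 0 0 = n) (hy : σ.vec n arrY = y)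
    {W : Finset (Fin n)} (hW : ∀ w : Fin n, σ.nat arrAct w = 1 ↔ w ∈ W) :
    ((selectVertex.run σ).nat natV 0 = n ∧ ∀ w ∈ W, ¬ y w < 1) ∨
      ∃ v : Fin n, (selectVertex.run σ).nat natV 0 = v ∧ v ∈ W ∧ y v < 1 ∧ ∀ w ∈ W, y w < 1 → y v ≤ y w := by
  set σ₁ := (Code.letNat natV .card).run σ with hσ₁
  set body := Code.when (.conj (.neq (.get arrAct (.var ctrT)) (.lit 1))
      (.flt (.get arrY (.var ctrT)) .one))
    (.ite (.neq (.var natV) .card) (.letNat natV (.var ctrT))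
      (.when (.flt (.get arrY (.var ctrT)) (.get arrY (.var natV))) (.letNat natV (.var ctrT))))
    with hbody
  have hrun : selectVertex.run σ = (Code.loop ctrT 1 body).run σ₁ := rfl
  have h1n : σ₁.nat 0 = σ.nat 0 := by
    funext i; simp [hσ₁, Code.run_letNat, State.nat_writeNat]
  have key := Code.loop_induction (a := ctrT) (d := 1) (c := body) (σ := σ₁) (n := n)
    (by rw [h1n, hn])
    (fun k s => (s.nat natV 0 = n ∧ ∀ w ∈ W, (w : ℕ) < k → ¬ y w < 1) ∨
      ∃ v : Fin n, s.nat natV 0 = v ∧ v ∈ W ∧ y v < 1 ∧ ∀ w ∈ W, (w : ℕ) < k → y w < 1 → y v ≤ y w)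
    ?_ ?_
  · rw [pow_one, ← hrun] at key
    rcases key with ⟨h1, h2⟩ | ⟨v, h1, h2, h3, h4⟩
    · exact Or.inl ⟨h1, fun w hw => h2 w hw w.2⟩
    · exact Or.inr ⟨v, h1, h2, h3, fun w hw => h4 w hw w.2⟩
  · left
    simp [State.nat_writeNat, hσ₁, Code.run_letNat, hn]
  · intro k hk s hs hnat hnum hP
    rw [pow_one] at hk
    have hs0 : s.nat 0 0 = n := by rw [hnat 0 (by decide), h1n, hn]
    have hsA : s.nat arrAct = σ.nat arrAct := by
      rw [hnat arrAct (by decide)]; funext i; simp [hσ₁, Code.run_letNat, State.nat_writeNat]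
    have hsY : ∀ w : Fin n, s.num arrY w = y w := by
      intro w
      rw [hnum arrY (by decide), ← hy]; rfl
    have hlt : ∀ w : Fin n, (w : ℕ) < k + 1 → (w : ℕ) < k ∨ w = ⟨k, hk⟩ := by
      intro w h
      rcases Nat.lt_succ_iff_lt_or_eq.1 h with h | h
      · exact Or.inl h
      · exact Or.inr (Fin.ext h)
    have hyk := hsY ⟨k, hk⟩
    have hAk := hW ⟨k, hk⟩
    simp only at hyk hAk
    by_cases hc : (⟨k, hk⟩ : Fin n) ∈ W ∧ y ⟨k, hk⟩ < 1
    · rw [hbody, Code.run_when_true (by simpa [hs, hsA, hyk, hAk] using hc)]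
      rcases hP with ⟨h1, h2⟩ | ⟨v, h1, h2, h3, h4⟩
      · rw [Code.run_ite_true (by simp [h1, hs0])]
        refine Or.inr ⟨⟨k, hk⟩, by simp [Code.run_letNat, State.nat_writeNat, hs], hc.1, hc.2, ?_⟩
        intro w hw hwk hy1
        rcases hlt w hwk with h | rfl
        · exact absurd hy1 (h2 w hw h)
        · exact le_rfl
      · rw [Code.run_ite_false (by simp [h1, hs0, v.2.ne])]
        by_cases hcmp : y ⟨k, hk⟩ < y v
        · rw [Code.run_when_true (by simpa [hs, h1, hyk, hsY] using hcmp)]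
          refine Or.inr ⟨⟨k, hk⟩, by simp [Code.run_letNat, State.nat_writeNat, hs], hc.1, hc.2, ?_⟩
          intro w hw hwk hy1
          rcases hlt w hwk with h | rfl
          · exact hcmp.le.trans (h4 w hw h hy1)
          · exact le_rfl
        · rw [Code.run_when_false (by simpa [hs, h1, hyk, hsY] using hcmp)]
          refine Or.inr ⟨v, by simp [State.nat_writeNat, h1], h2, h3, ?_⟩
          intro w hw hwk hy1
          rcases hlt w hwk with h | rfl
          · exact h4 w hw h hy1
          · exact not_lt.1 hcmp
    · rw [hbody, Code.run_when_false (by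
        intro h
        apply hc
        simpa [hs, hsA, hyk, hAk] using h)]
      rcases hP with ⟨h1, h2⟩ | ⟨v, h1, h2, h3, h4⟩
      · left
        refine ⟨by simp [State.nat_writeNat, h1], fun w hw hwk => ?_⟩
        rcases hlt w hwk with h | rfl
        · exact h2 w hw h
        · exact fun c => hc ⟨hw, c⟩
      · refine Or.inr ⟨v, by simp [State.nat_writeNat, h1], h2, h3, ?_⟩
        intro w hw hwk hy1
        rcases hlt w hwk with h | rfl
        · exact h4 w hw h hy1
        · exact absurd ⟨hw, hy1⟩ hc

theorem snapshot_spec {σ : State K} (hn : σ.nat 0 0 = n) {e : NExp} {m : ℕ}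
    (he : ∀ s : State K, (∀ c, c ≠ ctrA → c ≠ ctrB → s.nat c = σ.nat c) → e.eval s = m) :
    (∀ i j : Fin n, ((snapshot e).run σ).num arrSnap (pr (pr m i) j) = σ.mat n arrX i j) ∧
      ∀ k i j, k ≠ m → ((snapshot e).run σ).num arrSnap (pr (pr k i) j) = σ.num arrSnap (pr (pr k i) j) := by
  set row := Code.loop ctrB 1 (.setNum arrSnap (.pr (.pr e (.var ctrA)) (.var ctrB))
    (.get arrX (.pr (.var ctrA) (.var ctrB)))) with hrow
  have hrun : snapshot e = .loop ctrA 1 row := rfl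
  have key := Code.loop_induction (a := ctrA) (d := 1) (c := row) (σ := σ) (n := n) hn
    (fun k s => (∀ i j : Fin n, (i : ℕ) < k → s.num arrSnap (pr (pr m i) j) = σ.mat n arrX i j) ∧
      ∀ k i j, k ≠ m → s.num arrSnap (pr (pr k i) j) = σ.num arrSnap (pr (pr k i) j)) (by simp) ?_
  · rw [pow_one, ← hrun] at key
    exact ⟨fun i j => key.1 i j i.2, key.2⟩
  · rintro k hk s hs hnat hnum ⟨p1, p2⟩
    rw [pow_one] at hk
    have hs0 : s.nat 0 0 = n := by
      rw [hnat 0 (by simp [hrow, Code.natWrites]), hn]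
    obtain ⟨g1, g2⟩ := Code.run_loop_setNum (σ := s) (n := n) (a := arrSnap) (b := ctrB)
      (ix := .pr (.pr e (.var ctrA)) (.var ctrB)) (ex := .get arrX (.pr (.var ctrA) (.var ctrB))) hs0
      (fun j => pr (pr m k) j) (fun j => σ.num arrX (pr k j)) (by simp) (by
        intro s' e1 e2 _
        have h1 : e.eval s' = m := he s' fun c h1 h2 => by
          rw [e1 c h2, hnat c (by simp [hrow, Code.natWrites, h1, h2])]
        simp [h1, e1, e2, hs]
        rw [hnum 3 (by simp [hrow, Code.numWrites])])
    rw [← hrow] at g1 g2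
    constructor
    · intro i j hi
      rw [State.num_writeNat]
      rcases Nat.lt_succ_iff_lt_or_eq.1 hi with h | h
      · rw [g2 _ (by simp; omega), p1 i j h]
      · rw [h, g1 j j.2, State.mat, h]
    · intro k' i j hk'
      rw [State.num_writeNat, g2 _ (by simp [hk']), p2 k' i j hk']

/-- The vertices that have not been split off before step `k`, if the vertices are split off in the
order `ord`. -/
def remaining (n : ℕ) (ord : ℕ → ℕ) (k : ℕ) : Finset (Fin n) :=
  Finset.univ.filter fun w => ∀ l < k, ord l ≠ w

theorem mem_remaining {ord : ℕ → ℕ} {k : ℕ} {w : Fin n} :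
    w ∈ remaining n ord k ↔ ∀ l < k, ord l ≠ w := by
  simp [remaining]

theorem mem_remaining_succ {ord : ℕ → ℕ} {k : ℕ} {w : Fin n} :
    w ∈ remaining n ord (k + 1) ↔ w ∈ remaining n ord k ∧ ord k ≠ w := by
  simp only [mem_remaining, Nat.lt_succ_iff_lt_or_eq]
  exact ⟨fun h => ⟨fun l hl => h l (Or.inl hl), h k (Or.inr rfl)⟩,
    fun h l hl => hl.elim (h.1 l) (fun e => e ▸ h.2)⟩

/-- The vertex `v` has been split off completely, turning `X` into `X'`. -/
structure SplitStep (X X' : Fin n → Fin n → K) (v : Fin n) : Prop where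
  mono : ∀ a b, a ≠ v → b ≠ v → X a b ≤ X' a b
  isolated : ∀ a, X' a v = 0
  sum_eq : ∀ a, a ≠ v → ∑ j, X' a j = ∑ j, X a j

/-- The matrices `S 0, …, S i` arise by splitting off the vertices in the order `ord`. -/
structure SplitHistory (r : Fin n) (y : Fin n → K) (S : ℕ → Fin n → Fin n → K) (ord : ℕ → ℕ)
    (i : ℕ) : Prop where
  feasible : ∀ k ≤ i, CutFeasible (remaining n ord k) r (fun w => 2 * y w) (S k)
  isolated : ∀ k ≤ i, ∀ w ∉ remaining n ord k, ∀ j, S k w j = 0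
  step : ∀ k < i, (ord k = n ∧ S (k + 1) = S k) ∨ ∃ v : Fin n, ord k = v ∧ v ∈ remaining n ord k ∧
    y v < 1 ∧ (∀ w ∈ remaining n ord k, y w < 1 → y v ≤ y w) ∧ SplitStep (S k) (S (k + 1)) v
  progress : (∀ w ∈ remaining n ord i, ¬ y w < 1) ∨ i + (remaining n ord i).card ≤ n

theorem SplitHistory.mem_remaining {S : ℕ → Fin n → Fin n → K} {ord : ℕ → ℕ} {i : ℕ}
    (h : SplitHistory r y S ord i) {k : ℕ} (hk : k ≤ i) {w : Fin n} (hw : y w = 1) :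
    w ∈ remaining n ord k := by
  rw [PrizeCollecting.mem_remaining]
  intro l hl hlw
  rcases h.step l (by omega) with ⟨h1, _⟩ | ⟨v, h1, _, h3, _⟩
  · have := w.2; omega
  · have : v = w := Fin.ext (h1.symm.trans hlw)
    rw [this, hw] at h3
    exact lt_irrefl _ h3

/-- A stage writes only one new entry of the order and one new snapshot, so the history recorded
before carries over. -/
theorem SplitHistory.congr {S S' : ℕ → Fin n → Fin n → K} {ord ord' : ℕ → ℕ} {i : ℕ}
    (h : SplitHistory r y S ord i) (hS : ∀ k ≤ i, S' k = S k) (hord : ∀ k < i, ord' k = ord k) :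
    SplitHistory r y S' ord' i := by
  have hrem : ∀ k ≤ i, remaining n ord' k = remaining n ord k := by
    intro k hk
    ext w
    simp only [PrizeCollecting.mem_remaining]
    exact forall₂_congr fun l hl => by rw [hord l (by omega)]
  refine ⟨fun k hk => ?_, fun k hk => ?_, fun k hk => ?_, ?_⟩
  · rw [hrem k hk, hS k hk]; exact h.feasible k hk
  · rw [hrem k hk, hS k hk]; exact h.isolated k hk
  · rw [hrem k hk.le, hS k hk.le, hS (k + 1) hk, hord k hk]; exact h.step k hk
  · rw [hrem i le_rfl]; exact h.progress

end SplitAll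

section SplitAllSpec

variable {K : Type} [Field K] [LinearOrder K] [IsStrictOrderedRing K] {n : ℕ} {r : Fin n}
  {y : Fin n → K}

/-- The matrices stored by `snapshot`. -/
def State.snap (s : State K) (n : ℕ) (k : ℕ) : Fin n → Fin n → K :=
  fun i j => s.num arrSnap (pr (pr k i) j)

theorem readInput_spec {σ : State K} (hn : σ.nat 0 0 = n) {X : Fin n → Fin n → K}
    (hX : ∀ i j : Fin n, σ.num 0 (i * n + j) = X i j) :
    (readInput.run σ).mat n arrX = X ∧ ∀ w : Fin n, (readInput.run σ).nat arrAct w = 1 := by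
  set row := Code.loop ctrB 1 (.setNum arrX (.pr (.var ctrA) (.var ctrB))
      (.get 0 (.add (.mul (.var ctrA) .card) (.var ctrB)))) with hrow
  have hrun : readInput = .loop ctrA 1 (.setNat arrAct (.var ctrA) (.lit 1) ;; row) := rfl
  have key := Code.loop_induction (a := ctrA) (d := 1)
    (c := .setNat arrAct (.var ctrA) (.lit 1) ;; row) (σ := σ) (n := n) hn
    (fun k s => ∀ i : Fin n, (i : ℕ) < k → s.nat arrAct i = 1 ∧ ∀ j, s.mat n arrX i j = X i j)
    (by simp) ?_
  · rw [pow_one, ← hrun] at key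
    exact ⟨funext fun i => funext fun j => (key i i.2).2 j, fun w => (key w w.2).1⟩
  · intro k hk s hs hnat hnum hP i hi
    rw [pow_one] at hk
    have hs0 : s.nat 0 = σ.nat 0 := hnat 0 (by decide)
    have hsX : s.num 0 = σ.num 0 := hnum 0 (by decide)
    simp only [Code.run_seq, Code.run_setNat, NExp.eval_var, NExp.eval_lit, hs]
    obtain ⟨g1, g2⟩ := Code.run_loop_setNum (σ := s.writeNat arrAct k 1) (n := n) (a := arrX)
      (b := ctrB) (ix := .pr (.var ctrA) (.var ctrB))
      (ex := .get 0 (.add (.mul (.var ctrA) .card) (.var ctrB)))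
      (by simp [State.nat_writeNat, hs0, hn])
      (fun j => pr k j) (fun j => σ.num 0 (k * n + j)) (by simp) (by
        intro s' e1 e2 _
        simp [e1, e2, State.nat_writeNat, hs, hs0, hsX, hn])
    rw [← hrow] at g1 g2
    have hact : ∀ i, ((row.run (s.writeNat arrAct k 1)).writeNat ctrA 0 (k + 1)).nat arrAct i =
        if i = k then 1 else s.nat arrAct i := by
      intro i
      rw [State.nat_writeNat, if_neg (by simp), Code.run_nat_of_notMem _ (by decide),
        State.nat_writeNat]
      simp
    rw [hact]
    have hmat : ∀ i j, ((row.run (s.writeNat arrAct k 1)).writeNat ctrA 0 (k + 1)).mat n arrX i j =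
        (row.run (s.writeNat arrAct k 1)).num arrX (pr i j) := fun _ _ => rfl
    simp only [hmat]
    rcases Nat.lt_succ_iff_lt_or_eq.1 hi with h | h
    · obtain ⟨h1, h2⟩ := hP i h
      refine ⟨by simp [h1], fun j => ?_⟩
      rw [g2 _ (by simp; omega), ← h2 j]; rfl
    · refine ⟨by simp [h], fun j => ?_⟩
      rw [← hX, h, g1 j j.2]

theorem splitStage_spec {σ : State K} (hn : σ.nat 0 0 = n) (hr : σ.nat 0 1 = r)
    (hy : σ.vec n arrY = y) (hyr : y r = 1) {u : Fin n} (hur : u ≠ r) (hu : y u = 1) {i : ℕ}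
    (hi : σ.nat ctrStage 0 = i) (hh : SplitHistory r y (σ.snap n) (σ.nat arrOrd) i)
    (hX : σ.mat n arrX = σ.snap n i)
    (hact : ∀ w : Fin n, σ.nat arrAct w = 1 ↔ w ∈ remaining n (σ.nat arrOrd) i)
    {σ' : State K} (hσ' : splitStage.run σ = σ') :
    SplitHistory r y (σ'.snap n) (σ'.nat arrOrd) (i + 1) ∧ σ'.snap n 0 = σ.snap n 0 ∧
      σ'.mat n arrX = σ'.snap n (i + 1) ∧
      ∀ w : Fin n, σ'.nat arrAct w = 1 ↔ w ∈ remaining n (σ'.nat arrOrd) (i + 1) := by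
  set ord := σ.nat arrOrd with hord
  set W := remaining n ord i with hWdef
  have hsel := selectVertex_spec hn hy hact
  set σ₁ := selectVertex.run σ with hσ₁
  have hnat1 : ∀ c, c ≠ natV → c ≠ ctrT → σ₁.nat c = σ.nat c := by
    intro c h1 h2
    rw [hσ₁, Code.run_nat_of_notMem]
    change c ∉ [natV, ctrT, natV, natV]
    simp [h1, h2]
  have hnum1 : σ₁.num = σ.num := funext fun c => Code.run_num_of_notMem _ (by
    change c ∉ []
    simp) _
  set σ₂ := σ₁.writeNat arrOrd i (σ₁.nat natV 0) with hσ₂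
  have hrun1 : splitStage.run σ = (snapshot (.add (.var ctrStage) (.lit 1))).run
      ((Code.when (.nlt (.var natV) .card) (.setNat arrAct (.var natV) (.lit 0) ;; splitVertex)).run
        σ₂) := by
    simp only [splitStage, Code.run_seq, Code.run_setNat, ← hσ₁, NExp.eval_var,
      hnat1 ctrStage (by decide) (by decide), hi]
    rfl
  set σ₃ := (Code.when (.nlt (.var natV) .card)
    (.setNat arrAct (.var natV) (.lit 0) ;; splitVertex)).run σ₂ with hσ₃
  have hnat2 : ∀ c, c ≠ natV → c ≠ ctrT → c ≠ arrOrd → σ₂.nat c = σ.nat c := by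
    intro c h1 h2 h3
    rw [← hnat1 c h1 h2]
    funext j
    simp [hσ₂, State.nat_writeNat, h3]
  have hV2 : σ₂.nat natV 0 = σ₁.nat natV 0 := by simp [hσ₂, State.nat_writeNat]
  have hcard2 : σ₂.nat 0 0 = n := by rw [hnat2 0 (by decide) (by decide) (by decide), hn]
  have hX2 : σ₂.mat n arrX = σ.mat n arrX := by
    funext a b; simp [State.mat, hσ₂, hnum1]
  -- the state before taking the snapshot
  have hnat3 : ∀ c, c ∉ (Code.when (.nlt (.var natV) .card)
      (.setNat arrAct (.var natV) (.lit 0) ;; splitVertex)).natWrites → σ₃.nat c = σ₂.nat c :=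
    fun c hc => Code.run_nat_of_notMem _ hc _
  have hord3 : σ₃.nat arrOrd = σ₂.nat arrOrd := hnat3 _ (by decide)
  have hsnap3 : σ₃.num arrSnap = σ.num arrSnap := by
    rw [hσ₃, Code.run_num_of_notMem _ (by decide), hσ₂, State.num_writeNat, hnum1]
  have hstage3 : σ₃.nat ctrStage 0 = i := by
    rw [hnat3 _ (by decide), hnat2 _ (by decide) (by decide) (by decide), hi]
  obtain ⟨s1, s2⟩ := snapshot_spec (σ := σ₃) (n := n) (e := .add (.var ctrStage) (.lit 1)) (m := i + 1)
    (by rw [hnat3 _ (by decide), hcard2]) (by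
      intro s hs
      simp [hs ctrStage (by decide) (by decide), hstage3])
  rw [hσ'] at hrun1
  rw [← hrun1] at s1 s2
  have hsnapS : σ'.snap n (i + 1) = σ₃.mat n arrX := funext fun a => funext fun b => s1 a b
  have hsnapO : ∀ k, k ≠ i + 1 → σ'.snap n k = σ.snap n k := by
    intro k hk
    funext a b
    rw [State.snap, s2 k a b hk, hsnap3]; rfl
  have hnat4 : ∀ c, c ≠ ctrA → c ≠ ctrB → σ'.nat c = σ₃.nat c := by
    intro c h1 h2
    rw [hrun1, Code.run_nat_of_notMem]
    change c ∉ [ctrA, ctrB]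
    simp [h1, h2]
  have hord4 : ∀ k, σ'.nat arrOrd k = if k = i then σ₁.nat natV 0 else ord k := by
    intro k
    rw [hnat4 _ (by decide) (by decide), hord3, hσ₂, State.nat_writeNat,
      hnat1 arrOrd (by decide) (by decide)]
    simp [hord]
  have hX4 : σ'.mat n arrX = σ₃.mat n arrX := by
    funext a b
    rw [State.mat, hrun1, Code.run_num_of_notMem _ (by
      change arrX ∉ [arrSnap]
      decide)]; rfl
  have hcong := hh.congr (S' := σ'.snap n) (ord' := σ'.nat arrOrd) (fun k hk => hsnapO k (by omega))
    (fun k hk => by rw [hord4, if_neg (by omega)])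
  have hremeq : remaining n (σ'.nat arrOrd) i = W := by
    ext w
    simp only [hWdef, mem_remaining]
    exact forall₂_congr fun l hl => by rw [hord4, if_neg (by omega)]
  have hfeas := hh.feasible i le_rfl
  have hiso := hh.isolated i le_rfl
  refine ⟨?_, hsnapO 0 (by omega), by rw [hX4, hsnapS], ?_⟩
  · rcases hsel with ⟨h1, h2⟩ | ⟨v, h1, h2, h3, h4⟩
    · have hσ₃' : σ₃ = σ₂ := by
        rw [hσ₃, Code.run_when_false (by simp [hV2, h1, hcard2])]
      have hS : σ'.snap n (i + 1) = σ.snap n i := by rw [hsnapS, hσ₃', hX2, hX]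
      have hrem : remaining n (σ'.nat arrOrd) (i + 1) = W := by
        ext w
        rw [mem_remaining_succ, hremeq, hord4, if_pos rfl, h1]
        have := w.2
        exact ⟨fun h => h.1, fun h => ⟨h, by omega⟩⟩
      refine ⟨?_, ?_, ?_, ?_⟩
      · intro k hk
        rcases hk.eq_or_lt with rfl | hk
        · rw [hrem, hS]; exact hfeas
        · exact hcong.feasible k (by omega)
      · intro k hk
        rcases hk.eq_or_lt with rfl | hk
        · rw [hrem, hS]; exact hiso
        · exact hcong.isolated k (by omega)
      · intro k hk
        rcases Nat.lt_succ_iff_lt_or_eq.1 hk with hk | rfl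
        · exact hcong.step k hk
        · left
          rw [hord4, if_pos rfl, hS, hsnapO k (by omega)]
          exact ⟨h1, rfl⟩
      · left
        rw [hrem]; exact h2
    · have hvlt := v.2
      set σ₂' := σ₂.writeNat arrAct v 0 with hσ₂'
      have hσ₃' : σ₃ = splitVertex.run σ₂' := by
        rw [hσ₃, Code.run_when_true (by simp [hV2, h1, hcard2])]
        simp only [Code.run_seq, Code.run_setNat, NExp.eval_var, hV2, h1]
        rfl
      have hW' : ∀ w : Fin n, σ₂'.nat arrAct w = 1 ↔ w ∈ W.erase v := by
        intro w
        rw [hσ₂', State.nat_writeNat, hnat2 _ (by decide) (by decide) (by decide), Finset.mem_erase,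
          ← hact]
        by_cases hwv : w = v
        · simp [hwv]
        · have : (w : ℕ) ≠ v := fun c => hwv (Fin.ext c)
          simp [hwv, this]
      have hX2' : σ₂'.mat n arrX = σ.snap n i := by rw [← hX, ← hX2]; rfl
      have hsym := hfeas.symm
      -- Removing `v` from `W` merely drops the degree and cut conditions of `v`.
      have hf' : CutFeasible (W.erase v) r (fun w => 2 * y w) (σ₂'.mat n arrX) := by
        rw [hX2']
        exact ⟨hsym, hfeas.diag, hfeas.nonneg,
          fun w hw => hfeas.degree w (Finset.mem_of_mem_erase hw),
          fun S hS w hw hwW => hfeas.cut S hS w hw (Finset.mem_of_mem_erase hwW)⟩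
      obtain ⟨k1, k2, k3, k4⟩ := splitVertex_spec (σ := σ₂') (r := r) (y := y) (v := v) (W := W.erase v)
        (by simp [hσ₂', State.nat_writeNat, hcard2])
        (by simp [hσ₂', State.nat_writeNat, hnat2 0 (by decide) (by decide) (by decide), hr])
        (by rw [← hy]; funext w; simp [State.vec, hσ₂', hσ₂, hnum1])
        (by simp [hσ₂', State.nat_writeNat, hV2, h1]) hW' (by simp) hf' rfl
      rw [← hσ₃', ← hsnapS] at k1 k2 k3 k4
      rw [hX2'] at k2 k3
      have hcore : ∀ w : Fin n, y w = 1 → w ∈ W.erase v := by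
        intro w hw
        rw [Finset.mem_erase]
        refine ⟨?_, hh.mem_remaining le_rfl hw⟩
        rintro rfl
        rw [hw] at h3
        exact lt_irrefl _ h3
      -- Vertices eliminated earlier stay isolated: their degrees are unchanged and were zero.
      have hout : ∀ w, w ∉ W.erase v → w ≠ v → ∀ j, σ'.snap n (i + 1) w j = 0 := by
        intro w hw hwv j
        have hwW : w ∉ W := fun c => hw (Finset.mem_erase.2 ⟨hwv, c⟩)
        have h0 : ∑ j, σ'.snap n (i + 1) w j = 0 := by
          rw [k3 w hwv]
          exact Finset.sum_eq_zero fun j _ => hiso w hwW j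
        exact (Finset.sum_eq_zero_iff_of_nonneg fun j _ => k1.nonneg w j).1 h0 j (Finset.mem_univ j)
      -- The vertex `u` of value 1 provides the second certificate that is needed when a neighbour
      -- of `v` is the root.
      have hisov := k1.isolated_of_blocked (hcore r hyr) (by simp) (hcore u hu) hur
        (by simp [hyr, hu]) hout k4
      have hrem : remaining n (σ'.nat arrOrd) (i + 1) = W.erase v := by
        ext w
        rw [mem_remaining_succ, hremeq, hord4, if_pos rfl, h1, Finset.mem_erase, and_comm,
          ne_comm, ne_eq, ne_eq, Fin.ext_iff]
      refine ⟨?_, ?_, ?_, ?_⟩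
      · intro k hk
        rcases hk.eq_or_lt with rfl | hk
        · rw [hrem]; exact k1
        · exact hcong.feasible k (by omega)
      · intro k hk
        rcases hk.eq_or_lt with rfl | hk
        · rw [hrem]
          intro w hw j
          by_cases hwv : w = v
          · rw [hwv, k1.symm]; exact hisov j
          · exact hout w hw hwv j
        · exact hcong.isolated k (by omega)
      · intro k hk
        rcases Nat.lt_succ_iff_lt_or_eq.1 hk with hk | rfl
        · exact hcong.step k hk
        · right
          refine ⟨v, by rw [hord4, if_pos rfl, h1], by rw [hremeq]; exact h2, h3,
            by rw [hremeq]; exact h4, ?_⟩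
          rw [hsnapO k (by omega)]
          exact ⟨k2, hisov, k3⟩
      · right
        rw [hrem, Finset.card_erase_of_mem h2]
        have hpos := Finset.card_pos.2 ⟨v, h2⟩
        rcases hh.progress with hp | hp
        · exact absurd h3 (hp v h2)
        · rw [← hWdef] at hp; omega
  · intro w
    rw [mem_remaining_succ, hremeq, hord4, if_pos rfl, hnat4 _ (by decide) (by decide)]
    rcases hsel with ⟨h1, h2⟩ | ⟨v, h1, h2, h3, h4⟩
    · have hσ₃' : σ₃ = σ₂ := by
        rw [hσ₃, Code.run_when_false (by simp [hV2, h1, hcard2])]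
      rw [hσ₃', hnat2 _ (by decide) (by decide) (by decide), hact, h1]
      have := w.2
      exact ⟨fun h => ⟨h, by omega⟩, fun h => h.1⟩
    · have hvlt := v.2
      have hσ₃' : σ₃ = splitVertex.run (σ₂.writeNat arrAct v 0) := by
        rw [hσ₃, Code.run_when_true (by simp [hV2, h1, hcard2])]
        simp only [Code.run_seq, Code.run_setNat, NExp.eval_var, hV2, h1]
        rfl
      rw [hσ₃', Code.run_nat_of_notMem _ (by decide), State.nat_writeNat,
        hnat2 _ (by decide) (by decide) (by decide), h1, ← hact]
      by_cases hwv : w = v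
      · simp [hwv]
      · have : (w : ℕ) ≠ v := fun c => hwv (Fin.ext c)
        simp [this, this.symm]

theorem splitAll_spec {σ : State K} (hn : σ.nat 0 0 = n) (hr : σ.nat 0 1 = r)
    (hy : σ.vec n arrY = y) (hyr : y r = 1) {u : Fin n} (hur : u ≠ r) (hu : y u = 1)
    {X : Fin n → Fin n → K} (hX : ∀ i j : Fin n, σ.num 0 (i * n + j) = X i j)
    (hf : CutFeasible Finset.univ r (fun w => 2 * y w) X)
    {σ' : State K} (hσ' : splitAll.run σ = σ') :
    SplitHistory r y (σ'.snap n) (σ'.nat arrOrd) n ∧ σ'.snap n 0 = X ∧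
      σ'.mat n arrX = σ'.snap n n ∧ ∀ w ∈ remaining n (σ'.nat arrOrd) n, ¬ y w < 1 := by
  obtain ⟨i1, i2⟩ := readInput_spec hn hX
  set σ₁ := readInput.run σ with hσ₁
  have hn1 : σ₁.nat 0 = σ.nat 0 := Code.run_nat_of_notMem _ (by decide) _
  have hy1 : σ₁.num arrY = σ.num arrY := Code.run_num_of_notMem _ (by decide) _
  obtain ⟨s1, -⟩ := snapshot_spec (σ := σ₁) (n := n) (e := .lit 0) (m := 0) (by rw [hn1, hn]) (by simp)
  set σ₂ := (snapshot (.lit 0)).run σ₁ with hσ₂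
  have hn2 : σ₂.nat 0 = σ.nat 0 := by rw [hσ₂, Code.run_nat_of_notMem _ (by decide), hn1]
  have hA2 : σ₂.nat arrAct = σ₁.nat arrAct := Code.run_nat_of_notMem _ (by decide) _
  have hy2 : σ₂.num arrY = σ.num arrY := by rw [hσ₂, Code.run_num_of_notMem _ (by decide), hy1]
  have hX2 : σ₂.mat n arrX = X := by
    rw [← i1]; funext i j; rw [State.mat, hσ₂, Code.run_num_of_notMem _ (by decide)]; rfl
  have hsn2 : σ₂.snap n 0 = X := by
    funext i j
    rw [State.snap, s1, i1]
  have hrun : splitAll.run σ = (Code.loop ctrStage 1 splitStage).run σ₂ := rfl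
  have hrem0 : ∀ ord, remaining n ord 0 = Finset.univ := by
    intro ord; ext w; simp [mem_remaining]
  have key := Code.loop_induction (a := ctrStage) (d := 1) (c := splitStage) (σ := σ₂) (n := n)
    (by rw [hn2, hn])
    (fun k s => SplitHistory r y (s.snap n) (s.nat arrOrd) k ∧ s.snap n 0 = X ∧
      s.mat n arrX = s.snap n k ∧
      ∀ w : Fin n, s.nat arrAct w = 1 ↔ w ∈ remaining n (s.nat arrOrd) k) ?_ ?_
  · rw [pow_one, ← hrun, hσ'] at key
    obtain ⟨k1, k2, k3, -⟩ := key
    refine ⟨k1, k2, k3, ?_⟩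
    -- After `n` stages the second alternative would leave no vertex at all, but the root is never
    -- removed.
    rcases k1.progress with h | h
    · exact h
    · have := Finset.card_pos.2 ⟨r, k1.mem_remaining le_rfl hyr⟩
      omega
  · have e1 : (σ₂.writeNat ctrStage 0 0).snap n = σ₂.snap n := rfl
    have e2 : (σ₂.writeNat ctrStage 0 0).mat n arrX = σ₂.mat n arrX := rfl
    rw [e1, e2]
    refine ⟨⟨?_, ?_, by simp, ?_⟩, hsn2, by rw [hX2, hsn2], ?_⟩
    · intro k hk
      obtain rfl : k = 0 := by omega
      rw [hrem0, hsn2]; exact hf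
    · intro k hk w hw
      obtain rfl : k = 0 := by omega
      rw [hrem0] at hw
      simp at hw
    · right
      rw [hrem0]; simp
    · intro w
      rw [hrem0, State.nat_writeNat, hA2, i2]
      simp
  · rintro k hk s hs hnat hnum ⟨p1, p2, p3, p4⟩
    obtain ⟨g1, g2, g3, g4⟩ := splitStage_spec (σ := s) (r := r) (y := y) (u := u)
      (by rw [hnat 0 (by decide), hn2, hn])
      (by rw [hnat 0 (by decide), hn2, hr])
      (by rw [← hy]; funext w; rw [State.vec, hnum arrY (by decide), hy2]; rfl) hyr hur hu hs p1 p3 p4 rfl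
    have e0 : ∀ (s : State K) c, c ≠ ctrStage → (s.writeNat ctrStage 0 (k + 1)).nat c = s.nat c := by
      intro s c hc
      funext j
      simp [State.nat_writeNat, hc]
    have e1 : ∀ s : State K, (s.writeNat ctrStage 0 (k + 1)).snap n = s.snap n := fun _ => rfl
    have e2 : ∀ s : State K, (s.writeNat ctrStage 0 (k + 1)).mat n arrX = s.mat n arrX := fun _ => rfl
    rw [e1, e2, e0 _ _ (by decide), e0 _ _ (by decide)]
    exact ⟨g1, g2.trans p2, g3, g4⟩

end SplitAllSpec

/-! ### Operations on trees -/

section Trees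

variable {V : Type}

/-- `{i, j} = {p, q}` -/
def IsEdge (p q i j : V) : Prop := (i = p ∧ j = q) ∨ (i = q ∧ j = p)

instance [DecidableEq V] (p q i j : V) : Decidable (IsEdge p q i j) :=
  inferInstanceAs (Decidable (_ ∨ _))

theorem IsEdge.symm {p q i j : V} (h : IsEdge p q i j) : IsEdge p q j i := by
  unfold IsEdge at *; tauto

theorem isEdge_comm {p q i j : V} : IsEdge p q i j ↔ IsEdge q p i j := by
  unfold IsEdge; tauto

/-- A subgraph that is a tree, in terms of its extension to all vertices. -/
structure IsSubtree (T : (⊤ : SimpleGraph V).Subgraph) : Prop where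
  nonempty : T.verts.Nonempty
  acyclic : T.spanningCoe.IsAcyclic
  reachable : ∀ i ∈ T.verts, ∀ j ∈ T.verts, T.spanningCoe.Reachable i j

/-- A path in the graph on all vertices stays inside the vertex set of the subgraph, because edges
have their ends there. Working on all of `V` avoids changes of type when vertices are added. -/
theorem IsSubtree.isTree {T : (⊤ : SimpleGraph V).Subgraph} (h : IsSubtree T) : T.coe.IsTree := by
  refine ⟨?_, ?_⟩
  · have := h.nonempty.to_subtype
    refine ⟨?_⟩
    rintro ⟨i, hi⟩ ⟨j, hj⟩
    have h1 := h.reachable i hi j hj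
    rw [SimpleGraph.reachable_iff_reflTransGen] at h1
    induction h1 with
    | refl => exact SimpleGraph.Reachable.refl _
    | @tail b c _ hbc ih =>
      have hbc' : T.Adj b c := hbc
      refine (ih (T.edge_vert hbc')).trans (SimpleGraph.Adj.reachable ?_)
      exact hbc'
  · exact h.acyclic.comap (G := T.coe) (G' := T.spanningCoe) ⟨Subtype.val, fun h => h⟩
      Subtype.val_injective

/-- The graph `G` without the edge `{p, q}`. -/
def removeEdge (G : SimpleGraph V) (p q : V) : SimpleGraph V where
  Adj i j := G.Adj i j ∧ ¬ IsEdge p q i j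
  symm := ⟨fun _ _ h => ⟨h.1.symm, fun c => h.2 c.symm⟩⟩
  loopless := ⟨fun _ h => G.loopless.irrefl _ h.1⟩

theorem removeEdge_comm (G : SimpleGraph V) (p q : V) : removeEdge G p q = removeEdge G q p := by
  ext i j
  simp only [removeEdge, isEdge_comm (p := p)]

/-- A walk can be followed until it first uses the edge `{p,q}`; at this moment it is at `p` or `q`.
-/
theorem reachable_removeEdge {G : SimpleGraph V} {p q x : V} (h : G.Reachable x q) :
    (removeEdge G p q).Reachable x p ∨ (removeEdge G p q).Reachable x q := by
  rw [SimpleGraph.reachable_iff_reflTransGen] at h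
  induction h using Relation.ReflTransGen.head_induction_on with
  | refl => exact Or.inr (SimpleGraph.Reachable.refl _)
  | @head a c hac _ ih =>
    by_cases he : IsEdge p q a c
    · rcases he with ⟨rfl, rfl⟩ | ⟨rfl, rfl⟩
      · exact Or.inl (SimpleGraph.Reachable.refl _)
      · exact Or.inr (SimpleGraph.Reachable.refl _)
    · have hadj : (removeEdge G p q).Adj a c := ⟨hac, he⟩
      exact ih.imp hadj.reachable.trans hadj.reachable.trans

theorem removeEdge_le (G : SimpleGraph V) (p q : V) : removeEdge G p q ≤ G := fun _ _ h => h.1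

/-- Every edge of a forest is a bridge. This makes the side of `{p,q}` on which a vertex lies well
defined. -/
theorem not_reachable_removeEdge {G : SimpleGraph V} (hG : G.IsAcyclic) {p q : V} (h : G.Adj p q) :
    ¬ (removeEdge G p q).Reachable p q := by
  have h1 := SimpleGraph.isAcyclic_iff_forall_adj_isBridge.1 hG h
  rw [SimpleGraph.isBridge_iff] at h1
  have h2 : removeEdge G p q = G.deleteEdges {s(p, q)} := by
    ext i j
    simp [removeEdge, IsEdge]
  rw [h2]
  exact h1

/-- If `v` is on the same side of the edge `{p, q}` of a tree as `p`, then it is adjacent to `q` only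
if it equals `p`. -/
theorem IsSubtree.not_adj_or_eq {T : (⊤ : SimpleGraph V).Subgraph} (h : IsSubtree T) {p q v : V}
    (hpq : T.Adj p q) (hvp : (removeEdge T.spanningCoe p q).Reachable v p) :
    ¬ T.Adj v q ∨ v = p := by
  by_cases hvp' : v = p
  · exact Or.inr hvp'
  · left
    intro hvq
    have hq : v ≠ q := fun c => by subst c; exact (T.adj_sub hvq).ne rfl
    have hadj : (removeEdge T.spanningCoe p q).Adj v q := by
      refine ⟨hvq, ?_⟩
      rintro (⟨h1, -⟩ | ⟨h1, -⟩)
      · exact hvp' h1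
      · exact hq h1
    exact not_reachable_removeEdge h.acyclic hpq (hvp.symm.trans hadj.reachable)

/-- Replacing an edge `{p, q}` of a tree by `{v, q}`, where `v` is on the same side of `{p, q}` as
`p`. -/
theorem IsSubtree.exchange {T T' : (⊤ : SimpleGraph V).Subgraph} (h : IsSubtree T) {p q v : V}
    (hpq : T.Adj p q) (hv : v ∈ T.verts) (hvp : (removeEdge T.spanningCoe p q).Reachable v p)
    (hverts : T'.verts = T.verts)
    (hadj : ∀ i j, T'.Adj i j ↔ (T.Adj i j ∧ ¬ IsEdge p q i j) ∨ IsEdge v q i j) : IsSubtree T' := by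
  set G' := removeEdge T.spanningCoe p q with hG'
  have hnr : ¬ G'.Reachable v q := fun c =>
    not_reachable_removeEdge h.acyclic hpq (hvp.symm.trans c)
  have hvq : v ≠ q := fun c => hnr (by rw [c])
  have hT' : T'.spanningCoe = G' ⊔ SimpleGraph.edge v q := by
    ext i j
    rw [SimpleGraph.sup_adj, SimpleGraph.edge_adj, SimpleGraph.Subgraph.spanningCoe_adj, hadj]
    refine or_congr Iff.rfl ?_
    constructor
    · intro hc
      exact ⟨hc, by rintro rfl; rcases hc with ⟨rfl, rfl⟩ | ⟨rfl, rfl⟩ <;> exact hvq rfl⟩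
    · exact fun hc => hc.1
  have hle : G' ≤ T'.spanningCoe := by rw [hT']; exact le_sup_left
  have hvqr : T'.spanningCoe.Reachable v q := by
    refine SimpleGraph.Adj.reachable ?_
    rw [SimpleGraph.Subgraph.spanningCoe_adj, hadj]
    exact Or.inr (Or.inl ⟨rfl, rfl⟩)
  have hq : q ∈ T.verts := T.edge_vert hpq.symm
  -- A vertex on the side of `p` reaches `q` through `v` and the new edge; a vertex on the side of
  -- `q` needs no change.
  have hreach : ∀ i ∈ T.verts, T'.spanningCoe.Reachable i q := by
    intro i hi
    rcases reachable_removeEdge (p := p) (h.reachable i hi q hq) with h1 | h1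
    · exact ((h1.trans hvp.symm).mono hle).trans hvqr
    · exact h1.mono hle
  refine ⟨by rw [hverts]; exact h.nonempty, ?_, ?_⟩
  · rw [hT']
    exact SimpleGraph.IsAcyclic.sup_edge_of_not_reachable hnr
      (h.acyclic.anti (removeEdge_le _ _ _))
  · intro i hi j hj
    rw [hverts] at hi hj
    exact (hreach i hi).trans (hreach j hj).symm

/-- Attaching a leaf to a tree. -/
theorem IsSubtree.leaf {T T' : (⊤ : SimpleGraph V).Subgraph} (h : IsSubtree T) {p v : V}
    (hp : p ∈ T.verts) (hv : v ∉ T.verts) (hverts : T'.verts = insert v T.verts)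
    (hadj : ∀ i j, T'.Adj i j ↔ T.Adj i j ∨ IsEdge p v i j) : IsSubtree T' := by
  have hpv : p ≠ v := fun c => hv (c ▸ hp)
  have hnr : ¬ T.spanningCoe.Reachable p v := by
    refine SimpleGraph.not_reachable_of_neighborSet_right_eq_empty hpv ?_
    ext w
    simp only [SimpleGraph.mem_neighborSet, SimpleGraph.Subgraph.spanningCoe_adj,
      Set.mem_empty_iff_false, iff_false]
    exact fun c => hv (T.edge_vert c)
  have hT' : T'.spanningCoe = T.spanningCoe ⊔ SimpleGraph.edge p v := by
    ext i j
    rw [SimpleGraph.sup_adj, SimpleGraph.edge_adj, SimpleGraph.Subgraph.spanningCoe_adj, hadj,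
      SimpleGraph.Subgraph.spanningCoe_adj]
    refine or_congr Iff.rfl ?_
    constructor
    · intro hc
      exact ⟨hc, by rintro rfl; rcases hc with ⟨rfl, rfl⟩ | ⟨rfl, rfl⟩ <;> exact hpv rfl⟩
    · exact fun hc => hc.1
  have hle : T.spanningCoe ≤ T'.spanningCoe := by rw [hT']; exact le_sup_left
  have hvp : T'.spanningCoe.Reachable v p := by
    refine SimpleGraph.Adj.reachable ?_
    rw [SimpleGraph.Subgraph.spanningCoe_adj, hadj]
    exact Or.inr (Or.inr ⟨rfl, rfl⟩)
  have hreach : ∀ i ∈ T'.verts, T'.spanningCoe.Reachable i p := by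
    intro i hi
    rw [hverts] at hi
    rcases hi with rfl | hi
    · exact hvp
    · exact (h.reachable i hi p hp).mono hle
  refine ⟨by rw [hverts]; exact ⟨v, Or.inl rfl⟩, ?_, ?_⟩
  · rw [hT']
    exact SimpleGraph.IsAcyclic.sup_edge_of_not_reachable hnr h.acyclic
  · intro i hi j hj
    exact (hreach i hi).trans (hreach j hj).symm

/-- A single edge is a tree. -/
theorem IsSubtree.edge {T : (⊤ : SimpleGraph V).Subgraph} {a b : V} (hab : a ≠ b)
    (hverts : T.verts = {a, b}) (hadj : ∀ i j, T.Adj i j ↔ IsEdge a b i j) : IsSubtree T := by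
  have hT : T.spanningCoe = ⊥ ⊔ SimpleGraph.edge a b := by
    ext i j
    rw [bot_sup_eq, SimpleGraph.edge_adj, SimpleGraph.Subgraph.spanningCoe_adj, hadj]
    constructor
    · intro hc
      exact ⟨hc, by rintro rfl; rcases hc with ⟨rfl, rfl⟩ | ⟨rfl, rfl⟩ <;> exact hab rfl⟩
    · exact fun hc => hc.1
  have hr : T.spanningCoe.Reachable a b := by
    refine SimpleGraph.Adj.reachable ?_
    rw [SimpleGraph.Subgraph.spanningCoe_adj, hadj]
    exact Or.inl ⟨rfl, rfl⟩
  refine ⟨by rw [hverts]; exact ⟨a, Or.inl rfl⟩, ?_, ?_⟩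
  · rw [hT]
    refine SimpleGraph.IsAcyclic.sup_edge_of_not_reachable ?_ SimpleGraph.isAcyclic_bot
    rw [SimpleGraph.reachable_bot]
    exact hab
  · intro i hi j hj
    rw [hverts] at hi hj
    rcases hi with rfl | rfl <;> rcases hj with rfl | rfl
    · exact SimpleGraph.Reachable.refl _
    · exact hr
    · exact hr.symm
    · exact SimpleGraph.Reachable.refl _

/-- A subgraph of the complete graph, given by its vertices and adjacencies. -/
theorem exists_subgraph (U : Set V) (A : V → V → Prop) (hsymm : ∀ i j, A i j → A j i)
    (hne : ∀ i, ¬ A i i) (hU : ∀ i j, A i j → i ∈ U) :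
    ∃ T : (⊤ : SimpleGraph V).Subgraph, T.verts = U ∧ ∀ i j, T.Adj i j ↔ A i j :=
  ⟨{ verts := U
     Adj := A
     adj_sub := fun {i j} h => by
       rw [SimpleGraph.top_adj]
       rintro rfl
       exact hne _ h
     edge_vert := fun {i j} h => hU i j h
     symm := ⟨fun i j h => hsymm i j h⟩ }, rfl, fun _ _ => Iff.rfl⟩

end Trees

/-! ### Weighted families of trees -/

notation "arrVert" => (7 : ℕ)
notation "arrAdj" => (8 : ℕ)
notation "arrMark" => (9 : ℕ)
notation "natCnt" => (10 : ℕ)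
notation "natP" => (12 : ℕ)
notation "natQ" => (13 : ℕ)
notation "natEq" => (14 : ℕ)
notation "natI" => (16 : ℕ)
notation "arrWt" => (7 : ℕ)
notation "arrRel" => (8 : ℕ)
notation "numRem" => (11 : ℕ)
notation "ctrSlot" => (27 : ℕ)
notation "ctrI" => (28 : ℕ)
notation "ctrJ" => (29 : ℕ)
notation "ctrK" => (30 : ℕ)

/-- Copies the current tree to a new place. -/
def copySlot : Code :=
  .loop ctrI 1 (.setNat arrVert (.pr (.var natCnt) (.var ctrI)) (.get arrVert (.pr (.var ctrSlot) (.var ctrI))) ;;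
    .loop ctrJ 1 (.setNat arrAdj (.pr (.pr (.var natCnt) (.var ctrI)) (.var ctrJ))
      (.get arrAdj (.pr (.pr (.var ctrSlot) (.var ctrI)) (.var ctrJ)))))

/-- Takes as much weight as needed from the current tree; the excess weight goes to a copy. -/
def takeSlot : Code :=
  .when (.flt (.var numRem) (.get arrWt (.var ctrSlot)))
    (copySlot ;;
      .setNum arrWt (.var natCnt) (.sub (.get arrWt (.var ctrSlot)) (.var numRem)) ;;
      .setNum arrWt (.var ctrSlot) (.var numRem) ;;
      .letNat natCnt (.add (.var natCnt) (.lit 1))) ;;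
  .letNum numRem (.sub (.var numRem) (.get arrWt (.var ctrSlot)))

/-- Modifies trees that satisfy a condition, of total weight at most the one in `numRem`. -/
def redistribute (b : BExp) (c : Code) : Code :=
  .loop ctrSlot 5 (.when (.conj (.flt .zero (.var numRem))
    (.conj (.flt .zero (.get arrWt (.var ctrSlot))) b)) (takeSlot ;; c))

section Family

variable {K : Type} {n : ℕ}

/-- A nested loop over all pairs. -/
theorem Code.loop_loop_induction [Field K] [LinearOrder K] {a b : ℕ} {c : Code} {σ : State K}
    (hn : σ.nat 0 0 = n) (hab : a ≠ b) (hac : a ∉ c.natWrites) (h0 : 0 ∉ c.natWrites) (ha0 : a ≠ 0)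
    (hb0 : b ≠ 0) (P : ℕ → ℕ → State K → Prop)
    (hPa : ∀ i j s m, P i j s → P i j (s.writeNat a 0 m))
    (hPb : ∀ i j s m, P i j s → P i j (s.writeNat b 0 m)) (hP0 : P 0 0 σ)
    (hrow : ∀ i s, P i n s → P (i + 1) 0 s)
    (hs : ∀ i < n, ∀ j < n, ∀ s : State K, s.nat a 0 = i → s.nat b 0 = j →
      (∀ d ∉ (Code.loop a 1 (.loop b 1 c)).natWrites, s.nat d = σ.nat d) →
      (∀ d ∉ c.numWrites, s.num d = σ.num d) → P i j s → P i (j + 1) (c.run s)) :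
    P n 0 ((Code.loop a 1 (.loop b 1 c)).run σ) := by
  have key := Code.loop_induction (a := a) (d := 1) (c := .loop b 1 c) hn (fun i s => P i 0 s)
    (hPa _ _ _ _ hP0) ?_
  · rwa [pow_one] at key
  · intro i hi s hsa hnat hnum hP
    rw [pow_one] at hi
    have hab' : a ∉ (Code.loop b 1 c).natWrites := by simp [natWrites, hab, hac]
    have h0' : 0 ∉ (Code.loop a 1 (.loop b 1 c)).natWrites := by
      simp [natWrites, h0, ha0.symm, hb0.symm]
    refine hPa _ _ _ _ (hrow _ _ ?_)
    have key := Code.loop_induction (a := b) (d := 1) (c := c) (σ := s) (n := n)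
      (by rw [hnat 0 h0', hn]) (fun j s => P i j s) (hPb _ _ _ _ hP) ?_
    · rwa [pow_one] at key
    · intro j hj s' hsb hnat' hnum' hP'
      rw [pow_one] at hj
      refine hPb _ _ _ _ (hs i hi j hj s' ?_ hsb ?_ ?_ hP')
      · rw [hnat' a hab', hsa]
      · intro d hd
        have hd' : d ∉ (Code.loop b 1 c).natWrites := fun h => hd (List.mem_cons_of_mem _ h)
        rw [hnat' d hd', hnat d hd]
      · intro d hd
        rw [hnum' d hd, hnum d hd]

open Classical in
/-- The tree `T` is stored at the place `t`. -/
def State.Stores (s : State K) (t : ℕ) (T : (⊤ : SimpleGraph (Fin n)).Subgraph) : Prop :=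
  (∀ i : Fin n, s.nat arrVert (pr t i) = if i ∈ T.verts then 1 else 0) ∧
    ∀ i j : Fin n, s.nat arrAdj (pr (pr t i) j) = if T.Adj i j then 1 else 0

theorem State.Stores.congr {s s' : State K} {t t' : ℕ} {T : (⊤ : SimpleGraph (Fin n)).Subgraph}
    (h : s.Stores t T) (h1 : ∀ i : Fin n, s'.nat arrVert (pr t' i) = s.nat arrVert (pr t i))
    (h2 : ∀ i j : Fin n, s'.nat arrAdj (pr (pr t' i) j) = s.nat arrAdj (pr (pr t i) j)) :
    s'.Stores t' T :=
  ⟨fun i => by rw [h1, h.1], fun i j => by rw [h2, h.2]⟩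

theorem State.Stores.vert {s : State K} {t : ℕ} {T : (⊤ : SimpleGraph (Fin n)).Subgraph}
    (h : s.Stores t T) (i : Fin n) : s.nat arrVert (pr t i) = 1 ↔ i ∈ T.verts := by
  rw [h.1]; split_ifs <;> simp_all

theorem State.Stores.adj {s : State K} {t : ℕ} {T : (⊤ : SimpleGraph (Fin n)).Subgraph}
    (h : s.Stores t T) (i j : Fin n) : s.nat arrAdj (pr (pr t i) j) = 1 ↔ T.Adj i j := by
  rw [h.2]; split_ifs <;> simp_all

/-- The weighted family `T` of trees with the property `Good` is stored in the memory. -/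
structure Family [Zero K] [LT K] [LE K] (Good : (⊤ : SimpleGraph (Fin n)).Subgraph → Prop) (s : State K)
    (T : ℕ → (⊤ : SimpleGraph (Fin n)).Subgraph) : Prop where
  nonneg : ∀ t, 0 ≤ s.num arrWt t
  zero : ∀ t, s.nat natCnt 0 ≤ t → s.num arrWt t = 0
  stores : ∀ t, 0 < s.num arrWt t → s.Stores t (T t)
  good : ∀ t, 0 < s.num arrWt t → Good (T t)

variable [Field K]

/-- The total value of a family of trees. -/
def total (s : State K) (T : ℕ → (⊤ : SimpleGraph (Fin n)).Subgraph)
    (φ : (⊤ : SimpleGraph (Fin n)).Subgraph → K) : K :=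
  ∑ t ∈ Finset.range (n ^ 5), s.num arrWt t * φ (T t)

variable [LinearOrder K]

theorem Family.congr {Good : (⊤ : SimpleGraph (Fin n)).Subgraph → Prop} {s s' : State K}
    {T : ℕ → (⊤ : SimpleGraph (Fin n)).Subgraph} (h : Family Good s T)
    (h1 : s'.nat arrVert = s.nat arrVert) (h2 : s'.nat arrAdj = s.nat arrAdj)
    (h3 : s'.num arrWt = s.num arrWt) (h4 : s'.nat natCnt = s.nat natCnt) : Family Good s' T := by
  refine ⟨fun t => by rw [h3]; exact h.nonneg t, fun t ht => ?_, fun t ht => ?_, fun t ht => ?_⟩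
  · rw [h3]; rw [h4] at ht; exact h.zero t ht
  · rw [h3] at ht
    exact (h.stores t ht).congr (fun i => by rw [h1]) (fun i j => by rw [h2])
  · rw [h3] at ht; exact h.good t ht

theorem Family.mono {Good Good' : (⊤ : SimpleGraph (Fin n)).Subgraph → Prop} {s : State K}
    {T : ℕ → (⊤ : SimpleGraph (Fin n)).Subgraph} (h : Family Good s T)
    (hG : ∀ T, Good T → Good' T) : Family Good' s T :=
  ⟨h.nonneg, h.zero, h.stores, fun t ht => hG _ (h.good t ht)⟩

theorem total_congr {s s' : State K} (T : ℕ → (⊤ : SimpleGraph (Fin n)).Subgraph)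
    (φ : (⊤ : SimpleGraph (Fin n)).Subgraph → K) (h : s'.num arrWt = s.num arrWt) :
    total s' T φ = total s T φ := by
  simp only [total, h]

theorem copySlot_spec {σ : State K} (hn : σ.nat 0 0 = n) {t m : ℕ} (ht : σ.nat ctrSlot 0 = t)
    (hm : σ.nat natCnt 0 = m) (htm : t ≠ m) :
    ((∀ i < n, (copySlot.run σ).nat arrVert (pr m i) = σ.nat arrVert (pr t i)) ∧
      ∀ i < n, ∀ j < n, (copySlot.run σ).nat arrAdj (pr (pr m i) j) = σ.nat arrAdj (pr (pr t i) j)) ∧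
    (∀ k, k ≠ m → ∀ i, (copySlot.run σ).nat arrVert (pr k i) = σ.nat arrVert (pr k i)) ∧
    ∀ k, k ≠ m → ∀ i j, (copySlot.run σ).nat arrAdj (pr (pr k i) j) = σ.nat arrAdj (pr (pr k i) j) := by
  set row := Code.loop ctrJ 1 (.setNat arrAdj (.pr (.pr (.var natCnt) (.var ctrI)) (.var ctrJ))
      (.get arrAdj (.pr (.pr (.var ctrSlot) (.var ctrI)) (.var ctrJ)))) with hrow
  have key := Code.loop_induction (a := ctrI) (d := 1) (c := .setNat arrVert
      (.pr (.var natCnt) (.var ctrI)) (.get arrVert (.pr (.var ctrSlot) (.var ctrI))) ;; row)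
    (σ := σ) (n := n) hn
    (fun k s => ((∀ i < k, s.nat arrVert (pr m i) = σ.nat arrVert (pr t i)) ∧
      ∀ i < k, ∀ j < n, s.nat arrAdj (pr (pr m i) j) = σ.nat arrAdj (pr (pr t i) j)) ∧
      (∀ k, k ≠ m → ∀ i, s.nat arrVert (pr k i) = σ.nat arrVert (pr k i)) ∧
      ∀ k, k ≠ m → ∀ i j, s.nat arrAdj (pr (pr k i) j) = σ.nat arrAdj (pr (pr k i) j))
    ⟨⟨by simp, by simp⟩, by simp [State.nat_writeNat], by simp [State.nat_writeNat]⟩ ?_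
  · rw [pow_one] at key
    exact key
  · rintro i hi s hs hnat hnum ⟨⟨p1, p2⟩, p3, p4⟩
    rw [pow_one] at hi
    have hs0 : s.nat 0 0 = n := by rw [hnat 0 (by decide), hn]
    have hst : s.nat ctrSlot 0 = t := by rw [hnat ctrSlot (by decide), ht]
    have hsm : s.nat natCnt 0 = m := by rw [hnat natCnt (by decide), hm]
    simp only [Code.run_seq, Code.run_setNat, NExp.eval_var, NExp.eval_pr, NExp.eval_get, hs, hst, hsm]
    set s₁ := s.writeNat arrVert (pr m i) (s.nat arrVert (pr t i)) with hs₁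
    obtain ⟨g1, g2⟩ := Code.run_loop_setNat (σ := s₁) (n := n) (a := arrAdj)
      (b := ctrJ) (ix := .pr (.pr (.var natCnt) (.var ctrI)) (.var ctrJ))
      (ex := .get arrAdj (.pr (.pr (.var ctrSlot) (.var ctrI)) (.var ctrJ))) (by decide)
      (by simp [hs₁, State.nat_writeNat, hs0])
      (fun j => pr (pr m i) j) (fun j => s.nat arrAdj (pr (pr t i) j)) (by simp) (by
        intro s' e1 e2 e3 e4
        have a1 : s'.nat natCnt 0 = m := by
          rw [e1 _ (by decide) (by decide)]; simp [hs₁, State.nat_writeNat, hsm]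
        have a2 : s'.nat ctrI 0 = i := by
          rw [e1 _ (by decide) (by decide)]; simp [hs₁, State.nat_writeNat, hs]
        have a3 : s'.nat ctrSlot 0 = t := by
          rw [e1 _ (by decide) (by decide)]; simp [hs₁, State.nat_writeNat, hst]
        refine ⟨by simp [a1, a2], ?_⟩
        simp only [NExp.eval_get, NExp.eval_pr, NExp.eval_var, a2, a3]
        rw [e3 _ (by simp [htm])]
        simp [hs₁, State.nat_writeNat])
    rw [← hrow] at g1 g2
    have hv : ∀ x, ((row.run s₁).writeNat ctrI 0 (i + 1)).nat arrVert x =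
        if x = pr m i then s.nat arrVert (pr t i) else s.nat arrVert x := by
      intro x
      rw [State.nat_writeNat, if_neg (by simp), Code.run_nat_of_notMem _ (by decide), hs₁,
        State.nat_writeNat]
      simp
    have hA : ∀ x, ((row.run s₁).writeNat ctrI 0 (i + 1)).nat arrAdj x = (row.run s₁).nat arrAdj x := by
      intro x
      rw [State.nat_writeNat, if_neg (by simp)]
    have hA1 : s₁.nat arrAdj = s.nat arrAdj := by
      funext x; simp [hs₁, State.nat_writeNat]
    simp only [hv, hA]
    refine ⟨⟨?_, ?_⟩, ?_, ?_⟩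
    · intro k hk
      by_cases hki : k = i
      · rw [if_pos (by rw [hki]), p3 t htm, hki]
      · rw [if_neg (by simpa using hki), p1 k (by omega)]
    · intro k hk j hj
      by_cases hki : k = i
      · rw [hki, g1 j hj, p4 t htm]
      · rw [g2 _ (by simp [hki]), hA1, p2 k (by omega) j hj]
    · intro k hk x
      rw [if_neg (by simp [hk]), p3 k hk]
    · intro k hk x j
      rw [g2 _ (by simp [hk]), hA1, p4 k hk]

variable [IsStrictOrderedRing K] {Good : (⊤ : SimpleGraph (Fin n)).Subgraph → Prop}
  {T : ℕ → (⊤ : SimpleGraph (Fin n)).Subgraph}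

/-- If the tree is heavier than required, the surplus goes to a copy with the same tree, so every
weighted total is unchanged. This exhausts the remaining amount, hence one redistribution creates at
most one copy. -/
theorem takeSlot_spec {σ : State K} (hn : σ.nat 0 0 = n) {t : ℕ} (ht : σ.nat ctrSlot 0 = t)
    (hF : Family Good σ T) (hw : 0 < σ.num arrWt t) (hrem : 0 < σ.num numRem 0) (htN : t < n ^ 5)
    (hcnt : σ.nat natCnt 0 < n ^ 5) {σ' : State K} (hσ' : takeSlot.run σ = σ') :
    ∃ T', Family Good σ' T' ∧ T' t = T t ∧ (∀ φ, total σ' T' φ = total σ T φ) ∧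
      0 < σ'.num arrWt t ∧ σ'.num numRem 0 = σ.num numRem 0 - σ'.num arrWt t ∧
      0 ≤ σ'.num numRem 0 ∧ σ'.nat natCnt 0 ≤ σ.nat natCnt 0 + 1 ∧
      (σ'.num numRem 0 = 0 ∨ σ'.nat natCnt 0 = σ.nat natCnt 0 ∧ T' = T ∧
        σ'.num arrWt = σ.num arrWt) := by
  set m := σ.nat natCnt 0 with hm
  by_cases hlt : σ.num numRem 0 < σ.num arrWt t
  · have htm : t ≠ m := by
      intro c
      rw [hF.zero t (by omega)] at hw
      exact lt_irrefl _ hw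
    obtain ⟨⟨c1, c2⟩, c3, c4⟩ := copySlot_spec hn ht hm.symm htm
    set σ₁ := copySlot.run σ with hσ₁
    have e1 : σ₁.num = σ.num := funext fun c => Code.run_num_of_notMem _ (by
      change c ∉ []; simp) _
    have e2 : σ₁.nat ctrSlot 0 = t := by rw [hσ₁, Code.run_nat_of_notMem _ (by decide), ht]
    have e3 : σ₁.nat natCnt 0 = m := by rw [hσ₁, Code.run_nat_of_notMem _ (by decide)]
    have hrun : takeSlot.run σ = (((σ₁.writeNum arrWt m (σ.num arrWt t - σ.num numRem 0)).writeNum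
        arrWt t (σ.num numRem 0)).writeNat natCnt 0 (m + 1)).writeNum numRem 0 0 := by
      simp only [takeSlot, Code.run_seq]
      rw [Code.run_when_true (by simpa [ht] using hlt)]
      simp [Code.run_seq, Code.run_setNum, Code.run_letNat, Code.run_letNum, ← hσ₁, e1, e2, e3,
        State.num_writeNum, State.nat_writeNat]
    rw [hσ'] at hrun
    have hnat : ∀ c, c ≠ natCnt → σ'.nat c = σ₁.nat c := by
      intro c hc; funext j; simp [hrun, State.nat_writeNat, hc]
    have hcnt' : σ'.nat natCnt 0 = m + 1 := by simp [hrun, State.nat_writeNat]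
    have hwt : ∀ x, σ'.num arrWt x = if x = t then σ.num numRem 0 else
        if x = m then σ.num arrWt t - σ.num numRem 0 else σ.num arrWt x := by
      intro x; simp [hrun, State.num_writeNum, e1]
    have hr : σ'.num numRem 0 = 0 := by simp [hrun, State.num_writeNum]
    -- The place `m` is the first free one; its weight was zero, so overwriting its tree changes no
    -- total.
    refine ⟨Function.update T m (T t), ⟨?_, ?_, ?_, ?_⟩, ?_, ?_, ?_, ?_, hr.ge, hcnt'.le, Or.inl hr⟩
    · intro x
      rw [hwt]
      split_ifs
      · exact hrem.le
      · linarith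
      · exact hF.nonneg x
    · intro x hx
      have h1 : m < x := by omega
      have h2 : t < m := by
        by_contra h
        rw [hF.zero t (by omega)] at hw
        exact lt_irrefl _ hw
      rw [hwt, if_neg (by omega), if_neg (by omega), hF.zero x (by omega)]
    · intro x hx
      by_cases hxm : x = m
      · subst hxm
        rw [Function.update_self]
        refine (hF.stores t hw).congr (fun i => ?_) (fun i j => ?_)
        · rw [hnat _ (by decide), c1 i i.2]
        · rw [hnat _ (by decide), c2 i i.2 j j.2]
      · rw [Function.update_of_ne hxm]
        have hx' : 0 < σ.num arrWt x := by
          rw [hwt, if_neg hxm] at hx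
          by_cases hxt : x = t
          · rw [hxt]; exact hw
          · rwa [if_neg hxt] at hx
        refine (hF.stores x hx').congr (fun i => ?_) (fun i j => ?_)
        · rw [hnat _ (by decide), c3 x hxm]
        · rw [hnat _ (by decide), c4 x hxm]
    · intro x hx
      by_cases hxm : x = m
      · subst hxm
        rw [Function.update_self]
        exact hF.good t hw
      · rw [Function.update_of_ne hxm]
        refine hF.good x ?_
        rw [hwt, if_neg hxm] at hx
        by_cases hxt : x = t
        · rw [hxt]; exact hw
        · rwa [if_neg hxt] at hx
    · rw [Function.update_of_ne htm]
    · intro φ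
      have hterm : ∀ x, σ'.num arrWt x * φ (Function.update T m (T t) x) = σ.num arrWt x * φ (T x) +
          (if x = t then -((σ.num arrWt t - σ.num numRem 0) * φ (T t)) else 0) +
          (if x = m then (σ.num arrWt t - σ.num numRem 0) * φ (T t) else 0) := by
        intro x
        rw [hwt]
        by_cases hxt : x = t
        · rw [if_pos hxt, if_pos hxt, hxt, Function.update_of_ne htm, if_neg htm]; ring
        · rw [if_neg hxt, if_neg hxt]
          by_cases hxm : x = m
          · rw [if_pos hxm, if_pos hxm, hxm, Function.update_self, hF.zero m le_rfl]; ring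
          · rw [if_neg hxm, if_neg hxm, Function.update_of_ne hxm]; ring
      simp only [total, hterm, Finset.sum_add_distrib, Finset.sum_ite_eq', Finset.mem_range, htN, hcnt,
        if_true]
      ring
    · rw [hwt, if_pos rfl]; exact hrem
    · rw [hwt, if_pos rfl, hr, sub_self]
  · have hrun : takeSlot.run σ = σ.writeNum numRem 0 (σ.num numRem 0 - σ.num arrWt t) := by
      simp only [takeSlot, Code.run_seq]
      rw [Code.run_when_false (by simpa [ht] using hlt)]
      simp [Code.run_letNum, ht]
    rw [hσ'] at hrun
    have hnat : σ'.nat = σ.nat := by rw [hrun]; rfl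
    have hwt : σ'.num arrWt = σ.num arrWt := by funext x; simp [hrun, State.num_writeNum]
    have hr : σ'.num numRem 0 = σ.num numRem 0 - σ.num arrWt t := by simp [hrun, State.num_writeNum]
    refine ⟨T, hF.congr (by rw [hnat]) (by rw [hnat]) hwt (by rw [hnat]), rfl,
      fun φ => total_congr T φ hwt, by rw [hwt]; exact hw, by rw [hr, hwt], ?_, ?_,
      Or.inr ⟨by rw [hnat], rfl, hwt⟩⟩
    · rw [hr]; linarith
    · rw [hnat]; omega

/-- The program `c` modifies a tree with the property `C`, detected by `b`; the relation `Step`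
describes the modification, and the change of `arrRel` per unit of weight. -/
structure Modifies (Good C : (⊤ : SimpleGraph (Fin n)).Subgraph → Prop)
    (Step : (⊤ : SimpleGraph (Fin n)).Subgraph → (⊤ : SimpleGraph (Fin n)).Subgraph →
      (Fin n → K) → Prop) (σ : State K) (b : BExp) (c : Code) : Prop where
  nat : ∀ d ∈ [0, natV, ctrA, ctrB, ctrSlot, natCnt], d ∉ c.natWrites
  num : ∀ d ∈ [arrWt, numRem], d ∉ c.numWrites
  holds : ∀ (s : State K) T, (∀ d ∈ [0, natV, ctrA, ctrB], s.nat d = σ.nat d) →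
    s.Stores (s.nat ctrSlot 0) T → (b.Holds s ↔ C T)
  run : ∀ (s : State K) T, (∀ d ∈ [0, natV, ctrA, ctrB], s.nat d = σ.nat d) →
    s.Stores (s.nat ctrSlot 0) T → Good T → C T → ∃ T' g, Step T T' g ∧ Good T' ∧ ¬ C T' ∧
      (c.run s).Stores (s.nat ctrSlot 0) T' ∧
      (∀ t ≠ s.nat ctrSlot 0, ∀ T : (⊤ : SimpleGraph (Fin n)).Subgraph, s.Stores t T →
        (c.run s).Stores t T) ∧
      ∀ i : Fin n, (c.run s).num arrRel i = s.num arrRel i + s.num arrWt (s.nat ctrSlot 0) * g i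

/-- The bookkeeping is linear: the effect on an arbitrary weighted total, plus an arbitrary linear
functional of the released weights, is the amount used times the change `Δ` per unit. One pass over
the places is enough since a modified tree no longer has the property `C`. The last alternative is a
certificate of failure: weight is left over only if no tree of positive weight has the property `C`
any more. -/
theorem redistribute_spec {C : (⊤ : SimpleGraph (Fin n)).Subgraph → Prop}
    {Step : (⊤ : SimpleGraph (Fin n)).Subgraph → (⊤ : SimpleGraph (Fin n)).Subgraph →
      (Fin n → K) → Prop} {σ : State K} {b : BExp} {c : Code} (hM : Modifies Good C Step σ b c)
    (hn : σ.nat 0 0 = n) (hF : Family Good σ T) (hrem : 0 ≤ σ.num numRem 0)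
    (hcnt : σ.nat natCnt 0 < n ^ 5) {σ' : State K} (hσ' : (redistribute b c).run σ = σ') :
    ∃ T', Family Good σ' T' ∧ 0 ≤ σ'.num numRem 0 ∧ σ'.num numRem 0 ≤ σ.num numRem 0 ∧
      (∀ i : Fin n, (∀ T T' g, Step T T' g → 0 ≤ g i) → σ.num arrRel i ≤ σ'.num arrRel i) ∧
      σ'.nat natCnt 0 ≤ σ.nat natCnt 0 + 1 ∧
      (∀ (φ : (⊤ : SimpleGraph (Fin n)).Subgraph → K) (e : Fin n → K) (Δ : K),
        (∀ T T' g, Step T T' g → φ T' + ∑ i, e i * g i = φ T + Δ) →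
        total σ' T' φ + ∑ i, e i * σ'.num arrRel i = total σ T φ + ∑ i, e i * σ.num arrRel i +
          (σ.num numRem 0 - σ'.num numRem 0) * Δ) ∧
      (σ'.num numRem 0 = 0 ∨ ∀ t, 0 < σ'.num arrWt t → ¬ C (T' t)) := by
  set body := Code.when (.conj (.flt .zero (.var numRem))
    (.conj (.flt .zero (.get arrWt (.var ctrSlot))) b)) (takeSlot ;; c) with hbody
  set N := n ^ 5 with hN
  have key := Code.loop_induction (a := ctrSlot) (d := 5) (c := body) hn
    (fun k s => ∃ T', Family Good s T' ∧ (0 ≤ s.num numRem 0 ∧ s.num numRem 0 ≤ σ.num numRem 0 ∧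
        ∀ i : Fin n, (∀ T T' g, Step T T' g → 0 ≤ g i) → σ.num arrRel i ≤ s.num arrRel i) ∧
      (s.num numRem 0 = 0 ∨ s.nat natCnt 0 = σ.nat natCnt 0) ∧ s.nat natCnt 0 ≤ σ.nat natCnt 0 + 1 ∧
      (∀ (φ : (⊤ : SimpleGraph (Fin n)).Subgraph → K) (e : Fin n → K) (Δ : K),
        (∀ T T' g, Step T T' g → φ T' + ∑ i, e i * g i = φ T + Δ) →
        total s T' φ + ∑ i, e i * s.num arrRel i = total σ T φ + ∑ i, e i * σ.num arrRel i +
          (σ.num numRem 0 - s.num numRem 0) * Δ) ∧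
      (s.num numRem 0 = 0 ∨ ∀ t < k, 0 < s.num arrWt t → ¬ C (T' t))) ?_ ?_
  · have hrun : (redistribute b c).run σ = (Code.loop ctrSlot 5 body).run σ := rfl
    rw [← hrun, hσ'] at key
    obtain ⟨T', k1, k2, k3, k4, k5, k6⟩ := key
    refine ⟨T', k1, k2.1, k2.2.1, k2.2.2, k4, k5, ?_⟩
    rcases k6 with k6 | k6
    · exact Or.inl k6
    · rcases k3 with k3 | k3
      · exact Or.inl k3
      · right
        intro t ht
        refine k6 t ?_ ht
        by_contra hge
        rw [k1.zero t (by omega)] at ht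
        exact lt_irrefl _ ht
  · refine ⟨T, hF.congr ?_ ?_ rfl ?_, ⟨hrem, le_rfl, fun _ _ => le_rfl⟩, Or.inr ?_, ?_, ?_, Or.inr (by simp)⟩
    · funext j; simp [State.nat_writeNat]
    · funext j; simp [State.nat_writeNat]
    · funext j; simp [State.nat_writeNat]
    · simp [State.nat_writeNat]
    · simp [State.nat_writeNat]
    · intro φ e Δ _
      simp only [State.num_writeNat, sub_self, zero_mul, add_zero]
      rfl
  · rintro k hk s hs hnat hnum ⟨T₀, p1, p2, p3, p4, p5, p6⟩
    have hw : ∀ d ∈ [0, natV, ctrA, ctrB], d ∉ (Code.loop ctrSlot 5 body).natWrites := by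
      intro d hd
      have h1 : d ∉ c.natWrites := hM.nat d (by simp at hd ⊢; tauto)
      have h2 : d ∉ ctrSlot :: takeSlot.natWrites := by
        revert hd h1
        clear * -
        intro hd _
        simp only [List.mem_cons, List.not_mem_nil, or_false] at hd
        rcases hd with rfl | rfl | rfl | rfl <;> decide
      simp only [hbody, Code.when, Code.natWrites, List.mem_cons, List.mem_append,
        List.not_mem_nil, or_false] at h2 ⊢
      tauto
    have henv : ∀ d ∈ [0, natV, ctrA, ctrB], s.nat d = σ.nat d := fun d hd => hnat d (hw d hd)
    have hs0 : s.nat 0 0 = n := by rw [henv 0 (by simp), hn]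
    have hwr : ∀ (s : State K) d, d ≠ ctrSlot → (s.writeNat ctrSlot 0 (k + 1)).nat d = s.nat d := by
      intro s d hd; funext j; simp [State.nat_writeNat, hd]
    by_cases hc : 0 < s.num numRem 0 ∧ 0 < s.num arrWt k ∧ b.Holds s
    · have hcnt0 : s.nat natCnt 0 = σ.nat natCnt 0 := by
        rcases p3 with h | h
        · exact absurd h hc.1.ne'
        · exact h
      have hst := p1.stores k hc.2.1
      have hC : C (T₀ k) := (hM.holds s (T₀ k) henv (by rw [hs]; exact hst)).1 hc.2.2
      rw [hbody, Code.run_when_true (by simpa [hs] using hc), Code.run_seq]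
      obtain ⟨T₁, q1, q2, q3, q4, q5, q6, q7, q8⟩ := takeSlot_spec hs0 hs p1 hc.2.1 hc.1 hk
        (by omega) rfl
      set s₁ := takeSlot.run s with hs₁
      have hs1 : s₁.nat ctrSlot 0 = k := by rw [hs₁, Code.run_nat_of_notMem _ (by decide), hs]
      have henv1 : ∀ d ∈ [0, natV, ctrA, ctrB], s₁.nat d = σ.nat d := by
        intro d hd
        rw [← henv d hd, hs₁, Code.run_nat_of_notMem]
        simp only [List.mem_cons, List.not_mem_nil, or_false] at hd
        rcases hd with rfl | rfl | rfl | rfl <;> decide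
      obtain ⟨T', g, r1, r2, r3, r4, r5, r6⟩ := hM.run s₁ (T₁ k) henv1
        (by rw [hs1]; exact q1.stores k q4) (q1.good k q4) (by rw [q2]; exact hC)
      rw [hs1] at r4 r5 r6
      have hwt : (c.run s₁).num arrWt = s₁.num arrWt :=
        Code.run_num_of_notMem _ (hM.num _ (by simp)) _
      have hrm : (c.run s₁).num numRem = s₁.num numRem :=
        Code.run_num_of_notMem _ (hM.num _ (by simp)) _
      have hct : (c.run s₁).nat natCnt = s₁.nat natCnt :=
        Code.run_nat_of_notMem _ (hM.nat _ (by simp)) _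
      refine ⟨Function.update T₁ k T', ⟨?_, ?_, ?_, ?_⟩, ?_, ?_, ?_, ?_, ?_⟩
      · intro t; rw [State.num_writeNat, hwt]; exact q1.nonneg t
      · intro t ht
        rw [hwr _ _ (by decide), hct] at ht
        rw [State.num_writeNat, hwt]; exact q1.zero t ht
      · intro t ht
        rw [State.num_writeNat, hwt] at ht
        have hcg : ∀ T : (⊤ : SimpleGraph (Fin n)).Subgraph, (c.run s₁).Stores t T →
            ((c.run s₁).writeNat ctrSlot 0 (k + 1)).Stores t T := fun T h =>
          h.congr (fun i => by rw [hwr _ _ (by decide)]) (fun i j => by rw [hwr _ _ (by decide)])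
        apply hcg
        by_cases htk : t = k
        · rw [htk, Function.update_self]; exact r4
        · rw [Function.update_of_ne htk]
          exact r5 t htk _ (q1.stores t ht)
      · intro t ht
        rw [State.num_writeNat, hwt] at ht
        by_cases htk : t = k
        · rw [htk, Function.update_self]; exact r2
        · rw [Function.update_of_ne htk]
          exact q1.good t ht
      · rw [State.num_writeNat, hrm]
        refine ⟨q6, by linarith [p2.2.1], fun i hi => (p2.2.2 i hi).trans ?_⟩
        have hrel : s₁.num arrRel = s.num arrRel := Code.run_num_of_notMem _ (by decide) _
        rw [r6, hrel]
        exact le_add_of_nonneg_right (mul_nonneg q4.le (hi _ _ _ r1))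
      · rw [State.num_writeNat, hrm, hwr _ _ (by decide), hct]
        rcases q8 with h | ⟨h, -⟩
        · exact Or.inl h
        · exact Or.inr (by rw [h, hcnt0])
      · rw [hwr _ _ (by decide), hct]; omega
      · intro φ e Δ hφ
        have h1 := p5 φ e Δ hφ
        have h2 := hφ _ _ _ r1
        have h3 : total ((c.run s₁).writeNat ctrSlot 0 (k + 1)) (Function.update T₁ k T') φ =
            total s₁ T₁ φ + s₁.num arrWt k * (φ T' - φ (T₁ k)) := by
          have hterm : ∀ x, s₁.num arrWt x * φ (Function.update T₁ k T' x) =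
              s₁.num arrWt x * φ (T₁ x) +
              (if x = k then s₁.num arrWt k * (φ T' - φ (T₁ k)) else 0) := by
            intro x
            by_cases hxk : x = k
            · rw [if_pos hxk, hxk, Function.update_self]; ring
            · rw [if_neg hxk, Function.update_of_ne hxk, add_zero]
          simp only [total, State.num_writeNat, hwt, hterm, Finset.sum_add_distrib,
            Finset.sum_ite_eq', Finset.mem_range, hk, if_true]
        have hrel : s₁.num arrRel = s.num arrRel := Code.run_num_of_notMem _ (by decide) _
        have h4 : ∑ i, e i * ((c.run s₁).writeNat ctrSlot 0 (k + 1)).num arrRel (i : Fin n) =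
            ∑ i : Fin n, e i * s.num arrRel i + s₁.num arrWt k * ∑ i, e i * g i := by
          simp only [State.num_writeNat, r6, hrel, Finset.mul_sum, ← Finset.sum_add_distrib]
          exact Finset.sum_congr rfl fun i _ => by ring
        rw [h3, h4, q3, State.num_writeNat, hrm, q5]
        have h5 : ∑ i, e i * g i = φ (T₁ k) + Δ - φ T' := by rw [← h2]; ring
        rw [h5]
        linear_combination h1
      · rw [State.num_writeNat, hrm, hwt]
        rcases q8 with h | ⟨h1, h2, h3⟩
        · exact Or.inl h
        · rcases p6 with h | h
          · exact absurd h hc.1.ne'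
          · right
            intro t ht hpos
            by_cases htk : t = k
            · rw [htk, Function.update_self]; exact r3
            · rw [Function.update_of_ne htk, h2]
              rw [h3] at hpos
              exact h t (by omega) hpos
    · rw [hbody, Code.run_when_false (by simpa [hs] using hc)]
      refine ⟨T₀, p1.congr (hwr _ _ (by decide)) (hwr _ _ (by decide)) rfl (hwr _ _ (by decide)), p2,
        by rwa [hwr _ _ (by decide)], by rwa [hwr _ _ (by decide)], p5, ?_⟩
      rcases p6 with h | h
      · exact Or.inl h
      · by_cases hr0 : s.num numRem 0 = 0
        · exact Or.inl hr0
        · right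
          intro t ht hpos hCt
          rw [State.num_writeNat] at hpos
          by_cases htk : t = k
          · subst htk
            refine hc ⟨lt_of_le_of_ne p2.1 (Ne.symm hr0), hpos, ?_⟩
            exact (hM.holds s (T₀ t) henv (by rw [hs]; exact p1.stores t hpos)).2 hCt
          · exact h t (by omega) hpos hCt

end Family

/-! ### Modifications of trees -/

/-- Marks the vertices that are reachable from a vertex in the current tree. -/
def reach : Code :=
  .loop ctrI 1 (.setNat arrMark (.var ctrI) (.lit 0)) ;;
  .setNat arrMark (.var ctrB) (.lit 1) ;;
  .loop ctrK 1 (.loop ctrI 1 (.loop ctrJ 1 (.when (.conj (.neq (.get arrMark (.var ctrI)) (.lit 1))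
      (.neq (.get arrAdj (.pr (.pr (.var ctrSlot) (.var ctrI)) (.var ctrJ))) (.lit 1)))
    (.setNat arrMark (.var ctrJ) (.lit 1)))))

/-- Sets the adjacency of two vertices in the current tree. -/
def setAdj (p q : NExp) (m : ℕ) : Code :=
  .setNat arrAdj (.pr (.pr (.var ctrSlot) p) q) (.lit m) ;;
  .setNat arrAdj (.pr (.pr (.var ctrSlot) q) p) (.lit m)

/-- Inserts a vertex in the current tree. -/
def insertVertex (p : NExp) : Code := .setNat arrVert (.pr (.var ctrSlot) p) (.lit 1)

/-- Determines which end of a removed edge becomes connected to the new vertex. -/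
def chooseEnd : Code :=
  .when (.neq (.get arrMark (.var natV)) (.lit 1))
    (.letNat natP (.var ctrB) ;; .letNat natQ (.var ctrA)) ;;
  .setNum arrRel (.var natP) (.add (.get arrRel (.var natP)) (.get arrWt (.var ctrSlot)))

/-- Attaches a leaf to the current tree. -/
def attachLeaf : Code := insertVertex (.var natV) ;; setAdj (.var ctrA) (.var natV) 1

/-- Reroutes an edge of the current tree through a vertex. -/
def reroute : Code :=
  setAdj (.var ctrA) (.var ctrB) 0 ;; .letNat natP (.var ctrA) ;; .letNat natQ (.var ctrB) ;;
  .ite (.neq (.get arrVert (.pr (.var ctrSlot) (.var natV))) (.lit 1))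
    (reach ;; chooseEnd)
    attachLeaf ;;
  setAdj (.var natV) (.var natQ) 1

/-- The current tree contains an edge. -/
def hasEdge : BExp :=
  .neq (.get arrAdj (.pr (.pr (.var ctrSlot) (.var ctrA)) (.var ctrB))) (.lit 1)

/-- A leaf can be attached to the current tree. -/
def canAttach : BExp :=
  .conj (.neq (.get arrVert (.pr (.var ctrSlot) (.var ctrA))) (.lit 1))
    (.neg (.neq (.get arrVert (.pr (.var ctrSlot) (.var natV))) (.lit 1)))

section Indicators

theorem ite_insert {p q r : Prop} {_ : Decidable p} {_ : Decidable q} {_ : Decidable r} (h : r ↔ p ∨ q) :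
    (if p then 1 else if q then 1 else 0) = if r then 1 else 0 := by
  by_cases hp : p <;> by_cases hq : q <;> simp [h, hp, hq]

theorem ite_exchange {p q e r : Prop} {_ : Decidable p} {_ : Decidable q} {_ : Decidable e} {_ : Decidable r}
    (h : r ↔ (p ∧ ¬ q) ∨ e) :
    (if e then 1 else if q then 0 else if p then 1 else 0) = if r then 1 else 0 := by
  by_cases hp : p <;> by_cases hq : q <;> by_cases he : e <;> simp [h, hp, hq, he]

theorem ite_exchange_insert {p q e f r : Prop} {_ : Decidable p} {_ : Decidable q} {_ : Decidable e} {_ : Decidable f}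
    {_ : Decidable r} (h : r ↔ (p ∧ ¬ q) ∨ e ∨ f) :
    (if f then 1 else if e then 1 else if q then 0 else if p then 1 else 0) = if r then 1 else 0 := by
  by_cases hp : p <;> by_cases hq : q <;> by_cases he : e <;> by_cases hf : f <;>
    simp [h, hp, hq, he, hf]

end Indicators

/-! ### Correctness of the modifications of a tree. -/

section Modify

variable {K : Type} [Field K] [LinearOrder K] {n : ℕ}

/-- After `k` rounds all vertices joined to `b` by a walk of length at most `k` are marked, and a
path has fewer than `n` edges. Marks set within a round may spread early, which does no harm because
only reachable vertices are ever marked. -/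
theorem reach_spec {σ : State K} (hn : σ.nat 0 0 = n) {t : ℕ} (ht : σ.nat ctrSlot 0 = t) {b : Fin n}
    (hb : σ.nat ctrB 0 = b) {G : SimpleGraph (Fin n)}
    (hG : ∀ i j : Fin n, σ.nat arrAdj (pr (pr t i) j) = 1 ↔ G.Adj i j) (j : Fin n) :
    (reach.run σ).nat arrMark j = 1 ↔ G.Reachable b j := by
  obtain ⟨g1, -⟩ := Code.run_loop_setNat (σ := σ) (n := n) (a := arrMark) (b := ctrI)
    (ix := .var ctrI) (ex := .lit 0) (by decide) hn (fun j => j) (fun _ => 0) (by simp) (by simp)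
  set σ₁ := (Code.loop ctrI 1 (.setNat arrMark (.var ctrI) (.lit 0))).run σ with hσ₁
  have hnat1 : ∀ c, c ≠ ctrI → c ≠ arrMark → σ₁.nat c = σ.nat c := by
    intro c h1 h2
    rw [hσ₁, Code.run_nat_of_notMem]
    change c ∉ [ctrI, arrMark]
    simp [h1, h2]
  set σ₂ := σ₁.writeNat arrMark b 1 with hσ₂
  have hnat2 : ∀ c, c ≠ ctrI → c ≠ arrMark → σ₂.nat c = σ.nat c := by
    intro c h1 h2
    rw [← hnat1 c h1 h2]
    funext x
    simp [hσ₂, State.nat_writeNat, h2]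
  have hmark2 : ∀ i : Fin n, σ₂.nat arrMark i = if i = b then 1 else 0 := by
    intro i
    simp [hσ₂, State.nat_writeNat, Fin.ext_iff, g1 i i.2]
  set visit := Code.when (.conj (.neq (.get arrMark (.var ctrI)) (.lit 1))
      (.neq (.get arrAdj (.pr (.pr (.var ctrSlot) (.var ctrI)) (.var ctrJ))) (.lit 1)))
    (.setNat arrMark (.var ctrJ) (.lit 1)) with hvisit
  have hrun : reach.run σ = (Code.loop ctrK 1 (.loop ctrI 1 (.loop ctrJ 1 visit))).run σ₂ := by
    simp only [reach, Code.run_seq, Code.run_setNat, ← hσ₁, NExp.eval_var,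
      hnat1 ctrB (by decide) (by decide), hb]
    rfl
  have key := Code.loop_induction (a := ctrK) (d := 1) (c := .loop ctrI 1 (.loop ctrJ 1 visit))
    (σ := σ₂) (n := n) (by rw [hnat2 0 (by decide) (by decide), hn])
    (fun k s => (∀ i : Fin n, s.nat arrMark i = 1 → G.Reachable b i) ∧
      ∀ i : Fin n, ∀ w : G.Walk b i, w.length ≤ k → s.nat arrMark i = 1) ?_ ?_
  · rw [pow_one, ← hrun] at key
    refine ⟨key.1 j, fun h => ?_⟩
    obtain ⟨w, hw⟩ := h.exists_isPath
    have := hw.length_lt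
    rw [Fintype.card_fin] at this
    exact key.2 j w this.le
  · have e : (σ₂.writeNat ctrK 0 0).nat arrMark = σ₂.nat arrMark := by
      funext x; simp [State.nat_writeNat]
    rw [e]
    constructor
    · intro i hi
      rw [hmark2] at hi
      by_cases hib : i = b
      · rw [hib]
      · simp [hib] at hi
    · intro i w hw
      have : i = b := (SimpleGraph.Walk.eq_of_length_eq_zero (by omega : w.length = 0)).symm
      rw [hmark2, if_pos this]
  · rintro k hk s hs hnat hnum ⟨p1, p2⟩
    have hs0 : s.nat 0 0 = n := by rw [hnat 0 (by decide), hnat2 0 (by decide) (by decide), hn]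
    have hst : s.nat ctrSlot 0 = t := by
      rw [hnat ctrSlot (by decide), hnat2 ctrSlot (by decide) (by decide), ht]
    have hsA : s.nat arrAdj = σ.nat arrAdj := by
      rw [hnat arrAdj (by decide), hnat2 arrAdj (by decide) (by decide)]
    have hwr : ∀ (s : State K) a m, a ≠ arrMark → (s.writeNat a 0 m).nat arrMark = s.nat arrMark := by
      intro s a m ha; funext x; simp [State.nat_writeNat, ha.symm]
    have key := Code.loop_loop_induction (a := ctrI) (b := ctrJ) (c := visit) (σ := s) (n := n) hs0
      (by decide) (by decide) (by decide) (by decide) (by decide)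
      (fun i j s' => (∀ i : Fin n, s'.nat arrMark i = 1 → G.Reachable b i) ∧
        (∀ l : Fin n, s.nat arrMark l = 1 → s'.nat arrMark l = 1) ∧
        ∀ l m : Fin n, ((l : ℕ) < i ∨ (l : ℕ) = i ∧ (m : ℕ) < j) → s.nat arrMark l = 1 → G.Adj l m →
          s'.nat arrMark m = 1)
      (by intro i j s' m h; rw [hwr _ _ _ (by decide)]; exact h)
      (by intro i j s' m h; rw [hwr _ _ _ (by decide)]; exact h)
      ⟨p1, fun _ h => h, by simp⟩ ?_ ?_
    · rw [hwr _ _ _ (by decide)]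
      obtain ⟨k1, k2, k3⟩ := key
      refine ⟨k1, fun i w hw => ?_⟩
      by_cases hwk : w.length ≤ k
      · exact k2 i (p2 i w hwk)
      · have hpos : ¬ w.Nil := by
          intro hnil
          rw [← SimpleGraph.Walk.length_eq_zero_iff] at hnil; omega
        have hlen : w.dropLast.length + 1 = w.length := by
          have := SimpleGraph.Walk.length_dropLast_add_one hpos
          exact this
        have h1 := p2 _ w.dropLast (by omega)
        exact k3 _ _ (Or.inl w.penultimate.2) h1 (w.adj_penultimate hpos)
    · rintro i s' ⟨q1, q2, q3⟩
      refine ⟨q1, q2, fun l m h => q3 l m ?_⟩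
      have := m.2
      omega
    · rintro i hi j hj s' hsi hsj hnat' hnum' ⟨q1, q2, q3⟩
      have hst' : s'.nat ctrSlot 0 = t := by rw [hnat' ctrSlot (by decide), hst]
      have hsA' : s'.nat arrAdj = σ.nat arrAdj := by rw [hnat' arrAdj (by decide), hsA]
      have hadj := hG ⟨i, hi⟩ ⟨j, hj⟩
      have hcases : ∀ l m : Fin n, ((l : ℕ) < i ∨ (l : ℕ) = i ∧ (m : ℕ) < j + 1) →
          ((l : ℕ) < i ∨ (l : ℕ) = i ∧ (m : ℕ) < j) ∨ (l = ⟨i, hi⟩ ∧ m = ⟨j, hj⟩) := by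
        intro l m h
        simp only [Fin.ext_iff]
        omega
      by_cases hc : s'.nat arrMark i = 1 ∧ s'.nat arrAdj (pr (pr t i) j) = 1
      · rw [hvisit, Code.run_when_true (by simpa [hsi, hsj, hst'] using hc), Code.run_setNat]
        have hadj' : G.Adj ⟨i, hi⟩ ⟨j, hj⟩ := hadj.1 (by rw [← hsA']; exact hc.2)
        have hm : ∀ l : Fin n, (s'.writeNat arrMark ((NExp.var ctrJ).eval s')
            ((NExp.lit 1).eval s')).nat arrMark l = 1 ↔ s'.nat arrMark l = 1 ∨ l = ⟨j, hj⟩ := by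
          intro l
          simp only [State.nat_writeNat, NExp.eval_var, hsj, NExp.eval_lit, true_and, Fin.ext_iff]
          by_cases hlj : (l : ℕ) = j <;> simp [hlj]
        simp only [hm]
        refine ⟨?_, fun l h => Or.inl (q2 l h), ?_⟩
        · rintro l (h | rfl)
          · exact q1 l h
          · exact (q1 ⟨i, hi⟩ hc.1).trans hadj'.reachable
        · intro l m h h1 h2
          rcases hcases l m h with h | ⟨rfl, rfl⟩
          · exact Or.inl (q3 l m h h1 h2)
          · exact Or.inr rfl
      · rw [hvisit, Code.run_when_false (by simpa [hsi, hsj, hst'] using hc)]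
        refine ⟨q1, q2, ?_⟩
        intro l m h h1 h2
        rcases hcases l m h with h | ⟨rfl, rfl⟩
        · exact q3 l m h h1 h2
        · exact absurd ⟨q2 _ h1, by rw [hsA']; exact hadj.2 h2⟩ hc

theorem setAdj_spec {σ : State K} {t : ℕ} (ht : σ.nat ctrSlot 0 = t) {p q : NExp} {m : ℕ} {i j : Fin n}
    (hp : ∀ s : State K, (∀ c, c ≠ arrAdj → s.nat c = σ.nat c) → p.eval s = i)
    (hq : ∀ s : State K, (∀ c, c ≠ arrAdj → s.nat c = σ.nat c) → q.eval s = j) :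
    (∀ k l : Fin n, ((setAdj p q m).run σ).nat arrAdj (pr (pr t k) l) =
      if IsEdge i j k l then m else σ.nat arrAdj (pr (pr t k) l)) ∧
    ∀ t' k l, t' ≠ t → ((setAdj p q m).run σ).nat arrAdj (pr (pr t' k) l) =
      σ.nat arrAdj (pr (pr t' k) l) := by
  have h2 : ∀ x y c, c ≠ arrAdj → (σ.writeNat arrAdj x y).nat c = σ.nat c := by
    intro x y c hc; funext z; simp [State.nat_writeNat, hc]
  simp only [setAdj, Code.run_seq, Code.run_setNat, State.nat_writeNat, NExp.eval_pr, NExp.eval_var,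
    NExp.eval_lit, hp σ fun _ _ => rfl, hq σ fun _ _ => rfl, hp _ (h2 _ _), hq _ (h2 _ _), ht, true_and,
    pr_inj, IsEdge, Fin.ext_iff]
  constructor
  · intro k l
    by_cases c1 : (k : ℕ) = j ∧ (l : ℕ) = i
    · simp [c1]
    · by_cases c2 : (k : ℕ) = i ∧ (l : ℕ) = j <;> simp [c1, c2]
  · intro t' k l h
    simp [h]

theorem setAdj_nat (σ : State K) (p q : NExp) (m : ℕ) {c : ℕ} (hc : c ≠ arrAdj) :
    ((setAdj p q m).run σ).nat c = σ.nat c :=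
  Code.run_nat_of_notMem _ (by change c ∉ [arrAdj, arrAdj]; simpa using hc) _

variable {H : Set (Fin n) → Prop}

/-- A tree whose vertex set has the property `H`. -/
def GoodTree (H : Set (Fin n) → Prop) (T : (⊤ : SimpleGraph (Fin n)).Subgraph) : Prop :=
  IsSubtree T ∧ H T.verts

/-- The effect of attaching the leaf `v` to the vertex `a` of a tree. -/
structure LeafStep (a v : Fin n) (T T' : (⊤ : SimpleGraph (Fin n)).Subgraph) (g : Fin n → K) : Prop where
  mem : a ∈ T.verts
  notMem : v ∉ T.verts
  verts : T'.verts = insert v T.verts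
  adj : ∀ i j, T'.Adj i j ↔ T.Adj i j ∨ IsEdge a v i j
  change : g = 0

/-- The effect of rerouting the edge `{a, b}` of a tree through the vertex `v`. -/
structure RerouteStep (a b v : Fin n) (T T' : (⊤ : SimpleGraph (Fin n)).Subgraph) (g : Fin n → K) :
    Prop where
  adj : T.Adj a b
  cases : ∃ p q, ((p = a ∧ q = b) ∨ (p = b ∧ q = a)) ∧ ¬ T.Adj v q ∧
    ((v ∈ T.verts ∧ T'.verts = T.verts ∧ g = Pi.single p 1 ∧
      ∀ i j, T'.Adj i j ↔ (T.Adj i j ∧ ¬ IsEdge a b i j) ∨ IsEdge v q i j) ∨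
    (v ∉ T.verts ∧ T'.verts = insert v T.verts ∧ g = 0 ∧
      ∀ i j, T'.Adj i j ↔ (T.Adj i j ∧ ¬ IsEdge a b i j) ∨ IsEdge p v i j ∨ IsEdge v q i j))

/-- The tree contains `v` afterwards, so it does not satisfy the condition a second time. -/
theorem attachLeaf_modifies {σ : State K} {a v : Fin n} (ha : σ.nat ctrA 0 = a) (hv : σ.nat natV 0 = v)
    (hH : ∀ U, H U → H (insert v U)) :
    Modifies (GoodTree H) (fun T => a ∈ T.verts ∧ v ∉ T.verts) (LeafStep a v) σ canAttach
      attachLeaf := by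
  refine ⟨by decide, by decide, ?_, ?_⟩
  · intro s T henv hst
    have h1 : s.nat ctrA 0 = a := by rw [henv _ (by simp), ha]
    have h2 : s.nat natV 0 = v := by rw [henv _ (by simp), hv]
    simp [canAttach, h1, h2, hst.vert]
  · rintro s T henv hst ⟨hT, hHT⟩ ⟨haT, hvT⟩
    have h1 : s.nat ctrA 0 = a := by rw [henv _ (by simp), ha]
    have h2 : s.nat natV 0 = v := by rw [henv _ (by simp), hv]
    set t := s.nat ctrSlot 0 with ht
    have hav : a ≠ v := fun c => hvT (c ▸ haT)
    obtain ⟨T', hV', hA'⟩ := exists_subgraph (insert v T.verts) (fun i j => T.Adj i j ∨ IsEdge a v i j)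
      (fun i j h => h.imp (fun h => h.symm) (fun h => h.symm))
      (fun i h => by
        rcases h with h | h
        · exact (T.adj_sub h).ne rfl
        · rcases h with ⟨h3, h4⟩ | ⟨h3, h4⟩
          · exact hav (h3.symm.trans h4)
          · exact hav (h4.symm.trans h3))
      (fun i j h => by
        rcases h with h | h
        · exact Or.inr (T.edge_vert h)
        · rcases h with ⟨h3, h4⟩ | ⟨h3, h4⟩
          · exact Or.inr (h3 ▸ haT)
          · exact Or.inl h3)
    set s₁ := s.writeNat arrVert (pr t v) 1 with hs₁
    have hrun : attachLeaf.run s = (setAdj (.var ctrA) (.var natV) 1).run s₁ := by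
      simp [attachLeaf, insertVertex, Code.run_seq, Code.run_setNat, hs₁, h2, ht]
    have hs1 : ∀ c, c ≠ arrVert → s₁.nat c = s.nat c := by
      intro c hc; funext x; simp [hs₁, State.nat_writeNat, hc]
    obtain ⟨k1, k2⟩ := setAdj_spec (σ := s₁) (t := t) (p := .var ctrA) (q := .var natV) (m := 1)
      (i := a) (j := v) (by rw [hs1 _ (by decide)]) (by
        intro s' hs'
        rw [NExp.eval_var, hs' _ (by decide), hs1 _ (by decide), h1]) (by
        intro s' hs'
        rw [NExp.eval_var, hs' _ (by decide), hs1 _ (by decide), h2])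
    rw [← hrun] at k1 k2
    have hvert : ∀ x, (attachLeaf.run s).nat arrVert x = if x = pr t v then 1 else s.nat arrVert x := by
      intro x
      rw [hrun, setAdj_nat _ _ _ _ (by decide)]
      simp [hs₁, State.nat_writeNat]
    refine ⟨T', 0, ⟨haT, hvT, hV', hA', rfl⟩, ⟨hT.leaf haT hvT hV' hA', by rw [hV']; exact hH _ hHT⟩,
      fun h => h.2 (by rw [hV']; exact Or.inl rfl), ⟨fun i => ?_, fun i j => ?_⟩, ?_, ?_⟩
    · rw [hvert, hst.1]
      exact ite_insert (p := pr t i = pr t v) (by simp [hV', Fin.ext_iff])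
    · rw [k1, hs1 _ (by decide), hst.2]
      exact ite_insert ((hA' i j).trans or_comm)
    · intro t' ht' T hT
      refine hT.congr (fun i => ?_) (fun i j => ?_)
      · rw [hvert, if_neg (by simp [ht'])]
      · rw [k2 _ _ _ ht', hs1 _ (by decide)]
    · intro i
      rw [Code.run_num_of_notMem _ (by decide)]
      simp

-- If `v` already lies in the tree, inserting both edges at `v` would close a cycle. The search from
-- `b` without the edge `{a,b}` tells on which side `v` lies. The edge `{p,v}` to the end `p` on its
-- own side is recorded in `arrRel`, and only the edge to the other end `q` is inserted.
set_option maxHeartbeats 400000 in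
theorem reroute_modifies {σ : State K} (hn : σ.nat 0 0 = n) {a b v : Fin n} (ha : σ.nat ctrA 0 = a)
    (hb : σ.nat ctrB 0 = b) (hv : σ.nat natV 0 = v) (hav : a ≠ v) (hbv : b ≠ v)
    (hH : ∀ U, H U → H (insert v U)) :
    Modifies (GoodTree H) (fun T => T.Adj a b) (RerouteStep a b v) σ hasEdge reroute := by
  refine ⟨by decide, by decide, ?_, ?_⟩
  · intro s T henv hst
    have h1 : s.nat ctrA 0 = a := by rw [henv _ (by simp), ha]
    have h2 : s.nat ctrB 0 = b := by rw [henv _ (by simp), hb]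
    simp [hasEdge, h1, h2, hst.adj]
  · rintro s T henv hst ⟨hT, hHT⟩ hadj
    have h0 : s.nat 0 0 = n := by rw [henv _ (by simp), hn]
    have h1 : s.nat ctrA 0 = a := by rw [henv _ (by simp), ha]
    have h2 : s.nat ctrB 0 = b := by rw [henv _ (by simp), hb]
    have h3 : s.nat natV 0 = v := by rw [henv _ (by simp), hv]
    set t := s.nat ctrSlot 0 with ht
    have haT : a ∈ T.verts := T.edge_vert hadj
    have hbT : b ∈ T.verts := T.edge_vert hadj.symm
    have hab : a ≠ b := (T.adj_sub hadj).ne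
    -- removing the edge
    obtain ⟨k1, k2⟩ := setAdj_spec (σ := s) (t := t) (p := .var ctrA) (q := .var ctrB) (m := 0)
      (i := a) (j := b) rfl (by
        intro s' hs'
        rw [NExp.eval_var, hs' _ (by decide), h1]) (by
        intro s' hs'
        rw [NExp.eval_var, hs' _ (by decide), h2])
    set s₁ := (setAdj (.var ctrA) (.var ctrB) 0).run s with hs₁
    have hs1 : ∀ c, c ≠ arrAdj → s₁.nat c = s.nat c := fun c hc => setAdj_nat _ _ _ _ hc
    have hs1n : s₁.num = s.num := rfl
    set s₂ := (s₁.writeNat natP 0 a).writeNat natQ 0 b with hs₂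
    have hs2 : ∀ c, c ≠ natP → c ≠ natQ → s₂.nat c = s₁.nat c := by
      intro c c1 c2; funext x; simp [hs₂, State.nat_writeNat, c1, c2]
    have hrun : reroute.run s = (setAdj (.var natV) (.var natQ) 1).run
        ((Code.ite (.neq (.get arrVert (.pr (.var ctrSlot) (.var natV))) (.lit 1))
          (reach ;; chooseEnd) attachLeaf).run s₂) := by
      simp only [reroute, Code.run_seq, Code.run_letNat, ← hs₁, NExp.eval_var, State.nat_writeNat,
        hs1 ctrA (by decide), hs1 ctrB (by decide), h1, h2]
      simp only [hs₂]
      rfl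
    have e0 : s₂.nat 0 0 = n := by rw [hs2 _ (by decide) (by decide), hs1 _ (by decide), h0]
    have e1 : s₂.nat ctrA 0 = a := by rw [hs2 _ (by decide) (by decide), hs1 _ (by decide), h1]
    have e2 : s₂.nat ctrB 0 = b := by rw [hs2 _ (by decide) (by decide), hs1 _ (by decide), h2]
    have e3 : s₂.nat natV 0 = v := by rw [hs2 _ (by decide) (by decide), hs1 _ (by decide), h3]
    have e4 : s₂.nat ctrSlot 0 = t := by rw [hs2 _ (by decide) (by decide), hs1 _ (by decide)]
    have eV : s₂.nat arrVert = s.nat arrVert := by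
      rw [hs2 _ (by decide) (by decide), hs1 _ (by decide)]
    have eA : s₂.nat arrAdj = s₁.nat arrAdj := hs2 _ (by decide) (by decide)
    have hG : ∀ i j : Fin n, s₂.nat arrAdj (pr (pr t i) j) = 1 ↔
        (removeEdge T.spanningCoe a b).Adj i j := by
      intro i j
      rw [eA, k1]
      by_cases he : IsEdge a b i j
      · simp [he, removeEdge]
      · simp [he, removeEdge, hst.adj]
    by_cases hvT : v ∈ T.verts
    · rw [Code.run_ite_true (by simpa [e3, e4, eV] using (hst.vert v).2 hvT), Code.run_seq] at hrun
      have hmark := reach_spec e0 e4 e2 hG v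
      set s₃ := reach.run s₂ with hs₃
      have f1 : s₃.nat ctrA 0 = a := by rw [hs₃, Code.run_nat_of_notMem _ (by decide), e1]
      have f2 : s₃.nat ctrB 0 = b := by rw [hs₃, Code.run_nat_of_notMem _ (by decide), e2]
      have f3 : s₃.nat natV 0 = v := by rw [hs₃, Code.run_nat_of_notMem _ (by decide), e3]
      have f4 : s₃.nat ctrSlot 0 = t := by rw [hs₃, Code.run_nat_of_notMem _ (by decide), e4]
      have fP : s₃.nat natP 0 = a := by
        rw [hs₃, Code.run_nat_of_notMem _ (by decide)]; simp [hs₂, State.nat_writeNat]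
      have fQ : s₃.nat natQ 0 = b := by
        rw [hs₃, Code.run_nat_of_notMem _ (by decide)]; simp [hs₂, State.nat_writeNat]
      have fV : s₃.nat arrVert = s.nat arrVert := by
        rw [hs₃, Code.run_nat_of_notMem _ (by decide), eV]
      have fA : s₃.nat arrAdj = s₁.nat arrAdj := by
        rw [hs₃, Code.run_nat_of_notMem _ (by decide), eA]
      have fn : s₃.num = s.num := funext fun c => Code.run_num_of_notMem _ (by
        change c ∉ []; simp) _
      obtain ⟨p, q, hpq, hreach, hchoose⟩ : ∃ p q : Fin n, ((p = a ∧ q = b) ∨ (p = b ∧ q = a)) ∧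
          (removeEdge T.spanningCoe p q).Reachable v p ∧ ∃ s₄ : State K, s₄.num = s₃.num ∧
          (∀ c, c ≠ natP → c ≠ natQ → s₄.nat c = s₃.nat c) ∧ s₄.nat natP 0 = p ∧ s₄.nat natQ 0 = q ∧
          chooseEnd.run s₃ = s₄.writeNum arrRel p (s₄.num arrRel p + s₄.num arrWt t) := by
        by_cases hm : s₃.nat arrMark v = 1
        · refine ⟨b, a, Or.inr ⟨rfl, rfl⟩, ?_, (s₃.writeNat natP 0 b).writeNat natQ 0 a, rfl, ?_, ?_, ?_, ?_⟩
          · rw [removeEdge_comm]; exact (hmark.1 hm).symm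
          · intro c c1 c2; funext x; simp [State.nat_writeNat, c1, c2]
          · simp [State.nat_writeNat]
          · simp [State.nat_writeNat]
          · simp only [chooseEnd, Code.run_seq]
            rw [Code.run_when_true (by simpa [f3] using hm)]
            simp [Code.run_seq, Code.run_letNat, Code.run_setNum, State.nat_writeNat, f1, f2, f4]
        · refine ⟨a, b, Or.inl ⟨rfl, rfl⟩, ?_, s₃, rfl, fun _ _ _ => rfl, fP, fQ, ?_⟩
          -- If `v` was not marked from `b`, it must be on the side of `a`.
          · rcases reachable_removeEdge (p := a) (hT.reachable v hvT b hbT) with h | h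
            · exact h
            · exact absurd (hmark.2 h.symm) hm
          · simp only [chooseEnd, Code.run_seq]
            rw [Code.run_when_false (by simpa [f3] using hm)]
            simp [Code.run_setNum, f4, fP]
      obtain ⟨s₄, g1, g2, g3, g4, g5⟩ := hchoose
      rw [g5] at hrun
      have hpv : v ≠ p := by rcases hpq with ⟨h, -⟩ | ⟨h, -⟩ <;> rw [h] <;> exact Ne.symm ‹_›
      have hqv : v ≠ q := by rcases hpq with ⟨-, h⟩ | ⟨-, h⟩ <;> rw [h] <;> exact Ne.symm ‹_›
      have hpqT : T.Adj p q := by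
        rcases hpq with ⟨h, h'⟩ | ⟨h, h'⟩
        · rw [h, h']; exact hadj
        · rw [h, h']; exact hadj.symm
      have hedge : ∀ i j, IsEdge p q i j ↔ IsEdge a b i j := by
        intro i j
        rcases hpq with ⟨h, h'⟩ | ⟨h, h'⟩
        · rw [h, h']
        · rw [h, h', isEdge_comm]
      -- The inserted edge is new; otherwise the count of edge weights would be wrong.
      have hnadj : ¬ T.Adj v q := (hT.not_adj_or_eq hpqT hreach).resolve_right hpv
      obtain ⟨T', hV', hA'⟩ := exists_subgraph T.verts
        (fun i j => (T.Adj i j ∧ ¬ IsEdge p q i j) ∨ IsEdge v q i j)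
        (fun i j h => h.imp (fun h => ⟨h.1.symm, fun c => h.2 c.symm⟩) (fun h => h.symm))
        (fun i h => by
          rcases h with h | h
          · exact (T.adj_sub h.1).ne rfl
          · rcases h with ⟨h3, h4⟩ | ⟨h3, h4⟩
            · exact hqv (h3.symm.trans h4)
            · exact hqv (h4.symm.trans h3))
        (fun i j h => by
          rcases h with h | h
          · exact T.edge_vert h.1
          · rcases h with ⟨h3, h4⟩ | ⟨h3, h4⟩
            · exact h3 ▸ hvT
            · exact h3 ▸ T.edge_vert hpqT.symm)
      set s₅ := s₄.writeNum arrRel p (s₄.num arrRel p + s₄.num arrWt t) with hs₅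
      have hs5 : s₅.nat = s₄.nat := rfl
      obtain ⟨l1, l2⟩ := setAdj_spec (σ := s₅) (t := t) (p := .var natV) (q := .var natQ) (m := 1)
        (i := v) (j := q) (by rw [hs5, g2 _ (by decide) (by decide), f4]) (by
          intro s' hs'
          rw [NExp.eval_var, hs' _ (by decide), hs5, g2 _ (by decide) (by decide), f3]) (by
          intro s' hs'
          rw [NExp.eval_var, hs' _ (by decide), hs5, g4])
      rw [← hrun] at l1 l2
      have hvert : (reroute.run s).nat arrVert = s.nat arrVert := by
        rw [hrun, setAdj_nat _ _ _ _ (by decide), hs5, g2 _ (by decide) (by decide), fV]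
      have hadj5 : s₅.nat arrAdj = s₁.nat arrAdj := by
        rw [hs5, g2 _ (by decide) (by decide), fA]
      refine ⟨T', Pi.single p 1, ⟨hadj, p, q, hpq, hnadj, Or.inl ⟨hvT, hV', rfl, ?_⟩⟩,
        ⟨hT.exchange hpqT hvT hreach hV' hA', by rw [hV']; exact hHT⟩, ?_,
        ⟨fun i => ?_, fun i j => ?_⟩, ?_, ?_⟩
      · intro i j
        rw [hA', hedge]
      · rw [hA', hedge]
        rintro (h | h)
        · exact h.2 (Or.inl ⟨rfl, rfl⟩)
        · rcases h with ⟨h, -⟩ | ⟨-, h⟩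
          · exact hav h
          · exact hbv h
      · rw [hvert, hst.1, hV']
      · rw [l1, hadj5, k1, hst.2]
        exact ite_exchange (by rw [hA', hedge])
      · intro t' ht' T hT
        refine hT.congr (fun i => ?_) (fun i j => ?_)
        · rw [hvert]
        · rw [l2 _ _ _ ht', hadj5, k2 _ _ _ ht']
      · intro i
        rw [hrun]
        have : ∀ p q m (s : State K), ((setAdj p q m).run s).num = s.num := fun _ _ _ _ => rfl
        rw [this, hs₅, State.num_writeNum, g1, fn]
        by_cases hip : i = p
        · subst hip; simp
        · have : (i : ℕ) ≠ p := fun c => hip (Fin.ext c)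
          simp [this, hip]
    · rw [Code.run_ite_false (by simpa [e3, e4, eV] using fun h => hvT ((hst.vert v).1 h))] at hrun
      have hsub : ∀ i j, T.Adj i j → i ≠ v ∧ j ≠ v := fun i j h =>
        ⟨fun c => hvT (c ▸ T.edge_vert h), fun c => hvT (c ▸ T.edge_vert h.symm)⟩
      obtain ⟨T₁, hV₁, hA₁⟩ := exists_subgraph (insert v T.verts)
        (fun i j => T.Adj i j ∨ IsEdge a v i j)
        (fun i j h => h.imp (fun h => h.symm) (fun h => h.symm))
        (fun i h => by
          rcases h with h | h
          · exact (T.adj_sub h).ne rfl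
          · rcases h with ⟨h3, h4⟩ | ⟨h3, h4⟩
            · exact hav (h3.symm.trans h4)
            · exact hav (h4.symm.trans h3))
        (fun i j h => by
          rcases h with h | h
          · exact Or.inr (T.edge_vert h)
          · rcases h with ⟨h3, h4⟩ | ⟨h3, h4⟩
            · exact Or.inr (h3 ▸ haT)
            · exact Or.inl h3)
      -- The path through a new vertex is obtained in two steps: `v` becomes a leaf at `a`, and then
      -- `{a,b}` is exchanged for `{v,b}`.
      have hT₁ : IsSubtree T₁ := hT.leaf haT hvT hV₁ hA₁
      obtain ⟨T', hV', hA'⟩ := exists_subgraph T₁.verts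
        (fun i j => (T₁.Adj i j ∧ ¬ IsEdge a b i j) ∨ IsEdge v b i j)
        (fun i j h => h.imp (fun h => ⟨h.1.symm, fun c => h.2 c.symm⟩) (fun h => h.symm))
        (fun i h => by
          rcases h with h | h
          · exact (T₁.adj_sub h.1).ne rfl
          · rcases h with ⟨h3, h4⟩ | ⟨h3, h4⟩
            · exact hbv (h4.symm.trans h3)
            · exact hbv (h3.symm.trans h4))
        (fun i j h => by
          rcases h with h | h
          · exact T₁.edge_vert h.1
          · rw [hV₁]
            rcases h with ⟨h3, h4⟩ | ⟨h3, h4⟩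
            · exact Or.inl h3
            · exact Or.inr (h3 ▸ hbT))
      have hav' : (removeEdge T₁.spanningCoe a b).Reachable v a := by
        refine SimpleGraph.Adj.reachable ⟨(hA₁ _ _).2 (Or.inr (Or.inr ⟨rfl, rfl⟩)), ?_⟩
        rintro (⟨h, -⟩ | ⟨h, -⟩)
        · exact hav h.symm
        · exact hbv h.symm
      have hadj₁ : T₁.Adj a b := (hA₁ _ _).2 (Or.inl hadj)
      have hT' : IsSubtree T' :=
        hT₁.exchange hadj₁ (by rw [hV₁]; exact Or.inl rfl) hav' hV' hA'
      have hA'' : ∀ i j, T'.Adj i j ↔ (T.Adj i j ∧ ¬ IsEdge a b i j) ∨ IsEdge a v i j ∨ IsEdge v b i j := by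
        intro i j
        have hd : IsEdge a v i j → ¬ IsEdge a b i j := by
          rintro (⟨rfl, rfl⟩ | ⟨rfl, rfl⟩) (⟨h, h'⟩ | ⟨h, h'⟩)
          · exact hbv h'.symm
          · exact hab h
          · exact hav h.symm
          · exact hbv h.symm
        rw [hA', hA₁]
        tauto
      set s₃ := s₂.writeNat arrVert (pr t v) 1 with hs₃
      have hs3 : ∀ c, c ≠ arrVert → s₃.nat c = s₂.nat c := by
        intro c hc; funext x; simp [hs₃, State.nat_writeNat, hc]
      have hleaf : attachLeaf.run s₂ = (setAdj (.var ctrA) (.var natV) 1).run s₃ := by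
        simp [attachLeaf, insertVertex, Code.run_seq, Code.run_setNat, hs₃, e3, e4]
      rw [hleaf] at hrun
      obtain ⟨m1, m2⟩ := setAdj_spec (σ := s₃) (t := t) (p := .var ctrA) (q := .var natV) (m := 1)
        (i := a) (j := v) (by rw [hs3 _ (by decide), e4]) (by
          intro s' hs'
          rw [NExp.eval_var, hs' _ (by decide), hs3 _ (by decide), e1]) (by
          intro s' hs'
          rw [NExp.eval_var, hs' _ (by decide), hs3 _ (by decide), e3])
      set s₄ := (setAdj (.var ctrA) (.var natV) 1).run s₃ with hs₄
      have hs4 : ∀ c, c ≠ arrAdj → s₄.nat c = s₃.nat c := fun c hc => setAdj_nat _ _ _ _ hc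
      obtain ⟨l1, l2⟩ := setAdj_spec (σ := s₄) (t := t) (p := .var natV) (q := .var natQ) (m := 1)
        (i := v) (j := b) (by rw [hs4 _ (by decide), hs3 _ (by decide), e4]) (by
          intro s' hs'
          rw [NExp.eval_var, hs' _ (by decide), hs4 _ (by decide), hs3 _ (by decide), e3]) (by
          intro s' hs'
          rw [NExp.eval_var, hs' _ (by decide), hs4 _ (by decide), hs3 _ (by decide)]
          simp [hs₂, State.nat_writeNat])
      rw [← hrun] at l1 l2
      have hvert : ∀ x, (reroute.run s).nat arrVert x = if x = pr t v then 1 else s.nat arrVert x := by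
        intro x
        rw [hrun, setAdj_nat _ _ _ _ (by decide), hs4 _ (by decide)]
        simp [hs₃, State.nat_writeNat, eV]
      have hadj3 : s₃.nat arrAdj = s₁.nat arrAdj := by rw [hs3 _ (by decide), eA]
      refine ⟨T', 0, ⟨hadj, a, b, Or.inl ⟨rfl, rfl⟩, fun h => (hsub _ _ h).1 rfl,
        Or.inr ⟨hvT, hV'.trans hV₁, rfl, hA''⟩⟩, ⟨hT', by rw [hV', hV₁]; exact hH _ hHT⟩, ?_,
        ⟨fun i => ?_, fun i j => ?_⟩, ?_, ?_⟩
      · rw [hA'']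
        rintro (h | (⟨-, h⟩ | ⟨h, -⟩) | (⟨h, -⟩ | ⟨-, h⟩))
        · exact h.2 (Or.inl ⟨rfl, rfl⟩)
        · exact hbv h
        · exact hav h
        · exact hav h
        · exact hbv h
      · rw [hvert, hst.1]
        exact ite_insert (p := pr t i = pr t v) (by simp [hV', hV₁, Fin.ext_iff])
      · rw [l1, m1, hadj3, k1, hst.2]
        exact ite_exchange_insert (hA'' i j)
      · intro t' ht' T hT
        refine hT.congr (fun i => ?_) (fun i j => ?_)
        · rw [hvert, if_neg (by simp [ht'])]
        · rw [l2 _ _ _ ht', m2 _ _ _ ht', hadj3, k2 _ _ _ ht']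
      · intro i
        rw [hrun]
        have : ∀ p q m (s : State K), ((setAdj p q m).run s).num = s.num := fun _ _ _ _ => rfl
        rw [this, hs₄, this, hs₃, State.num_writeNat, hs₂]
        simp [hs1n]

end Modify

/-! ### Reinserting the vertices into the trees -/

/-- Reroutes the edges of trees that were created by splitting off a vertex. -/
def rerouteAll : Code :=
  .loop ctrA 1 (.loop ctrB 1 (.when (.conj (.neg (.neq (.var ctrA) (.var ctrB)))
      (.conj (.neg (.neq (.var ctrA) (.var natV))) (.neg (.neq (.var ctrB) (.var natV)))))
    (.letNum numRem (.half (.sub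
        (.get arrSnap (.pr (.pr (.add (.var natI) (.lit 1)) (.var ctrA)) (.var ctrB)))
        (.get arrSnap (.pr (.pr (.var natI) (.var ctrA)) (.var ctrB))))) ;;
      redistribute hasEdge reroute)))

/-- Attaches the released edges as leaves. -/
def attachAll : Code :=
  .loop ctrA 1 (.letNum numRem (.get arrRel (.var ctrA)) ;; .setNum arrRel (.var ctrA) .zero ;;
    redistribute canAttach attachLeaf)

/-- Reinserts a vertex. -/
def insertStage : Code :=
  .letNat natI (.sub .card (.add (.var ctrStage) (.lit 1))) ;;
  .letNat natV (.get arrOrd (.var natI)) ;;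
  .when (.nlt (.var natV) .card)
    (.loop ctrA 1 (.setNum arrRel (.var ctrA) .zero) ;; rerouteAll ;; attachAll)

/-- Reinserts all vertices that have been split off, in reverse order. -/
def insertAll : Code := .loop ctrStage 1 insertStage

section LexSum

variable {K : Type} [Field K] {n : ℕ}

/-- The sum over the pairs that precede `(i, j)` in the lexicographic order. -/
def lexSum (f : Fin n → Fin n → K) (i j : ℕ) : K :=
  ∑ p : Fin n, ∑ q : Fin n, if (p : ℕ) < i ∨ (p : ℕ) = i ∧ (q : ℕ) < j then f p q else 0

theorem lexSum_zero (f : Fin n → Fin n → K) : lexSum f 0 0 = 0 := by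
  simp [lexSum]

theorem lexSum_row (f : Fin n → Fin n → K) (i : ℕ) : lexSum f i n = lexSum f (i + 1) 0 := by
  refine Finset.sum_congr rfl fun p _ => Finset.sum_congr rfl fun q _ => if_congr ?_ rfl rfl
  have := q.2
  omega

theorem lexSum_all (f : Fin n → Fin n → K) : lexSum f n 0 = ∑ p, ∑ q, f p q := by
  refine Finset.sum_congr rfl fun p _ => Finset.sum_congr rfl fun q _ => if_pos ?_
  have := p.2
  omega

theorem lexSum_succ (f : Fin n → Fin n → K) (i j : Fin n) :
    lexSum f i (j + 1) = lexSum f i j + f i j := by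
  have h : ∀ p q : Fin n, (if (p : ℕ) < i ∨ (p : ℕ) = i ∧ (q : ℕ) < (j : ℕ) + 1 then f p q else 0) =
      (if (p : ℕ) < i ∨ (p : ℕ) = i ∧ (q : ℕ) < j then f p q else 0) +
      if p = i then (if q = j then f i j else 0) else 0 := by
    intro p q
    by_cases h1 : p = i
    · by_cases h2 : q = j
      · subst h1; subst h2; simp
      · have : (q : ℕ) ≠ j := fun c => h2 (Fin.ext c)
        have h3 : (q : ℕ) < j + 1 ↔ (q : ℕ) < j := by omega
        simp [h1, h2, h3]
    · have : (p : ℕ) ≠ i := fun c => h1 (Fin.ext c)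
      simp [h1, this]
  simp only [lexSum, h, Finset.sum_add_distrib]
  simp

/-- Bounds what earlier pairs have consumed together with the demand of the current pair. -/
theorem lexSum_add_le [LinearOrder K] [IsStrictOrderedRing K] {f : Fin n → Fin n → K}
    (hf : ∀ p q, 0 ≤ f p q) (i j : Fin n) : lexSum f i j + f i j ≤ ∑ p, ∑ q, f p q := by
  rw [← lexSum_succ]
  refine Finset.sum_le_sum fun p _ => Finset.sum_le_sum fun q _ => ?_
  split_ifs
  · exact le_rfl
  · exact hf p q

end LexSum

/-! ### The effect of the modifications on edge and vertex counts. -/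

section Functionals

theorem indicator_or {K : Type} [Field K] {p e r : Prop} {_ : Decidable p} {_ : Decidable e}
    {_ : Decidable r} (h : r ↔ p ∨ e) (h1 : e → ¬ p) :
    (if r then (1 : K) else 0) = (if p then 1 else 0) + if e then 1 else 0 := by
  by_cases hp : p <;> by_cases he : e <;> simp_all

theorem indicator_exchange {K : Type} [Field K] {p q e r : Prop} {_ : Decidable p} {_ : Decidable q}
    {_ : Decidable e} {_ : Decidable r} (h : r ↔ (p ∧ ¬ q) ∨ e) (h1 : q → p) (h2 : e → ¬ p) :
    (if r then (1 : K) else 0) =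
      (if p then 1 else 0) + ((if e then 1 else 0) - if q then 1 else 0) := by
  by_cases hp : p <;> by_cases hq : q <;> by_cases he : e <;> simp_all

theorem indicator_exchange_insert {K : Type} [Field K] {p q e f r : Prop} {_ : Decidable p}
    {_ : Decidable q} {_ : Decidable e} {_ : Decidable f} {_ : Decidable r}
    (h : r ↔ (p ∧ ¬ q) ∨ e ∨ f) (h1 : q → p) (h2 : e → ¬ p) (h3 : f → ¬ p) (h4 : e → ¬ f) :
    (if r then (1 : K) else 0) =
      (if p then 1 else 0) + ((if e then 1 else 0) + (if f then 1 else 0) - if q then 1 else 0) := by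
  by_cases hp : p <;> by_cases hq : q <;> by_cases he : e <;> by_cases hf : f <;> simp_all

variable {K : Type} [Field K] {n : ℕ}

open Classical in
/-- The indicator of the adjacency of `i` and `j`. -/
noncomputable def adjFun (K : Type) [Field K] (i j : Fin n) (T : (⊤ : SimpleGraph (Fin n)).Subgraph) : K :=
  if T.Adj i j then 1 else 0

open Classical in
/-- The indicator of the vertex `w`. -/
noncomputable def memFun (K : Type) [Field K] (w : Fin n) (T : (⊤ : SimpleGraph (Fin n)).Subgraph) : K :=
  if w ∈ T.verts then 1 else 0

theorem edgeMatrix_eq (p q i j : Fin n) :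
    (edgeMatrix p q i j : K) = if IsEdge p q i j then 1 else 0 := rfl

theorem edgeMatrix_swap (p q i j : Fin n) : (edgeMatrix p q i j : K) = edgeMatrix q p i j := by
  rw [edgeMatrix_eq, edgeMatrix_eq]
  exact if_congr isEdge_comm rfl rfl

theorem memFun_insert {w v : Fin n} (h : w ≠ v) {T T' : (⊤ : SimpleGraph (Fin n)).Subgraph}
    (hT : T'.verts = insert v T.verts) : memFun K w T' = memFun K w T := by
  have : w ∈ T'.verts ↔ w ∈ T.verts := by rw [hT, Set.mem_insert_iff, or_iff_right h]
  unfold memFun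
  by_cases hw : w ∈ T.verts
  · rw [if_pos hw, if_pos (this.2 hw)]
  · rw [if_neg hw, if_neg (fun h => hw (this.1 h))]

theorem memFun_congr {w : Fin n} {T T' : (⊤ : SimpleGraph (Fin n)).Subgraph}
    (hT : T'.verts = T.verts) : memFun K w T' = memFun K w T := by
  unfold memFun
  rw [hT]

theorem sum_sum_mul_edgeMatrix (f : Fin n → Fin n → K) {i j : Fin n} (hij : i ≠ j) :
    ∑ p, ∑ q, f p q * edgeMatrix p q i j = f i j + f j i := by
  have : ∀ p q, f p q * (edgeMatrix p q i j : K) =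
      (if p = i then if q = j then f i j else 0 else 0) +
        if p = j then if q = i then f j i else 0 else 0 := by
    intro p q
    have h : IsEdge p q i j ↔ (p = i ∧ q = j) ∨ (p = j ∧ q = i) := by
      unfold IsEdge
      constructor <;> rintro (⟨rfl, rfl⟩ | ⟨rfl, rfl⟩) <;> simp
    rw [edgeMatrix_eq, if_congr h rfl rfl]
    by_cases h1 : p = i
    · subst h1
      by_cases h2 : q = j
      · subst h2; simp [hij]
      · simp [h2, hij]
    · by_cases h2 : p = j
      · subst h2
        by_cases h3 : q = i
        · subst h3; simp [h1]
        · simp [h1, h3]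
      · simp [h1, h2]
  simp only [this, Finset.sum_add_distrib]
  simp

variable {a b v : Fin n} {T T' : (⊤ : SimpleGraph (Fin n)).Subgraph} {g : Fin n → K}

/-- If the released edges are counted as present, both kinds of rerouting have the same effect,
namely that of undoing the splitting off: `{a,b}` is replaced by `{a,v}` and `{b,v}`. -/
theorem RerouteStep.adjFun (h : RerouteStep a b v T T' g) (hav : a ≠ v) (hbv : b ≠ v) (i j : Fin n) :
    adjFun K i j T' + ∑ l, edgeMatrix l v i j * g l =
      adjFun K i j T + (edgeMatrix a v i j + edgeMatrix b v i j - edgeMatrix a b i j) := by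
  have hab : a ≠ b := (T.adj_sub h.adj).ne
  have h1 : IsEdge a b i j → T.Adj i j := by
    rintro (⟨rfl, rfl⟩ | ⟨rfl, rfl⟩)
    · exact h.adj
    · exact h.adj.symm
  obtain ⟨p, q, hpq, hnadj, hc⟩ := h.cases
  have h2 : IsEdge v q i j → ¬ T.Adj i j := by
    rintro (⟨rfl, rfl⟩ | ⟨rfl, rfl⟩)
    · exact hnadj
    · exact fun h => hnadj h.symm
  have hsum : (edgeMatrix a v i j : K) + edgeMatrix b v i j = edgeMatrix p v i j + edgeMatrix v q i j := by
    rw [edgeMatrix_swap v q]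
    rcases hpq with ⟨rfl, rfl⟩ | ⟨rfl, rfl⟩
    · rfl
    · rw [add_comm]
  rw [hsum]
  rcases hc with ⟨-, -, rfl, hadj⟩ | ⟨hv, -, rfl, hadj⟩
  · have h3 : ∑ l, (edgeMatrix l v i j : K) * (Pi.single p 1 : Fin n → K) l = edgeMatrix p v i j := by
      simp [Pi.single_apply]
    rw [h3]
    rw [show (edgeMatrix p v i j : K) + edgeMatrix v q i j - edgeMatrix a b i j =
      (edgeMatrix v q i j - edgeMatrix a b i j) + edgeMatrix p v i j by ring, ← add_assoc]
    congr 1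
    exact indicator_exchange (hadj i j) h1 h2
  · have h3 : IsEdge p v i j → ¬ T.Adj i j := by
      rintro (⟨-, rfl⟩ | ⟨rfl, -⟩)
      · exact fun h => hv (T.edge_vert h.symm)
      · exact fun h => hv (T.edge_vert h)
    have hpq' : p ≠ q := by
      rcases hpq with ⟨rfl, rfl⟩ | ⟨rfl, rfl⟩
      · exact hab
      · exact hab.symm
    have hpv : p ≠ v := by
      rcases hpq with ⟨rfl, rfl⟩ | ⟨rfl, rfl⟩ <;> assumption
    have h5 : IsEdge p v i j → ¬ IsEdge v q i j := by
      rintro (⟨rfl, rfl⟩ | ⟨rfl, rfl⟩) (⟨h, h'⟩ | ⟨h, h'⟩)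
      · exact hpv h
      · exact hpq' h
      · exact hpq' h'
      · exact hpv h'
    simp only [Pi.zero_apply, mul_zero, Finset.sum_const_zero, add_zero]
    exact indicator_exchange_insert (hadj i j) h1 h3 h2 h5

theorem RerouteStep.nonneg [LinearOrder K] [IsStrictOrderedRing K] (h : RerouteStep a b v T T' g)
    (i : Fin n) : 0 ≤ g i := by
  obtain ⟨p, q, -, -, ⟨-, -, rfl, -⟩ | ⟨-, -, rfl, -⟩⟩ := h.cases
  · rw [Pi.single_apply]; split_ifs <;> simp
  · exact le_rfl

/-- Each rerouted unit either brings `v` into a tree or releases one unit. This is why coverage plus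
released weight depends only on the total amount rerouted. -/
theorem RerouteStep.memFun_self (h : RerouteStep a b v T T' g) :
    memFun K v T' + ∑ l, 1 * g l = memFun K v T + 1 := by
  obtain ⟨p, q, -, -, ⟨hv, hT, rfl, -⟩ | ⟨hv, hT, rfl, -⟩⟩ := h.cases
  · rw [memFun_congr hT]
    simp
  · simp [memFun, hT, hv]

theorem RerouteStep.memFun (h : RerouteStep a b v T T' g) {w : Fin n} (hw : w ≠ v) :
    memFun K w T' = memFun K w T := by
  obtain ⟨p, q, -, -, ⟨-, hT, -⟩ | ⟨-, hT, -⟩⟩ := h.cases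
  · exact memFun_congr hT
  · exact memFun_insert hw hT

theorem LeafStep.adjFun (h : LeafStep a v T T' g) (i j : Fin n) :
    adjFun K i j T' = adjFun K i j T + edgeMatrix a v i j := by
  have h3 : IsEdge a v i j → ¬ T.Adj i j := by
    rintro (⟨-, rfl⟩ | ⟨rfl, -⟩)
    · exact fun h' => h.notMem (T.edge_vert h'.symm)
    · exact fun h' => h.notMem (T.edge_vert h')
  exact indicator_or (h.adj i j) h3

theorem LeafStep.memFun_self (h : LeafStep a v T T' g) : PrizeCollecting.memFun K v T' =
    PrizeCollecting.memFun K v T + 1 := by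
  simp [PrizeCollecting.memFun, h.verts, h.notMem]

theorem LeafStep.memFun (h : LeafStep a v T T' g) {w : Fin n} (hw : w ≠ v) :
    PrizeCollecting.memFun K w T' = PrizeCollecting.memFun K w T :=
  memFun_insert hw h.verts

theorem adjFun_nonneg [LinearOrder K] [IsStrictOrderedRing K] (i j : Fin n) : 0 ≤ adjFun K i j T := by
  unfold adjFun; split_ifs <;> simp

theorem memFun_nonneg [LinearOrder K] [IsStrictOrderedRing K] (w : Fin n) : 0 ≤ memFun K w T := by
  unfold memFun; split_ifs <;> simp

end Functionals

section Total

variable {K : Type} [Field K] [LinearOrder K] [IsStrictOrderedRing K] {n : ℕ}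
  {Good : (⊤ : SimpleGraph (Fin n)).Subgraph → Prop} {s : State K}
  {T : ℕ → (⊤ : SimpleGraph (Fin n)).Subgraph} {φ ψ : (⊤ : SimpleGraph (Fin n)).Subgraph → K}

theorem Family.total_mono (h : Family Good s T) (hφ : ∀ t, 0 < s.num arrWt t → φ (T t) ≤ ψ (T t)) :
    total s T φ ≤ total s T ψ := by
  refine Finset.sum_le_sum fun t _ => ?_
  rcases (h.nonneg t).eq_or_lt with h0 | h0
  · rw [← h0]; simp
  · exact mul_le_mul_of_nonneg_left (hφ t h0) h0.le

theorem total_zero : total s T (fun _ => 0) = 0 := by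
  simp [total]

theorem Family.total_nonneg (h : Family Good s T) (hφ : ∀ T, 0 ≤ φ T) : 0 ≤ total s T φ := by
  rw [← total_zero (s := s) (T := T)]
  exact h.total_mono fun t _ => hφ _

end Total

/-! ### Rerouting and leaf attachment never run out of trees. -/

section InsertSpec

variable {K : Type} [Field K] [LinearOrder K] [IsStrictOrderedRing K] {n : ℕ}
  {H : Set (Fin n) → Prop} {T : ℕ → (⊤ : SimpleGraph (Fin n)).Subgraph}

/-- Half of the weight that the splitting off at `v` adds to an edge. -/
def splitWeight (S S' : Fin n → Fin n → K) (v p q : Fin n) : K :=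
  if p ≠ q ∧ p ≠ v ∧ q ≠ v then (S' p q - S p q) / 2 else 0

/-- Both orders of a pair are treated, each with half of the added weight. The change of every
suitable linear functional is recorded, so edge counts, coverage and anchor pairs can later be read
off from one statement. -/
theorem rerouteAll_spec {σ : State K} (hn : σ.nat 0 0 = n) {v : Fin n} (hv : σ.nat natV 0 = v)
    {i : ℕ} (hi : σ.nat natI 0 = i) (hH : ∀ U, H U → H (insert v U))
    (hF : Family (GoodTree H) σ T) {S S' F : Fin n → Fin n → K} (hS : σ.snap n i = S)
    (hS' : σ.snap n (i + 1) = S') (hmono : ∀ a b, a ≠ v → b ≠ v → S a b ≤ S' a b)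
    (hsymm : ∀ a b, S a b = S b a) (hsymm' : ∀ a b, S' a b = S' b a)
    (hle : ∀ a b, a ≠ v → b ≠ v → F a b ≤ S a b)
    (hadj : ∀ a b, total σ T (adjFun K a b) = S' a b - F a b)
    (hcnt : σ.nat natCnt 0 + n * n ≤ n ^ 5)
    {σ' : State K} (hσ' : rerouteAll.run σ = σ') :
    ∃ T', Family (GoodTree H) σ' T' ∧ (∀ a : Fin n, σ.num arrRel a ≤ σ'.num arrRel a) ∧
      σ'.nat natCnt 0 ≤ σ.nat natCnt 0 + n * n ∧
      ∀ (φ : (⊤ : SimpleGraph (Fin n)).Subgraph → K) (e : Fin n → K) (Δ : Fin n → Fin n → K),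
        (∀ a b, a ≠ v → b ≠ v → ∀ T T' g, RerouteStep a b v T T' g →
          φ T' + ∑ l, e l * g l = φ T + Δ a b) →
        total σ' T' φ + ∑ l, e l * σ'.num arrRel l = total σ T φ + ∑ l, e l * σ.num arrRel l +
          ∑ p, ∑ q, splitWeight S S' v p q * Δ p q := by
  set w := splitWeight S S' v with hw
  have hw0 : ∀ p q, 0 ≤ w p q := by
    intro p q
    rw [hw, splitWeight]
    split_ifs with h
    · have := hmono p q h.2.1 h.2.2
      linarith
    · exact le_rfl
  have hwsymm : ∀ p q, w p q = w q p := by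
    intro p q
    simp only [hw, splitWeight, hsymm p q, hsymm' p q]
    exact if_congr (by rw [ne_comm]; tauto) rfl rfl
  set body := Code.when (.conj (.neg (.neq (.var ctrA) (.var ctrB)))
      (.conj (.neg (.neq (.var ctrA) (.var natV))) (.neg (.neq (.var ctrB) (.var natV)))))
    (.letNum numRem (.half (.sub
        (.get arrSnap (.pr (.pr (.add (.var natI) (.lit 1)) (.var ctrA)) (.var ctrB)))
        (.get arrSnap (.pr (.pr (.var natI) (.var ctrA)) (.var ctrB))))) ;;
      redistribute hasEdge reroute) with hbody
  have key := Code.loop_loop_induction (a := ctrA) (b := ctrB) (c := body) hn (by decide) (by decide)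
    (by decide) (by decide) (by decide)
    (fun k m s => ∃ T', Family (GoodTree H) s T' ∧ (∀ a : Fin n, σ.num arrRel a ≤ s.num arrRel a) ∧
      s.nat natCnt 0 ≤ σ.nat natCnt 0 + k * n + m ∧
      ∀ (φ : (⊤ : SimpleGraph (Fin n)).Subgraph → K) (e : Fin n → K) (Δ : Fin n → Fin n → K),
        (∀ a b, a ≠ v → b ≠ v → ∀ T T' g, RerouteStep a b v T T' g →
          φ T' + ∑ l, e l * g l = φ T + Δ a b) →
        total s T' φ + ∑ l, e l * s.num arrRel l = total σ T φ + ∑ l, e l * σ.num arrRel l +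
          lexSum (fun p q => w p q * Δ p q) k m) ?_ ?_ ?_ ?_ ?_
  · have hrun : rerouteAll.run σ = (Code.loop ctrA 1 (.loop ctrB 1 body)).run σ := rfl
    rw [← hrun, hσ'] at key
    obtain ⟨T', k1, k2, k3, k4⟩ := key
    refine ⟨T', k1, k2, by omega, fun φ e Δ h => ?_⟩
    rw [k4 φ e Δ h, lexSum_all]
  · rintro k m s x ⟨T', k1, k2, k3, k4⟩
    have hwr : ∀ c, c ≠ ctrA → (s.writeNat ctrA 0 x).nat c = s.nat c := by
      intro c hc; funext z; simp [State.nat_writeNat, hc]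
    exact ⟨T', k1.congr (hwr _ (by decide)) (hwr _ (by decide)) rfl (hwr _ (by decide)), k2,
      by rwa [hwr _ (by decide)], k4⟩
  · rintro k m s x ⟨T', k1, k2, k3, k4⟩
    have hwr : ∀ c, c ≠ ctrB → (s.writeNat ctrB 0 x).nat c = s.nat c := by
      intro c hc; funext z; simp [State.nat_writeNat, hc]
    exact ⟨T', k1.congr (hwr _ (by decide)) (hwr _ (by decide)) rfl (hwr _ (by decide)), k2,
      by rwa [hwr _ (by decide)], k4⟩
  · refine ⟨T, hF, fun _ => le_rfl, by simp, fun φ e Δ _ => ?_⟩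
    rw [lexSum_zero, add_zero]
  · rintro k s ⟨T', k1, k2, k3, k4⟩
    refine ⟨T', k1, k2, by rw [add_mul]; omega, fun φ e Δ h => ?_⟩
    rw [k4 φ e Δ h, lexSum_row]
  · rintro k hk m hm s hsa hsb hnat hnum ⟨T₀, p1, p2, p3, p4⟩
    set a : Fin n := ⟨k, hk⟩ with ha
    set b : Fin n := ⟨m, hm⟩ with hb
    have hsucc : ∀ f : Fin n → Fin n → K, lexSum f k (m + 1) = lexSum f k m + f a b :=
      fun f => lexSum_succ f a b
    have hsv : s.nat natV 0 = v := by rw [hnat _ (by decide), hv]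
    have hsi : s.nat natI 0 = i := by rw [hnat _ (by decide), hi]
    have hs0 : s.nat 0 0 = n := by rw [hnat _ (by decide), hn]
    have hsS : s.num arrSnap = σ.num arrSnap := hnum _ (by decide)
    by_cases hc : a ≠ b ∧ a ≠ v ∧ b ≠ v
    · rw [hbody, Code.run_when_true (by
        simpa [hsa, hsb, hsv, ha, hb, Fin.ext_iff] using hc), Code.run_seq, Code.run_letNum]
      have hval : (FExp.half (.sub
          (.get arrSnap (.pr (.pr (.add (.var natI) (.lit 1)) (.var ctrA)) (.var ctrB)))
          (.get arrSnap (.pr (.pr (.var natI) (.var ctrA)) (.var ctrB))))).eval s = w a b := by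
        rw [hw, splitWeight, if_pos hc, ← hS, ← hS']
        simp [hsa, hsb, hsi, hsS, State.snap, ha, hb]
      rw [hval]
      set s₁ := s.writeNum numRem 0 (w a b) with hs₁
      have hs1w : s₁.num arrWt = s.num arrWt := by funext z; simp [hs₁, State.num_writeNum]
      have hs1r : s₁.num arrRel = s.num arrRel := by funext z; simp [hs₁, State.num_writeNum]
      have hs1m : s₁.num numRem 0 = w a b := by simp [hs₁, State.num_writeNum]
      have hM := reroute_modifies (H := H) (σ := s₁) (K := K) (a := a) (b := b) (v := v) hs0 hsa hsb hsv
        hc.2.1 hc.2.2 hH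
      have hbd : k * n + m < n * n := by
        have : (k + 1) * n ≤ n * n := Nat.mul_le_mul_right n hk
        rw [add_mul] at this; omega
      obtain ⟨T', q1, q2, q3, q4, q5, q6, q7⟩ := redistribute_spec (σ := s₁) hM hs0
        (p1.congr rfl rfl hs1w rfl) (by rw [hs1m]; exact hw0 a b)
        (by change s.nat natCnt 0 < _; omega) rfl
      set s₂ := (redistribute hasEdge reroute).run s₁ with hs₂
      have hEab : ∀ l, (edgeMatrix l v a b : K) = 0 := by
        intro l
        rw [edgeMatrix_eq, if_neg]
        rintro (⟨-, h⟩ | ⟨h, -⟩)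
        · exact hc.2.2 h
        · exact hc.2.1 h
      -- The trees contain `{a,b}` with total weight `S' a b - F a b` at the beginning. The two
      -- orders of this pair require `S' a b - S a b` in total, which is no more since `F ≤ S`;
      -- rerouting other pairs does not affect the edge. So an unfinished request would contradict
      -- the absence of trees with this edge.
      have hr0 : s₂.num numRem 0 = 0 := by
        rcases q7 with h | h
        · exact h
        · refine le_antisymm ?_ q2
          have hz : total s₂ T' (adjFun K a b) = 0 := by
            refine le_antisymm ?_ (q1.total_nonneg fun _ => adjFun_nonneg a b)
            rw [← total_zero (s := s₂) (T := T')]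
            refine q1.total_mono fun t ht => ?_
            rw [adjFun, if_neg (h t ht)]
          have e1 := q6 (adjFun K a b) (fun l => edgeMatrix l v a b) (-1) (by
            intro T T' g hg
            rw [hg.adjFun hc.2.1 hc.2.2 a b]
            have : (edgeMatrix a b a b : K) = 1 := if_pos (Or.inl ⟨rfl, rfl⟩)
            simp [hEab, this])
          have e2 := p4 (adjFun K a b) (fun l => edgeMatrix l v a b)
            (fun p q => edgeMatrix p v a b + edgeMatrix q v a b - edgeMatrix p q a b)
            (fun p q hp hq T T' g hg => hg.adjFun hp hq a b)
          simp only [hEab, zero_mul, Finset.sum_const_zero, add_zero, zero_sub, hz, hs1m,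
            total_congr _ _ hs1w, hadj] at e1 e2
          have e3 := lexSum_add_le (f := fun p q => w p q * edgeMatrix p q a b)
            (fun p q => mul_nonneg (hw0 p q) (edgeMatrix_nonneg _ _ _ _)) a b
          have e4 : ∑ p, ∑ q, w p q * (edgeMatrix p q a b : K) = w a b + w b a :=
            sum_sum_mul_edgeMatrix w hc.1
          have e5 : lexSum (fun p q => w p q * -(edgeMatrix p q a b : K)) k m =
              - lexSum (fun p q => w p q * (edgeMatrix p q a b : K)) a b := by
            simp only [lexSum, ← Finset.sum_neg_distrib]
            refine Finset.sum_congr rfl fun p _ => Finset.sum_congr rfl fun q _ => ?_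
            simp only [ha, hb]
            split_ifs <;> ring
          have e6 : (edgeMatrix a b a b : K) = 1 := if_pos (Or.inl ⟨rfl, rfl⟩)
          have e7 : w a b = (S' a b - S a b) / 2 := if_pos hc
          have e8 := hle a b hc.2.1 hc.2.2
          rw [e4, e6, hwsymm b a] at e3
          rw [e5] at e2
          linarith
      refine ⟨T', q1, fun l => (p2 l).trans ?_, ?_, ?_⟩
      · rw [← hs1r]
        exact q4 l fun T T' g hg => hg.nonneg l
      · have : s₁.nat natCnt 0 = s.nat natCnt 0 := rfl
        omega
      · intro φ e Δ hφ
        have e1 := q6 φ e (Δ a b) (hφ a b hc.2.1 hc.2.2)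
        have e2 := p4 φ e Δ hφ
        rw [hr0, hs1m, total_congr _ _ hs1w, hs1r] at e1
        rw [e1, e2, hsucc]
        ring
    · rw [hbody, Code.run_when_false (by
        simpa [hsa, hsb, hsv, ha, hb, Fin.ext_iff] using hc)]
      refine ⟨T₀, p1, p2, by omega, ?_⟩
      intro φ e Δ hφ
      rw [p4 φ e Δ hφ, hsucc]
      have : w a b = 0 := if_neg hc
      simp [this]

/-- The vertex `v` is to be covered exactly `Y` times, and each unit of a released edge `{a,v}` asks
for a tree that contains `a` but not `v`. -/
theorem attachAll_spec {σ : State K} (hn : σ.nat 0 0 = n) {v : Fin n} (hv : σ.nat natV 0 = v)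
    (hH : ∀ U, H U → H (insert v U)) (hF : Family (GoodTree H) σ T) {Y : K}
    (hrel : ∀ a : Fin n, 0 ≤ σ.num arrRel a)
    (hcov : total σ T (memFun K v) + ∑ a : Fin n, σ.num arrRel a = Y)
    (hge : ∀ a : Fin n, 0 < σ.num arrRel a → a ≠ v ∧ Y ≤ total σ T (memFun K a))
    (hcnt : σ.nat natCnt 0 + n ≤ n ^ 5)
    {σ' : State K} (hσ' : attachAll.run σ = σ') :
    ∃ T', Family (GoodTree H) σ' T' ∧ σ'.nat natCnt 0 ≤ σ.nat natCnt 0 + n ∧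
      ∀ (φ : (⊤ : SimpleGraph (Fin n)).Subgraph → K) (Δ : Fin n → K),
        (∀ a T T' (g : Fin n → K), LeafStep a v T T' g → φ T' = φ T + Δ a) →
        total σ' T' φ = total σ T φ + ∑ a : Fin n, σ.num arrRel a * Δ a := by
  set body := Code.letNum numRem (.get arrRel (.var ctrA)) ;; .setNum arrRel (.var ctrA) .zero ;;
    redistribute canAttach attachLeaf with hbody
  have key := Code.loop_induction (a := ctrA) (d := 1) (c := body) hn
    (fun k s => ∃ T', Family (GoodTree H) s T' ∧ s.nat natCnt 0 ≤ σ.nat natCnt 0 + k ∧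
      (∀ a : Fin n, k ≤ a → s.num arrRel a = σ.num arrRel a) ∧
      ∀ (φ : (⊤ : SimpleGraph (Fin n)).Subgraph → K) (Δ : Fin n → K),
        (∀ a T T' (g : Fin n → K), LeafStep a v T T' g → φ T' = φ T + Δ a) →
        total s T' φ = total σ T φ + ∑ a : Fin n, if (a : ℕ) < k then σ.num arrRel a * Δ a else 0)
    ?_ ?_
  · rw [pow_one] at key
    have hrun : attachAll.run σ = (Code.loop ctrA 1 body).run σ := rfl
    rw [← hrun, hσ'] at key
    obtain ⟨T', k1, k2, -, k4⟩ := key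
    refine ⟨T', k1, k2, fun φ Δ h => ?_⟩
    rw [k4 φ Δ h]
    congr 1
    exact Finset.sum_congr rfl fun a _ => if_pos a.2
  · have hwr : ∀ c, c ≠ ctrA → (σ.writeNat ctrA 0 0).nat c = σ.nat c := by
      intro c hc; funext z; simp [State.nat_writeNat, hc]
    refine ⟨T, hF.congr (hwr _ (by decide)) (hwr _ (by decide)) rfl (hwr _ (by decide)),
      by rw [hwr _ (by decide)]; omega, fun _ _ => rfl, fun φ Δ _ => ?_⟩
    rw [show total (σ.writeNat ctrA 0 0) T φ = total σ T φ from rfl]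
    simp
  · rintro k hk s hsa hnat hnum ⟨T₀, p1, p2, p3, p4⟩
    rw [pow_one] at hk
    set a : Fin n := ⟨k, hk⟩ with ha
    have hsv : s.nat natV 0 = v := by rw [hnat _ (by decide), hv]
    have hs0 : s.nat 0 0 = n := by rw [hnat _ (by decide), hn]
    have hwr : ∀ (s : State K) c, c ≠ ctrA → (s.writeNat ctrA 0 (k + 1)).nat c = s.nat c := by
      intro s c hc; funext z; simp [State.nat_writeNat, hc]
    have hra := p3 a le_rfl
    set s₁ := (s.writeNum numRem 0 (σ.num arrRel a)).writeNum arrRel k 0 with hs₁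
    have hrun : body.run s = (redistribute canAttach attachLeaf).run s₁ := by
      have : s.num arrRel k = σ.num arrRel a := hra
      simp only [hbody, Code.run_seq, Code.run_letNum, Code.run_setNum, NExp.eval_var, FExp.eval_get,
        hsa, State.nat_writeNum, FExp.eval_zero, this]
      rfl
    rw [hrun]
    have hs1w : s₁.num arrWt = s.num arrWt := by funext z; simp [hs₁, State.num_writeNum]
    have hs1m : s₁.num numRem 0 = σ.num arrRel a := by simp [hs₁, State.num_writeNum]
    have hM := attachLeaf_modifies (H := H) (σ := s₁) (K := K) (a := a) (v := v) hsa hsv hH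
    obtain ⟨T', q1, q2, q3, -, q5, q6, q7⟩ := redistribute_spec (σ := s₁) hM hs0
      (p1.congr rfl rfl hs1w rfl) (by rw [hs1m]; exact hrel a)
      (by change s.nat natCnt 0 < _; omega) rfl
    set s₂ := (redistribute canAttach attachLeaf).run s₁ with hs₂
    have hsum : ∀ Δ : Fin n → K,
        (∑ l : Fin n, if (l : ℕ) < k + 1 then σ.num arrRel l * Δ l else 0) =
        (∑ l : Fin n, if (l : ℕ) < k then σ.num arrRel l * Δ l else 0) + σ.num arrRel a * Δ a := by
      intro Δ
      have : ∀ l : Fin n, (if (l : ℕ) < k + 1 then σ.num arrRel l * Δ l else 0) =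
          (if (l : ℕ) < k then σ.num arrRel l * Δ l else 0) +
          if l = a then σ.num arrRel a * Δ a else 0 := by
        intro l
        by_cases hla : l = a
        · subst hla; simp [ha]
        · have h1 : (l : ℕ) ≠ k := fun c => hla (Fin.ext c)
          have h2 : (l : ℕ) < k + 1 ↔ (l : ℕ) < k := by omega
          simp [hla, h2]
      simp only [this, Finset.sum_add_distrib]
      simp
    have q6' : ∀ (φ : (⊤ : SimpleGraph (Fin n)).Subgraph → K) (Δ : Fin n → K),
        (∀ a T T' (g : Fin n → K), LeafStep a v T T' g → φ T' = φ T + Δ a) →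
        total s₂ T' φ = total s T₀ φ + (σ.num arrRel a - s₂.num numRem 0) * Δ a := by
      intro φ Δ hφ
      have := q6 φ 0 (Δ a) (fun T T' g hg => by simp [hφ a T T' g hg])
      simpa [hs1m, total_congr T₀ φ hs1w] using this
    -- Otherwise every tree through `a` contains `v`, so `v` is covered at least as much as `a`,
    -- that is, at least `Y`. But some released weight is unused, hence `v` is covered strictly less
    -- than `Y`.
    have hr0 : s₂.num numRem 0 = 0 := by
      by_contra hne
      have h := q7.resolve_left hne
      have hpos : 0 < s₂.num numRem 0 := lt_of_le_of_ne q2 (Ne.symm hne)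
      have hra' : 0 < σ.num arrRel a := by rw [hs1m] at q3; linarith
      obtain ⟨hav, hY⟩ := hge a hra'
      have hle : total s₂ T' (memFun K a) ≤ total s₂ T' (memFun K v) := by
        refine q1.total_mono fun t ht => ?_
        by_cases hat : a ∈ (T' t).verts
        · have hvt : v ∈ (T' t).verts := by
            by_contra hvt
            exact h t ht ⟨hat, hvt⟩
          rw [memFun, memFun, if_pos hat, if_pos hvt]
        · rw [memFun, if_neg hat]
          exact memFun_nonneg v
      have e1 := q6' (memFun K a) 0 (fun _ T T' g hg => by simp [hg.memFun hav])
      have e2 := q6' (memFun K v) 1 (fun _ T T' g hg => by simp [hg.memFun_self])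
      have e3 := p4 (memFun K a) 0 (fun _ T T' g hg => by simp [hg.memFun hav])
      have e4 := p4 (memFun K v) 1 (fun _ T T' g hg => by simp [hg.memFun_self])
      have e5 : (∑ l : Fin n, if (l : ℕ) < k then σ.num arrRel l * (1 : Fin n → K) l else 0) +
          σ.num arrRel a * (1 : Fin n → K) a ≤ ∑ l : Fin n, σ.num arrRel l := by
        rw [← hsum]
        refine Finset.sum_le_sum fun l _ => ?_
        split_ifs
        · simp
        · exact hrel l
      simp only [Pi.zero_apply, mul_zero, ite_self, Finset.sum_const_zero, add_zero, Pi.one_apply,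
        mul_one] at e1 e2 e3 e4 e5
      linarith
    have hrel2 : s₂.num arrRel = s₁.num arrRel := Code.run_num_of_notMem _ (by decide) _
    refine ⟨T', q1.congr (hwr _ _ (by decide)) (hwr _ _ (by decide)) rfl (hwr _ _ (by decide)),
      ?_, ?_, ?_⟩
    · rw [hwr _ _ (by decide)]
      have : s₁.nat natCnt 0 = s.nat natCnt 0 := rfl
      omega
    · intro l hl
      have hlk : (l : ℕ) ≠ k := by omega
      rw [State.num_writeNat, hrel2, ← p3 l (by omega)]
      simp [hs₁, State.num_writeNum, hlk]
    · intro φ Δ hφ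
      rw [show total (s₂.writeNat ctrA 0 (k + 1)) T' φ = total s₂ T' φ from rfl, q6' φ Δ hφ, p4 φ Δ hφ, hsum, hr0]
      ring

end InsertSpec

/-! ### Recovering the weights before a splitting off. -/

section SplitWeight

variable {K : Type} [Field K] [LinearOrder K] [IsStrictOrderedRing K] {n : ℕ}
  {S S' : Fin n → Fin n → K} {v : Fin n}

theorem splitWeight_symm (hsymm : ∀ a b, S a b = S b a) (hsymm' : ∀ a b, S' a b = S' b a)
    (p q : Fin n) : splitWeight S S' v p q = splitWeight S S' v q p := by
  simp only [splitWeight, hsymm p q, hsymm' p q]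
  exact if_congr (by rw [ne_comm]; tauto) rfl rfl

/-- The degree of `i` is preserved and `{i,v}` loses all its weight, so the gains on the other edges
at `i` add up to `S i v`. -/
theorem SplitStep.sum_splitWeight (h : SplitStep S S' v) (hd : ∀ a, S a a = 0) (hd' : ∀ a, S' a a = 0)
    (i : Fin n) : 2 * ∑ q, splitWeight S S' v i q = S i v := by
  by_cases hi : i = v
  · subst hi
    simp [splitWeight, hd]
  · have h1 : ∀ q, splitWeight S S' v i q = (S' i q - S i q) / 2 + if q = v then S i v / 2 else 0 := by
      intro q
      unfold splitWeight
      by_cases hq : q = v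
      · subst hq
        rw [if_neg (by tauto), if_pos rfl, h.isolated]
        ring
      · by_cases hiq : i = q
        · subst hiq
          simp [hd, hd', hi]
        · simp [hi, hq, hiq]
    have h2 := h.sum_eq i hi
    simp only [h1, Finset.sum_add_distrib, ← Finset.sum_div, Finset.sum_sub_distrib, h2]
    simp
    ring

/-- Only the two matrices before and after are needed, not the sequence of single splits. Away from
`v` the identity is the definition of the weights, and at `v` it follows from the row sums. -/
theorem SplitStep.eq_add (h : SplitStep S S' v) (hd : ∀ a, S a a = 0) (hd' : ∀ a, S' a a = 0)
    (hsymm : ∀ a b, S a b = S b a) (hsymm' : ∀ a b, S' a b = S' b a) (i j : Fin n) :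
    S' i j + ∑ p, ∑ q, splitWeight S S' v p q *
      (edgeMatrix p v i j + edgeMatrix q v i j - edgeMatrix p q i j) = S i j := by
  have hadd : ∀ {i j : Fin n}, i ≠ j → ∑ p, ∑ q, splitWeight S S' v p q *
      (edgeMatrix p v i j + edgeMatrix q v i j - edgeMatrix p q i j) =
      (∑ p, (∑ q, splitWeight S S' v p q) * edgeMatrix p v i j) +
      (∑ q, (∑ p, splitWeight S S' v p q) * edgeMatrix q v i j) -
      (splitWeight S S' v i j + splitWeight S S' v j i) := by
    intro i j hij
    rw [← sum_sum_mul_edgeMatrix (K := K) (splitWeight S S' v) hij]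
    simp only [Finset.sum_mul]
    rw [Finset.sum_comm (f := fun q p => splitWeight S S' v p q * (edgeMatrix q v i j : K))]
    simp only [← Finset.sum_add_distrib, ← Finset.sum_sub_distrib]
    exact Finset.sum_congr rfl fun p _ => Finset.sum_congr rfl fun q _ => by ring
  have hcol : ∀ i, 2 * ∑ p, splitWeight S S' v p i = S i v := by
    intro i
    rw [← h.sum_splitWeight hd hd' i]
    congr 1
    exact Finset.sum_congr rfl fun p _ => splitWeight_symm hsymm hsymm' p i
  have hv : ∀ i, i ≠ v → S' i v + ∑ p, ∑ q, splitWeight S S' v p q *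
      (edgeMatrix p v i v + edgeMatrix q v i v - edgeMatrix p q i v) = S i v := by
    intro i hi
    rw [hadd hi, h.isolated]
    have h1 : ∀ p, (edgeMatrix p v i v : K) = if p = i then 1 else 0 := by
      intro p
      rw [edgeMatrix_eq]
      refine if_congr ?_ rfl rfl
      unfold IsEdge
      constructor
      · rintro (⟨h, -⟩ | ⟨h, -⟩)
        · exact h.symm
        · exact absurd h hi
      · rintro rfl
        exact Or.inl ⟨rfl, rfl⟩
    have h2 : splitWeight S S' v i v = 0 := if_neg (by tauto)
    have h3 : splitWeight S S' v v i = 0 := if_neg (by tauto)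
    simp only [h1, h2, h3, mul_ite, mul_one, mul_zero, Finset.sum_ite_eq', Finset.mem_univ, if_true]
    have h4 := h.sum_splitWeight hd hd' i
    have h5 := hcol i
    linarith
  by_cases hij : i = j
  · subst hij
    rw [hd, hd', zero_add]
    refine Finset.sum_eq_zero fun p _ => Finset.sum_eq_zero fun q _ => ?_
    unfold splitWeight
    split_ifs with hw
    · have h1 : ∀ p q : Fin n, p ≠ q → (edgeMatrix p q i i : K) = 0 := by
        intro p q hpq
        rw [edgeMatrix_eq, if_neg]
        rintro (⟨rfl, rfl⟩ | ⟨rfl, rfl⟩) <;> exact hpq rfl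
      rw [h1 _ _ hw.1, h1 _ _ hw.2.1, h1 _ _ hw.2.2]
      ring
    · ring
  · by_cases hj : j = v
    · subst hj
      exact hv i hij
    · by_cases hi : i = v
      · subst hi
        rw [hsymm i j, hsymm' i j, ← hv j hj]
        congr 1
        refine Finset.sum_congr rfl fun p _ => Finset.sum_congr rfl fun q _ => ?_
        rw [edgeMatrix_symm p, edgeMatrix_symm q, edgeMatrix_symm p q]
      · rw [hadd hij]
        have h1 : ∀ p, (edgeMatrix p v i j : K) = 0 := by
          intro p
          rw [edgeMatrix_eq, if_neg]
          rintro (⟨-, h⟩ | ⟨h, -⟩)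
          · exact hj h
          · exact hi h
        have h2 : splitWeight S S' v i j = (S' i j - S i j) / 2 := if_pos ⟨hij, hi, hj⟩
        rw [splitWeight_symm hsymm hsymm' j i, h2]
        simp only [h1, mul_zero, Finset.sum_const_zero]
        ring

end SplitWeight

/-! ### Reinsertion of a vertex and the invariant of the families of trees. -/

section InsertStage

variable {K : Type} [Field K] [LinearOrder K] [IsStrictOrderedRing K] {n : ℕ}

/-- The vertex set `U ⊆ W` contains two vertices of the core set. -/
def Anchored (y : Fin n → K) (W : Finset (Fin n)) (U : Set (Fin n)) : Prop :=
  (U ∩ core y).ncard = 2 ∧ U ⊆ W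

/-- The family `T` of trees decomposes the weights `S - F` on the vertex set `W`; its trees connect
the vertices of the core set as described by the weights `Z - F`. -/
structure Represents (y : Fin n → K) (Z F S : Fin n → Fin n → K) (W : Finset (Fin n)) (s : State K)
    (T : ℕ → (⊤ : SimpleGraph (Fin n)).Subgraph) : Prop where
  family : Family (GoodTree (Anchored y W)) s T
  adj : ∀ i j, total s T (adjFun K i j) = S i j - F i j
  cover : ∀ w ∈ W, y w ≠ 1 → total s T (memFun K w) = y w
  cover_core : ∀ w, y w = 1 → 1 ≤ total s T (memFun K w)
  pair : ∀ a b, a ≠ b → y a = 1 → y b = 1 →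
    total s T (fun T => memFun K a T * memFun K b T) = Z a b - F a b

theorem Represents.congr {y : Fin n → K} {Z F S : Fin n → Fin n → K} {W : Finset (Fin n)}
    {s s' : State K} {T : ℕ → (⊤ : SimpleGraph (Fin n)).Subgraph} (h : Represents y Z F S W s T)
    (h1 : s'.nat arrVert = s.nat arrVert) (h2 : s'.nat arrAdj = s.nat arrAdj)
    (h3 : s'.num arrWt = s.num arrWt) (h4 : s'.nat natCnt = s.nat natCnt) :
    Represents y Z F S W s' T :=
  ⟨h.family.congr h1 h2 h3 h4, fun i j => by rw [total_congr _ _ h3, h.adj],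
    fun w hw hy => by rw [total_congr _ _ h3, h.cover w hw hy],
    fun w hy => by rw [total_congr _ _ h3]; exact h.cover_core w hy,
    fun a b hab ha hb => by rw [total_congr _ _ h3, h.pair a b hab ha hb]⟩

variable {y : Fin n → K} {Z F S S' : Fin n → Fin n → K} {W : Finset (Fin n)} {r v : Fin n}
  {T : ℕ → (⊤ : SimpleGraph (Fin n)).Subgraph}

/-- This combines the two phases. Rerouting yields the edge weights `S - F` up to the released
edges, and attaching leaves inserts exactly these. Coverage of other vertices and anchor pairs are
untouched, as `v` is the only vertex added. -/
theorem insertVertex_spec {σ : State K} (hn : σ.nat 0 0 = n) (hv : σ.nat natV 0 = v) {i : ℕ}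
    (hi : σ.nat natI 0 = i) (hS : σ.snap n i = S) (hS' : σ.snap n (i + 1) = S')
    (hf : CutFeasible W r (fun w => 2 * y w) S) (hiso : ∀ w ∉ W, ∀ j, S w j = 0)
    (hsymm' : ∀ a b, S' a b = S' b a) (hd' : ∀ a, S' a a = 0)
    (hstep : SplitStep S S' v) (hvW : v ∈ W) (hy1 : y v < 1) (hle1 : ∀ w, y w ≤ 1)
    (hmin : ∀ w ∈ W, y w < 1 → y v ≤ y w) (hF0 : ∀ a b, 0 ≤ F a b) (hFS : ∀ a b, F a b ≤ S a b)
    (hR : Represents y Z F S' (W.erase v) σ T) (hcnt : σ.nat natCnt 0 + (n * n + n) ≤ n ^ 5)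
    {σ' : State K} (hσ' : (Code.loop ctrA 1 (.setNum arrRel (.var ctrA) .zero) ;; rerouteAll ;;
      attachAll).run σ = σ') :
    ∃ T', Represents y Z F S W σ' T' ∧ σ'.nat natCnt 0 ≤ σ.nat natCnt 0 + (n * n + n) := by
  obtain ⟨g1, -⟩ := Code.run_loop_setNum (σ := σ) (n := n) (a := arrRel) (b := ctrA)
    (ix := .var ctrA) (ex := .zero) hn (fun j => j) (fun _ => (0 : K)) (by simp) (by simp)
  simp only [Code.run_seq] at hσ'
  set σ₁ := (Code.loop ctrA 1 (.setNum arrRel (.var ctrA) .zero)).run σ with hσ₁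
  have hnat1 : ∀ c, c ≠ ctrA → σ₁.nat c = σ.nat c := by
    intro c hc
    rw [hσ₁, Code.run_nat_of_notMem]
    change c ∉ [ctrA]
    simpa using hc
  have hnum1 : ∀ c, c ≠ arrRel → σ₁.num c = σ.num c := by
    intro c hc
    rw [hσ₁, Code.run_num_of_notMem]
    change c ∉ [arrRel]
    simpa using hc
  have hrel1 : ∀ a : Fin n, σ₁.num arrRel a = 0 := fun a => g1 a a.2
  have hR1 : Represents y Z F S' (W.erase v) σ₁ T := hR.congr (hnat1 _ (by decide))
    (hnat1 _ (by decide)) (hnum1 _ (by decide)) (hnat1 _ (by decide))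
  have hvcore : v ∉ core y := fun h => hy1.ne h
  -- Inserting `v` does not change the anchors because `v` is not in the core set.
  have hH : ∀ U, Anchored y W U → Anchored y W (insert v U) := by
    rintro U ⟨h1, h2⟩
    refine ⟨?_, Set.insert_subset hvW h2⟩
    rw [Set.insert_inter_of_notMem hvcore, h1]
  have hF1 : Family (GoodTree (Anchored y W)) σ₁ T := hR1.family.mono fun T h =>
    ⟨h.1, h.2.1, fun x hx => Finset.mem_of_mem_erase (h.2.2 hx)⟩
  have hcnt1 : σ₁.nat natCnt 0 = σ.nat natCnt 0 := by rw [hnat1 _ (by decide)]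
  obtain ⟨T₂, k1, k2, k3, k4⟩ := rerouteAll_spec (σ := σ₁) (v := v) (i := i) (F := F)
    (by rw [hnat1 _ (by decide), hn]) (by rw [hnat1 _ (by decide), hv])
    (by rw [hnat1 _ (by decide), hi]) hH hF1 (S := S) (S' := S')
    (by rw [← hS]; funext a b; rw [State.snap, hnum1 _ (by decide)]; rfl)
    (by rw [← hS']; funext a b; rw [State.snap, hnum1 _ (by decide)]; rfl)
    hstep.mono hf.symm hsymm' (fun a b _ _ => hFS a b) hR1.adj (by omega) rfl
  set σ₂ := rerouteAll.run σ₁ with hσ₂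
  have hnat2 : ∀ c, c ∉ rerouteAll.natWrites → σ₂.nat c = σ₁.nat c := fun c hc =>
    Code.run_nat_of_notMem _ hc _
  have hrel2 : ∀ a : Fin n, 0 ≤ σ₂.num arrRel a := fun a => by rw [← hrel1 a]; exact k2 a
  have hadj2 : ∀ i j, total σ₂ T₂ (adjFun K i j) + ∑ l, edgeMatrix l v i j * σ₂.num arrRel l =
      S i j - F i j := by
    intro i j
    rw [k4 (adjFun K i j) (fun l => edgeMatrix l v i j)
      (fun p q => edgeMatrix p v i j + edgeMatrix q v i j - edgeMatrix p q i j)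
      (fun p q hp hq T T' g hg => hg.adjFun hp hq i j), hR1.adj,
      ← hstep.eq_add hf.diag hd' hf.symm hsymm' i j]
    simp only [hrel1, mul_zero, Finset.sum_const_zero]
    ring
  have hcov2 : ∀ w, w ≠ v → total σ₂ T₂ (memFun K w) = total σ₁ T (memFun K w) := by
    intro w hw
    have := k4 (memFun K w) 0 0 (fun p q hp hq T T' g hg => by simp [hg.memFun hw])
    simpa using this
  have hpair2 : ∀ a b, a ≠ v → b ≠ v → total σ₂ T₂ (fun T => memFun K a T * memFun K b T) =
      total σ₁ T (fun T => memFun K a T * memFun K b T) := by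
    intro a b ha hb
    have := k4 (fun T => memFun K a T * memFun K b T) 0 0
      (fun p q hp hq T T' g hg => by simp [hg.memFun ha, hg.memFun hb])
    simpa using this
  -- At first no tree contains `v`. The total amount rerouted is half of the degree `2 * y v` of
  -- `v`.
  have hcovv : total σ₂ T₂ (memFun K v) + ∑ a : Fin n, σ₂.num arrRel a = y v := by
    have h1 := k4 (memFun K v) (fun _ => 1) (fun _ _ => 1)
      (fun p q hp hq T T' g hg => hg.memFun_self)
    have h2 : total σ₁ T (memFun K v) = 0 := by
      refine le_antisymm ?_ (hF1.total_nonneg fun _ => memFun_nonneg v)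
      rw [← total_zero (s := σ₁) (T := T)]
      refine hR1.family.total_mono fun t ht => ?_
      rw [memFun, if_neg]
      intro h
      have := (hR1.family.good t ht).2.2 h
      simp at this
    have h3 := hf.degree v hvW
    have h4 : ∑ j, S v j = 2 * ∑ p, ∑ q, splitWeight S S' v p q := by
      rw [Finset.mul_sum]
      refine Finset.sum_congr rfl fun j _ => ?_
      rw [hstep.sum_splitWeight hf.diag hd' j, hf.symm]
    simp only [one_mul, mul_one, hrel1, h2, Finset.sum_const_zero] at h1
    rw [h1]
    linarith
  obtain ⟨T₃, l1, l2, l3⟩ := attachAll_spec (σ := σ₂) (v := v) (Y := y v)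
    (by rw [hnat2 _ (by decide), hnat1 _ (by decide), hn])
    (by rw [hnat2 _ (by decide), hnat1 _ (by decide), hv]) hH k1 hrel2 hcovv (by
      intro a ha
      have h1 := hadj2 a v
      -- A released edge `{a,v}` is part of the weight `S a v`, which is therefore positive; in
      -- particular `a` belongs to `W` and differs from `v`.
      have h2 : σ₂.num arrRel a ≤ ∑ l : Fin n, edgeMatrix l v a v * σ₂.num arrRel l := by
        have h3 : (edgeMatrix a v a v : K) = 1 := if_pos (Or.inl ⟨rfl, rfl⟩)
        have h4 := Finset.single_le_sum (f := fun l : Fin n => edgeMatrix l v a v * σ₂.num arrRel l)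
          (fun l _ => mul_nonneg (edgeMatrix_nonneg _ _ _ _) (hrel2 l)) (Finset.mem_univ a)
        simp only [h3, one_mul] at h4
        exact h4
      have h3 := k1.total_nonneg fun T => adjFun_nonneg (K := K) (T := T) a v
      have h4 := hF0 a v
      have h5 : 0 < S a v := by linarith
      have hav : a ≠ v := by
        rintro rfl
        rw [hf.diag] at h5
        exact lt_irrefl _ h5
      have haW : a ∈ W := by
        by_contra haW
        rw [hiso a haW] at h5
        exact lt_irrefl _ h5
      refine ⟨hav, ?_⟩
      rw [hcov2 a hav]
      -- Here the order of elimination enters: a vertex outside the core set that is still present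
      -- has `y a ≥ y v`, and a core vertex is covered at least once.
      rcases (hle1 a).eq_or_lt with h6 | h6
      · exact hy1.le.trans (hR1.cover_core a h6)
      · rw [hR1.cover a (Finset.mem_erase.2 ⟨hav, haW⟩) h6.ne]
        exact hmin a haW h6) (by omega) hσ'
  refine ⟨T₃, ⟨l1, ?_, ?_, ?_, ?_⟩, by omega⟩
  · intro i j
    rw [l3 (adjFun K i j) (fun a => edgeMatrix a v i j) (fun a T T' g hg => hg.adjFun i j), ← hadj2]
    congr 1
    exact Finset.sum_congr rfl fun a _ => mul_comm _ _
  · intro w hw hyw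
    by_cases hwv : w = v
    · rw [hwv, l3 (memFun K v) (fun _ => 1) (fun a T T' g hg => hg.memFun_self), ← hcovv]
      simp
    · rw [l3 (memFun K w) (fun _ => 0) (fun a T T' g hg => by simp [hg.memFun hwv]), hcov2 w hwv,
        hR1.cover w (Finset.mem_erase.2 ⟨hwv, hw⟩) hyw]
      simp
  · intro w hyw
    have hwv : w ≠ v := fun h => hy1.ne (h ▸ hyw)
    rw [l3 (memFun K w) (fun _ => 0) (fun a T T' g hg => by simp [hg.memFun hwv]), hcov2 w hwv]
    simpa using hR1.cover_core w hyw
  · intro a b hab ha hb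
    have hav : a ≠ v := fun h => hy1.ne (h ▸ ha)
    have hbv : b ≠ v := fun h => hy1.ne (h ▸ hb)
    rw [l3 _ (fun _ => 0) (fun _ T T' g hg => by simp [hg.memFun hav, hg.memFun hbv]),
      hpair2 a b hav hbv, hR1.pair a b hab ha hb]
    simp

/-- Stage `k` undoes the elimination stage `n - (k + 1)`. The bound on the counter allows `n * n`
copies for rerouting and `n` for the leaves in each stage. -/
theorem insertAll_spec {σ : State K} (hn : σ.nat 0 0 = n) (hle1 : ∀ w, y w ≤ 1)
    (hh : SplitHistory r y (σ.snap n) (σ.nat arrOrd) n) (hF0 : ∀ a b, 0 ≤ F a b)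
    (hFS : ∀ i ≤ n, ∀ a b, F a b ≤ σ.snap n i a b)
    (hR : Represents y Z F (σ.snap n n) (remaining n (σ.nat arrOrd) n) σ T)
    (hcnt : σ.nat natCnt 0 + n * (n * n + n) ≤ n ^ 5) {σ' : State K} (hσ' : insertAll.run σ = σ') :
    ∃ T', Represents y Z F (σ.snap n 0) Finset.univ σ' T' ∧
      σ'.nat natCnt 0 ≤ σ.nat natCnt 0 + n * (n * n + n) := by
  set ord := σ.nat arrOrd with hord
  have key := Code.loop_induction (a := ctrStage) (d := 1) (c := insertStage) hn
    (fun k s => ∃ T', Represents y Z F (σ.snap n (n - k)) (remaining n ord (n - k)) s T' ∧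
      s.nat natCnt 0 ≤ σ.nat natCnt 0 + k * (n * n + n)) ?_ ?_
  · rw [pow_one] at key
    have hrun : insertAll.run σ = (Code.loop ctrStage 1 insertStage).run σ := rfl
    rw [← hrun, hσ', Nat.sub_self] at key
    have hrem0 : remaining n ord 0 = Finset.univ := by ext w; simp [mem_remaining]
    rwa [hrem0] at key
  · have hwr : ∀ c, c ≠ ctrStage → (σ.writeNat ctrStage 0 0).nat c = σ.nat c := by
      intro c hc; funext z; simp [State.nat_writeNat, hc]
    exact ⟨T, hR.congr (hwr _ (by decide)) (hwr _ (by decide)) rfl (hwr _ (by decide)),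
      by rw [hwr _ (by decide)]; omega⟩
  · rintro k hk s hs hnat hnum ⟨T₀, p1, p2⟩
    rw [pow_one] at hk
    have hs0 : s.nat 0 0 = n := by rw [hnat _ (by decide), hn]
    have hsO : s.nat arrOrd = ord := hnat _ (by decide)
    have hsS : s.num arrSnap = σ.num arrSnap := hnum _ (by decide)
    obtain ⟨i, hi⟩ : ∃ i, n - (k + 1) = i := ⟨_, rfl⟩
    have hi1 : n - k = i + 1 := by omega
    rw [hi1] at p1
    rw [hi]
    have hwr : ∀ (s : State K) c, c ≠ ctrStage → (s.writeNat ctrStage 0 (k + 1)).nat c = s.nat c := by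
      intro s c hc; funext z; simp [State.nat_writeNat, hc]
    have hfin : ∀ s' : State K, (∃ T', Represents y Z F (σ.snap n i) (remaining n ord i) s' T' ∧
        s'.nat natCnt 0 ≤ s.nat natCnt 0 + (n * n + n)) →
        ∃ T', Represents y Z F (σ.snap n i) (remaining n ord i) (s'.writeNat ctrStage 0 (k + 1)) T' ∧
          (s'.writeNat ctrStage 0 (k + 1)).nat natCnt 0 ≤ σ.nat natCnt 0 + (k + 1) * (n * n + n) := by
      rintro s' ⟨T', h1, h2⟩
      refine ⟨T', h1.congr (hwr _ _ (by decide)) (hwr _ _ (by decide)) rfl (hwr _ _ (by decide)), ?_⟩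
      rw [hwr _ _ (by decide), add_mul, one_mul]
      omega
    apply hfin
    set s₁ := (s.writeNat natI 0 i).writeNat natV 0 (ord i) with hs₁
    have hrun : insertStage.run s = (Code.when (.nlt (.var natV) .card)
        (.loop ctrA 1 (.setNum arrRel (.var ctrA) .zero) ;; rerouteAll ;; attachAll)).run s₁ := by
      simp only [insertStage, Code.run_seq, Code.run_letNat, NExp.eval_sub, NExp.eval_card,
        NExp.eval_add, NExp.eval_var, NExp.eval_lit, NExp.eval_get, hs0, hs, hi, State.nat_writeNat,
        hsO, hs₁]
      simp
    rw [hrun]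
    have hwr1 : ∀ c, c ≠ natI → c ≠ natV → s₁.nat c = s.nat c := by
      intro c h1 h2; funext z; simp [hs₁, State.nat_writeNat, h1, h2]
    have p1' : Represents y Z F (σ.snap n (i + 1)) (remaining n ord (i + 1)) s₁ T₀ :=
      p1.congr (hwr1 _ (by decide) (by decide)) (hwr1 _ (by decide) (by decide)) rfl
        (hwr1 _ (by decide) (by decide))
    have hc1 : s₁.nat natCnt 0 = s.nat natCnt 0 := by rw [hwr1 _ (by decide) (by decide)]
    have hs10 : s₁.nat 0 0 = n := by rw [hwr1 _ (by decide) (by decide), hs0]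
    have hV1 : s₁.nat natV 0 = ord i := by simp [hs₁, State.nat_writeNat]
    have hI1 : s₁.nat natI 0 = i := by simp [hs₁, State.nat_writeNat]
    have hsn : ∀ m, s₁.snap n m = σ.snap n m := by
      intro m; funext a b
      have : s₁.num = s.num := rfl
      rw [State.snap, this, hsS]; rfl
    rcases hh.step i (by omega) with ⟨h1, h2⟩ | ⟨v, h1, h2, h3, h4, h5⟩
    · rw [Code.run_when_false (by simp [hV1, hs10, h1])]
      have hrem : remaining n ord (i + 1) = remaining n ord i := by
        ext w
        rw [mem_remaining_succ, h1]
        have := w.2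
        exact ⟨fun h => h.1, fun h => ⟨h, by omega⟩⟩
      rw [h2, hrem] at p1'
      exact ⟨T₀, p1', by omega⟩
    · rw [Code.run_when_true (by simp [hV1, hs10, h1])]
      have hrem : remaining n ord (i + 1) = (remaining n ord i).erase v := by
        ext w
        rw [mem_remaining_succ, h1, Finset.mem_erase, and_comm, ne_comm, ne_eq, ne_eq, Fin.ext_iff]
      rw [hrem] at p1'
      have hf := hh.feasible i (by omega)
      have hf' := hh.feasible (i + 1) (by omega)
      have hb : s.nat natCnt 0 + (n * n + n) ≤ n ^ 5 := by
        have : (k + 1) * (n * n + n) ≤ n * (n * n + n) := Nat.mul_le_mul_right _ hk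
        rw [add_mul, one_mul] at this
        omega
      obtain ⟨T', m1, m2⟩ := insertVertex_spec (σ := s₁) (i := i) hs10 (by rw [hV1, h1]) hI1 (hsn i)
        (hsn (i + 1)) hf (hh.isolated i (by omega)) hf'.symm hf'.diag h5 h2 h3 hle1 h4 hF0
        (hFS i (by omega)) p1' (by rw [hc1]; exact hb) rfl
      exact ⟨T', m1, by rw [hc1] at m2; exact m2⟩

end InsertStage

/-! ### The initial trees -/

/-- Removes one copy of the edge `e₀`. -/
def subtractEdge : Code :=
  .letNum numN (.sub .zero .one) ;; addEdge (.get 0 (.lit 2)) (.get 0 (.lit 3)) numN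

/-- Creates a tree with a single edge. -/
def createTree : Code :=
  .setNat arrVert (.pr (.var natCnt) (.var ctrA)) (.lit 1) ;;
  .setNat arrVert (.pr (.var natCnt) (.var ctrB)) (.lit 1) ;;
  .setNat arrAdj (.pr (.pr (.var natCnt) (.var ctrA)) (.var ctrB)) (.lit 1) ;;
  .setNat arrAdj (.pr (.pr (.var natCnt) (.var ctrB)) (.var ctrA)) (.lit 1) ;;
  .setNum arrWt (.var natCnt) (.half (.get arrX (.pr (.var ctrA) (.var ctrB)))) ;;
  .letNat natCnt (.add (.var natCnt) (.lit 1))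

/-- Creates trees for all edges. -/
def createTrees : Code :=
  .loop ctrA 1 (.loop ctrB 1 (.when (.flt .zero (.get arrX (.pr (.var ctrA) (.var ctrB)))) createTree))

section Create

variable {K : Type} [Field K] [LinearOrder K] [IsStrictOrderedRing K] {n : ℕ}

/-- The tree with a single edge `{p, q}`. -/
def edgeTree (p q : Fin n) : (⊤ : SimpleGraph (Fin n)).Subgraph where
  verts := {p, q}
  Adj i j := p ≠ q ∧ IsEdge p q i j
  adj_sub {i j} h := by
    rw [SimpleGraph.top_adj]
    rintro rfl
    rcases h with ⟨h, ⟨rfl, rfl⟩ | ⟨rfl, rfl⟩⟩ <;> exact h rfl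
  edge_vert {i j} h := by
    rcases h with ⟨-, ⟨rfl, -⟩ | ⟨rfl, -⟩⟩ <;> simp
  symm := ⟨fun i j h => ⟨h.1, h.2.symm⟩⟩

theorem isSubtree_edgeTree {p q : Fin n} (hpq : p ≠ q) : IsSubtree (edgeTree p q) :=
  IsSubtree.edge hpq rfl fun _ _ => and_iff_right hpq

theorem adjFun_edgeTree {p q : Fin n} (hpq : p ≠ q) (i j : Fin n) :
    adjFun K i j (edgeTree p q) = edgeMatrix p q i j := by
  have h : (edgeTree p q).Adj i j ↔ IsEdge p q i j := and_iff_right hpq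
  unfold adjFun
  rw [edgeMatrix_eq]
  by_cases he : IsEdge p q i j
  · rw [if_pos he, if_pos (h.2 he)]
  · rw [if_neg he, if_neg (fun c => he (h.1 c))]

theorem memFun_edgeTree {p q : Fin n} (hpq : p ≠ q) (w : Fin n) :
    memFun K w (edgeTree p q) = (if p = w then 1 else 0) + if q = w then 1 else 0 := by
  have h : w ∈ (edgeTree p q).verts ↔ w = p ∨ w = q := Iff.rfl
  unfold memFun
  by_cases h1 : p = w
  · subst h1
    rw [if_pos (h.2 (Or.inl rfl))]
    simp [hpq.symm]
  · by_cases h2 : q = w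
    · subst h2
      rw [if_pos (h.2 (Or.inr rfl))]
      simp [hpq]
    · rw [if_neg (fun c => (h.1 c).elim (fun c => h1 c.symm) fun c => h2 c.symm)]
      simp [h1, h2]

theorem memFun_mul_edgeTree {p q : Fin n} (hpq : p ≠ q) {a b : Fin n} (hab : a ≠ b) :
    memFun K a (edgeTree p q) * memFun K b (edgeTree p q) = edgeMatrix p q a b := by
  have h : IsEdge p q a b ↔ (p = a ∧ q = b) ∨ (q = a ∧ p = b) := by
    unfold IsEdge
    constructor <;> rintro (⟨rfl, rfl⟩ | ⟨rfl, rfl⟩) <;> simp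
  rw [memFun_edgeTree hpq, memFun_edgeTree hpq, edgeMatrix_eq, if_congr h rfl rfl]
  by_cases c1 : p = a
  · have c2 : q ≠ a := fun e => hpq (c1.trans e.symm)
    have c3 : p ≠ b := fun e => hab (c1.symm.trans e)
    simp [c1, c2, c3, hab]
  · by_cases c2 : q = a
    · have c4 : q ≠ b := fun e => hab (c2.symm.trans e)
      simp [c1, c2, c4, hab]
    · simp [c1, c2]

/-- Every edge gives rise to two trees, one for each order of its ends, with half of its weight
each. Equal trees are merged only in the output. -/
theorem createTrees_spec {σ : State K} (hn : σ.nat 0 0 = n) {X : Fin n → Fin n → K}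
    (hX : σ.mat n arrX = X) (hnn : ∀ i j, 0 ≤ X i j) (hd : ∀ i, X i i = 0)
    {Good : (⊤ : SimpleGraph (Fin n)).Subgraph → Prop}
    (hGood : ∀ p q, 0 < X p q → Good (edgeTree p q)) (hV : ∀ x, σ.nat arrVert x = 0)
    (hA : ∀ x, σ.nat arrAdj x = 0) (hW : ∀ x, σ.num arrWt x = 0) (hC : σ.nat natCnt 0 = 0)
    {σ' : State K} (hσ' : createTrees.run σ = σ') :
    ∃ T, Family Good σ' T ∧ σ'.nat natCnt 0 ≤ n * n ∧
      ∀ φ, total σ' T φ = ∑ p, ∑ q, X p q / 2 * φ (edgeTree p q) := by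
  set body := Code.when (.flt .zero (.get arrX (.pr (.var ctrA) (.var ctrB)))) createTree with hbody
  have key := Code.loop_loop_induction (a := ctrA) (b := ctrB) (c := body) hn (by decide) (by decide)
    (by decide) (by decide) (by decide)
    (fun k m s => ∃ T, Family Good s T ∧ s.nat natCnt 0 ≤ k * n + m ∧
      (∀ t, s.nat natCnt 0 ≤ t → ∀ i, s.nat arrVert (pr t i) = 0) ∧
      (∀ t, s.nat natCnt 0 ≤ t → ∀ i j, s.nat arrAdj (pr (pr t i) j) = 0) ∧
      ∀ φ, total s T φ = lexSum (fun p q => X p q / 2 * φ (edgeTree p q)) k m) ?_ ?_ ?_ ?_ ?_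
  · have hrun : createTrees.run σ = (Code.loop ctrA 1 (.loop ctrB 1 body)).run σ := rfl
    rw [← hrun, hσ'] at key
    obtain ⟨T, k1, k2, -, -, k5⟩ := key
    refine ⟨T, k1, by omega, fun φ => ?_⟩
    rw [k5, lexSum_all]
  · rintro k m s x ⟨T', k1, k2, k3, k4, k5⟩
    have hwr : ∀ c, c ≠ ctrA → (s.writeNat ctrA 0 x).nat c = s.nat c := by
      intro c hc; funext z; simp [State.nat_writeNat, hc]
    refine ⟨T', k1.congr (hwr _ (by decide)) (hwr _ (by decide)) rfl (hwr _ (by decide)), ?_, ?_, ?_, k5⟩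
    · rwa [hwr _ (by decide)]
    · rwa [hwr _ (by decide), hwr _ (by decide)]
    · rwa [hwr _ (by decide), hwr _ (by decide)]
  · rintro k m s x ⟨T', k1, k2, k3, k4, k5⟩
    have hwr : ∀ c, c ≠ ctrB → (s.writeNat ctrB 0 x).nat c = s.nat c := by
      intro c hc; funext z; simp [State.nat_writeNat, hc]
    refine ⟨T', k1.congr (hwr _ (by decide)) (hwr _ (by decide)) rfl (hwr _ (by decide)), ?_, ?_, ?_, k5⟩
    · rwa [hwr _ (by decide)]
    · rwa [hwr _ (by decide), hwr _ (by decide)]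
    · rwa [hwr _ (by decide), hwr _ (by decide)]
  · refine ⟨fun _ => ⊥, ⟨fun t => (hW t).ge, fun t _ => hW t, fun t ht => ?_, fun t ht => ?_⟩, by omega,
      fun t _ i => hV _, fun t _ i j => hA _, fun φ => ?_⟩
    · rw [hW] at ht; exact absurd ht (lt_irrefl _)
    · rw [hW] at ht; exact absurd ht (lt_irrefl _)
    · rw [lexSum_zero]
      simp [total, hW]
  · rintro k s ⟨T', k1, k2, k3, k4, k5⟩
    refine ⟨T', k1, by rw [add_mul]; omega, k3, k4, fun φ => ?_⟩
    rw [k5 φ, lexSum_row]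
  · rintro k hk m hm s hsa hsb hnat hnum ⟨T₀, p1, p2, p3, p4, p5⟩
    set a : Fin n := ⟨k, hk⟩ with ha
    set b : Fin n := ⟨m, hm⟩ with hb
    have hsucc : ∀ f : Fin n → Fin n → K, lexSum f k (m + 1) = lexSum f k m + f a b :=
      fun f => lexSum_succ f a b
    have hsX : s.num arrX (pr k m) = X a b := by rw [hnum _ (by decide), ← hX]; rfl
    by_cases hc : 0 < X a b
    · rw [hbody, Code.run_when_true (by simpa [hsa, hsb, hsX] using hc)]
      obtain ⟨s', hs'⟩ : ∃ s', createTree.run s = s' := ⟨_, rfl⟩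
      rw [hs']
      obtain ⟨t, ht⟩ : ∃ t, s.nat natCnt 0 = t := ⟨_, rfl⟩
      rw [ht] at p2 p3 p4
      have hab : a ≠ b := by
        intro h
        rw [h, hd] at hc
        exact lt_irrefl _ hc
      have htN : t < n ^ 5 := by
        have h1 : (k + 1) * n ≤ n * n := Nat.mul_le_mul_right n hk
        rw [add_mul] at h1
        have h2 : n ^ 2 ≤ n ^ 5 := Nat.pow_le_pow_right (by omega) (by norm_num)
        rw [pow_two] at h2
        omega
      have eV : ∀ x, s'.nat arrVert x = if x = pr t k ∨ x = pr t m then 1 else s.nat arrVert x := by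
        intro x
        rw [← hs']
        simp only [createTree, Code.run_seq, Code.run_setNat, Code.run_setNum, Code.run_letNat,
          State.nat_writeNat, State.nat_writeNum, NExp.eval_pr, NExp.eval_var, NExp.eval_lit, hsa, hsb,
          ht]
        by_cases h1 : x = pr t m
        · simp [h1]
        · by_cases h2 : x = pr t k <;> simp [h1, h2]
      have eA : ∀ x, s'.nat arrAdj x =
          if x = pr (pr t k) m ∨ x = pr (pr t m) k then 1 else s.nat arrAdj x := by
        intro x
        rw [← hs']
        simp only [createTree, Code.run_seq, Code.run_setNat, Code.run_setNum, Code.run_letNat,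
          State.nat_writeNat, State.nat_writeNum, NExp.eval_pr, NExp.eval_var, NExp.eval_lit, hsa, hsb,
          ht]
        by_cases h1 : x = pr (pr t m) k
        · simp [h1]
        · by_cases h2 : x = pr (pr t k) m <;> simp [h1, h2]
      have eC : s'.nat natCnt 0 = t + 1 := by
        rw [← hs']
        simp [createTree, Code.run_seq, Code.run_setNat, Code.run_setNum, Code.run_letNat,
          State.nat_writeNat, ht]
      have eW : ∀ x, s'.num arrWt x = if x = t then X a b / 2 else s.num arrWt x := by
        intro x
        rw [← hs', ← hsX]
        simp [createTree, Code.run_seq, Code.run_setNat, Code.run_setNum, Code.run_letNat,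
          State.nat_writeNat, State.num_writeNum, ht, hsa, hsb]
      have hwt : s.num arrWt t = 0 := p1.zero t ht.le
      refine ⟨Function.update T₀ t (edgeTree a b), ⟨?_, ?_, ?_, ?_⟩, by omega, ?_, ?_, ?_⟩
      · intro x
        rw [eW]
        split_ifs
        · linarith
        · exact p1.nonneg x
      · intro x hx
        rw [eW, if_neg (by omega)]
        exact p1.zero x (by omega)
      · intro x hx
        by_cases hxt : x = t
        · subst hxt
          rw [Function.update_self]
          refine ⟨fun i => ?_, fun i j => ?_⟩
          · rw [eV, p3 x le_rfl]
            have h : i ∈ (edgeTree a b).verts ↔ (pr x i = pr x k ∨ pr x i = pr x m) := by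
              change (i = a ∨ i = b) ↔ _
              simp [Fin.ext_iff, ha, hb]
            by_cases hi : i ∈ (edgeTree a b).verts
            · rw [if_pos hi, if_pos (h.1 hi)]
            · rw [if_neg hi, if_neg (fun c => hi (h.2 c))]
          · rw [eA, p4 x le_rfl]
            have h : (edgeTree a b).Adj i j ↔
                (pr (pr x i) j = pr (pr x k) m ∨ pr (pr x i) j = pr (pr x m) k) := by
              change (a ≠ b ∧ IsEdge a b i j) ↔ _
              rw [and_iff_right hab]
              simp [IsEdge, Fin.ext_iff, ha, hb]
            by_cases hi : (edgeTree a b).Adj i j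
            · rw [if_pos hi, if_pos (h.1 hi)]
            · rw [if_neg hi, if_neg (fun c => hi (h.2 c))]
        · rw [Function.update_of_ne hxt]
          rw [eW, if_neg hxt] at hx
          refine (p1.stores x hx).congr (fun i => ?_) (fun i j => ?_)
          · rw [eV, if_neg (by simp [hxt])]
          · rw [eA, if_neg (by simp [hxt])]
      · intro x hx
        by_cases hxt : x = t
        · subst hxt
          rw [Function.update_self]
          exact hGood a b hc
        · rw [Function.update_of_ne hxt]
          rw [eW, if_neg hxt] at hx
          exact p1.good x hx
      · intro x hx i
        have hxt : x ≠ t := by omega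
        rw [eV, if_neg (by simp [hxt]), p3 x (by omega)]
      · intro x hx i j
        have hxt : x ≠ t := by omega
        rw [eA, if_neg (by simp [hxt]), p4 x (by omega)]
      · intro φ
        rw [hsucc, ← p5 φ]
        have hterm : ∀ x, s'.num arrWt x * φ (Function.update T₀ t (edgeTree a b) x) =
            s.num arrWt x * φ (T₀ x) + if x = t then X a b / 2 * φ (edgeTree a b) else 0 := by
          intro x
          rw [eW]
          by_cases hxt : x = t
          · rw [if_pos hxt, if_pos hxt, hxt, Function.update_self, hwt]; ring
          · rw [if_neg hxt, if_neg hxt, Function.update_of_ne hxt, add_zero]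
        simp only [total, hterm, Finset.sum_add_distrib, Finset.sum_ite_eq', Finset.mem_range, htN,
          if_true]
    · rw [hbody, Code.run_when_false (by simpa [hsa, hsb, hsX] using hc)]
      have h0 : X a b = 0 := le_antisymm (not_lt.1 hc) (hnn a b)
      refine ⟨T₀, p1, by omega, p3, p4, fun φ => ?_⟩
      rw [hsucc, p5 φ, h0]
      simp

/-- The initial family of trees. -/
theorem createTrees_represents {σ : State K} (hn : σ.nat 0 0 = n) {r u v : Fin n} {y : Fin n → K}
    {Z : Fin n → Fin n → K} {W : Finset (Fin n)} (huv : u ≠ v)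
    (hX : σ.mat n arrX = fun i j => Z i j - edgeMatrix u v i j)
    (hf : CutFeasible W r (fun w => 2 * y w) Z) (hiso : ∀ w ∉ W, ∀ j, Z w j = 0)
    (hW1 : ∀ w, w ∈ W ↔ y w = 1) (hF : ∀ i j, edgeMatrix u v i j ≤ Z i j)
    (hV : ∀ x, σ.nat arrVert x = 0)
    (hA : ∀ x, σ.nat arrAdj x = 0) (hW : ∀ x, σ.num arrWt x = 0) (hC : σ.nat natCnt 0 = 0)
    {σ' : State K} (hσ' : createTrees.run σ = σ') :
    ∃ T, Represents y Z (edgeMatrix u v) Z W σ' T ∧ σ'.nat natCnt 0 ≤ n * n := by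
  have hFd : ∀ i, (edgeMatrix u v i i : K) = 0 := by
    intro i
    rw [edgeMatrix_eq, if_neg]
    rintro (⟨rfl, rfl⟩ | ⟨rfl, rfl⟩) <;> exact huv rfl
  obtain ⟨X, hXdef⟩ : ∃ X : Fin n → Fin n → K, X = fun i j => Z i j - edgeMatrix u v i j := ⟨_, rfl⟩
  have hXv : ∀ i j, X i j = Z i j - edgeMatrix u v i j := fun i j => by rw [hXdef]
  have hXs : ∀ i j, X i j = X j i := fun i j => by rw [hXv, hXv, hf.symm, edgeMatrix_symm]
  have hXd : ∀ i, X i i = 0 := fun i => by rw [hXv, hf.diag, hFd, sub_zero]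
  have hXn : ∀ i j, 0 ≤ X i j := fun i j => by rw [hXv]; linarith [hF i j]
  have hpos : ∀ p q, 0 < X p q → p ≠ q ∧ y p = 1 ∧ y q = 1 := by
    intro p q h
    have hZ : 0 < Z p q := by
      rw [hXv] at h
      linarith [edgeMatrix_nonneg (K := K) u v p q]
    refine ⟨?_, ?_, ?_⟩
    · rintro rfl
      rw [hXd] at h
      exact lt_irrefl _ h
    · rw [← hW1]
      by_contra hp
      rw [hiso p hp] at hZ
      exact lt_irrefl _ hZ
    · rw [← hW1]
      by_contra hp
      rw [hf.symm, hiso q hp] at hZ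
      exact lt_irrefl _ hZ
  obtain ⟨T, k1, k2, k3⟩ := createTrees_spec hn (X := X) (by rw [hX, hXdef]) hXn hXd
    (Good := GoodTree (Anchored y W)) (by
      intro p q h
      obtain ⟨h1, h2, h3⟩ := hpos p q h
      refine ⟨isSubtree_edgeTree h1, ?_, ?_⟩
      · have : (edgeTree p q).verts ∩ core y = {p, q} := by
          refine Set.inter_eq_left.2 ?_
          rintro x (rfl | rfl)
          · exact h2
          · exact h3
        rw [this, Set.ncard_pair h1]
      · rintro x (rfl | rfl)
        · exact (hW1 _).2 h2
        · exact (hW1 _).2 h3) hV hA hW hC hσ'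
  have hcongr : ∀ (φ : (⊤ : SimpleGraph (Fin n)).Subgraph → K) (ψ : Fin n → Fin n → K),
      (∀ p q, p ≠ q → φ (edgeTree p q) = ψ p q) →
      ∑ p, ∑ q, X p q / 2 * φ (edgeTree p q) = ∑ p, ∑ q, X p q / 2 * ψ p q := by
    intro φ ψ h
    refine Finset.sum_congr rfl fun p _ => Finset.sum_congr rfl fun q _ => ?_
    by_cases hpq : p = q
    · subst hpq; simp [hXd]
    · rw [h p q hpq]
  have hE : ∀ i j, ∑ p, ∑ q, X p q / 2 * (edgeMatrix p q i j : K) = X i j := by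
    intro i j
    by_cases hij : i = j
    · subst hij
      rw [hXd]
      refine Finset.sum_eq_zero fun p _ => Finset.sum_eq_zero fun q _ => ?_
      by_cases hpq : p = q
      · subst hpq; simp [hXd]
      · rw [edgeMatrix_eq, if_neg, mul_zero]
        rintro (⟨rfl, rfl⟩ | ⟨rfl, rfl⟩) <;> exact hpq rfl
    · rw [sum_sum_mul_edgeMatrix (fun p q => X p q / 2) hij, hXs j i]
      ring
  refine ⟨T, ⟨k1, ?_, ?_, ?_, ?_⟩, k2⟩
  · intro i j
    rw [k3, hcongr _ _ fun p q hpq => adjFun_edgeTree hpq i j, hE, hXv]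
  · intro w hw hyw
    exact absurd ((hW1 w).1 hw) hyw
  -- A core vertex has degree 2 and loses at most 1 to `e₀`, so the trees cover it at least once.
  · intro w hyw
    rw [k3, hcongr _ _ fun p q hpq => memFun_edgeTree hpq w]
    have h1 : ∑ p, ∑ q, X p q / 2 * ((if p = w then (1 : K) else 0) + if q = w then 1 else 0) =
        ∑ q, X w q := by
      simp only [mul_add, Finset.sum_add_distrib, mul_ite, mul_one, mul_zero]
      rw [Finset.sum_comm (f := fun p q => if p = w then X p q / 2 else 0)]
      simp only [Finset.sum_ite_eq', Finset.mem_univ, if_true, ← Finset.sum_add_distrib]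
      exact Finset.sum_congr rfl fun q _ => by rw [hXs q w]; ring
    have h2 := hf.degree w ((hW1 w).2 hyw)
    rw [h1]
    simp only [hXv, Finset.sum_sub_distrib]
    rw [h2, hyw, sum_edgeMatrix huv]
    split_ifs <;> norm_num
  · intro a b hab ha hb
    rw [k3, hcongr (fun T => memFun K a T * memFun K b T) _
      fun p q hpq => memFun_mul_edgeTree hpq hab, hE, hXv]

end Create

/-! ### Writing the output -/

/-- Compares the current tree with a tree of the output. -/
def compareTrees : Code :=
  .letNat natEq (.lit 1) ;;
  .loop ctrI 1 (.when (.neg (.neq (.get arrVert (.pr (.var ctrSlot) (.var ctrI)))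
    (.get 2 (.add (.mul (.var ctrT) .card) (.var ctrI))))) (.letNat natEq (.lit 0))) ;;
  .loop ctrI 1 (.loop ctrJ 1 (.when
    (.neg (.neq (.get arrAdj (.pr (.pr (.var ctrSlot) (.var ctrI)) (.var ctrJ)))
      (.get 3 (.add (.mul (.add (.mul (.var ctrT) .card) (.var ctrI)) .card) (.var ctrJ)))))
    (.letNat natEq (.lit 0))))

/-- Writes the current tree to the output. -/
def emitTree : Code :=
  .loop ctrI 1 (.setNat 2 (.add (.mul (.var 1) .card) (.var ctrI))
    (.get arrVert (.pr (.var ctrSlot) (.var ctrI)))) ;;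
  .loop ctrI 1 (.loop ctrJ 1 (.setNat 3
    (.add (.mul (.add (.mul (.var 1) .card) (.var ctrI)) .card) (.var ctrJ))
    (.get arrAdj (.pr (.pr (.var ctrSlot) (.var ctrI)) (.var ctrJ))))) ;;
  .setNum 2 (.var 1) (.get arrWt (.var ctrSlot)) ;;
  .letNat 1 (.add (.var 1) (.lit 1))

/-- Searches the current tree in the output, and adds its weight there. -/
def searchTree : Code :=
  .letNat natP (.lit 0) ;;
  .loop ctrT 5 (.when (.nlt (.var ctrT) (.var 1)) (compareTrees ;;
    .when (.neq (.var natEq) (.lit 1))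
      (.setNum 2 (.var ctrT) (.add (.get 2 (.var ctrT)) (.get arrWt (.var ctrSlot))) ;;
        .letNat natP (.lit 1))))

/-- Writes the trees to the output, merging equal trees. -/
def writeOutput : Code :=
  .loop ctrSlot 5 (.when (.flt .zero (.get arrWt (.var ctrSlot)))
    (searchTree ;; .when (.neq (.var natP) (.lit 0)) emitTree))

/-! ### Correctness of the output. -/

section Output

variable {K : Type} [Field K] [LinearOrder K] [IsStrictOrderedRing K] {n : ℕ}

open Classical in
/-- The tree `T` is the tree `t` of the output. -/
def State.Emitted (s : State K) (t : ℕ) (T : (⊤ : SimpleGraph (Fin n)).Subgraph) : Prop :=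
  (∀ i : Fin n, s.nat 2 (t * n + i) = if i ∈ T.verts then 1 else 0) ∧
    ∀ i j : Fin n, s.nat 3 ((t * n + i) * n + j) = if T.Adj i j then 1 else 0

theorem State.Emitted.congr {s s' : State K} {t : ℕ} {T : (⊤ : SimpleGraph (Fin n)).Subgraph}
    (h : s.Emitted t T) (h1 : ∀ i : Fin n, s'.nat 2 (t * n + i) = s.nat 2 (t * n + i))
    (h2 : ∀ i j : Fin n, s'.nat 3 ((t * n + i) * n + j) = s.nat 3 ((t * n + i) * n + j)) :
    s'.Emitted t T :=
  ⟨fun i => by rw [h1, h.1], fun i j => by rw [h2, h.2]⟩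

theorem ite_eq_ite_iff {p q : Prop} {_ : Decidable p} {_ : Decidable q} :
    ((if p then 1 else 0 : ℕ) = if q then 1 else 0) ↔ (p ↔ q) := by
  by_cases hp : p <;> by_cases hq : q <;> simp [hp, hq]

theorem mul_add_inj {a b i j : ℕ} (hi : i < n) (hj : j < n) (h : a * n + i = b * n + j) :
    a = b ∧ i = j := by
  have h1 := congrArg (· / n) h
  have h2 := congrArg (· % n) h
  have hn : 0 < n := by omega
  simp only [Nat.add_comm (_ * n), Nat.add_mul_div_right _ _ hn,
    Nat.add_mul_mod_self_right, Nat.div_eq_of_lt hi, Nat.div_eq_of_lt hj, Nat.mod_eq_of_lt hi,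
    Nat.mod_eq_of_lt hj, zero_add] at h1 h2
  exact ⟨h1, h2⟩

theorem compareTrees_spec {σ : State K} (hn : σ.nat 0 0 = n)
    {T T' : (⊤ : SimpleGraph (Fin n)).Subgraph} (hT : σ.Stores (σ.nat ctrSlot 0) T)
    (hT' : σ.Emitted (σ.nat ctrT 0) T') : (compareTrees.run σ).nat natEq 0 = 1 ↔ T = T' := by
  set t := σ.nat ctrSlot 0 with ht
  set m := σ.nat ctrT 0 with hm
  set σ₁ := σ.writeNat natEq 0 1 with hσ₁
  have hnat1 : ∀ c, c ≠ natEq → σ₁.nat c = σ.nat c := by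
    intro c hc; funext x; simp [hσ₁, State.nat_writeNat, hc]
  set c1 := Code.when (.neg (.neq (.get arrVert (.pr (.var ctrSlot) (.var ctrI)))
    (.get 2 (.add (.mul (.var ctrT) .card) (.var ctrI))))) (.letNat natEq (.lit 0)) with hc1
  set c2 := Code.when
    (.neg (.neq (.get arrAdj (.pr (.pr (.var ctrSlot) (.var ctrI)) (.var ctrJ)))
      (.get 3 (.add (.mul (.add (.mul (.var ctrT) .card) (.var ctrI)) .card) (.var ctrJ)))))
    (.letNat natEq (.lit 0)) with hc2
  have hwr : ∀ (s : State K) c x, c ≠ natEq → (s.writeNat c 0 x).nat natEq 0 = s.nat natEq 0 := by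
    intro s c x hc; simp [State.nat_writeNat, hc.symm]
  have key1 := Code.loop_induction (a := ctrI) (d := 1) (c := c1) (σ := σ₁) (n := n)
    (by rw [hnat1 _ (by decide), hn])
    (fun k s => s.nat natEq 0 = 1 ↔ ∀ i : Fin n, (i : ℕ) < k → (i ∈ T.verts ↔ i ∈ T'.verts)) ?_ ?_
  · rw [pow_one] at key1
    set σ₂ := (Code.loop ctrI 1 c1).run σ₁ with hσ₂
    have hnat2 : ∀ c, c ≠ natEq → c ≠ ctrI → σ₂.nat c = σ.nat c := by
      intro c h1 h2
      rw [hσ₂, Code.run_nat_of_notMem, hnat1 _ h1]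
      change c ∉ [ctrI, natEq]
      simp [h1, h2]
    have key2 := Code.loop_loop_induction (a := ctrI) (b := ctrJ) (c := c2) (σ := σ₂) (n := n)
      (by rw [hnat2 _ (by decide) (by decide), hn]) (by decide) (by decide) (by decide) (by decide)
      (by decide)
      (fun i j s => s.nat natEq 0 = 1 ↔ T.verts = T'.verts ∧ ∀ l k : Fin n,
        ((l : ℕ) < i ∨ (l : ℕ) = i ∧ (k : ℕ) < j) → (T.Adj l k ↔ T'.Adj l k))
      (fun i j s x h => by rw [hwr _ _ _ (by decide)]; exact h)
      (fun i j s x h => by rw [hwr _ _ _ (by decide)]; exact h) ?_ ?_ ?_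
    · have hrun : compareTrees.run σ = (Code.loop ctrI 1 (.loop ctrJ 1 c2)).run σ₂ := rfl
      rw [hrun, key2]
      constructor
      · rintro ⟨h1, h2⟩
        refine SimpleGraph.Subgraph.ext h1 ?_
        funext l k
        exact propext (h2 l k (Or.inl l.2))
      · rintro rfl
        exact ⟨rfl, fun _ _ _ => Iff.rfl⟩
    · rw [key1]
      constructor
      · intro h
        exact ⟨Set.ext fun i => h i i.2, by simp⟩
      · rintro ⟨h, -⟩ i -
        rw [h]
    · intro i s h
      rw [h]
      refine and_congr Iff.rfl (forall₂_congr fun l k => ?_)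
      have := k.2
      exact imp_congr (by omega) Iff.rfl
    · intro i hi j hj s hsi hsj hnat hnum h
      have e0 : s.nat 0 0 = n := by rw [hnat _ (by decide), hnat2 _ (by decide) (by decide), hn]
      have e1 : s.nat ctrSlot 0 = t := by rw [hnat _ (by decide), hnat2 _ (by decide) (by decide)]
      have e2 : s.nat ctrT 0 = m := by rw [hnat _ (by decide), hnat2 _ (by decide) (by decide)]
      have e3 : s.nat arrAdj (pr (pr t i) j) = σ.nat arrAdj (pr (pr t i) j) := by
        rw [hnat _ (by decide), hnat2 _ (by decide) (by decide)]
      have e4 : s.nat 3 ((m * n + i) * n + j) = σ.nat 3 ((m * n + i) * n + j) := by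
        rw [hnat _ (by decide), hnat2 _ (by decide) (by decide)]
      have h1 := hT.2 ⟨i, hi⟩ ⟨j, hj⟩
      have h2 := hT'.2 ⟨i, hi⟩ ⟨j, hj⟩
      rw [← e3] at h1
      rw [← e4] at h2
      have hiff : s.nat arrAdj (pr (pr t i) j) = s.nat 3 ((m * n + i) * n + j) ↔
          (T.Adj ⟨i, hi⟩ ⟨j, hj⟩ ↔ T'.Adj ⟨i, hi⟩ ⟨j, hj⟩) := by
        rw [h1, h2, ite_eq_ite_iff]
      have hcases : ∀ l k : Fin n, ((l : ℕ) < i ∨ (l : ℕ) = i ∧ (k : ℕ) < j + 1) ↔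
          ((l : ℕ) < i ∨ (l : ℕ) = i ∧ (k : ℕ) < j) ∨ (l = ⟨i, hi⟩ ∧ k = ⟨j, hj⟩) := by
        intro l k
        simp only [Fin.ext_iff]
        omega
      by_cases hc : s.nat arrAdj (pr (pr t i) j) = s.nat 3 ((m * n + i) * n + j)
      · rw [hc2, Code.run_when_false (by simpa [hsi, hsj, e0, e1, e2] using hc), h]
        refine and_congr Iff.rfl ⟨fun H l k hlk => ?_, fun H l k hlk => H l k ((hcases l k).2 (Or.inl hlk))⟩
        rcases (hcases l k).1 hlk with hlk | ⟨rfl, rfl⟩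
        · exact H l k hlk
        · exact hiff.1 hc
      · rw [hc2, Code.run_when_true (by simpa [hsi, hsj, e0, e1, e2] using hc), Code.run_letNat]
        simp only [State.nat_writeNat, NExp.eval_lit, and_self, if_true, zero_ne_one, false_iff]
        rintro ⟨-, H⟩
        exact hc (hiff.2 (H _ _ ((hcases _ _).2 (Or.inr ⟨rfl, rfl⟩))))
  · rw [hwr _ _ _ (by decide)]
    simp [hσ₁, State.nat_writeNat]
  · intro i hi s hsi hnat hnum h
    rw [pow_one] at hi
    have e0 : s.nat 0 0 = n := by rw [hnat _ (by decide), hnat1 _ (by decide), hn]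
    have e1 : s.nat ctrSlot 0 = t := by rw [hnat _ (by decide), hnat1 _ (by decide)]
    have e2 : s.nat ctrT 0 = m := by rw [hnat _ (by decide), hnat1 _ (by decide)]
    have e3 : s.nat arrVert (pr t i) = σ.nat arrVert (pr t i) := by
      rw [hnat _ (by decide), hnat1 _ (by decide)]
    have e4 : s.nat 2 (m * n + i) = σ.nat 2 (m * n + i) := by
      rw [hnat _ (by decide), hnat1 _ (by decide)]
    have h1 := hT.1 ⟨i, hi⟩
    have h2 := hT'.1 ⟨i, hi⟩
    rw [← e3] at h1
    rw [← e4] at h2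
    have hiff : s.nat arrVert (pr t i) = s.nat 2 (m * n + i) ↔
        ((⟨i, hi⟩ : Fin n) ∈ T.verts ↔ (⟨i, hi⟩ : Fin n) ∈ T'.verts) := by
      rw [h1, h2, ite_eq_ite_iff]
    rw [hwr _ _ _ (by decide)]
    by_cases hc : s.nat arrVert (pr t i) = s.nat 2 (m * n + i)
    · rw [hc1, Code.run_when_false (by simpa [hsi, e0, e1, e2] using hc), h]
      refine ⟨fun H l hl => ?_, fun H l hl => H l (by omega)⟩
      rcases Nat.lt_succ_iff_lt_or_eq.1 hl with hl | hl
      · exact H l hl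
      · have : l = ⟨i, hi⟩ := Fin.ext hl
        rw [this]
        exact hiff.1 hc
    · rw [hc1, Code.run_when_true (by simpa [hsi, e0, e1, e2] using hc), Code.run_letNat]
      simp only [State.nat_writeNat, NExp.eval_lit, and_self, if_true, zero_ne_one, false_iff]
      intro H
      exact hc (hiff.2 (H ⟨i, hi⟩ (Nat.lt_succ_self i)))

theorem emitTree_spec {σ : State K} (hn : σ.nat 0 0 = n) {t k : ℕ} (ht : σ.nat ctrSlot 0 = t)
    (hk : σ.nat 1 0 = k) {T : (⊤ : SimpleGraph (Fin n)).Subgraph} (hT : σ.Stores t T)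
    {σ' : State K} (hσ' : emitTree.run σ = σ') :
    σ'.Emitted k T ∧ (∀ m, m ≠ k → ∀ T : (⊤ : SimpleGraph (Fin n)).Subgraph, σ.Emitted m T →
      σ'.Emitted m T) ∧ σ'.nat 1 0 = k + 1 ∧
      ∀ x, σ'.num 2 x = if x = k then σ.num arrWt t else σ.num 2 x := by
  have hinj : ∀ {i j l m : Fin n} {a b : ℕ}, (a * n + i) * n + j = (b * n + l) * n + m →
      a = b ∧ i = l ∧ j = m := by
    intro i j l m a b h
    obtain ⟨h1, h2⟩ := mul_add_inj j.2 m.2 h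
    obtain ⟨h3, h4⟩ := mul_add_inj i.2 l.2 h1
    exact ⟨h3, Fin.ext h4, Fin.ext h2⟩
  obtain ⟨g1, g2⟩ := Code.run_loop_setNat (σ := σ) (n := n) (a := 2) (b := ctrI)
    (ix := .add (.mul (.var 1) .card) (.var ctrI))
    (ex := .get arrVert (.pr (.var ctrSlot) (.var ctrI))) (by decide) hn (fun j => k * n + j)
    (fun j => σ.nat arrVert (pr t j)) (by intro j _ l _ h; exact Nat.add_left_cancel h) (by
      intro s h1 h2 _ _
      simp [h1 1 (by decide) (by decide), h1 0 (by decide) (by decide),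
        h1 ctrSlot (by decide) (by decide), h1 arrVert (by decide) (by decide), hn, ht, hk])
  set σ₁ := (Code.loop ctrI 1 (.setNat 2 (.add (.mul (.var 1) .card) (.var ctrI))
    (.get arrVert (.pr (.var ctrSlot) (.var ctrI))))).run σ with hσ₁
  have hnat1 : ∀ c, c ≠ 2 → c ≠ ctrI → σ₁.nat c = σ.nat c := by
    intro c h1 h2
    rw [hσ₁, Code.run_nat_of_notMem]
    change c ∉ [ctrI, 2]
    simp [h1, h2]
  set c2 := Code.setNat 3
    (.add (.mul (.add (.mul (.var 1) .card) (.var ctrI)) .card) (.var ctrJ))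
    (.get arrAdj (.pr (.pr (.var ctrSlot) (.var ctrI)) (.var ctrJ))) with hc2
  have hwr : ∀ (s : State K) c x, c ≠ 3 → (s.writeNat c 0 x).nat 3 = s.nat 3 := by
    intro s c x hc; funext z; simp [State.nat_writeNat, hc.symm]
  have key := Code.loop_loop_induction (a := ctrI) (b := ctrJ) (c := c2) (σ := σ₁) (n := n)
    (by rw [hnat1 _ (by decide) (by decide), hn]) (by decide) (by decide) (by decide) (by decide)
    (by decide)
    (fun i j s => (∀ l m : Fin n, ((l : ℕ) < i ∨ (l : ℕ) = i ∧ (m : ℕ) < j) →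
        s.nat 3 ((k * n + l) * n + m) = σ.nat arrAdj (pr (pr t l) m)) ∧
      ∀ x, (∀ l m : Fin n, x ≠ (k * n + l) * n + m) → s.nat 3 x = σ.nat 3 x)
    (fun i j s x h => by rw [hwr _ _ _ (by decide)]; exact h)
    (fun i j s x h => by rw [hwr _ _ _ (by decide)]; exact h)
    ⟨by simp, fun x _ => by rw [hnat1 _ (by decide) (by decide)]⟩ ?_ ?_
  · set σ₂ := (Code.loop ctrI 1 (.loop ctrJ 1 c2)).run σ₁ with hσ₂
    have hnat2 : ∀ c, c ≠ 2 → c ≠ 3 → c ≠ ctrI → c ≠ ctrJ → σ₂.nat c = σ.nat c := by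
      intro c h1 h2 h3 h4
      rw [hσ₂, Code.run_nat_of_notMem, hnat1 c h1 h3]
      change c ∉ [ctrI, ctrJ, 3]
      simp [h2, h3, h4]
    have hnum2 : σ₂.num = σ.num := by
      funext c
      rw [hσ₂, Code.run_num_of_notMem, hσ₁, Code.run_num_of_notMem]
      · change c ∉ []
        simp
      · change c ∉ []
        simp
    have h21 : σ₂.nat 1 0 = k := by
      rw [hnat2 _ (by decide) (by decide) (by decide) (by decide), hk]
    have h2S : σ₂.nat ctrSlot 0 = t := by
      rw [hnat2 _ (by decide) (by decide) (by decide) (by decide), ht]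
    have hrun : emitTree.run σ = (σ₂.writeNum 2 k (σ.num arrWt t)).writeNat 1 0 (k + 1) := by
      have : emitTree.run σ = (Code.setNum 2 (.var 1) (.get arrWt (.var ctrSlot)) ;;
        .letNat 1 (.add (.var 1) (.lit 1))).run σ₂ := rfl
      rw [this]
      simp [Code.run_seq, Code.run_setNum, Code.run_letNat, h21, h2S, hnum2]
    rw [hσ'] at hrun
    have f2 : σ'.nat 2 = σ₁.nat 2 := by
      have : σ₂.nat 2 = σ₁.nat 2 := Code.run_nat_of_notMem _ (by decide) _
      rw [← this]
      funext x; simp [hrun, State.nat_writeNat]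
    have f3 : σ'.nat 3 = σ₂.nat 3 := by
      funext x; simp [hrun, State.nat_writeNat]
    refine ⟨⟨fun i => ?_, fun i j => ?_⟩, fun m hm T' hT' => hT'.congr (fun i => ?_) (fun i j => ?_),
      ?_, ?_⟩
    · rw [f2, g1 i i.2, hT.1]
    · rw [f3, key.1 i j (Or.inl i.2), hT.2]
    · rw [f2, g2]
      intro j hj h
      exact hm (mul_add_inj i.2 hj h).1
    · rw [f3, key.2]
      intro l q h
      exact hm (hinj h).1
    · simp [hrun, State.nat_writeNat]
    · intro x
      rw [hrun]
      simp [State.num_writeNum, hnum2]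
  · rintro i s ⟨h1, h2⟩
    refine ⟨fun l m h => h1 l m ?_, h2⟩
    have := m.2
    omega
  · rintro i hi j hj s hsi hsj hnat hnum ⟨h1, h2⟩
    have e0 : s.nat 0 0 = n := by rw [hnat _ (by decide), hnat1 _ (by decide) (by decide), hn]
    have e1 : s.nat 1 0 = k := by rw [hnat _ (by decide), hnat1 _ (by decide) (by decide), hk]
    have e2 : s.nat ctrSlot 0 = t := by rw [hnat _ (by decide), hnat1 _ (by decide) (by decide), ht]
    have e3 : s.nat arrAdj = σ.nat arrAdj := by rw [hnat _ (by decide), hnat1 _ (by decide) (by decide)]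
    have hv : ∀ x, (c2.run s).nat 3 x = if x = (k * n + i) * n + j then σ.nat arrAdj (pr (pr t i) j)
        else s.nat 3 x := by
      intro x
      simp [hc2, Code.run_setNat, State.nat_writeNat, e0, e1, e2, e3, hsi, hsj]
    refine ⟨fun l m h => ?_, fun x hx => ?_⟩
    · rw [hv]
      by_cases hlm : l = ⟨i, hi⟩ ∧ m = ⟨j, hj⟩
      · obtain ⟨rfl, rfl⟩ := hlm
        simp
      · rw [if_neg]
        · refine h1 l m ?_
          simp only [Fin.ext_iff] at hlm
          omega
        · intro h
          exact hlm (hinj (i := l) (j := m) (l := ⟨i, hi⟩) (m := ⟨j, hj⟩) h).2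
    · rw [hv, if_neg (hx ⟨i, hi⟩ ⟨j, hj⟩), h2 x hx]

end Output

section Output

variable {K : Type} [Field K] [LinearOrder K] [IsStrictOrderedRing K] {n : ℕ}

/-- By injectivity of the trees already written there is at most one match, so the weight is added
only once. -/
theorem searchTree_spec {σ : State K} (hn : σ.nat 0 0 = n) {m k : ℕ} (hm : σ.nat ctrSlot 0 = m)
    (hk : σ.nat 1 0 = k) (hkn : k ≤ n ^ 5) {T : (⊤ : SimpleGraph (Fin n)).Subgraph}
    (hT : σ.Stores m T) {O : ℕ → (⊤ : SimpleGraph (Fin n)).Subgraph}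
    (hO : ∀ t < k, σ.Emitted t (O t)) (hinj : ∀ t < k, ∀ t' < k, O t = O t' → t = t')
    {σ' : State K} (hσ' : searchTree.run σ = σ') :
    (σ'.nat natP 0 = 0 ∧ σ'.num 2 = σ.num 2 ∧ ∀ t < k, O t ≠ T) ∨
      (σ'.nat natP 0 = 1 ∧ ∃ t < k, O t = T ∧
        ∀ x, σ'.num 2 x = if x = t then σ.num 2 t + σ.num arrWt m else σ.num 2 x) := by
  set σ₁ := σ.writeNat natP 0 0 with hσ₁
  have hnat1 : ∀ c, c ≠ natP → σ₁.nat c = σ.nat c := by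
    intro c hc; funext x; simp [hσ₁, State.nat_writeNat, hc]
  set c1 := Code.when (.nlt (.var ctrT) (.var 1)) (compareTrees ;;
    .when (.neq (.var natEq) (.lit 1))
      (.setNum 2 (.var ctrT) (.add (.get 2 (.var ctrT)) (.get arrWt (.var ctrSlot))) ;;
        .letNat natP (.lit 1))) with hc1
  have hwr : ∀ (s : State K) x, (s.writeNat ctrT 0 x).nat natP 0 = s.nat natP 0 := by
    intro s x; simp [State.nat_writeNat]
  have key := Code.loop_induction (a := ctrT) (d := 5) (c := c1) (σ := σ₁) (n := n)
    (by rw [hnat1 _ (by decide), hn])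
    (fun j s => (s.nat natP 0 = 0 ∧ s.num 2 = σ.num 2 ∧ ∀ t < k, t < j → O t ≠ T) ∨
      (s.nat natP 0 = 1 ∧ ∃ t < k, t < j ∧ O t = T ∧
        ∀ x, s.num 2 x = if x = t then σ.num 2 t + σ.num arrWt m else σ.num 2 x)) ?_ ?_
  · have hrun : searchTree.run σ = (Code.loop ctrT 5 c1).run σ₁ := rfl
    rw [← hrun, hσ'] at key
    rcases key with ⟨h1, h2, h3⟩ | ⟨h1, t, h2, -, h3⟩
    · exact Or.inl ⟨h1, h2, fun t ht => h3 t ht (by omega)⟩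
    · exact Or.inr ⟨h1, t, h2, h3⟩
  · left
    refine ⟨?_, rfl, by simp⟩
    rw [hwr]
    simp [hσ₁, State.nat_writeNat]
  · intro j hj s hsj hnat hnum h
    have hf : ∀ c ∈ [0, 1, 2, 3, ctrSlot, arrVert, arrAdj], s.nat c = σ.nat c := by
      intro c hc
      simp only [List.mem_cons, List.not_mem_nil, or_false] at hc
      rcases hc with rfl | rfl | rfl | rfl | rfl | rfl | rfl <;>
        rw [hnat _ (by decide), hnat1 _ (by decide)]
    have e1 : s.nat 1 0 = k := by rw [hf 1 (by simp), hk]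
    have e2 : s.nat ctrSlot 0 = m := by rw [hf _ (by simp), hm]
    have e3 : s.num arrWt = σ.num arrWt := by rw [hnum _ (by decide)]; rfl
    rw [hwr, State.num_writeNat]
    by_cases hjk : j < k
    · set s₁ := compareTrees.run s with hs₁
      have hst : s.Stores (s.nat ctrSlot 0) T := by
        rw [e2]
        exact hT.congr (fun i => by rw [hf _ (by simp)]) (fun i l => by rw [hf _ (by simp)])
      have hem : s.Emitted (s.nat ctrT 0) (O j) := by
        rw [hsj]
        exact (hO j hjk).congr (fun i => by rw [hf _ (by simp)]) (fun i l => by rw [hf _ (by simp)])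
      have hcmp := compareTrees_spec (by rw [hf 0 (by simp), hn]) hst hem
      rw [← hs₁] at hcmp
      have g1 : s₁.nat natP = s.nat natP := Code.run_nat_of_notMem _ (by decide) _
      have g2 : s₁.num = s.num := funext fun c => Code.run_num_of_notMem _ (by simp [compareTrees, Code.natWrites, Code.numWrites, Code.when, Code.letNat]) _
      have g3 : s₁.nat ctrSlot = s.nat ctrSlot := Code.run_nat_of_notMem _ (by decide) _
      have g4 : s₁.nat ctrT = s.nat ctrT := Code.run_nat_of_notMem _ (by decide) _
      have hrun : c1.run s = (Code.when (.neq (.var natEq) (.lit 1))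
          (.setNum 2 (.var ctrT) (.add (.get 2 (.var ctrT)) (.get arrWt (.var ctrSlot))) ;;
          .letNat natP (.lit 1))).run s₁ := by
        rw [hc1, Code.run_when_true (by simpa [hsj, e1] using hjk)]
        rfl
      rw [hrun]
      by_cases hc : s₁.nat natEq 0 = 1
      · have hTO := hcmp.1 hc
        rw [Code.run_when_true (by simpa using hc)]
        right
        rcases h with ⟨-, h2, -⟩ | ⟨-, t, h2, h3, h4, -⟩
        · refine ⟨by simp [Code.run_seq, Code.run_letNat, State.nat_writeNat], j, hjk,
            Nat.lt_succ_self j, hTO.symm, fun x => ?_⟩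
          simp [Code.run_seq, Code.run_letNat, Code.run_setNum, State.num_writeNum, g2, g3, g4, e2,
            hsj, h2, e3]
        · have := hinj t h2 j hjk (h4.trans hTO)
          omega
      · rw [Code.run_when_false (by simpa using hc), g1, g2]
        have hne : O j ≠ T := fun h => hc (hcmp.2 h.symm)
        rcases h with ⟨h1, h2, h3⟩ | ⟨h1, t, h2, h3, h4⟩
        · refine Or.inl ⟨h1, h2, fun t ht htj => ?_⟩
          rcases Nat.lt_succ_iff_lt_or_eq.1 htj with htj | rfl
          · exact h3 t ht htj
          · exact hne
        · exact Or.inr ⟨h1, t, h2, by omega, h4⟩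
    · rw [hc1, Code.run_when_false (by simpa [hsj, e1] using hjk)]
      rcases h with ⟨h1, h2, h3⟩ | ⟨h1, t, h2, h3, h4⟩
      · exact Or.inl ⟨h1, h2, fun t ht _ => h3 t ht (by omega)⟩
      · exact Or.inr ⟨h1, t, h2, by omega, h4⟩

/-- Merging makes the trees pairwise distinct, since the result is a set of trees. All weighted
totals are preserved, and only trees of positive weight are written. -/
theorem writeOutput_spec {σ : State K} (hn : σ.nat 0 0 = n) (hk : σ.nat 1 0 = 0)
    {Good : (⊤ : SimpleGraph (Fin n)).Subgraph → Prop}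
    {T : ℕ → (⊤ : SimpleGraph (Fin n)).Subgraph} (hF : Family Good σ T) {σ' : State K}
    (hσ' : writeOutput.run σ = σ') :
    ∃ (k : ℕ) (O : ℕ → (⊤ : SimpleGraph (Fin n)).Subgraph), σ'.nat 1 0 = k ∧
      (∀ t < k, σ'.Emitted t (O t) ∧ Good (O t) ∧ 0 < σ'.num 2 t) ∧
      (∀ t < k, ∀ t' < k, O t = O t' → t = t') ∧
      ∀ φ : _ → K, ∑ t ∈ Finset.range k, σ'.num 2 t * φ (O t) = total σ T φ := by
  set body := Code.when (.flt .zero (.get arrWt (.var ctrSlot)))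
    (searchTree ;; .when (.neq (.var natP) (.lit 0)) emitTree) with hbody
  have key := Code.loop_induction (a := ctrSlot) (d := 5) (c := body) hn
    (fun m s => ∃ (k : ℕ) (O : ℕ → (⊤ : SimpleGraph (Fin n)).Subgraph), k ≤ m ∧ s.nat 1 0 = k ∧
      (∀ t < k, s.Emitted t (O t) ∧ Good (O t) ∧ 0 < s.num 2 t) ∧
      (∀ t < k, ∀ t' < k, O t = O t' → t = t') ∧
      ∀ φ : _ → K, ∑ t ∈ Finset.range k, s.num 2 t * φ (O t) =
        ∑ t ∈ Finset.range m, σ.num arrWt t * φ (T t)) ?_ ?_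
  · have hrun : writeOutput.run σ = (Code.loop ctrSlot 5 body).run σ := rfl
    rw [← hrun, hσ'] at key
    obtain ⟨k, O, -, h⟩ := key
    exact ⟨k, O, h⟩
  · refine ⟨0, T, le_rfl, ?_, by simp, by simp, by simp⟩
    simpa [State.nat_writeNat] using hk
  · rintro m hm s hsm hnat hnum ⟨k, O, hkm, hsk, h1, h2, h3⟩
    have hwr : ∀ (s : State K) x c, c ≠ ctrSlot → (s.writeNat ctrSlot 0 x).nat c = s.nat c := by
      intro s x c hc; funext z; simp [State.nat_writeNat, hc]
    have hwE : ∀ (s : State K) x t (T : (⊤ : SimpleGraph (Fin n)).Subgraph), s.Emitted t T →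
        (s.writeNat ctrSlot 0 x).Emitted t T := fun s x t T h =>
      h.congr (fun i => by rw [hwr _ _ _ (by decide)]) (fun i j => by rw [hwr _ _ _ (by decide)])
    have e0 : s.nat 0 0 = n := by rw [hnat _ (by decide), hn]
    have e1 : s.num arrWt = σ.num arrWt := hnum _ (by decide)
    have e2 : s.nat arrVert = σ.nat arrVert := hnat _ (by decide)
    have e3 : s.nat arrAdj = σ.nat arrAdj := hnat _ (by decide)
    by_cases hpos : 0 < σ.num arrWt m
    · have hst : s.Stores m (T m) := (hF.stores m hpos).congr (fun i => by rw [e2])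
        (fun i j => by rw [e3])
      obtain ⟨s₁, hs₁⟩ : ∃ s₁, searchTree.run s = s₁ := ⟨_, rfl⟩
      have hsr := searchTree_spec e0 hsm hsk (by omega) hst (fun t ht => (h1 t ht).1) h2 hs₁
      have hf : ∀ c ∈ [0, 1, 2, 3, ctrSlot, arrVert, arrAdj], s₁.nat c = s.nat c := by
        intro c hc
        simp only [List.mem_cons, List.not_mem_nil, or_false] at hc
        rw [← hs₁]
        rcases hc with rfl | rfl | rfl | rfl | rfl | rfl | rfl <;>
          exact Code.run_nat_of_notMem _ (by decide) _
      have hwt : s₁.num arrWt = σ.num arrWt := by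
        rw [← hs₁, Code.run_num_of_notMem _ (by decide), e1]
      have hem : ∀ t < k, s₁.Emitted t (O t) := fun t ht => (h1 t ht).1.congr
        (fun i => by rw [hf _ (by simp)]) (fun i j => by rw [hf _ (by simp)])
      have hrun : body.run s = (Code.when (.neq (.var natP) (.lit 0)) emitTree).run s₁ := by
        rw [hbody, Code.run_when_true (by simpa [hsm, e1] using hpos), Code.run_seq, hs₁]
      rw [hrun, hwr _ _ _ (by decide)]
      rcases hsr with ⟨p1, p2, p3⟩ | ⟨p1, t₀, p2, p3, p4⟩
      · rw [Code.run_when_true (by simpa using p1)]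
        obtain ⟨q1, q2, q3, q4⟩ := emitTree_spec (σ := s₁) (by rw [hf _ (by simp), e0])
          (by rw [hf _ (by simp), hsm]) (by rw [hf _ (by simp), hsk])
          (hst.congr (fun i => by rw [hf _ (by simp)]) (fun i j => by rw [hf _ (by simp)])) rfl
        have hup : ∀ t < k, Function.update O k (T m) t = O t := fun t ht =>
          Function.update_of_ne ht.ne _ _
        refine ⟨k + 1, Function.update O k (T m), by omega, q3, fun t ht => ?_, ?_, fun φ => ?_⟩
        · rw [State.num_writeNat, q4]
          rcases Nat.lt_succ_iff_lt_or_eq.1 ht with ht | rfl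
          · rw [hup t ht, if_neg ht.ne, p2]
            exact ⟨hwE _ _ _ _ (q2 t ht.ne _ (hem t ht)), (h1 t ht).2⟩
          · rw [Function.update_self, if_pos rfl, hwt]
            exact ⟨hwE _ _ _ _ q1, hF.good m hpos, hpos⟩
        · intro t ht t' ht' h
          rcases Nat.lt_succ_iff_lt_or_eq.1 ht with ht | rfl <;>
            rcases Nat.lt_succ_iff_lt_or_eq.1 ht' with ht' | rfl
          · rw [hup t ht, hup t' ht'] at h
            exact h2 t ht t' ht' h
          · rw [hup t ht, Function.update_self] at h
            exact absurd h (p3 t ht)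
          · rw [hup t' ht', Function.update_self] at h
            exact absurd h.symm (p3 t' ht')
          · rfl
        · rw [Finset.sum_range_succ, Finset.sum_range_succ, ← h3 φ, State.num_writeNat, q4 k,
            if_pos rfl, Function.update_self, hwt]
          refine congrArg₂ _ (Finset.sum_congr rfl fun t ht => ?_) rfl
          have ht := Finset.mem_range.1 ht
          rw [q4, if_neg ht.ne, hup t ht, p2]
      · rw [Code.run_when_false (by simp [p1])]
        refine ⟨k, O, by omega, by rw [hf _ (by simp), hsk], fun t ht => ⟨hwE _ _ _ _ (hem t ht),
          (h1 t ht).2.1, ?_⟩, h2, fun φ => ?_⟩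
        · rw [State.num_writeNat, p4]
          split_ifs
          · exact add_pos (h1 _ p2).2.2 (by rw [e1]; exact hpos)
          · exact (h1 t ht).2.2
        · rw [Finset.sum_range_succ, ← h3 φ, State.num_writeNat]
          have hterm : ∀ t, s₁.num 2 t * φ (O t) = s.num 2 t * φ (O t) +
              if t = t₀ then σ.num arrWt m * φ (T m) else 0 := by
            intro t
            rw [p4]
            by_cases h : t = t₀
            · rw [if_pos h, if_pos h, h, p3, e1]; ring
            · rw [if_neg h, if_neg h, add_zero]
          simp only [hterm, Finset.sum_add_distrib, Finset.sum_ite_eq', Finset.mem_range, p2, if_true]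
    · have h0 : σ.num arrWt m = 0 := le_antisymm (not_lt.1 hpos) (hF.nonneg m)
      rw [hbody, Code.run_when_false (by simpa [hsm, e1] using hpos), hwr _ _ _ (by decide)]
      refine ⟨k, O, by omega, hsk, fun t ht => ⟨hwE _ _ _ _ (h1 t ht).1, (h1 t ht).2⟩, h2,
        fun φ => ?_⟩
      rw [Finset.sum_range_succ, h0, zero_mul, add_zero, ← h3 φ, State.num_writeNat]

end Output

/-! ### Weighted complete graphs and symmetric matrices -/

section Bridge

variable {K : Type} [Field K] {n : ℕ}

/-- The symmetric matrix of the values of `x`. -/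
def edgeValues (x : Edge (Fin n) → K) (i j : Fin n) : K :=
  if h : i ≠ j then x (mkEdge i j h) else 0

theorem mkEdge_comm {V : Type} {i j : V} (h : i ≠ j) : mkEdge i j h = mkEdge j i h.symm :=
  Subtype.ext Sym2.eq_swap

theorem edgeValues_mkEdge (x : Edge (Fin n) → K) {i j : Fin n} (h : i ≠ j) :
    edgeValues x i j = x (mkEdge i j h) := dif_pos h

theorem ends_mkEdge {V : Type} {p q : V} (h : p ≠ q) : (mkEdge p q h).ends = {p, q} := by
  ext w
  simp [Edge.ends, mkEdge]

theorem exists_eq_mkEdge {V : Type} (e : Edge V) : ∃ p q, ∃ h : p ≠ q, e = mkEdge p q h := by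
  obtain ⟨e, he⟩ := e
  induction e with
  | _ p q => exact ⟨p, q, by simpa using he, rfl⟩

theorem crosses_pair {V : Type} {p q : V} (h : p ≠ q) (S : Set V) :
    Crosses {p, q} S ↔ ¬ (p ∈ S ↔ q ∈ S) := by
  unfold Crosses
  by_cases hp : p ∈ S <;> by_cases hq : q ∈ S
  · have h1 : ({p, q} : Set V) ∩ S = {p, q} := by
      ext w; simp only [Set.mem_inter_iff, Set.mem_insert_iff, Set.mem_singleton_iff]
      constructor
      · exact fun h => h.1
      · rintro (rfl | rfl) <;> simp [hp, hq]
    simp [h1, Set.ncard_pair h, hp, hq]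
  · have h1 : ({p, q} : Set V) ∩ S = {p} := by
      ext w; simp only [Set.mem_inter_iff, Set.mem_insert_iff, Set.mem_singleton_iff]
      constructor
      · rintro ⟨rfl | rfl, hc⟩
        · rfl
        · exact absurd hc hq
      · rintro rfl; simp [hp]
    have h2 : ({p, q} : Set V) \ S = {q} := by
      ext w; simp only [Set.mem_diff, Set.mem_insert_iff, Set.mem_singleton_iff]
      constructor
      · rintro ⟨rfl | rfl, hc⟩
        · exact absurd hp hc
        · rfl
      · rintro rfl; simp [hq]
    simp [h1, h2, hp, hq]
  · have h1 : ({p, q} : Set V) ∩ S = {q} := by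
      ext w; simp only [Set.mem_inter_iff, Set.mem_insert_iff, Set.mem_singleton_iff]
      constructor
      · rintro ⟨rfl | rfl, hc⟩
        · exact absurd hc hp
        · rfl
      · rintro rfl; simp [hq]
    have h2 : ({p, q} : Set V) \ S = {p} := by
      ext w; simp only [Set.mem_diff, Set.mem_insert_iff, Set.mem_singleton_iff]
      constructor
      · rintro ⟨rfl | rfl, hc⟩
        · rfl
        · exact absurd hq hc
      · rintro rfl; simp [hp]
    simp [h1, h2, hp, hq]
  · have h1 : ({p, q} : Set V) ∩ S = ∅ := by
      ext w; simp only [Set.mem_inter_iff, Set.mem_insert_iff, Set.mem_singleton_iff,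
        Set.mem_empty_iff_false, iff_false]
      rintro ⟨rfl | rfl, hc⟩
      · exact hp hc
      · exact hq hc
    simp [h1, hp, hq]

-- A crossing edge corresponds to exactly one ordered pair with its first entry inside `S` and its
-- second outside.
open Classical in
theorem cutWeight_ends (x : Edge (Fin n) → K) (S : Set (Fin n)) :
    cutWeight Edge.ends x S = cut (edgeValues x) S.toFinset := by
  unfold cutWeight cut
  rw [← Finset.sum_filter, ← Finset.sum_product', ← Finset.sum_filter]
  symm
  refine Finset.sum_bij (fun (p : Fin n × Fin n) hp => mkEdge p.1 p.2 ?_) ?_ ?_ ?_ ?_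
  · simp only [Finset.mem_filter, Set.mem_toFinset] at hp
    rintro h
    exact hp.2.2 (h ▸ hp.2.1)
  · rintro ⟨p, q⟩ hp
    simp only [Finset.mem_filter, Set.mem_toFinset] at hp
    have hpq : p ≠ q := fun h => hp.2.2 (h ▸ hp.2.1)
    simp only [Finset.mem_filter, Finset.mem_univ, true_and]
    rw [ends_mkEdge, crosses_pair hpq]
    simp [hp.2]
  · rintro ⟨p, q⟩ hp ⟨p', q'⟩ hp' h
    simp only [Finset.mem_filter, Set.mem_toFinset] at hp hp'
    have h' : s(p, q) = s(p', q') := congrArg Subtype.val h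
    rcases Sym2.eq_iff.1 h' with ⟨rfl, rfl⟩ | ⟨rfl, rfl⟩
    · rfl
    · exact absurd hp.2.1 hp'.2.2
  · intro e he
    obtain ⟨p, q, hpq, rfl⟩ := exists_eq_mkEdge e
    simp only [Finset.mem_filter, Finset.mem_univ, true_and] at he
    rw [ends_mkEdge, crosses_pair hpq] at he
    by_cases hp : p ∈ S
    · exact ⟨(p, q), by simp only [Finset.mem_filter, Set.mem_toFinset]; simp; tauto, rfl⟩
    · exact ⟨(q, p), by simp only [Finset.mem_filter, Set.mem_toFinset]; simp; tauto,
        (mkEdge_comm hpq).symm⟩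
  · rintro ⟨p, q⟩ hp
    exact edgeValues_mkEdge x _

variable [LinearOrder K] [IsStrictOrderedRing K]

/-- The degree of the root is only bounded above by the relaxation. Equality follows from the cut
condition of the set of all other vertices, which contains a vertex `u` with `y u = 1`. -/
theorem Feasible.cutFeasible {r u : Fin n} {x : Edge (Fin n) → K} {y : Fin n → K}
    (h : Feasible r x y) (hur : u ≠ r) (hu : y u = 1) :
    CutFeasible Finset.univ r (fun w => 2 * y w) (edgeValues x) := by
  classical
  have hsymm : ∀ i j, edgeValues x i j = edgeValues x j i := by
    intro i j
    by_cases hij : i = j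
    · rw [hij]
    · rw [edgeValues_mkEdge x hij, edgeValues_mkEdge x (Ne.symm hij), mkEdge_comm hij]
  have hdiag : ∀ i, edgeValues x i i = 0 := fun i => dif_neg (fun h => h rfl)
  have hdeg : ∀ w, ∑ j, edgeValues x w j = cutWeight Edge.ends x {w} := by
    intro w
    rw [cutWeight_ends, ← cut_singleton hdiag]
    congr 1
    ext; simp
  have hcut : ∀ S : Finset (Fin n), r ∉ S → ∀ w ∈ S,
      2 * y w ≤ PrizeCollecting.cut (edgeValues x) S := by
    intro S hr w hw
    have := h.cut (S : Set (Fin n)) (by simpa using hr) w (by simpa using hw)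
    rwa [cutWeight_ends, Finset.toFinset_coe] at this
  refine ⟨hsymm, hdiag, fun i j => ?_, fun w _ => ?_, fun S hr w hw _ => hcut S hr w hw⟩
  · unfold edgeValues
    split_ifs
    · exact h.edge_nonneg _
    · exact le_rfl
  · by_cases hwr : w = r
    · subst hwr
      refine le_antisymm ?_ ?_
      · rw [hdeg, h.root, mul_one]
        exact h.degree_root
      · rw [← cut_singleton hdiag, ← cut_compl hsymm, h.root, ← hu]
        exact hcut _ (by simp) u (by simpa using hur)
    · rw [hdeg]
      exact h.degree w hwr

end Bridge

/-! ### Decompositions -/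

/-! ### From weighted totals to the required decomposition. -/

section Decomposition

variable {K : Type} [Field K] [LinearOrder K] [IsStrictOrderedRing K] {n : ℕ}

/-- The cut of `{a,b}` has weight `4 - 2 * Z a b`, and a third vertex `c` ensures that it is a
proper subset, whose cut weighs at least 2. -/
theorem CutFeasible.le_one {W : Finset (Fin n)} {r : Fin n} {Z : Fin n → Fin n → K}
    (h : CutFeasible W r (fun _ => 2) Z) {a b c : Fin n} (ha : a ∈ W) (hb : b ∈ W) (hc : c ∈ W)
    (hab : a ≠ b) (hca : c ≠ a) (hcb : c ≠ b) : Z a b ≤ 1 := by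
  have h1 : 2 ≤ PrizeCollecting.cut Z {a, b} := by
    by_cases hr : r ∈ ({a, b} : Finset (Fin n))
    · exact h.le_cut (w := c) hc (by simp [hr, hca, hcb])
    · exact h.le_cut (w := a) ha (by simp [hr])
  have h2 : PrizeCollecting.cut Z {a, b} ≤
      ∑ i ∈ {a, b}, ∑ j, (Z i j - if i = a ∧ j = b ∨ i = b ∧ j = a then Z a b else 0) := by
    unfold PrizeCollecting.cut
    rw [← Finset.sum_subset (Finset.subset_univ {a, b})]
    · refine Finset.sum_le_sum fun i hi => Finset.sum_le_sum fun j _ => ?_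
      have hz := h.nonneg i j
      by_cases he : i = a ∧ j = b ∨ i = b ∧ j = a
      · rw [if_pos he, if_neg]
        · rcases he with ⟨rfl, rfl⟩ | ⟨rfl, rfl⟩
          · simp
          · rw [h.symm]; simp
        · rcases he with ⟨rfl, rfl⟩ | ⟨rfl, rfl⟩ <;> simp
      · rw [if_neg he, sub_zero]
        split_ifs
        · exact le_rfl
        · exact hz
    · intro i _ hi
      exact Finset.sum_eq_zero fun j _ => if_neg fun h => hi h.1
  rw [Finset.sum_pair hab] at h2
  have e1 : ∑ j, (if a = a ∧ j = b ∨ a = b ∧ j = a then Z a b else 0) = Z a b := by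
    simp [hab]
  have e2 : ∑ j, (if b = a ∧ j = b ∨ b = b ∧ j = a then Z a b else 0) = Z a b := by
    simp [hab.symm]
  rw [Finset.sum_sub_distrib, Finset.sum_sub_distrib, e1, e2, h.degree a ha, h.degree b hb] at h2
  linarith

/-- The anchor edges together with `e₀` have the cut weights of `Z`, so the Held–Karp conditions are
inherited from `Z`. The bound `μ t ≤ 1` is also read off from `Z`. -/
theorem isDecomposition_of_sums {r u v : Fin n} (huv : u ≠ v) {x : Edge (Fin n) → K} {y : Fin n → K}
    (hu : y u = 1) (hv : y v = 1) {Z : Fin n → Fin n → K} {W : Finset (Fin n)}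
    (hf : CutFeasible W r (fun w => 2 * y w) Z) (hiso : ∀ w ∉ W, ∀ j, Z w j = 0)
    (hW : ∀ w, w ∈ W ↔ y w = 1) {k : ℕ}
    {T : Fin k → (⊤ : SimpleGraph (Fin n)).Subgraph} {μ : Fin k → K} (hT : Function.Injective T)
    (htree : ∀ t, IsSubtree (T t)) (hanchor : ∀ t, ((T t).verts ∩ core y).ncard = 2)
    (hμ : ∀ t, 0 < μ t)
    (hadj : ∀ i j, ∑ t, μ t * adjFun K i j (T t) = edgeValues x i j - edgeMatrix u v i j)
    (hcov : ∀ w, y w ≠ 1 → ∑ t, μ t * memFun K w (T t) = y w)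
    (hpair : ∀ a b, a ≠ b → y a = 1 → y b = 1 →
      ∑ t, μ t * (memFun K a (T t) * memFun K b (T t)) = Z a b - edgeMatrix u v a b) :
    IsDecomposition x y (mkEdge u v huv) T μ := by
  classical
  have hf2 : CutFeasible W r (fun _ => 2) Z := ⟨hf.symm, hf.diag, hf.nonneg,
    fun w hw => by rw [hf.degree w hw, (hW w).1 hw, mul_one],
    fun S hr w hwS hw => by simpa [(hW w).1 hw] using hf.cut S hr w hwS hw⟩
  choose a b hab hends using fun t => Set.ncard_eq_two.1 (hanchor t)
  have hcore : ∀ t i, i ∈ (T t).verts ∧ y i = 1 ↔ i = a t ∨ i = b t := fun t i =>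
    Set.ext_iff.1 (hends t) i
  have hya : ∀ t, y (a t) = 1 := fun t => ((hcore t _).2 (Or.inl rfl)).2
  have hyb : ∀ t, y (b t) = 1 := fun t => ((hcore t _).2 (Or.inr rfl)).2
  have hsum : ∀ i j, i ≠ j → ∑ t, μ t * edgeMatrix (a t) (b t) i j = Z i j - edgeMatrix u v i j := by
    intro i j hij
    by_cases hi : y i = 1 ∧ y j = 1
    · rw [← hpair i j hij hi.1 hi.2]
      refine Finset.sum_congr rfl fun t _ => ?_
      have h1 : i ∈ (T t).verts ↔ i = a t ∨ i = b t := by rw [← hcore, and_iff_left hi.1]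
      have h2 : j ∈ (T t).verts ↔ j = a t ∨ j = b t := by rw [← hcore, and_iff_left hi.2]
      unfold memFun
      rw [edgeMatrix_eq, ite_zero_mul_ite_zero, mul_one]
      refine congrArg _ (if_congr ?_ rfl rfl)
      rw [h1, h2]
      unfold IsEdge
      have := hab t
      constructor
      · rintro (⟨rfl, rfl⟩ | ⟨rfl, rfl⟩) <;> simp
      · rintro ⟨rfl | rfl, rfl | rfl⟩
        · exact absurd rfl hij
        · exact Or.inl ⟨rfl, rfl⟩
        · exact Or.inr ⟨rfl, rfl⟩
        · exact absurd rfl hij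
    · have hzero : ∀ p q, y p = 1 → y q = 1 → (edgeMatrix p q i j : K) = 0 := by
        intro p q hp hq
        rw [edgeMatrix_eq, if_neg]
        rintro (⟨rfl, rfl⟩ | ⟨rfl, rfl⟩)
        · exact hi ⟨hp, hq⟩
        · exact hi ⟨hq, hp⟩
      have hZ : Z i j = 0 := by
        rcases not_and_or.1 hi with h | h
        · exact hiso i (fun c => h ((hW i).1 c)) j
        · rw [hf.symm]; exact hiso j (fun c => h ((hW j).1 c)) i
      rw [hzero u v hu hv, hZ, sub_zero]
      exact Finset.sum_eq_zero fun t _ => by rw [hzero _ _ (hya t) (hyb t), mul_zero]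
  have hcutw : ∀ S : Set (Fin n), cutWeight (anchorEnds y (mkEdge u v huv) T)
      (∑ t, μ t • Pi.single (some t) (1 : K) + Pi.single none (1 : K)) S = cut Z S.toFinset := by
    intro S
    have hz : ∀ o : Option (Fin k),
        (∑ t, μ t • Pi.single (some t) (1 : K) + Pi.single none (1 : K) : Option (Fin k) → K) o =
        o.elim 1 μ := by
      rintro (_ | t)
      · simp
      · simp [Finset.sum_apply, Pi.single_apply]
    have hcr : ∀ (p q : Fin n) (c : K), p ≠ q → (if Crosses {p, q} S then c else 0) =
        c * cut (edgeMatrix p q) S.toFinset := by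
      intro p q c hpq
      rw [cut_edgeMatrix hpq]
      by_cases h : p ∈ S ↔ q ∈ S
      · simp [crosses_pair hpq, h]
      · simp [crosses_pair hpq, h]
    unfold cutWeight
    simp only [hz, Fintype.sum_option, Option.elim, anchorEnds, hends, ends_mkEdge]
    rw [hcr u v 1 huv, one_mul, Finset.sum_congr rfl fun t _ => hcr (a t) (b t) (μ t) (hab t)]
    have hZ : cut Z S.toFinset = cut (fun i j => edgeMatrix u v i j +
        ∑ t, μ t * edgeMatrix (a t) (b t) i j) S.toFinset := by
      unfold cut
      refine Finset.sum_congr rfl fun i _ => Finset.sum_congr rfl fun j _ => ?_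
      split_ifs with h
      · have := hsum i j (fun e => h.2 (e ▸ h.1))
        simp only [this]
        ring
      · rfl
    rw [hZ]
    have hlin : ∀ t, μ t * cut (edgeMatrix (a t) (b t)) S.toFinset =
        ∑ i, ∑ j, if i ∈ S.toFinset ∧ j ∉ S.toFinset then μ t * edgeMatrix (a t) (b t) i j else 0 := by
      intro t
      unfold cut
      simp only [Finset.mul_sum, mul_ite, mul_zero]
    simp only [hlin]
    rw [Finset.sum_comm]
    unfold cut
    rw [← Finset.sum_add_distrib]
    refine Finset.sum_congr rfl fun i _ => ?_
    rw [Finset.sum_comm, ← Finset.sum_add_distrib]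
    refine Finset.sum_congr rfl fun j _ => ?_
    split_ifs
    · rfl
    · simp
  refine ⟨hT, fun t => (htree t).isTree, fun t => ⟨(hμ t).le, ?_⟩, ?_, fun w hw => ?_, hanchor, ?_⟩
  -- The weight of a tree is at most the weight of its anchor pair in `Z - e₀`. If this pair is
  -- `e₀`, the degree bound gives `Z ≤ 2` and one unit is subtracted. Otherwise there is a third
  -- core vertex, and `Z ≤ 1` on the pair.
  · have h1 : μ t ≤ ∑ s, μ s * edgeMatrix (a s) (b s) (a t) (b t) := by
      refine le_trans (le_of_eq ?_) (Finset.single_le_sum (f := fun s => μ s *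
        edgeMatrix (a s) (b s) (a t) (b t)) (fun s _ => mul_nonneg (hμ s).le
          (edgeMatrix_nonneg _ _ _ _)) (Finset.mem_univ t))
      simp [edgeMatrix]
    rw [hsum _ _ (hab t)] at h1
    by_cases he : IsEdge u v (a t) (b t)
    · rw [edgeMatrix_eq, if_pos he] at h1
      have h2 : Z (a t) (b t) ≤ ∑ j, Z (a t) j := Finset.single_le_sum
        (fun j _ => hf.nonneg _ j) (Finset.mem_univ (b t))
      rw [hf2.degree _ ((hW _).2 (hya t))] at h2
      linarith
    -- Without a third core vertex both `u` and `v` would be anchors of this tree.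
    · have h3 : ∃ c, y c = 1 ∧ c ≠ a t ∧ c ≠ b t := by
        by_contra hno
        push Not at hno
        refine he ?_
        have h4 := hno u hu
        have h5 := hno v hv
        unfold IsEdge
        by_cases h6 : u = a t
        · exact Or.inl ⟨h6.symm, (h5 fun h => huv (h6.trans h.symm)).symm⟩
        · refine Or.inr ⟨?_, (h4 h6).symm⟩
          by_contra h7
          exact huv ((h4 h6).trans (h5 fun h => h7 h.symm).symm)
      obtain ⟨c, hc1, hc2, hc3⟩ := h3
      have h4 := hf2.le_one ((hW _).2 (hya t)) ((hW _).2 (hyb t)) ((hW _).2 hc1) (hab t) hc2 hc3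
      have h5 := edgeMatrix_nonneg (K := K) u v (a t) (b t)
      linarith
  · funext e
    obtain ⟨i, j, hij, rfl⟩ := exists_eq_mkEdge e
    have h1 := hadj i j
    rw [edgeValues_mkEdge x hij] at h1
    have h2 : ∀ t, chi (K := K) (T t).edgeSet (mkEdge i j hij) = adjFun K i j (T t) := by
      intro t
      simp [chi, adjFun, mkEdge]
    have h3 : chi (K := K) {((mkEdge u v huv : Edge (Fin n)) : Sym2 (Fin n))} (mkEdge i j hij) =
        edgeMatrix u v i j := by
      simp [chi, edgeMatrix, mkEdge]
    simp only [Pi.add_apply, Finset.sum_apply, Pi.smul_apply, smul_eq_mul, h2, h3, h1]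
    ring
  · rw [← hcov w hw]
    refine Finset.sum_congr rfl fun t _ => ?_
    simp [memFun]
  · refine ⟨?_, fun w hw => ?_, fun S hS hne => ?_⟩
    · rintro (_ | t)
      · simp
      · simp [Finset.sum_apply, Pi.single_apply, (hμ t).le]
    · rw [hcutw, ← hf2.degree w ((hW w).2 hw), ← cut_singleton hf.diag]
      congr 1
      ext; simp
    · rw [hcutw]
      obtain ⟨w, hw⟩ := hne
      obtain ⟨c, hc, hcS⟩ := Set.exists_of_ssubset hS
      by_cases hr : r ∈ S
      · exact hf2.le_cut (w := c) ((hW c).2 hc) (by simp [hcS, hr])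
      · exact hf2.le_cut (w := w) ((hW w).2 (hS.1 hw)) (by simp [hw, hr])

end Decomposition

/-! ### The complete program -/

/-- Computes a decomposition into trees: the vertices outside the core set are split off in the order
of increasing `y`, the resulting edges (without `e₀`) are the initial trees, and the vertices are
inserted into the trees in the reverse order. -/
def decompose : Code := splitAll ;; subtractEdge ;; createTrees ;; insertAll ;; writeOutput

/-! ### The complete algorithm. -/

section Main

variable {K : Type} [Field K] [LinearOrder K] [IsStrictOrderedRing K] {n : ℕ}

theorem initState_num (r u v : Fin n) (x : Edge (Fin n) → K) (y : Fin n → K) (i j : Fin n) :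
    (initState r u v x y).num 0 (i * n + j) = edgeValues x i j := by
  have hn : 0 < n := i.pos
  have hd : ((i : ℕ) * n + j) / n = i := by
    rw [Nat.add_comm, Nat.add_mul_div_right _ _ hn, Nat.div_eq_of_lt j.2, zero_add]
  have hm : ((i : ℕ) * n + j) % n = j := by
    rw [Nat.add_comm, Nat.add_mul_mod_self_right, Nat.mod_eq_of_lt j.2]
  simp only [initState, if_true, edgeValues]
  by_cases h : i = j
  · rw [dif_neg (by rw [hd, hm]; simp [h]), dif_neg (by simp [h])]
  · rw [dif_pos (by rw [hd, hm]; exact ⟨i.2, j.2, fun e => h (Fin.ext e)⟩), dif_pos h]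
    congr 1
    simp only [mkEdge, hd, hm]

theorem subtractEdge_spec {σ : State K} {u v : Fin n} (hu : σ.nat 0 2 = u) (hv : σ.nat 0 3 = v)
    (huv : u ≠ v) : (subtractEdge.run σ).mat n arrX =
      fun i j => σ.mat n arrX i j - edgeMatrix u v i j := by
  have hrun : subtractEdge.run σ = (addEdge (.get 0 (.lit 2)) (.get 0 (.lit 3)) numN).run
    (σ.writeNum numN 0 (-1)) := by
    simp [subtractEdge, Code.run_seq, Code.run_letNum]
  rw [hrun, addEdge_spec (by decide) huv]
  · funext i j
    simp [State.mat, State.num_writeNum, sub_eq_add_neg]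
  · intro s hs
    simp [hs, hu]
  · intro s hs
    simp [hs, hv]

/-- Both ends of `e₀` survive all stages, and weights between survivors never decrease; so one copy
of `e₀` can be set aside throughout. -/
theorem SplitHistory.edgeMatrix_le {r u v : Fin n} {y : Fin n → K} {S : ℕ → Fin n → Fin n → K}
    {ord : ℕ → ℕ} {i : ℕ} (h : SplitHistory r y S ord i) (hu : y u = 1) (hv : y v = 1)
    (h0 : 1 ≤ S 0 u v) {k : ℕ} (hk : k ≤ i) (a b : Fin n) : edgeMatrix u v a b ≤ S k a b := by
  have key : 1 ≤ S k u v := by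
    induction k with
    | zero => exact h0
    | succ k ih =>
      have ih := ih (by omega)
      rcases h.step k (by omega) with ⟨-, e⟩ | ⟨w, -, -, hw, -, hs⟩
      · rwa [e]
      · refine ih.trans (hs.mono u v ?_ ?_)
        · rintro rfl
          exact hw.ne hu
        · rintro rfl
          exact hw.ne hv
  rw [edgeMatrix_eq]
  split_ifs with he
  · rcases he with ⟨rfl, rfl⟩ | ⟨rfl, rfl⟩
    · exact key
    · rw [(h.feasible k hk).symm]
      exact key
  · exact (h.feasible k hk).nonneg a b

theorem decompose_spec {r u v : Fin n} (huv : u ≠ v) {x : Edge (Fin n) → K} {y : Fin n → K}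
    (hf : Feasible r x y) (hu : u ∈ core y) (hv : v ∈ core y) (hx : 1 ≤ x (mkEdge u v huv)) :
    ∃ (k : ℕ) (T : Fin k → (⊤ : SimpleGraph (Fin n)).Subgraph) (μ : Fin k → K),
      IsDecomposition x y (mkEdge u v huv) T μ ∧ Outputs (decompose.run (initState r u v x y)) T μ := by
  have hu1 : y u = 1 := hu
  have hv1 : y v = 1 := hv
  -- At least one end of `e₀` differs from the root; it is the second vertex of value 1 that
  -- splitting off relies on.
  obtain ⟨c, hcr, hc⟩ : ∃ c, c ≠ r ∧ y c = 1 := by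
    by_cases h : u = r
    · exact ⟨v, fun e => huv (h.trans e.symm), hv1⟩
    · exact ⟨u, h, hu1⟩
  set σ₀ := initState r u v x y with hσ₀
  have hzero : ∀ a, a ≠ 0 → ∀ i, σ₀.nat a i = 0 := fun a ha i => if_neg ha
  have h00 : σ₀.nat 0 0 = n := rfl
  obtain ⟨σ₁, hσ₁⟩ : ∃ σ₁, splitAll.run σ₀ = σ₁ := ⟨_, rfl⟩
  obtain ⟨σ₂, hσ₂⟩ : ∃ σ₂, subtractEdge.run σ₁ = σ₂ := ⟨_, rfl⟩
  obtain ⟨σ₃, hσ₃⟩ : ∃ σ₃, createTrees.run σ₂ = σ₃ := ⟨_, rfl⟩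
  obtain ⟨σ₄, hσ₄⟩ : ∃ σ₄, insertAll.run σ₃ = σ₄ := ⟨_, rfl⟩
  obtain ⟨σ₅, hσ₅⟩ : ∃ σ₅, writeOutput.run σ₄ = σ₅ := ⟨_, rfl⟩
  have hrun : decompose.run σ₀ = σ₅ := by
    rw [decompose, Code.run_seq, Code.run_seq, Code.run_seq, Code.run_seq, hσ₁, hσ₂, hσ₃, hσ₄, hσ₅]
  have n1 : σ₁.nat 0 = σ₀.nat 0 := by rw [← hσ₁, Code.run_nat_of_notMem _ (by decide)]
  have n2 : σ₂.nat 0 = σ₀.nat 0 := by rw [← hσ₂, Code.run_nat_of_notMem _ (by decide), n1]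
  have n3 : σ₃.nat 0 = σ₀.nat 0 := by rw [← hσ₃, Code.run_nat_of_notMem _ (by decide), n2]
  have n4 : σ₄.nat 0 = σ₀.nat 0 := by rw [← hσ₄, Code.run_nat_of_notMem _ (by decide), n3]
  have z2 : ∀ a ∈ [1, arrVert, arrAdj, natCnt], ∀ i, σ₂.nat a i = 0 := by
    intro a ha i
    simp only [List.mem_cons, List.not_mem_nil, or_false] at ha
    rcases ha with rfl | rfl | rfl | rfl <;>
      rw [← hσ₂, Code.run_nat_of_notMem _ (by decide), ← hσ₁, Code.run_nat_of_notMem _ (by decide),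
        hzero _ (by decide)]
  have w2 : ∀ i, σ₂.num arrWt i = 0 := by
    intro i
    rw [← hσ₂, Code.run_num_of_notMem _ (by decide), ← hσ₁, Code.run_num_of_notMem _ (by decide)]
    simp [hσ₀, initState]
  have o4 : σ₄.nat 1 0 = 0 := by
    rw [← hσ₄, Code.run_nat_of_notMem _ (by decide), ← hσ₃, Code.run_nat_of_notMem _ (by decide),
      z2 _ (by simp)]
  have sn : σ₃.num arrSnap = σ₁.num arrSnap := by
    rw [← hσ₃, Code.run_num_of_notMem _ (by decide), ← hσ₂, Code.run_num_of_notMem _ (by decide)]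
  have so : σ₃.nat arrOrd = σ₁.nat arrOrd := by
    rw [← hσ₃, Code.run_nat_of_notMem _ (by decide), ← hσ₂, Code.run_nat_of_notMem _ (by decide)]
  have hsnap : σ₃.snap n = σ₁.snap n := by
    funext k i j
    simp only [State.snap, sn]
  have hyv : σ₀.vec n arrY = y := by
    funext i
    simp [State.vec, hσ₀, initState]
  obtain ⟨hh, hS0, hSn, hrem⟩ := splitAll_spec (σ := σ₀) h00 rfl hyv hf.root hcr hc
    (initState_num r u v x y) (hf.cutFeasible hcr hc) hσ₁
  have hW : ∀ w, w ∈ remaining n (σ₁.nat arrOrd) n ↔ y w = 1 := fun w =>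
    ⟨fun h => le_antisymm (hf.vertex_mem w).2 (not_lt.1 (hrem w h)), fun h => hh.mem_remaining le_rfl h⟩
  have hF : ∀ k ≤ n, ∀ a b, edgeMatrix u v a b ≤ σ₁.snap n k a b := fun k hk a b =>
    hh.edgeMatrix_le hu1 hv1 (by rw [hS0, edgeValues_mkEdge x huv]; exact hx) hk a b
  have hX2 : σ₂.mat n arrX = fun i j => σ₁.snap n n i j - edgeMatrix u v i j := by
    rw [← hσ₂, subtractEdge_spec (by rw [n1]; rfl) (by rw [n1]; rfl) huv, hSn]
  obtain ⟨T₃, hR3, hc3⟩ := createTrees_represents (σ := σ₂) (r := r) (by rw [n2, h00]) huv hX2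
    (hh.feasible n le_rfl) (hh.isolated n le_rfl) hW (hF n le_rfl) (z2 _ (by simp)) (z2 _ (by simp))
    w2 (z2 _ (by simp) 0) hσ₃
  have hn2 : 2 ≤ n := by
    by_contra hlt
    have h1 := u.2
    have h2 := v.2
    exact huv (Fin.ext (by omega))
  -- At most `n * n` initial trees, and at most `n * n + n` copies for each of the `n` stages: the
  -- `n ^ 5` places that the loops visit are enough.
  have hcnt : n * n + n * (n * n + n) ≤ n ^ 5 := by
    have h1 : n + 2 ≤ n * n := by nlinarith
    have h2 : n * n ≤ n * n * n := Nat.le_mul_of_pos_right _ (by omega)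
    calc n * n + n * (n * n + n) = (n + 2) * (n * n) := by ring
      _ ≤ (n * n * n) * (n * n) := Nat.mul_le_mul_right _ (h1.trans h2)
      _ = n ^ 5 := by ring
  obtain ⟨T₄, hR4, -⟩ := insertAll_spec (σ := σ₃) (by rw [n3, h00]) (fun w => (hf.vertex_mem w).2)
    (by rw [hsnap, so]; exact hh) (edgeMatrix_nonneg u v) (by rw [hsnap]; exact hF)
    (by rw [hsnap, so]; exact hR3) (by omega) hσ₄
  rw [hsnap, hS0] at hR4
  obtain ⟨k, O, q1, q2, q3, q4⟩ := writeOutput_spec (by rw [n4, h00]) o4 hR4.family hσ₅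
  have hsum : ∀ φ : _ → K, ∑ t : Fin k, σ₅.num 2 t * φ (O t) = total σ₄ T₄ φ := fun φ => by
    rw [← q4 φ, Finset.sum_range]
  refine ⟨k, fun t => O t, fun t => σ₅.num 2 t, ?_, ?_⟩
  · refine isDecomposition_of_sums huv hu1 hv1 (hh.feasible n le_rfl) (hh.isolated n le_rfl) hW
      (fun t t' h => Fin.ext (q3 t t.2 t' t'.2 h)) (fun t => (q2 t t.2).2.1.1)
      (fun t => (q2 t t.2).2.1.2.1) (fun t => (q2 t t.2).2.2) (fun i j => ?_) (fun w hw => ?_)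
      (fun a b hab ha hb => ?_)
    · rw [hsum, hR4.adj]
    · rw [hsum, hR4.cover w (Finset.mem_univ w) hw]
    · rw [hsum fun T => memFun K a T * memFun K b T, hR4.pair a b hab ha hb]
  · rw [hrun]
    refine ⟨q1, fun t => rfl, fun t i => ?_, fun t i => ?_, fun t i j => ?_, fun t i j => ?_⟩
    · rw [(q2 t t.2).1.1]; split_ifs <;> simp
    · rw [(q2 t t.2).1.1]; simp
    · rw [(q2 t t.2).1.2]; split_ifs <;> simp
    · rw [(q2 t t.2).1.2]; simp

end Main

end PrizeCollecting

theorem lemma5 :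
    ∃ (P : Program) (p : Polynomial ℕ),
      (∀ (n : ℕ) (r u v : Fin n) (huv : u ≠ v) (x : Edge (Fin n) → ℝ) (y : Fin n → ℝ),
        Feasible r x y → u ∈ core y → v ∈ core y → 1 ≤ x (mkEdge u v huv) →
          ∃ (k : ℕ) (T : Fin k → (⊤ : SimpleGraph (Fin n)).Subgraph) (μ : Fin k → ℝ)
            (τ : State ℝ) (t : ℕ),
            IsDecomposition x y (mkEdge u v huv) T μ ∧
            Exec unitBits P (initState r u v x y) τ t ∧ Outputs τ T μ ∧
            t ≤ p.eval n) ∧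
      (∀ (n : ℕ) (r u v : Fin n) (huv : u ≠ v) (x : Edge (Fin n) → ℚ) (y : Fin n → ℚ),
        Feasible r x y → u ∈ core y → v ∈ core y → 1 ≤ x (mkEdge u v huv) →
          ∃ (k : ℕ) (T : Fin k → (⊤ : SimpleGraph (Fin n)).Subgraph) (μ : Fin k → ℚ)
            (τ : State ℚ) (t : ℕ),
            IsDecomposition x y (mkEdge u v huv) T μ ∧
            Exec ratBits P (initState r u v x y) τ t ∧ Outputs τ T μ ∧
            t ≤ p.eval (inputLength ratBits x y)) := by
  -- The syntactic conditions on the program hold by evaluation, hence `rfl`.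
  obtain ⟨p, hR, hQ⟩ := Code.exists_program decompose rfl
  refine ⟨decompose.toProgram, p, fun n r u v huv x y hf hu hv hx => ?_,
    fun n r u v huv x y hf hu hv hx => ?_⟩
  · obtain ⟨k, T, μ, h1, h2⟩ := decompose_spec huv hf hu hv hx
    obtain ⟨t, ht, h3⟩ := hR n r u v x y
    exact ⟨k, T, μ, _, t, h1, h3, h2, ht⟩
  · obtain ⟨k, T, μ, h1, h2⟩ := decompose_spec huv hf hu hv hx
    obtain ⟨t, ht, h3⟩ := hQ n r u v x y
    exact ⟨k, T, μ, _, t, h1, h3, h2, ht⟩
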